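/- Let $N\ge 2$ be an integer. Write $(t)_\infty=\prod_{n\ge 0}(1-tq^n)$. For $1\le i<j\le N$, $\ell\in\{1,2\}$ and $1\le r\le N$ let $y_1,\dots,y_N,a,b,z_\ell^{i,j},v_\ell^{i,j},z_r,v_r$ be formal variables, and put $y_{i,j}=y_i^{-1}y_j$, $x_\ell^{i,j}=\exp(z_\ell^{i,j})$, $u_\ell^{i,j}=\exp(v_\ell^{i,j})$, $x_r=\exp(z_r)$, $u_r=\exp(v_r)$. Let $$\mathfrak P_N^{a,b}=\prod_{1\le i<j\le N}\frac{(x_1^{i,j}x_2^{i,j}y_{i,j})_\infty\,(y_{i,j})_\infty}{(x_1^{i,j}y_{i,j})_\infty\,(x_2^{i,j}y_{i,j})_\infty}\cdot\frac{(u_1^{i,j}u_2^{i,j}y_{i,j}^{-1}q)_\infty\,(y_{i,j}^{-1}q)_\infty}{(u_1^{i,j}y_{i,j}^{-1}q)_\infty\,(u_2^{i,j}y_{i,j}^{-1}q)_\infty}\cdot\prod_{1\le i\le N}\left(\frac{(x_iy_i)_\infty}{(y_i)_\infty}\right)^{a}\left(\frac{(u_iy_i^{-1}q)_\infty}{(y_i^{-1}q)_\infty}\right)^{b},$$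 where each factor is expanded as a formal power series in $q$, in $y_{i,j}$, $y_{i,j}^{-1}q$, $y_i$ or $y_i^{-1}q$ respectively, and in the $z$'s, $v$'s, $a$, $b$, and where $F^c=\exp(c\log F)$. Let $\mathrm{Coeff}_{y_1^0\cdots y_N^0}$ denote the coefficient of $y_1^0\cdots y_N^0$. For $\ell\ge 0$, $s_1,\dots,s_\ell\ge 1$ and $r_1,\dots,r_\ell\ge 0$, the bi-bracket of weight $\sum_{i=1}^\ell(s_i+r_i)$ is $$\begin{bmatrix}s_1,\dots,s_\ell\\ r_1,\dots,r_\ell\end{bmatrix}=\sum_{\substack{u_1>\cdots>u_\ell>0\\ v_1,\dots,v_\ell>0}}\ \prod_{i=1}^\ell\frac{u_i^{r_i}}{r_i!}\frac{v_i^{s_i-1}}{(s_i-1)!}\cdot q^{u_1v_1+\cdots+u_\ell v_\ell}\in\mathbb Q[[q]]$$ (equal to $1$ for $\ell=0$). Let $\mathcal{BD}$ be the $\mathbb Q$-span of all bi-brackets, and let $\mathrm q\mathcal{BD}$ be the $\mathbb Q$-span of $1$ and of all bi-brackets with $\ell\ge 1$ and $s_1>1$. An element of $\mathcal{BD}$ (of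 $\mathrm q\mathcal{BD}$) has weight at most $W$ if it is a $\mathbb Q$-linear combination of spanning bi-brackets of $\mathcal{BD}$ (of $\mathrm q\mathcal{BD}$) of weight at most $W$; an element of $\mathcal{BD}[a,b]$ has weight at most $W$ if all its coefficients do. (i) For all integers $m_\ell^{i,j},n_\ell^{i,j},m_i,n_i\ge 0$, the coefficient of $$\prod_{1\le i<j\le N,\ 1\le \ell\le 2}(z_\ell^{i,j})^{m_\ell^{i,j}}(v_\ell^{i,j})^{n_\ell^{i,j}}\cdot\prod_{1\le i\le N}z_i^{m_i}v_i^{n_i}$$ in $\mathrm{Coeff}_{y_1^0\cdots y_N^0}(\mathfrak P_N^{a,b})$ lies in $\mathcal{BD}[a,b]$, has weight at most $\sum_{i<j,\,\ell}(m_\ell^{i,j}+n_\ell^{i,j})+\sum_i(m_i+n_i)$, and has total degree in $a,b$ at most $\sum_i(m_i+n_i)$. (ii) For all integers $m_\ell^{i,j},n_\ell^{i,j}\ge 0$, the coefficient of $\prod_{1\le i<j\le N,\ 1\le \ell\le 2}(z_\ell^{i,j})^{m_\ell^{i,j}}(v_\ell^{i,j})^{n_\ell^{i,j}}$ in $\mathrm{Coeff}_{y_1^0\cdots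 y_N^0}(\mathfrak P_N^{0,0})$ lies in $\mathrm q\mathcal{BD}$ and has weight at most $\sum_{i<j,\,\ell}(m_\ell^{i,j}+n_\ell^{i,j})$. -/

import Mathlib

open scoped PowerSeries

/-! Bi-brackets and the spaces they span. -/

namespace BiBracket

/-- The bi-bracket `[s_1, …, s_ℓ; r_1, …, r_ℓ]`, i.e. the `q`-series
`∑ ∏ᵢ (u_i ^ r_i / r_i!) (v_i ^ (s_i - 1) / (s_i - 1)!) q ^ (u_1 v_1 + ⋯ + u_ℓ v_ℓ)`
over `u_1 > ⋯ > u_ℓ > 0` and `v_1, …, v_ℓ > 0`. In the coefficient of `q ^ n` only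
`1 ≤ u_i, v_i ≤ n` can occur. For `ℓ = 0` this is the series `1`.
It is only used when every `s_i` is at least `1`. -/
noncomputable def biBracket {l : ℕ} (s r : Fin l → ℕ) : ℚ⟦X⟧ :=
  PowerSeries.mk fun n =>
    ∑ u ∈ Fintype.piFinset fun _ : Fin l => Finset.Icc 1 n,
      ∑ v ∈ Fintype.piFinset fun _ : Fin l => Finset.Icc 1 n,
        open Classical in
        if StrictAnti u ∧ ∑ i, u i * v i = n then
          ∏ i, ((u i : ℚ) ^ r i / (r i).factorial *
            ((v i : ℚ) ^ (s i - 1) / (s i - 1).factorial))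
        else 0

/-- The `ℚ`-span of the bi-brackets of weight `∑ (s_i + r_i)` at most `W`
(depth `0` included): the part of weight at most `W` of the space `BD`. -/
noncomputable def BD (W : ℕ) : Submodule ℚ ℚ⟦X⟧ :=
  Submodule.span ℚ
    {f | ∃ (l : ℕ) (s r : Fin l → ℕ), (∀ i, 1 ≤ s i) ∧
      ∑ i, (s i + r i) ≤ W ∧ f = biBracket s r}

/-- The `ℚ`-span of the bi-brackets of weight at most `W` whose first upper entry `s_1`
is greater than `1` (no condition in depth `0`): the part of weight at most `W` of `qBD`. -/
noncomputable def qBD (W : ℕ) : Submodule ℚ ℚ⟦X⟧ :=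
  Submodule.span ℚ
    {f | ∃ (l : ℕ) (s r : Fin l → ℕ), (∀ i, 1 ≤ s i) ∧ (∀ h : 0 < l, 1 < s ⟨0, h⟩) ∧
      ∑ i, (s i + r i) ≤ W ∧ f = biBracket s r}

end BiBracket

/-! The trace. -/

namespace Trace

/-- Pairs `1 ≤ i < j ≤ N`. -/
abbrev Pair (N : ℕ) : Type := {p : Fin N × Fin N // p.1 < p.2}

/-- The formal variables. `pz p l`, `pv p l` are `z_l^{i,j}`, `v_l^{i,j}` for `p = (i, j)`;
`z i`, `v i` are `z_i`, `v_i`; `a`, `b` are the two exponents. The variables `w 0, …, w N` serve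
to express the Laurent monomials in `q, y_1, …, y_N` (see `lexp` and `qy`); they stand for
`q / y_N, y_1, y_2 / y_1, …, y_N / y_{N-1}`. -/
inductive Var (N : ℕ) : Type
  | pz (p : Pair N) (l : Fin 2)
  | pv (p : Pair N) (l : Fin 2)
  | z (i : Fin N)
  | v (i : Fin N)
  | a
  | b
  | w (k : Fin (N + 1))

/-- The ring of formal series in which the trace lives: series in `z, v, a, b` and in the
Laurent monomials `q ^ k * y_1 ^ e_1 * ⋯ * y_N ^ e_N` from the cone `Admissible`. The trace only
involves such monomials, and on them multiplication of infinite formal series makes sense,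
because this cone is freely generated by the `N + 1` monomials `w 0, …, w N`. -/
abbrev Ser (N : ℕ) : Type := MvPowerSeries (Var N) ℚ

/-- The exponents of `w 0, …, w N` in `q ^ k * y_1 ^ e_1 * ⋯ * y_N ^ e_N`: since
`q = w_0 w_1 ⋯ w_N` and `y_j = w_1 ⋯ w_j`, the exponent of `w_0` is `k` and the one of `w_i` is
`k + e_i + e_{i+1} + ⋯ + e_N` for `1 ≤ i ≤ N`. -/
def lexp {N : ℕ} (k : ℤ) (e : Fin N → ℤ) : Fin (N + 1) → ℤ :=
  Fin.cons k fun i => k + ∑ j ∈ Finset.Ici i, e j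

/-- The Laurent monomials that are products of `w 0, …, w N`. -/
def Admissible {N : ℕ} (k : ℤ) (e : Fin N → ℤ) : Prop :=
  ∀ i, 0 ≤ lexp k e i

/-- The exponent vector of the (admissible) Laurent monomial `q ^ k * y_1 ^ e_1 * ⋯ * y_N ^ e_N`. -/
noncomputable def qyExp {N : ℕ} (k : ℤ) (e : Fin N → ℤ) : Var N →₀ ℕ :=
  ∑ i, Finsupp.single (Var.w i) (lexp k e i).toNat

/-- The (admissible) Laurent monomial `q ^ k * y_1 ^ e_1 * ⋯ * y_N ^ e_N`. -/
noncomputable def qy {N : ℕ} (k : ℤ) (e : Fin N → ℤ) : Ser N :=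
  MvPowerSeries.monomial (qyExp k e) 1

/-- The variable `q`. -/
noncomputable def q (N : ℕ) : Ser N := qy 1 0

/-- The variable `y_i`. -/
noncomputable def y {N : ℕ} (i : Fin N) : Ser N := qy 0 (Pi.single i 1)

/-- The monomial `y_i ^ (-1) * q`. -/
noncomputable def yInvq {N : ℕ} (i : Fin N) : Ser N := qy 1 (-Pi.single i 1)

/-- The monomial `y_{i,j} = y_i ^ (-1) * y_j`, for `p = (i, j)`. -/
noncomputable def yy {N : ℕ} (p : Pair N) : Ser N :=
  qy 0 (Pi.single p.1.2 1 - Pi.single p.1.1 1)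

/-- The monomial `y_{i,j} ^ (-1) * q`, for `p = (i, j)`. -/
noncomputable def yyInvq {N : ℕ} (p : Pair N) : Ser N :=
  qy 1 (Pi.single p.1.1 1 - Pi.single p.1.2 1)

/-! Sanity facts: distinct Laurent monomials are distinct, they multiply as they should, and
all those used are admissible. -/

theorem lexp_add {N : ℕ} (k k' : ℤ) (e e' : Fin N → ℤ) :
    lexp (k + k') (e + e') = lexp k e + lexp k' e' := by
  funext i
  refine Fin.cases ?_ (fun i => ?_) i
  · simp [lexp]
  · simp [lexp, Finset.sum_add_distrib]; ring

theorem lexp_injective {N : ℕ} {k k' : ℤ} {e e' : Fin N → ℤ} (h : lexp k e = lexp k' e') :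
    k = k' ∧ e = e' := by
  have h0 : k = k' := by simpa [lexp] using congrFun h 0
  subst h0
  refine ⟨rfl, ?_⟩
  have hs : ∀ i : Fin N, ∑ j ∈ Finset.Ici i, e j = ∑ j ∈ Finset.Ici i, e' j := fun i => by
    simpa [lexp] using congrFun h i.succ
  have ht : ∀ i : Fin N, ∑ j ∈ Finset.Ioi i, e j = ∑ j ∈ Finset.Ioi i, e' j := fun i => by
    by_cases hi : i.val + 1 < N
    · have : Finset.Ioi i = Finset.Ici (⟨i.val + 1, hi⟩ : Fin N) := by
        ext j
        rw [Finset.mem_Ioi, Finset.mem_Ici, Fin.lt_def, Fin.le_def]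
        exact Nat.lt_iff_add_one_le
      rw [this]; exact hs _
    · have : Finset.Ioi i = ∅ := by
        ext j
        have := j.isLt
        rw [Finset.mem_Ioi, Fin.lt_def]
        constructor
        · intro h; omega
        · intro h; simp at h
      simp [this]
  funext i
  have h1 := hs i
  rw [← Finset.Ioi_insert i, Finset.sum_insert (by simp), Finset.sum_insert (by simp), ht i] at h1
  exact add_right_cancel h1

theorem qy_mul {N : ℕ} {k k' : ℤ} {e e' : Fin N → ℤ} (h : Admissible k e)
    (h' : Admissible k' e') : qy k e * qy k' e' = qy (k + k') (e + e') := by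
  have : qyExp k e + qyExp k' e' = qyExp (k + k') (e + e') := by
    simp only [qyExp, lexp_add, ← Finset.sum_add_distrib, Pi.add_apply]
    refine Finset.sum_congr rfl fun i _ => ?_
    rw [← Finsupp.single_add, Int.toNat_add (h i) (h' i)]
  rw [qy, qy, MvPowerSeries.monomial_mul_monomial, this, one_mul, qy]

theorem sum_Ici_single {N : ℕ} (i j : Fin N) :
    ∑ x ∈ Finset.Ici i, (Pi.single j 1 : Fin N → ℤ) x = if i ≤ j then 1 else 0 := by
  simp

theorem admissible_all {N : ℕ} (k : ℕ) (i : Fin N) (p : Pair N) :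
    Admissible (k : ℤ) (0 : Fin N → ℤ) ∧ Admissible (0 : ℤ) (Pi.single i 1) ∧
    Admissible (1 : ℤ) (-Pi.single i 1 : Fin N → ℤ) ∧
    Admissible (0 : ℤ) (Pi.single p.1.2 1 - Pi.single p.1.1 1 : Fin N → ℤ) ∧
    Admissible (1 : ℤ) (Pi.single p.1.1 1 - Pi.single p.1.2 1 : Fin N → ℤ) := by
  have hp := p.2
  refine ⟨?_, ?_, ?_, ?_, ?_⟩ <;> intro j <;> refine Fin.cases ?_ (fun j => ?_) j <;>
    simp only [lexp, Fin.cons_zero, Fin.cons_succ, Pi.zero_apply, Pi.neg_apply, Pi.sub_apply,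
      Finset.sum_const_zero, Finset.sum_neg_distrib, Finset.sum_sub_distrib, sum_Ici_single] <;>
    (try split_ifs) <;> omega

theorem y_mul_yInvq {N : ℕ} (p : Pair N) (i : Fin N) : y i * yInvq i = q N := by
  obtain ⟨-, h1, h2, -, -⟩ := admissible_all 0 i p
  rw [y, yInvq, qy_mul h1 h2, q]; simp

theorem yy_mul_y {N : ℕ} (p : Pair N) : yy p * y p.1.1 = y p.1.2 := by
  obtain ⟨-, h1, -, h2, -⟩ := admissible_all 0 p.1.1 p
  rw [y, yy, qy_mul h2 h1, y]; simp

theorem yy_mul_yyInvq {N : ℕ} (p : Pair N) : yy p * yyInvq p = q N := by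
  obtain ⟨-, -, -, h1, h2⟩ := admissible_all 0 p.1.1 p
  rw [yy, yyInvq, qy_mul h1 h2, q]; simp

/-- The power series `exp (s)` of a variable `s`. -/
noncomputable def expVar {N : ℕ} (s : Var N) : Ser N :=
  (PowerSeries.exp ℚ).subst (MvPowerSeries.X s : Ser N)

open scoped MvPowerSeries.WithPiTopology in
/-- The infinite product `(t)_∞ = (1 - t) (1 - t q) (1 - t q ^ 2) ⋯`; every coefficient of the
partial products is eventually constant. -/
noncomputable def poch {N : ℕ} (t : Ser N) : Ser N :=
  ∏' n : ℕ, (1 - t * q N ^ n)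

open scoped MvPowerSeries.WithPiTopology in
/-- The product defining `(t)_∞` converges, so `poch t` is its genuine value. -/
theorem multipliable_poch {N : ℕ} (t : Ser N) :
    Multipliable fun n : ℕ => 1 - t * q N ^ n := by
  have hq : MvPowerSeries.constantCoeff (q N) = 0 := by
    classical
    have hne : qyExp 1 (0 : Fin N → ℤ) ≠ 0 := by
      intro h
      have := DFunLike.congr_fun h (Var.w 0)
      simp [qyExp, lexp, Fin.sum_univ_succ, Fin.succ_ne_zero] at this
    rw [q, qy, ← MvPowerSeries.coeff_zero_eq_constantCoeff_apply, MvPowerSeries.coeff_monomial,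
      if_neg hne.symm]
  have h := MvPowerSeries.WithPiTopology.multipliable_one_add_of_tendsto_order_atTop_nhds_top
    (f := fun n : ℕ => -t * q N ^ n) ?_
  · simpa [sub_eq_add_neg] using h
  · simp_rw [ENat.tendsto_nhds_top_iff_natCast_lt, Filter.eventually_atTop]
    intro n
    refine ⟨n + 1, fun m hm => lt_of_lt_of_le (ENat.natCast_lt_natCast.mpr (by omega : n < m)) ?_⟩
    exact (MvPowerSeries.le_order_pow_of_constantCoeff_eq_zero m hq).trans
      (le_add_self.trans MvPowerSeries.le_order_mul)

/-- `(x x' t)_∞ (t)_∞ / ((x t)_∞ (x' t)_∞)`; the denominator has constant term `1`. -/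
noncomputable def ratio {N : ℕ} (x x' t : Ser N) : Ser N :=
  poch (x * x' * t) * poch t * (poch (x * t) * poch (x' * t))⁻¹

/-- The formal power `F ^ c = exp (c * log F)`, for a series `F` with constant term `1`. -/
noncomputable def fpow {N : ℕ} (F c : Ser N) : Ser N :=
  (PowerSeries.exp ℚ).subst (c * (PowerSeries.log ℚ).subst (F - 1))

/-- The trace `𝔓_N` with exponents `c` and `d`. -/
noncomputable def trace (N : ℕ) (c d : Ser N) : Ser N :=
  (∏ p : Pair N,
    ratio (expVar (.pz p 0)) (expVar (.pz p 1)) (yy p) *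
      ratio (expVar (.pv p 0)) (expVar (.pv p 1)) (yyInvq p)) *
  ∏ i : Fin N,
    fpow (poch (expVar (.z i) * y i) * (poch (y i))⁻¹) c *
      fpow (poch (expVar (.v i) * yInvq i) * (poch (yInvq i))⁻¹) d

/-- The exponent vector of `∏ (z_l^{i,j})^(m i j l) (v_l^{i,j})^(n i j l) * ∏ z_i^(m' i) v_i^(n' i)`. -/
noncomputable def zvExp {N : ℕ} (m n : Pair N → Fin 2 → ℕ) (m' n' : Fin N → ℕ) : Var N →₀ ℕ :=
  (∑ p, ∑ l, (Finsupp.single (.pz p l) (m p l) + Finsupp.single (.pv p l) (n p l))) +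
    ∑ i, (Finsupp.single (.z i) (m' i) + Finsupp.single (.v i) (n' i))

/-- The coefficient of the monomial with exponents `m, n, m', n'` in `Coeff_{y_1^0 ⋯ y_N^0} F`,
as a series in `a` (variable `0`) and `b` (variable `1`) whose coefficients are series in `q`. -/
noncomputable def coeffY0 {N : ℕ} (m n : Pair N → Fin 2 → ℕ) (m' n' : Fin N → ℕ) (F : Ser N) :
    MvPowerSeries (Fin 2) ℚ⟦X⟧ :=
  fun d => PowerSeries.mk fun k =>
    MvPowerSeries.coeff
      (zvExp m n m' n' + Finsupp.single .a (d 0) + Finsupp.single .b (d 1) + qyExp (k : ℤ) 0) F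

end Trace

/-! ### Nested sums whose letters involve the upper end point -/

/-! The proof has three stages: expand the trace, take the constant term by residues, and evaluate
the remaining sums over positions.

Expansion. Let every variable z, v have degree one and let E be the Euler derivation. A factor of
the trace is built from terms 1 - xY, where Y is q^n times a Laurent monomial y_j / y_i (with y_0 =
1), so its logarithmic derivative is a sum over n of rational expressions in T = Y/(1 - Y). Their
coefficients in z, v are polynomials in T without constant term, of degree at most the degree in z,
v. The relation E F = F h then computes the coefficients of the trace recursively
(`exists_slice_traceN`): they are combinations of products of sums over n of polynomials g_e(T),
with X dividing g_e and the total degree bounded by the weight. For a pair, the logarithmic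
derivative is even divisible by T(1 + T) (`pairDer_eq`), which is what (ii) rests on. Each a or b
comes with at least one z_i or v_i, which bounds the degree in a, b.

Constant term. The factors are edges of a multigraph on the vertices 0, ..., N. The constant term in
y_v is a sum of residues at the poles y_v = q^h y_i with h at least 1 (`sum_res`, `cval_contract`).
At such a pole the edges having it disappear, v is contracted to i, and Taylor expansion raises the
degrees of the other edges by less than the degree that has disappeared. Repeating this from the
largest vertex down leaves loops, and a sum over heights of the vertices (`cval_mem_heightSpan`);
each contraction frees one unit of degree, which pays for one vertex of positive height. When edge
labels are replaced by edge positions, the sums over labels and heights become sums over positions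
of products over arcs, under conditions that depend on the order type only (`sum_heights_eq`).

Positions. Put t(m) = q^m/(1 - q^m). For (i) one has to sum, over chains 0 < x_1 < ... < x_k,
products of values t of distances attached to a connected graph, in which virtual edges of value 1
may occur. Partial fractions t(a) t(b) = t(a + b)(1 + t(a) + t(b)) collect all edges at the smallest
vertex into powers of a single t, while the graph on the other vertices stays connected
(`elim_star`). Summing over this vertex produces nested sums whose letters involve the distance to
the end point. These distances are removed by `out_strictSum`: shifting the end point by one
together with all distance letters turns one kind of weak inequalities into another, so that the sum
telescopes, with differences that have fewer letters. At the end only letters u^r t(u)^a are left.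
For a > 0 they equal u^r times the sum of p(v) q^(uv) with deg p < a; for a = 0 they are summed as
powers. The result is a combination of bi-brackets (`brTop_ofFn`). The sum over the largest vertex
converges because of divisibility by a power of q (`EndSum.fsum_mem`).

For (ii) all edges carry t(1 + t). Two adjacent edges of this kind equal the edge joining their far
ends times a square (`kd_mul_kd_of_lt`), so the edge from 0 to the largest vertex can be split off
(`exists_kdProd`). For this edge the polynomial p vanishes at 0, which means s_1 > 1. Virtual edges
are of no use for this splitting; instead, a component not attached to 0 is slid along the line and
the sum over its position telescopes (`evSum_sameOrder`). -/

namespace Nested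
noncomputable section

open scoped Polynomial
open Algebra (smul_def)
open BiBracket (BD biBracket qBD)
open Finset (Icc Ico Ioc Ioo card_image_le card_univ disjoint_left mem_Icc mem_Ico mem_Ioc mem_Ioo
  mem_erase mem_filter mem_image mem_image_of_mem mem_insert_self mem_product mem_range mem_sigma
  mem_sort mem_univ mul_sum prod_congr range smul_sum sum_add_distrib sum_comm sum_comm' sum_congr
  sum_eq_zero sum_filter sum_insert sum_mul sum_neg_distrib sum_range_succ sum_singleton sum_smul
  sum_sub_distrib sum_subset univ)
open Finset.HasAntidiagonal (mem_antidiagonal)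
open Fintype (card mem_piFinset ofFinite piFinset)
open Function (comp onFun)
open LinearMap (mulLeft)
open List (getD_eq_getElem getElem_mem length_cons map_map mem_append mem_cons mem_cons_of_mem
  mem_cons_self mem_map ofFn ofFn_succ pairwise_cons replicate)
open Nat (cast_pow lt_succ_of_le)
open Polynomial (X X_ne_zero aeval eval_C eval_X eval_add eval_comp eval_eq_sum_range eval_one
  eval_pow natDegree_X_add_C natDegree_X_pow natDegree_comp_le natDegree_mul natDegree_sub_C)
open PowerSeries (X_pow_dvd_iff coeff coeff_X_pow_mul' coeff_mk coeff_monomial coeff_mul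
  smul_eq_C_mul)
open Submodule (smul_mem span span_induction span_induction₂ span_le span_mono subset_span)

section

variable {Env M : Type*} [CommRing M]

/-- A letter of a word: a function of the summation variable, or a function of the distance of the
summation variable to the upper end point of the sum. -/
abbrev Letter (Env M : Type*) := (Env → ℕ → M) ⊕ (ℕ → M)

/-- The value of a letter at the summation variable `y`, for the upper end point `b`. -/
def Letter.val : Letter Env M → Env → ℕ → ℕ → M
  | .inl φ, e, _, y => φ e y
  | .inr ψ, _, b, y => ψ (b - y)

/-- The nested sum of a word over `0 < y_r < ⋯ < y_1 < U`. -/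
def strictSum : List (Letter Env M) → Env → ℕ → ℕ → M
  | [], _, _, _ => 1
  | l :: w, e, b, U => ∑ y ∈ Ioo 0 U, l.val e b y * strictSum w e b y

/-- Whether a letter depends on the distance to the end point. -/
def Letter.isT (l : Letter Env M) : Bool := l.isRight

/-- The sum of a word over a chain in which equality is allowed between neighbours `y ≤ y'`
when `y` is of distance type and `y'` is not. -/
def sumA : List (Letter Env M) → Bool → Env → ℕ → ℕ → M
  | [], _, _, _, U => if 0 < U then 1 else 0
  | l :: w, τ, e, b, U =>
    ∑ y ∈ range (if l.isT && !τ then U + 1 else U), l.val e b y * sumA w l.isT e b y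

/-- The sum of a word over a chain in which equality is allowed between neighbours `y ≤ y'`
when `y'` is of distance type and `y` is not. -/
def sumB : List (Letter Env M) → Bool → Env → ℕ → ℕ → M
  | [], τ, _, _, U => if 0 < U ∨ τ = true then 1 else 0
  | l :: w, τ, e, b, U =>
    ∑ y ∈ range (if !l.isT && τ then U + 1 else U), l.val e b y * sumB w l.isT e b y

theorem sumA_true_zero (w : List (Letter Env M)) (e : Env) (b : ℕ) : sumA w true e b 0 = 0 := by
  cases w <;> simp [sumA]

/-- Shifting the end point together with all letters of distance type. -/
theorem sumA_succ (w : List (Letter Env M)) (τ : Bool) (e : Env) (b U : ℕ) :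
    sumA w τ e (b + 1) (if τ then U + 1 else U) = sumB w τ e b U := by
  induction w generalizing τ U with
  | nil => cases τ <;> simp [sumA, sumB]
  | cons l w ih =>
    rcases l with φ | ψ
    · have h : ∀ y, sumA w false e (b + 1) y = sumB w false e b y := fun y => by
        simpa using ih false y
      cases τ <;> simp [sumA, sumB, Letter.isT, Letter.val, h]
    · have h : ∀ y, sumA w true e (b + 1) (y + 1) = sumB w true e b y := fun y => by
        simpa using ih true y
      have h0 := sumA_true_zero w e (b + 1)
      cases τ <;>
        simp [sumA, sumB, Letter.isT, Letter.val, Finset.sum_range_succ', h, h0]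

/-- Telescoping in the end point: `sumA_succ` evaluates the sum at b + 1 in terms of data at b, and
the sum at 0 vanishes. -/
theorem sumA_self_eq_sum {w : List (Letter Env M)} (e : Env) (b : ℕ) :
    sumA w true e b b =
      ∑ b' ∈ range b, (sumB w true e b' b' - sumA w true e b' b') := by
  induction b with
  | zero => simpa using sumA_true_zero w e 0
  | succ b ih =>
    rw [sum_range_succ, ← ih]
    have := sumA_succ w true e b b
    simp only [if_true] at this
    rw [this]; ring

section Families

variable [Algebra ℚ M]

variable (Dom : Env → ℕ → Prop) (𝓛 𝒞 : ℕ → Submodule ℚ (Env → ℕ → M))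
  (Ψ : ℕ → Submodule ℚ (ℕ → M))

/-- Words whose letters lie in the given families, with their total degree. -/
inductive Deg : List (Letter Env M) → ℕ → Prop
  | nil : Deg [] 0
  | left {φ d w D} : φ ∈ 𝓛 d → Deg w D → Deg (.inl φ :: w) (d + D)
  | right {ψ d w D} : ψ ∈ Ψ d → Deg w D → Deg (.inr ψ :: w) (d + D)

/-- Combinations of words of length less than `r`, with coefficients depending on the end point. -/
inductive Shorter (r D : ℕ) : (Env → ℕ → ℕ → M) → Prop
  | coef {c d w D'} : c ∈ 𝒞 d → Deg 𝓛 Ψ w D' → w.length < r → d + D' = D →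
      Shorter r D fun e b U => c e b * strictSum w e b U
  | zero : Shorter r D 0
  | add {f g} : Shorter r D f → Shorter r D g → Shorter r D (f + g)
  | smul {f} (x : ℚ) : Shorter r D f → Shorter r D (x • f)
  | congr {f g} : (∀ e b U, Dom e b → 0 < U → U ≤ b → f e b U = g e b U) →
      Shorter r D f → Shorter r D g

/-- Combinations of letters with coefficients depending on the end point. -/
inductive Split (D : ℕ) : (Env → ℕ → ℕ → M) → Prop
  | left {c d φ d'} : c ∈ 𝒞 d → φ ∈ 𝓛 d' → d + d' = D → Split D fun e b y => c e b * φ e y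
  | right {c d ψ d'} : c ∈ 𝒞 d → ψ ∈ Ψ d' → d + d' = D → Split D fun e b y => c e b * ψ (b - y)
  | zero : Split D 0
  | add {f g} : Split D f → Split D g → Split D (f + g)
  | smul {f} (x : ℚ) : Split D f → Split D (x • f)
  | congr {f g} : (∀ e b y, Dom e b → 0 < y → y < b → f e b y = g e b y) →
      Split D f → Split D g

/-- Combinations of nested sums without letters of distance type. -/
inductive Pure : ℕ → (Env → ℕ → M) → Prop
  | one : Pure 0 1
  | cons {φ d D f} : φ ∈ 𝓛 d → Pure D f →
      Pure (d + D) fun e U => ∑ y ∈ Ioo 0 U, φ e y * f e y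
  | zero (D) : Pure D 0
  | add {D f g} : Pure D f → Pure D g → Pure D (f + g)
  | smul {D f} (x : ℚ) : Pure D f → Pure D (x • f)
  | congr {D f g} : (∀ e b, Dom e b → 0 < b → f e b = g e b) → Pure D f → Pure D g

/-- Combinations of nested sums without letters of distance type, with coefficients. -/
inductive Out (D : ℕ) : (Env → ℕ → M) → Prop
  | pure {f} : Pure Dom 𝓛 D f → Out D f
  | coef {c d D' f} : c ∈ 𝒞 d → Pure Dom 𝓛 D' f → d + D' = D → Out D (c * f)
  | add {f g} : Out D f → Out D g → Out D (f + g)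
  | smul {f} (x : ℚ) : Out D f → Out D (x • f)
  | congr {f g} : (∀ e b, Dom e b → 0 < b → f e b = g e b) → Out D f → Out D g

variable {Dom 𝓛 𝒞 Ψ}

theorem Out.mul (hmul : ∀ {d d' φ φ'}, φ ∈ 𝒞 d → φ' ∈ 𝒞 d' → φ * φ' ∈ 𝒞 (d + d'))
    {c : Env → ℕ → M} {d D f} (hc : c ∈ 𝒞 d) (hf : Out Dom 𝓛 𝒞 D f) : Out Dom 𝓛 𝒞 (d + D) (c * f) := by
  induction hf with
  | pure h => exact .coef hc h rfl
  | coef hc' h he =>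
    rw [← mul_assoc]; exact .coef (hmul hc hc') h (by omega)
  | add _ _ h1 h2 => rw [mul_add]; exact .add h1 h2
  | smul x _ h => rw [mul_smul_comm]; exact .smul x h
  | congr h _ h' => exact .congr (fun e b hd hb => by simp [h e b hd hb]) h'

/-- Summation of a combination with a coefficient of positive degree gives a pure word. -/
theorem Out.sum (hmul : ∀ {d d' φ φ'}, φ ∈ 𝓛 d → φ' ∈ 𝒞 d' → φ * φ' ∈ 𝓛 (d + d'))
    (hdom : ∀ e b b', Dom e b → b' ≤ b → Dom e b')
    {c : Env → ℕ → M} {d D f} (hc : c ∈ 𝓛 d) (hf : Out Dom 𝓛 𝒞 D f) :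
    Pure Dom 𝓛 (d + D) fun e U => ∑ y ∈ Ioo 0 U, c e y * f e y := by
  induction hf with
  | pure h => exact .cons hc h
  | coef hc' h he =>
    subst he
    have := Pure.cons (hmul hc hc') h
    rw [add_assoc] at this
    exact .congr (fun e b _ _ => sum_congr rfl fun y _ => by simp [mul_assoc]) this
  | add _ _ h1 h2 =>
    exact .congr (fun e b _ _ => by simp [mul_add, sum_add_distrib]) (h1.add h2)
  | smul x _ h =>
    exact .congr (fun e b _ _ => by simp [smul_sum]) (h.smul x)
  | congr h _ h' =>
    refine .congr (fun e b hd hb => sum_congr rfl fun y hy => ?_) h'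
    rw [mem_Ioo] at hy
    rw [h e y (hdom e b y hd hy.2.le) hy.1]

theorem Shorter.mono {r r' D} (h : r ≤ r') {f : Env → ℕ → ℕ → M} (hf : Shorter Dom 𝓛 𝒞 Ψ r D f) :
    Shorter Dom 𝓛 𝒞 Ψ r' D f := by
  induction hf with
  | coef h1 h2 h3 h4 => exact .coef h1 h2 (by omega) h4
  | zero => exact .zero
  | add _ _ h1 h2 => exact h1.add h2
  | smul x _ h => exact h.smul x
  | congr h _ h' => exact h'.congr h

theorem Shorter.mul (hmul : ∀ {d d' φ φ'}, φ ∈ 𝒞 d → φ' ∈ 𝒞 d' → φ * φ' ∈ 𝒞 (d + d'))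
    {c : Env → ℕ → M} {d r D f} (hc : c ∈ 𝒞 d) (hf : Shorter Dom 𝓛 𝒞 Ψ r D f) :
    Shorter Dom 𝓛 𝒞 Ψ r (d + D) fun e b U => c e b * f e b U := by
  induction hf with
  | coef h1 h2 h3 h4 =>
    refine .congr (fun e b U _ _ _ => ?_) (Shorter.coef (hmul hc h1) h2 h3 (by omega))
    simp [mul_assoc]
  | zero => exact .congr (fun e b U _ _ _ => by simp) .zero
  | add _ _ h1 h2 => exact .congr (fun e b U _ _ _ => by simp [mul_add]) (h1.add h2)
  | smul x _ h => exact .congr (fun e b U _ _ _ => by simp) (h.smul x)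
  | congr h _ h' => exact .congr (fun e b U h1 h2 h3 => by simp [h e b U h1 h2 h3]) h'

theorem Deg.cons {l : Letter Env M} {w d D} (hl : Deg 𝓛 Ψ [l] d) (hw : Deg 𝓛 Ψ w D) :
    Deg 𝓛 Ψ (l :: w) (d + D) := by
  cases hl with
  | left h h' => cases h'; exact .left h hw
  | right h h' => cases h'; exact .right h hw

theorem Shorter.cons {l : Letter Env M} {d r D f} (hl : Deg 𝓛 Ψ [l] d)
    (hf : Shorter Dom 𝓛 𝒞 Ψ r D f) :
    Shorter Dom 𝓛 𝒞 Ψ (r + 1) (d + D)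
      fun e b U => ∑ y ∈ Ioo 0 U, l.val e b y * f e b y := by
  induction hf with
  | @coef c d' w D' h1 h2 h3 h4 =>
    refine .congr (fun e b U _ _ _ => ?_)
      (Shorter.coef (w := l :: w) h1 (hl.cons h2) (by simpa using h3) (by omega))
    simp only [strictSum, mul_sum]
    exact sum_congr rfl fun y _ => by ring
  | zero => exact .congr (fun e b U _ _ _ => by simp) .zero
  | add _ _ h1 h2 =>
    exact .congr (fun e b U _ _ _ => by simp [mul_add, sum_add_distrib]) (h1.add h2)
  | smul x _ h => exact .congr (fun e b U _ _ _ => by simp [smul_sum]) (h.smul x)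
  | congr h _ h' =>
    refine .congr (fun e b U h1 h2 h3 => sum_congr rfl fun y hy => ?_) h'
    rw [mem_Ioo] at hy
    rw [h e b y h1 hy.1 (by omega)]

/-- A letter which is a product of the two kinds. -/
theorem Split.word {D g} (hg : Split Dom 𝓛 𝒞 Ψ D g) {w D'} (hw : Deg 𝓛 Ψ w D') :
    Shorter Dom 𝓛 𝒞 Ψ (w.length + 2) (D + D')
      fun e b U => ∑ y ∈ Ioo 0 U, g e b y * strictSum w e b y := by
  induction hg with
  | @left c d φ d' h1 h2 h3 =>
    refine .congr (fun e b U _ _ _ => ?_)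
      (Shorter.coef (w := .inl φ :: w) h1 (.left h2 hw) (by simp) (by omega))
    simp only [strictSum, mul_sum, Letter.val]
    exact sum_congr rfl fun y _ => by ring
  | @right c d ψ d' h1 h2 h3 =>
    refine .congr (fun e b U _ _ _ => ?_)
      (Shorter.coef (w := .inr ψ :: w) h1 (.right h2 hw) (by simp) (by omega))
    simp only [strictSum, mul_sum, Letter.val]
    exact sum_congr rfl fun y _ => by ring
  | zero => exact .congr (fun e b U _ _ _ => by simp) .zero
  | add _ _ h1 h2 =>
    exact .congr (fun e b U _ _ _ => by simp [add_mul, sum_add_distrib]) (h1.add h2)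
  | smul x _ h => exact .congr (fun e b U _ _ _ => by simp [smul_sum]) (h.smul x)
  | congr h _ h' =>
    refine .congr (fun e b U h1 h2 h3 => sum_congr rfl fun y hy => ?_) h'
    rw [mem_Ioo] at hy
    rw [h e b y h1 hy.1 (by omega)]

theorem Split.shorter (hmul : ∀ {d d' φ φ'}, φ ∈ 𝒞 d → φ' ∈ 𝒞 d' → φ * φ' ∈ 𝒞 (d + d'))
    {D g} (hg : Split Dom 𝓛 𝒞 Ψ D g) {r D' f} (hf : Shorter Dom 𝓛 𝒞 Ψ r D' f) :
    Shorter Dom 𝓛 𝒞 Ψ (r + 2) (D + D')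
      fun e b U => ∑ y ∈ Ioo 0 U, g e b y * f e b y := by
  induction hf with
  | @coef c d' w D' h1 h2 h3 h4 =>
    have h5 := (hg.word h2).mul hmul h1
    rw [show d' + (D + D') = D + (d' + D') by omega, h4] at h5
    refine .congr (fun e b U _ _ _ => ?_) (h5.mono (by omega))
    simp only [mul_sum]
    exact sum_congr rfl fun y _ => by ring
  | zero => exact .congr (fun e b U _ _ _ => by simp) .zero
  | add _ _ h1 h2 =>
    exact .congr (fun e b U _ _ _ => by simp [mul_add, sum_add_distrib]) (h1.add h2)
  | smul x _ h => exact .congr (fun e b U _ _ _ => by simp [smul_sum]) (h.smul x)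
  | congr h _ h' =>
    refine .congr (fun e b U h1 h2 h3 => sum_congr rfl fun y hy => ?_) h'
    rw [mem_Ioo] at hy
    rw [h e b y h1 hy.1 (by omega)]

end Families

theorem sumB_false_zero (w : List (Letter Env M)) (e : Env) (b : ℕ) : sumB w false e b 0 = 0 := by
  cases w <;> simp [sumB]

theorem sum_range_eq_Ioo {f : ℕ → M} (h0 : f 0 = 0) (U : ℕ) :
    ∑ y ∈ range U, f y = ∑ y ∈ Ioo 0 U, f y := by
  refine (sum_subset (fun y hy => by simp at hy ⊢; omega) fun y hy hy' => ?_).symm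
  have : y = 0 := by simp at hy hy'; omega
  rw [this, h0]

section Families

variable [Algebra ℚ M]

variable {Dom : Env → ℕ → Prop} {𝓛 𝒞 : ℕ → Submodule ℚ (Env → ℕ → M)}
  {Ψ : ℕ → Submodule ℚ (ℕ → M)}

/-- A weak sum exceeds the strict one by terms in which two neighbours of different type coincide.
Their letters multiply to φ(y) ψ(b - y), which `hsplit` turns into single letters with coefficients
at the end point, so the word gets shorter. The bottom 0 behaves like a neighbour of ordinary type:
in `sumB` the last distance letter may sit at 0, and this gives the coefficient ψ(b) of `hzero`. The
chosen flags forbid equality at the upper end. -/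
theorem shorter_sub (hmul : ∀ {d d' φ φ'}, φ ∈ 𝓛 d → φ' ∈ 𝓛 d' → φ * φ' ∈ 𝓛 (d + d'))
    (hsplit : ∀ {d d' φ ψ}, φ ∈ 𝓛 d → ψ ∈ Ψ d' →
      Split Dom 𝓛 𝓛 Ψ (d + d') fun e b y => φ e y * ψ (b - y))
    (hzero : ∀ {d ψ}, ψ ∈ Ψ d → (fun _ b => ψ b) ∈ 𝓛 d) (n : ℕ) :
    ∀ {w D}, w.length = n → Deg 𝓛 Ψ w D →
      Shorter Dom 𝓛 𝓛 Ψ n D (fun e b U => sumA w true e b U - strictSum w e b U) ∧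
      Shorter Dom 𝓛 𝓛 Ψ n D (fun e b U => sumB w false e b U - strictSum w e b U) := by
  induction n using Nat.strong_induction_on with
  | _ n ih =>
  intro w D hn hw
  cases hw with
  | nil =>
    constructor <;>
    exact .congr (fun e b U _ h _ => by simp [sumA, sumB, strictSum, h]) .zero
  | @left φ d w D hφ hw =>
    subst hn
    have hl : Deg 𝓛 Ψ [.inl φ] d := .left hφ .nil
    obtain ⟨ihA, ihB⟩ := ih w.length (by simp) rfl hw
    constructor
    · have h0 : ∀ e b, sumA w false e b 0 = 0 := fun e b => by
        rcases w with _ | ⟨_ | _, w⟩ <;> simp [sumA, Letter.isT, sumA_true_zero]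
      have h1 : ∀ e b U, sumA (.inl φ :: w) true e b U - strictSum (.inl φ :: w) e b U =
          ∑ y ∈ Ioo 0 U, φ e y * (sumA w false e b y - strictSum w e b y) := by
        intro e b U
        simp only [sumA, strictSum, mul_sub, sum_sub_distrib, Letter.isT, Letter.val,
          Sum.isRight_inl, Bool.false_and, Bool.false_eq_true, if_false]
        rw [sum_range_eq_Ioo (by simp [h0])]
      cases hw with
      | nil =>
        refine .congr (fun e b U _ _ _ => ?_) .zero
        rw [h1]
        refine (sum_eq_zero fun y hy => ?_).symm
        rw [mem_Ioo] at hy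
        simp [sumA, strictSum, hy.1]
      | left hφ' hw' =>
        refine .congr (fun e b U _ _ _ => ?_) (ihA.cons hl)
        rw [h1]; rfl
      | @right ψ d' w D' hψ hw' =>
        have hs := hsplit hφ hψ
        obtain ⟨ihA', -⟩ := ih w.length (by simp) rfl hw'
        have k1 := ihA.cons hl
        have k2 := hs.word hw'
        have k3 := hs.shorter hmul ihA'
        rw [add_assoc] at k2 k3
        refine .congr (fun e b U _ _ _ => ?_) ((k1.add k2).add k3)
        rw [h1]
        simp only [Pi.add_apply, ← sum_add_distrib]
        refine sum_congr rfl fun y _ => ?_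
        simp only [sumA, strictSum, Letter.val, Letter.isT, Sum.isRight_inr, Bool.not_true,
          Bool.not_false, Bool.and_true, Bool.and_false, if_true, Bool.false_eq_true, if_false,
          sum_range_succ]
        ring
    · refine .congr (fun e b U _ _ _ => ?_) (ihB.cons hl)
      simp only [sumB, strictSum, mul_sub, sum_sub_distrib, Letter.isT, Letter.val,
          Sum.isRight_inl, Bool.not_false, Bool.and_false, Bool.false_eq_true, if_false]
      rw [sum_range_eq_Ioo (by simp [sumB_false_zero])]
  | @right ψ d w D hψ hw =>
    subst hn
    have hl : Deg 𝓛 Ψ [.inr ψ] d := .right hψ .nil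
    obtain ⟨ihA, ihB⟩ := ih w.length (by simp) rfl hw
    constructor
    · refine .congr (fun e b U _ _ _ => ?_) (ihA.cons hl)
      simp only [sumA, strictSum, mul_sub, sum_sub_distrib, Letter.isT, Letter.val,
          Sum.isRight_inr, Bool.not_true, Bool.and_false, Bool.false_eq_true, if_false]
      rw [sum_range_eq_Ioo (by simp [sumA_true_zero])]
    · cases hw with
      | nil =>
        refine .congr (fun e b U _ hU _ => ?_)
          (Shorter.coef (c := fun _ b => ψ b) (d := d) (w := []) (hzero hψ) .nil (by simp) rfl)
        obtain ⟨U, rfl⟩ : ∃ V, U = V + 1 := ⟨U - 1, by omega⟩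
        have : range (U + 1) = insert 0 (Ioo 0 (U + 1)) := Finset.ext fun x => by
          simp only [mem_range, Finset.mem_insert, mem_Ioo]; omega
        simp only [sumB, strictSum, Letter.isT, Letter.val, Sum.isRight_inr, Bool.not_true,
          Bool.false_and, Bool.false_eq_true, if_false, or_true, if_true, mul_one]
        rw [this, sum_insert (by simp), Nat.sub_zero, add_sub_cancel_right]
      | right hψ' hw' =>
        refine .congr (fun e b U _ _ _ => ?_) (ihB.cons hl)
        simp only [sumB, strictSum, mul_sub, sum_sub_distrib, Letter.isT, Letter.val,
          Sum.isRight_inr, Bool.not_true, Bool.false_and, Bool.false_eq_true, if_false]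
        rw [sum_range_eq_Ioo (by simp)]
      | @left φ d' w D' hφ hw' =>
        have hs := hsplit hφ hψ
        obtain ⟨-, ihB'⟩ := ih w.length (by simp) rfl hw'
        have k1 := ihB.cons hl
        have k2 := hs.word hw'
        have k3 := hs.shorter hmul ihB'
        rw [show d' + d + D' = d + (d' + D') by omega] at k2 k3
        refine .congr (fun e b U _ _ _ => ?_) ((k1.add k2).add k3)
        have h1 : sumB (.inr ψ :: .inl φ :: w) false e b U
            - strictSum (.inr ψ :: .inl φ :: w) e b U = ∑ y ∈ Ioo 0 U,
            ψ (b - y) * (sumB (.inl φ :: w) true e b y - strictSum (.inl φ :: w) e b y) := by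
          rw [sumB]
          simp only [strictSum, mul_sub, sum_sub_distrib, Letter.isT, Letter.val,
            Sum.isRight_inr, Bool.and_false, Bool.false_eq_true, if_false]
          rw [sum_range_eq_Ioo (by simp [sumB, Letter.isT, sumB_false_zero])]
        rw [h1]
        simp only [Pi.add_apply, ← sum_add_distrib]
        refine sum_congr rfl fun y _ => ?_
        simp only [sumB, strictSum, Letter.val, Letter.isT, Sum.isRight_inl, Bool.not_false,
          Bool.and_true, Bool.and_false, if_true, Bool.false_eq_true, if_false,
          sum_range_succ]
        ring

theorem Shorter.out (hmulC : ∀ {d d' φ φ'}, φ ∈ 𝒞 d → φ' ∈ 𝒞 d' → φ * φ' ∈ 𝒞 (d + d'))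
    {𝒦 : ℕ → Submodule ℚ (Env → ℕ → M)} (hle : ∀ {d φ}, φ ∈ 𝒦 d → φ ∈ 𝒞 d) {n : ℕ}
    (ih : ∀ {w D}, w.length < n → Deg 𝓛 Ψ w D → Out Dom 𝓛 𝒞 D fun e b => strictSum w e b b)
    {D f} (hf : Shorter Dom 𝓛 𝒦 Ψ n D f) : Out Dom 𝓛 𝒞 D fun e b => f e b b := by
  induction hf with
  | coef h1 h2 h3 h4 => subst h4; exact (ih h3 h2).mul hmulC (hle h1)
  | zero => exact .congr (fun _ _ _ _ => rfl) (.pure (.zero _))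
  | add _ _ h1 h2 => exact h1.add h2
  | smul x _ h => exact h.smul x
  | congr h _ h' => exact h'.congr fun e b hd hb => h e b b hd hb le_rfl

/-- Summation of a combination of shorter words with coefficients. -/
theorem Shorter.sum (hmul : ∀ {d d' φ φ'}, φ ∈ 𝓛 d → φ' ∈ 𝒞 d' → φ * φ' ∈ 𝓛 (d + d'))
    (hdom : ∀ e b b', Dom e b → b' ≤ b → Dom e b')
    {n : ℕ} (ih : ∀ {w D}, w.length < n → Deg 𝓛 Ψ w D →
      Out Dom 𝓛 𝒞 D fun e b => strictSum w e b b)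
    {D f} (hf : Shorter Dom 𝓛 𝓛 Ψ n D f) :
    Pure Dom 𝓛 D fun e b => ∑ y ∈ Ioo 0 b, f e y y := by
  induction hf with
  | coef h1 h2 h3 h4 => subst h4; exact (ih h3 h2).sum hmul hdom h1
  | zero => exact .congr (fun _ _ _ _ => by simp) (.zero _)
  | add _ _ h1 h2 => exact .congr (fun _ _ _ _ => by simp [sum_add_distrib]) (h1.add h2)
  | smul x _ h => exact .congr (fun _ _ _ _ => by simp [smul_sum]) (h.smul x)
  | congr h _ h' =>
    refine h'.congr fun e b hd hb => sum_congr rfl fun y hy => ?_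
    rw [mem_Ioo] at hy
    exact h e y y (hdom e b y hd hy.2.le) hy.1 le_rfl

/-- A nested sum whose letters may involve the upper end point is a combination, with coefficients
depending on the end point, of nested sums whose letters do not. -/
theorem out_strictSum (hle : ∀ {d φ}, φ ∈ 𝓛 d → φ ∈ 𝒞 d)
    (hmulC : ∀ {d d' φ φ'}, φ ∈ 𝒞 d → φ' ∈ 𝒞 d' → φ * φ' ∈ 𝒞 (d + d'))
    (hmulLC : ∀ {d d' φ φ'}, φ ∈ 𝓛 d → φ' ∈ 𝒞 d' → φ * φ' ∈ 𝓛 (d + d'))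
    (hdom : ∀ e b b', Dom e b → b' ≤ b → Dom e b')
    (hsplit : ∀ {d d' φ ψ}, φ ∈ 𝓛 d → ψ ∈ Ψ d' →
      Split Dom 𝓛 𝓛 Ψ (d + d') fun e b y => φ e y * ψ (b - y))
    (hzero : ∀ {d ψ}, ψ ∈ Ψ d → (fun _ b => ψ b) ∈ 𝓛 d) {w D} (hw : Deg 𝓛 Ψ w D) :
    Out Dom 𝓛 𝒞 D fun e b => strictSum w e b b := by
  induction hn : w.length using Nat.strong_induction_on generalizing w D with
  | _ n ih =>
  have ih' : ∀ {w D}, w.length < n → Deg 𝓛 Ψ w D → Out Dom 𝓛 𝒞 D fun e b => strictSum w e b b :=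
    fun h1 h2 => ih _ h1 h2 rfl
  by_cases hw0 : w = []
  · subst hw0; cases hw; exact .pure (.congr (fun _ _ _ _ => rfl) .one)
  obtain ⟨hA, hB⟩ := shorter_sub (fun h h' => hmulLC h (hle h')) @hsplit @hzero n hn hw
  -- the terms in which the outermost letter has moved to the end point
  obtain ⟨g, hC, hg⟩ : ∃ g, Shorter Dom 𝓛 𝓛 Ψ n D g ∧ ∀ e b, 0 < b →
      g e b b = sumB w true e b b - sumB w false e b b := by
    cases hw with
    | nil => simp at hw0
    | right _ _ => exact ⟨0, .zero, fun e b _ => by simp [sumB, Letter.isT]⟩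
    | @left φ d w D hφ hw =>
      obtain ⟨-, hB'⟩ := shorter_sub (Dom := Dom) (fun h h' => hmulLC h (hle h')) @hsplit @hzero w.length rfl hw
      have k1 := (hB'.mul (fun h h' => hmulLC h (hle h')) hφ).mono (show w.length ≤ n by simp at hn; omega)
      have k2 : Shorter Dom 𝓛 𝓛 Ψ n (d + D) fun e b U => φ e b * strictSum w e b U :=
        .coef hφ hw (by simp at hn; omega) rfl
      refine ⟨_, k1.add k2, fun e b _ => ?_⟩
      simp only [sumB, Letter.isT, Letter.val, Sum.isRight_inl, Bool.not_false, Bool.and_true,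
        Bool.and_false, if_true, Bool.false_eq_true, if_false, sum_range_succ, Pi.add_apply]
      ring
  -- The increment at b' is (`sumB` false - strict) + (`sumB` true - `sumB` false) - (`sumA` true -
  -- strict), three combinations of shorter words; their sum over b' is pure by induction. `hE`
  -- accounts for strict minus `sumA` at b itself.
  have hD := ((hB.add hC).add (hA.smul (-1))).sum hmulLC hdom ih'
  have hE := (hA.smul (-1)).out hmulC hle ih'
  refine .congr (fun e b _ hb => ?_) ((Out.pure hD).add hE)
  -- Telescoping starts at 0 but nested sums start at 1, so the increment at 0 has to vanish; a
  -- nonempty word has no room there.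
  have h0 : sumB w true e 0 0 - sumA w true e 0 0 = 0 := by
    have h0 : sumB w true e 0 0 = sumA w true e 1 1 := by
      simpa using (sumA_succ w true e 0 0).symm
    have h1 : sumA w true e 1 1 = 0 := by
      rcases w with _ | ⟨φ | ψ, w'⟩
      · exact absurd rfl hw0
      · rcases w' with _ | ⟨_ | _, w⟩ <;> simp [sumA, Letter.isT, sumA_true_zero]
      · simp [sumA, Letter.isT, sumA_true_zero]
    simp [h0, h1, sumA_true_zero]
  have h1 := sumA_self_eq_sum (w := w) e b
  rw [sum_range_eq_Ioo h0] at h1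
  simp only [Pi.add_apply, Pi.smul_apply, Pi.neg_apply, neg_smul, one_smul, neg_sub]
  rw [sum_congr rfl (g := fun b' => sumB w true e b' b' - sumA w true e b' b'), ← h1]
  · ring
  · intro y hy
    rw [hg e y (mem_Ioo.1 hy).1]
    ring

end Families

end

/-! ### The series q^m / (1 - q^m) and partial fractions. -/

/-- The series `q ^ m / (1 - q ^ m)`, with the value `0` for `m = 0`. -/
def tt (m : ℕ) : ℚ⟦X⟧ := PowerSeries.mk fun n => if 0 < n ∧ m ∣ n then 1 else 0

@[simp] theorem tt_zero : tt 0 = 0 := by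
  ext n
  simp only [tt, coeff_mk, zero_dvd_iff, map_zero, ite_eq_right_iff]
  rintro ⟨h, rfl⟩
  omega

theorem one_sub_mul_tt {m : ℕ} (hm : 0 < m) : (1 - (PowerSeries.X : ℚ⟦X⟧) ^ m) * tt m =
    PowerSeries.X ^ m := by
  ext n
  rw [sub_mul, one_mul, map_sub, coeff_X_pow_mul', PowerSeries.coeff_X_pow]
  simp only [tt, coeff_mk]
  by_cases h : m ≤ n
  · have h1 : m ∣ n - m ↔ m ∣ n := by rw [Nat.dvd_sub_iff_left h dvd_rfl]
    have h2 : n = m ↔ ¬ 0 < n - m := by omega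
    rw [if_pos h]
    simp only [h1]
    by_cases h3 : m ∣ n
    · by_cases h4 : n = m
      · subst h4; simp [hm]
      · have : 0 < n - m := by omega
        have : 0 < n := by omega
        simp [*]
    · have : n ≠ m := by rintro rfl; exact h3 dvd_rfl
      rw [if_neg (by tauto), if_neg (by tauto), if_neg this, sub_zero]
  · have h1 : ¬ (0 < n ∧ m ∣ n) := fun ⟨h1, h2⟩ => h (Nat.le_of_dvd h1 h2)
    rw [if_neg h, if_neg h1, if_neg (by omega), sub_zero]

theorem one_sub_X_pow_ne {m : ℕ} (hm : 0 < m) : (1 - (PowerSeries.X : ℚ⟦X⟧) ^ m) ≠ 0 := by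
  intro h
  have := congrArg PowerSeries.constantCoeff h
  simp [hm.ne'] at this

/-- Partial fractions. -/
theorem tt_mul_tt {a b : ℕ} (ha : 0 < a) (hb : 0 < b) :
    tt a * tt b = tt (a + b) * (1 + tt a + tt b) := by
  have h1 := one_sub_mul_tt ha
  have h2 := one_sub_mul_tt hb
  have h3 := one_sub_mul_tt (show 0 < a + b by omega)
  have hne := mul_ne_zero (mul_ne_zero (one_sub_X_pow_ne ha) (one_sub_X_pow_ne hb))
    (one_sub_X_pow_ne (show 0 < a + b by omega))
  rw [pow_add] at h3 hne
  refine mul_left_cancel₀ hne ?_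
  generalize (PowerSeries.X : ℚ⟦X⟧) ^ a = x at *
  generalize (PowerSeries.X : ℚ⟦X⟧) ^ b = y at *
  generalize tt (a + b) = t at *
  generalize tt a = s at *
  generalize tt b = u at *
  linear_combination (1 - x * y) * (1 - y) * u * h1 + (1 - x * y) * x * h2
    - ((1 - x) * (1 - y) + (1 - x) * s * (1 - y) + (1 - y) * u * (1 - x)) * h3
    - x * y * (1 - y) * h1 - x * y * (1 - x) * h2

/-! ### Letters and coefficients with their degrees. -/

/-- The condition that all elements of the environment exceed `b`. -/
def Below (e : List ℕ) (b : ℕ) : Prop := ∀ x ∈ e, b < x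

theorem Below.mono {e : List ℕ} {b b' : ℕ} (h : Below e b) (hb : b' ≤ b) : Below e b' :=
  fun x hx => hb.trans_lt (h x hx)

theorem Below.cons {e : List ℕ} {b b' : ℕ} (h : Below e b) (hb : b' < b) : Below (b :: e) b' := by
  intro x hx
  rcases mem_cons.1 hx with rfl | hx
  · exact hb
  · exact hb.trans (h x hx)

/-- Monomials of degree `a` in the series `tt y` and `tt (x - y)`, for `x` in the environment. -/
inductive Mono : ℕ → (List ℕ → ℕ → ℚ⟦X⟧) → Prop
  | one : Mono 0 1
  | self {a φ} : Mono a φ → Mono (a + 1) fun e y => tt y * φ e y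
  | env {a φ} (j : ℕ) : Mono a φ → Mono (a + 1) fun e y => tt (e.getD j 0 - y) * φ e y

theorem Mono.mul {a a' φ φ'} (h : Mono a φ) (h' : Mono a' φ') : Mono (a + a') (φ * φ') := by
  induction h with
  | one => simpa using h'
  | self _ ih =>
    rw [add_right_comm]
    convert ih.self using 1
    ext1 e; ext1 y; simp [mul_assoc]
  | env j _ ih =>
    rw [add_right_comm]
    convert ih.env j using 1
    ext1 e; ext1 y; simp [mul_assoc]

/-- Coefficients: the degree counts the factors. -/
def coefFam (d : ℕ) : Submodule ℚ (List ℕ → ℕ → ℚ⟦X⟧) :=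
  span ℚ {φ | ∃ a r φ', Mono a φ' ∧ a + r ≤ d ∧
    φ = fun (e : List ℕ) (y : ℕ) => (y : ℚ⟦X⟧) ^ r * φ' e y}

/-- Letters: the degree counts the factors, but a letter without a factor `tt` counts as one. -/
def letterFam (d : ℕ) : Submodule ℚ (List ℕ → ℕ → ℚ⟦X⟧) :=
  span ℚ {φ | ∃ a r φ', Mono a φ' ∧ max 1 a + r ≤ d ∧
    φ = fun (e : List ℕ) (y : ℕ) => (y : ℚ⟦X⟧) ^ r * φ' e y}

/-- Letters depending on the distance to the end point. -/
def distFam (d : ℕ) : Submodule ℚ (ℕ → ℚ⟦X⟧) :=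
  span ℚ {ψ | ∃ a r : ℕ, 1 ≤ a ∧ a + r ≤ d ∧ ψ = fun m : ℕ => (m : ℚ⟦X⟧) ^ r * tt m ^ a}

theorem mem_letterFam {a r d φ} (h : Mono a φ) (hd : max 1 a + r ≤ d) :
    (fun (e : List ℕ) (y : ℕ) => (y : ℚ⟦X⟧) ^ r * φ e y) ∈ letterFam d :=
  subset_span ⟨a, r, φ, h, hd, rfl⟩

theorem letterFam_le {d φ} (h : φ ∈ letterFam d) : φ ∈ coefFam d := by
  refine span_mono ?_ h
  rintro _ ⟨a, r, φ, h, hd, rfl⟩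
  exact ⟨a, r, φ, h, by omega, rfl⟩

theorem coefFam_mul {d d' φ φ'} (h : φ ∈ coefFam d) (h' : φ' ∈ coefFam d') :
    φ * φ' ∈ coefFam (d + d') := by
  refine span_induction₂ (p := fun x y _ _ => x * y ∈ coefFam (d + d')) ?_ ?_ ?_ ?_ ?_ ?_
    ?_ h h'
  · rintro _ _ ⟨a, r, φ, h, hd, rfl⟩ ⟨a', r', φ', h', hd', rfl⟩
    refine subset_span ⟨_, r + r', _, h.mul h', by omega, ?_⟩
    ext1 e; ext1 y; simp only [Pi.mul_apply]; ring
  · intros; simp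
  · intros; simp
  · intro x y z _ _ _ h1 h2; rw [add_mul]; exact add_mem h1 h2
  · intro x y z _ _ _ h1 h2; rw [mul_add]; exact add_mem h1 h2
  · intro c x y _ _ h; rw [smul_mul_assoc]; exact smul_mem _ _ h
  · intro c x y _ _ h; rw [mul_smul_comm]; exact smul_mem _ _ h

theorem letterFam_mul_coefFam {d d' φ φ'} (h : φ ∈ letterFam d) (h' : φ' ∈ coefFam d') :
    φ * φ' ∈ letterFam (d + d') := by
  refine span_induction₂ (p := fun x y _ _ => x * y ∈ letterFam (d + d')) ?_ ?_ ?_ ?_ ?_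
    ?_ ?_ h h'
  · rintro _ _ ⟨a, r, φ, h, hd, rfl⟩ ⟨a', r', φ', h', hd', rfl⟩
    refine subset_span ⟨_, r + r', _, h.mul h', by omega, ?_⟩
    ext1 e; ext1 y; simp only [Pi.mul_apply]; ring
  · intros; simp
  · intros; simp
  · intro x y z _ _ _ h1 h2; rw [add_mul]; exact add_mem h1 h2
  · intro x y z _ _ _ h1 h2; rw [mul_add]; exact add_mem h1 h2
  · intro c x y _ _ h; rw [smul_mul_assoc]; exact smul_mem _ _ h
  · intro c x y _ _ h; rw [mul_smul_comm]; exact smul_mem _ _ h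

theorem one_mem_coefFam : (1 : List ℕ → ℕ → ℚ⟦X⟧) ∈ coefFam 0 := by
  refine subset_span ⟨_, 0, _, Mono.one, le_rfl, ?_⟩
  ext1 e; ext1 y; simp

theorem one_mem_letterFam : (1 : List ℕ → ℕ → ℚ⟦X⟧) ∈ letterFam 1 := by
  refine subset_span ⟨_, 0, _, Mono.one, le_rfl, ?_⟩
  ext1 e; ext1 y; simp

theorem nat_mem_coefFam : (fun (_ : List ℕ) (y : ℕ) => (y : ℚ⟦X⟧)) ∈ coefFam 1 := by
  refine subset_span ⟨_, 1, _, Mono.one, le_rfl, ?_⟩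
  ext1 e; ext1 y; simp

theorem tt_mem_letterFam : (fun _ y => tt y) ∈ letterFam 1 := by
  refine subset_span ⟨_, 0, _, Mono.one.self, le_rfl, ?_⟩
  ext1 e; ext1 y; simp

theorem env_mem_letterFam (j : ℕ) : (fun (e : List ℕ) y => tt (e.getD j 0 - y)) ∈ letterFam 1 := by
  refine subset_span ⟨_, 0, _, (Mono.one.env j), le_rfl, ?_⟩
  ext1 e; ext1 y; simp

theorem letterFam_mono {d d' φ} (hd : d ≤ d') (h : φ ∈ letterFam d) : φ ∈ letterFam d' := by
  refine span_mono ?_ h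
  rintro _ ⟨a, r, φ, h, h', rfl⟩
  exact ⟨a, r, φ, h, by omega, rfl⟩

theorem coefFam_mono {d d' φ} (hd : d ≤ d') (h : φ ∈ coefFam d) : φ ∈ coefFam d' := by
  refine span_mono ?_ h
  rintro _ ⟨a, r, φ, h, h', rfl⟩
  exact ⟨a, r, φ, h, by omega, rfl⟩

theorem letterFam_mul_letterFam {d d' φ φ'} (h : φ ∈ letterFam d) (h' : φ' ∈ letterFam d') :
    φ * φ' ∈ letterFam (d + d') := letterFam_mul_coefFam h (letterFam_le h')

theorem nat_mul_distFam {d ψ} (h : ψ ∈ distFam d) :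
    (fun m : ℕ => (m : ℚ⟦X⟧) * ψ m) ∈ distFam (d + 1) := by
  refine span_induction (p := fun x _ => (fun m : ℕ => (m : ℚ⟦X⟧) * x m) ∈ distFam (d + 1))
    ?_ ?_ ?_ ?_ h
  · rintro _ ⟨a, r, ha, hd, rfl⟩
    refine subset_span ⟨a, r + 1, ha, by omega, ?_⟩
    ext1 m; simp only []; ring
  · convert Submodule.zero_mem _ using 1; ext1; simp
  · intro x y _ _ hx hy
    convert add_mem hx hy using 1
    ext1; simp [mul_add]
  · intro c x _ hx
    convert smul_mem _ c hx using 1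
    ext1; simp

/-- Coefficients from `letterFam` have degree at least one, those from `coefFam` may be constants of
degree zero. Products of an ordinary letter and a distance letter allow the first kind; a vertex
leaving the environment requires the second. -/
abbrev SplitF := Split (M := ℚ⟦X⟧) Below letterFam
abbrev LSplit := SplitF letterFam distFam
abbrev CSplit := SplitF coefFam distFam

section

variable {𝒞 : ℕ → Submodule ℚ (List ℕ → ℕ → ℚ⟦X⟧)}

theorem SplitF.coef_mul {c : List ℕ → ℕ → ℚ⟦X⟧} {d D g} (hg : SplitF 𝒞 distFam D g)
    (hc : ∀ {d' φ}, φ ∈ 𝒞 d' → c * φ ∈ 𝒞 (d + d')) :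
    SplitF 𝒞 distFam (d + D) fun e b y => c e b * g e b y := by
  induction hg with
  | left h1 h2 h3 =>
    exact .congr (fun e b y _ _ _ => by simp [mul_assoc]) (.left (hc h1) h2 (by omega))
  | right h1 h2 h3 =>
    exact .congr (fun e b y _ _ _ => by simp [mul_assoc]) (.right (hc h1) h2 (by omega))
  | zero => exact .congr (fun e b U _ _ _ => by simp) .zero
  | add _ _ h1 h2 => exact .congr (fun e b U _ _ _ => by simp [mul_add]) (h1.add h2)
  | smul x _ h => exact .congr (fun e b U _ _ _ => by simp) (h.smul x)
  | congr h _ h' => exact .congr (fun e b U h1 h2 h3 => by simp [h e b U h1 h2 h3]) h'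

/-- Write y = b - (b - y): the first summand goes into the coefficient, the second into the distance
letter. -/
theorem SplitF.nat_mul {D g} (hg : SplitF 𝒞 distFam D g)
    (hc : ∀ {d' φ}, φ ∈ 𝒞 d' → (fun (_ : List ℕ) (y : ℕ) => (y : ℚ⟦X⟧)) * φ ∈ 𝒞 (1 + d')) :
    SplitF 𝒞 distFam (D + 1) fun e b y => (y : ℚ⟦X⟧) * g e b y := by
  induction hg with
  | left h1 h2 h3 =>
    refine .congr (fun e b y _ _ _ => ?_)
      (.left h1 (letterFam_mul_coefFam h2 nat_mem_coefFam) (by omega))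
    simp only [Pi.mul_apply]; ring
  | right h1 h2 h3 =>
    refine .congr (fun e b y _ _ hy => ?_)
      ((Split.right (hc h1) h2 (by omega)).add
        ((Split.right h1 (nat_mul_distFam h2) (by omega)).smul (-1)))
    simp only [Pi.mul_apply, Pi.add_apply, Pi.neg_apply, neg_smul, one_smul,
      Nat.cast_sub hy.le]
    ring
  | zero => exact .congr (fun e b U _ _ _ => by simp) .zero
  | add _ _ h1 h2 => exact .congr (fun e b U _ _ _ => by simp [mul_add]) (h1.add h2)
  | smul x _ h => exact .congr (fun e b U _ _ _ => by simp) (h.smul x)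
  | congr h _ h' => exact .congr (fun e b U h1 h2 h3 => by simp [h e b U h1 h2 h3]) h'

end

theorem LSplit.dist_mul {D g} (hg : LSplit D g) :
    LSplit (D + 1) fun e b y => ((b - y : ℕ) : ℚ⟦X⟧) * g e b y := by
  have h1 : LSplit (1 + D) fun e b y => (b : ℚ⟦X⟧) * g e b y :=
    SplitF.coef_mul (c := fun _ y => (y : ℚ⟦X⟧)) hg fun h => by
      rw [mul_comm, add_comm]; exact letterFam_mul_coefFam h nat_mem_coefFam
  have h2 := SplitF.nat_mul hg fun h => by
      rw [mul_comm, add_comm]; exact letterFam_mul_coefFam h nat_mem_coefFam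
  rw [add_comm] at h1
  refine .congr (fun e b y _ _ hy => ?_) (h1.add (h2.smul (-1)))
  simp only [Pi.add_apply, Pi.neg_apply, neg_smul, one_smul, Nat.cast_sub hy.le]
  ring

theorem dist_mem {k r d : ℕ} (hk : 1 ≤ k) (hd : k + r ≤ d) :
    (fun m : ℕ => (m : ℚ⟦X⟧) ^ r * tt m ^ k) ∈ distFam d :=
  subset_span ⟨k, r, hk, hd, rfl⟩

/-- Partial fractions for y + (b - y) = b. The mixed product that remains has a lower power of `tt
(b - y)`, and its new factor `tt b` is a coefficient, so induction on k applies. -/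
theorem lsplit_tt_mul_tt_pow (k : ℕ) :
    LSplit (k + 2) fun _ b y => tt y * tt (b - y) ^ (k + 1) := by
  have h1 : (1 : List ℕ → ℕ → ℚ⟦X⟧) ∈ letterFam 1 := one_mem_letterFam
  have ht := tt_mem_letterFam
  have h3 : ∀ k D, k + 1 < D → LSplit D fun _ b y => tt b * tt (b - y) ^ (k + 1) := fun k D h =>
    .congr (fun e b y _ _ _ => by simp)
      (Split.right ht (dist_mem (k := k + 1) (r := 0) (d := D - 1) (by omega) (by omega))
        (by omega))
  induction k with
  | zero =>
    refine .congr (fun e b y _ hy hb => ?_)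
      (((Split.left ht h1 rfl).add (Split.left ht ht rfl)).add (h3 0 2 (by omega)))
    have := tt_mul_tt hy (show 0 < b - y by omega)
    rw [Nat.add_sub_cancel' hb.le] at this
    simp only [Pi.add_apply, Pi.one_apply]
    rw [zero_add, pow_one, this]; ring
  | succ k ih =>
    have h4 := SplitF.coef_mul (c := fun _ y => tt y) ih fun h => letterFam_mul_letterFam ht h
    rw [add_comm 1] at h4
    refine .congr (fun e b y _ hy hb => ?_) (((h3 k (k + 2 + 1) (by omega)).add h4).add
      (h3 (k + 1) (k + 2 + 1) (by omega)))
    have := tt_mul_tt hy (show 0 < b - y by omega)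
    rw [Nat.add_sub_cancel' hb.le] at this
    simp only [Pi.add_apply]
    linear_combination -tt (b - y) ^ (k + 1) * this

/-- Partial fractions for (x - b) + (b - y) = x - y, solved for the product of the two factors that
contain y. This needs b < x, which is what `Below` provides. -/
theorem lsplit_env_mul_tt_pow (j k : ℕ) :
    LSplit (k + 2) fun e b y => tt (e.getD j 0 - y) * tt (b - y) ^ (k + 1) := by
  have h1 : (1 : List ℕ → ℕ → ℚ⟦X⟧) ∈ letterFam 1 := one_mem_letterFam
  have ht := env_mem_letterFam j
  have h3 : ∀ k D, k + 1 < D → LSplit D fun e b y => tt (e.getD j 0 - b) * tt (b - y) ^ (k + 1) :=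
    fun k D h => .congr (fun e b y _ _ _ => by simp)
      (Split.right ht (dist_mem (k := k + 1) (r := 0) (d := D - 1) (by omega) (by omega))
        (by omega))
  have key : ∀ (e : List ℕ) b y, Below e b → 0 < y → y < b → tt (e.getD j 0 - y) * tt (b - y) =
      tt (e.getD j 0 - b) * tt (b - y) - (tt (e.getD j 0 - b) + 1) * tt (e.getD j 0 - y) := by
    intro e b y he hy hb
    rcases lt_or_ge j e.length with h | h
    · rw [getD_eq_getElem _ _ h]
      have hx : b < e[j] := he _ (getElem_mem h)
      have := tt_mul_tt (show 0 < e[j] - b by omega) (show 0 < b - y by omega)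
      rw [show e[j] - b + (b - y) = e[j] - y by omega] at this
      rw [this]; ring
    -- A missing entry reads as 0, and `tt 0 = 0` makes both sides vanish.
    · rw [List.getD_eq_default _ _ h]; simp
  induction k with
  | zero =>
    refine .congr (fun e b y he hy hb => ?_)
      (((h3 0 2 (by omega)).add ((Split.left ht ht rfl).smul (-1))).add
        ((Split.left h1 ht rfl).smul (-1)))
    simp only [Pi.add_apply, Pi.one_apply, Pi.neg_apply, neg_smul, one_smul]
    rw [zero_add, pow_one, key e b y he hy hb]; ring
  | succ k ih =>
    have h4 := SplitF.coef_mul (c := fun (e : List ℕ) y => tt (e.getD j 0 - y)) ih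
      fun h => letterFam_mul_letterFam ht h
    have h5 := SplitF.coef_mul (c := 1) ih fun h => letterFam_mul_letterFam h1 h
    rw [add_comm 1] at h4 h5
    refine .congr (fun e b y he hy hb => ?_) (((h3 (k + 1) (k + 2 + 1) (by omega)).add
      (h4.smul (-1))).add (h5.smul (-1)))
    simp only [Pi.add_apply, Pi.one_apply, Pi.neg_apply, neg_smul, one_smul]
    linear_combination -tt (b - y) ^ (k + 1) * key e b y he hy hb

/-- Ordinary letters absorb the new factor. A distance letter is first freed from its power of b -
y, so that only c times a power of `tt (b - y)` has to be split. -/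
theorem LSplit.mul_letter {c : List ℕ → ℕ → ℚ⟦X⟧} {D g} (hg : LSplit D g) (hc : c ∈ letterFam 1)
    (h : ∀ k, LSplit (k + 2) fun e b y => c e y * tt (b - y) ^ (k + 1)) :
    LSplit (D + 1) fun e b y => c e y * g e b y := by
  induction hg with
  | left h1 h2 h3 =>
    refine .congr (fun e b y _ _ _ => ?_)
      (.left h1 (letterFam_mul_letterFam h2 hc) (by omega))
    simp only [Pi.mul_apply]; ring
  | @right c' d ψ d' h1 h2 h3 =>
    have h4 : LSplit (d' + 1) fun e b y => c e y * ψ (b - y) := by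
      refine span_induction
        (p := fun ψ _ => LSplit (d' + 1) fun e b y => c e y * ψ (b - y)) ?_ ?_ ?_ ?_ h2
      · rintro _ ⟨a, r, ha, hd, rfl⟩
        obtain ⟨k, rfl⟩ : ∃ k, a = k + 1 := ⟨a - 1, by omega⟩
        have h5 : ∀ r, LSplit (k + 2 + r)
            fun e b y => ((b - y : ℕ) : ℚ⟦X⟧) ^ r * (c e y * tt (b - y) ^ (k + 1)) := by
          intro r
          induction r with
          | zero => simpa using h k
          | succ r ih =>
            refine .congr (fun e b y _ _ _ => ?_) ih.dist_mul
            ring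
        -- Multiplication by 1 pads the degree: the families bound degrees from above only.
        have h6 := SplitF.coef_mul (c := 1) (d := d' - (k + 1 + r)) (h5 r) fun h => by
          rw [one_mul]; exact letterFam_mono (by omega) h
        rw [show d' - (k + 1 + r) + (k + 2 + r) = d' + 1 by omega] at h6
        refine .congr (fun e b y _ _ _ => ?_) h6
        simp only [Pi.one_apply]; ring
      · exact .congr (fun e b U _ _ _ => by simp) .zero
      · intro x y _ _ h1 h2
        exact .congr (fun e b U _ _ _ => by simp [mul_add]) (h1.add h2)
      · intro x y _ h
        exact .congr (fun e b U _ _ _ => by simp) (h.smul x)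
    have h5 := SplitF.coef_mul (c := c') h4 fun h => letterFam_mul_letterFam h1 h
    rw [← h3]
    refine .congr (fun e b y _ _ _ => ?_) h5
    simp only []; ring
  | zero => exact .congr (fun e b U _ _ _ => by simp) .zero
  | add _ _ h1 h2 => exact .congr (fun e b U _ _ _ => by simp [mul_add]) (h1.add h2)
  | smul x _ h => exact .congr (fun e b U _ _ _ => by simp) (h.smul x)
  | congr h _ h' => exact .congr (fun e b U h1 h2 h3 => by simp [h e b U h1 h2 h3]) h'

/-- The factors of the monomial are multiplied in one at a time. For the empty monomial the
coefficient 1 still has degree one as a letter, whence `max 1 a`. -/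
theorem lsplit_mono {a φ} (h : Mono a φ) (k : ℕ) :
    LSplit (max 1 a + (k + 1)) fun e b y => φ e y * tt (b - y) ^ (k + 1) := by
  have one : LSplit (1 + (k + 1)) fun e b y => tt (b - y) ^ (k + 1) :=
    .congr (fun e b y _ _ _ => by simp)
      (Split.right one_mem_letterFam (dist_mem (k := k + 1) (r := 0) (by omega) le_rfl) rfl)
  have step : ∀ c ∈ letterFam 1,
      (∀ k, LSplit (k + 2) fun e b y => c e y * tt (b - y) ^ (k + 1)) → ∀ {a φ}, Mono a φ →
      LSplit (max 1 a + (k + 1)) (fun e b y => φ e y * tt (b - y) ^ (k + 1)) →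
      LSplit (max 1 (a + 1) + (k + 1)) fun e b y => c e y * φ e y * tt (b - y) ^ (k + 1) := by
    intro c hc h a φ hφ ih
    cases hφ with
    | one =>
      rw [show max 1 (0 + 1) + (k + 1) = k + 2 by simp; omega]
      exact .congr (fun e b y _ _ _ => by simp) (h k)
    | self h' | env j h' =>
      have := ih.mul_letter hc h
      rw [add_right_comm, show ∀ a, max 1 (a + 1) + 1 = max 1 (a + 1 + 1) by omega] at this
      exact .congr (fun e b y _ _ _ => by simp [mul_assoc]) this
  induction h with
  | one => exact .congr (fun e b y _ _ _ => by simp) one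
  | self h ih => exact step _ tt_mem_letterFam lsplit_tt_mul_tt_pow h ih
  | env j h ih => exact step _ (env_mem_letterFam j) (lsplit_env_mul_tt_pow j) h ih

/-- Powers of b - y and of y do not interfere with partial fractions and are put back afterwards. -/
theorem lsplit_mul {d d' φ ψ} (hφ : φ ∈ letterFam d) (hψ : ψ ∈ distFam d') :
    LSplit (d + d') fun e b y => φ e y * ψ (b - y) := by
  refine span_induction₂
    (p := fun φ ψ _ _ => LSplit (d + d') fun e b y => φ e y * ψ (b - y)) ?_ ?_ ?_ ?_ ?_ ?_ ?_ hφ hψ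
  · rintro _ _ ⟨a, r, φ, hφ, hd, rfl⟩ ⟨k, s, hk, hd', rfl⟩
    obtain ⟨k, rfl⟩ : ∃ l, k = l + 1 := ⟨k - 1, by omega⟩
    have h5 : ∀ s, LSplit (max 1 a + (k + 1) + s)
        fun e b y => ((b - y : ℕ) : ℚ⟦X⟧) ^ s * (φ e y * tt (b - y) ^ (k + 1)) := by
      intro s
      induction s with
      | zero => simpa using lsplit_mono hφ k
      | succ s ih =>
        refine .congr (fun e b y _ _ _ => ?_) ih.dist_mul
        ring
    have h6 : ∀ r, LSplit (max 1 a + (k + 1) + s + r) fun e b y =>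
        (y : ℚ⟦X⟧) ^ r * (((b - y : ℕ) : ℚ⟦X⟧) ^ s * (φ e y * tt (b - y) ^ (k + 1))) := by
      intro r
      induction r with
      | zero => simpa using h5 s
      | succ r ih =>
        refine .congr (fun e b y _ _ _ => ?_) (SplitF.nat_mul ih fun h => by
          rw [mul_comm, add_comm]; exact letterFam_mul_coefFam h nat_mem_coefFam)
        ring
    have h7 := SplitF.coef_mul (c := 1) (d := d + d' - (max 1 a + (k + 1) + s + r)) (h6 r)
      fun h => by rw [one_mul]; exact letterFam_mono (by omega) h
    rw [Nat.sub_add_cancel (by omega)] at h7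
    refine .congr (fun e b y _ _ _ => ?_) h7
    simp only [Pi.one_apply]; ring
  · intro x _; exact .congr (fun e b U _ _ _ => by simp) .zero
  · intro x _; exact .congr (fun e b U _ _ _ => by simp) .zero
  · intro x y z _ _ _ h1 h2
    exact .congr (fun e b U _ _ _ => by simp [add_mul]) (h1.add h2)
  · intro x y z _ _ _ h1 h2
    exact .congr (fun e b U _ _ _ => by simp [mul_add]) (h1.add h2)
  · intro c x y _ _ h
    exact .congr (fun e b U _ _ _ => by simp) (h.smul c)
  · intro c x y _ _ h
    exact .congr (fun e b U _ _ _ => by simp) (h.smul c)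

theorem LSplit.csplit {D g} (h : LSplit D g) : CSplit D g := by
  induction h with
  | left h1 h2 h3 => exact .left (letterFam_le h1) h2 h3
  | right h1 h2 h3 => exact .right (letterFam_le h1) h2 h3
  | zero => exact .zero
  | add _ _ h1 h2 => exact h1.add h2
  | smul x _ h => exact h.smul x
  | congr h _ h' => exact h'.congr h

theorem Mono.cons_env {a φ} (h : Mono a φ) : ∃ a' k φ', Mono a' φ' ∧ a' + k = a ∧
    ∀ e b y, φ (b :: e) y = φ' e y * tt (b - y) ^ k := by
  induction h with
  | one => exact ⟨0, 0, 1, .one, rfl, by simp⟩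
  | self h ih =>
    obtain ⟨a', k, φ', h', rfl, he⟩ := ih
    exact ⟨_, k, _, h'.self, by omega, fun e b y => by simp [he, mul_assoc]⟩
  | env j h ih =>
    obtain ⟨a', k, φ', h', rfl, he⟩ := ih
    cases j with
    | zero => exact ⟨_, k + 1, _, h', by omega, fun e b y => by simp [he]; ring⟩
    | succ j => exact ⟨_, k, _, h'.env j, by omega, fun e b y => by simp [he, mul_assoc]⟩

/-- When b leaves the environment and becomes the end point, its factors `tt (b - y)` turn into
distance letters, and the mixed products are split. If one kind of factor is absent the coefficient
is 1, of degree zero; hence coefficients in `coefFam`. -/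
theorem csplit_cons {d φ} (hφ : φ ∈ letterFam d) : CSplit d fun e b y => φ (b :: e) y := by
  refine span_induction (p := fun φ _ => CSplit d fun e b y => φ (b :: e) y)
    ?_ ?_ ?_ ?_ hφ
  · rintro _ ⟨a, r, φ, hφ, hd, rfl⟩
    obtain ⟨a', k, φ', h', rfl, he⟩ := hφ.cons_env
    have h1 : CSplit (max 1 (a' + k)) fun e b y => φ' e y * tt (b - y) ^ k := by
      rcases k with _ | k
      · refine .congr (fun e b y _ _ _ => ?_)
          (Split.left one_mem_coefFam (mem_letterFam (r := 0) h' le_rfl) (by simp))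
        simp
      · cases h' with
        | one =>
          refine .congr (fun e b y _ _ _ => ?_)
            (Split.right one_mem_coefFam (dist_mem (k := k + 1) (r := 0) (by omega) le_rfl)
              (by omega))
          simp
        | self h'' | env j h'' =>
          rename_i a'' φ''
          rw [show max 1 (a'' + 1 + (k + 1)) = max 1 (a'' + 1) + (k + 1) by omega]
          first
            | exact (lsplit_mono h''.self k).csplit
            | exact (lsplit_mono (h''.env j) k).csplit
    have h6 : ∀ r, CSplit (max 1 (a' + k) + r) fun e b y =>
        (y : ℚ⟦X⟧) ^ r * (φ' e y * tt (b - y) ^ k) := by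
      intro r
      induction r with
      | zero => simpa using h1
      | succ r ih =>
        refine .congr (fun e b y _ _ _ => ?_) (SplitF.nat_mul ih fun h => by
          rw [mul_comm, add_comm]; exact coefFam_mul h nat_mem_coefFam)
        ring
    have h7 := SplitF.coef_mul (c := 1) (d := d - (max 1 (a' + k) + r)) (h6 r)
      fun h => by rw [one_mul]; exact coefFam_mono (by omega) h
    rw [Nat.sub_add_cancel (by omega)] at h7
    refine .congr (fun e b y _ _ _ => ?_) h7
    simp only [Pi.one_apply, he]; ring
  · exact .congr (fun e b U _ _ _ => by simp) .zero
  · intro x y _ _ h1 h2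
    exact .congr (fun e b U _ _ _ => by simp) (h1.add h2)
  · intro x y _ h
    exact .congr (fun e b U _ _ _ => by simp) (h.smul x)

theorem distFam_le_letterFam {d ψ} (h : ψ ∈ distFam d) : (fun _ b => ψ b) ∈ letterFam d := by
  refine span_induction (p := fun ψ _ => (fun _ b => ψ b) ∈ letterFam d)
    ?_ ?_ ?_ ?_ h
  · rintro _ ⟨a, r, ha, hd, rfl⟩
    have h1 : ∀ a, Mono a fun _ y => tt y ^ a := by
      intro a
      induction a with
      | zero => convert Mono.one using 1; ext1; ext1; simp
      | succ a ih => convert ih.self using 1; ext1; ext1; ring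
    exact mem_letterFam (h1 a) (by omega)
  · exact zero_mem _
  · intro x y _ _ h1 h2
    exact add_mem h1 h2
  · intro x y _ h
    exact smul_mem _ x h

/-! ### Summing out the smallest vertex -/

abbrev OutF := Out (M := ℚ⟦X⟧) Below letterFam coefFam
abbrev PureF := Pure (M := ℚ⟦X⟧) Below letterFam
abbrev ShorterF := Shorter (M := ℚ⟦X⟧) Below letterFam coefFam distFam

theorem split_shorter {D g n D' f} (hg : CSplit D g) (hf : ShorterF n D' f) :
    ShorterF (n + 2) (D + D') fun e b U => ∑ y ∈ Ioo 0 U, g e b y * f e b y :=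
  Split.shorter (Dom := Below) (𝓛 := letterFam) (𝒞 := coefFam) (Ψ := distFam) coefFam_mul hg hf

/-- Letter by letter, `csplit_cons` replaces dependence on the first entry b of the environment by
distances to b. Only bounds U < b are covered, as all variables must stay below b. -/
theorem PureF.shorter {D f} (hf : PureF D f) : ∃ n g, ShorterF n D g ∧
    ∀ e b U, Below e b → 0 < U → U < b → g e b U = f (b :: e) U := by
  induction hf with
  | one => exact ⟨1, _, .coef one_mem_coefFam .nil (by simp) rfl, by simp [strictSum]⟩
  | @cons φ d D f hφ hf ih =>
    obtain ⟨n, g, hg, he⟩ := ih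
    refine ⟨_, _, split_shorter (csplit_cons hφ) hg, fun e b U hb hU hUb => ?_⟩
    refine sum_congr rfl fun y hy => ?_
    rw [mem_Ioo] at hy
    rw [he e b y hb hy.1 (by omega)]
  | zero D => exact ⟨1, _, .zero, by simp⟩
  | add _ _ h1 h2 =>
    obtain ⟨n, g, hg, he⟩ := h1
    obtain ⟨n', g', hg', he'⟩ := h2
    refine ⟨max n n', _, (hg.mono (le_max_left _ _)).add (hg'.mono (le_max_right _ _)), ?_⟩
    intro e b U hb hU hUb
    simp [he e b U hb hU hUb, he' e b U hb hU hUb]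
  | smul x _ h =>
    obtain ⟨n, g, hg, he⟩ := h
    exact ⟨n, _, hg.smul x, fun e b U hb hU hUb => by simp [he e b U hb hU hUb]⟩
  | congr h _ h' =>
    obtain ⟨n, g, hg, he⟩ := h'
    exact ⟨n, g, hg, fun e b U hb hU hUb => by
      rw [he e b U hb hU hUb, h _ _ (hb.cons hUb) hU]⟩

theorem OutF.shorter {d D f φ} (hf : OutF D f) (hφ : φ ∈ letterFam d) : ∃ n, ShorterF n (d + D)
    fun e b U => ∑ y ∈ Ioo 0 U, φ (b :: e) y * f (b :: e) y := by
  induction hf generalizing φ d with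
  | pure h =>
    obtain ⟨n, g, hg, he⟩ := PureF.shorter h
    refine ⟨_, .congr (fun e b U hb hU hUb => ?_) (split_shorter (csplit_cons hφ) hg)⟩
    refine sum_congr rfl fun y hy => ?_
    rw [mem_Ioo] at hy
    rw [he e b y hb hy.1 (by omega)]
  | coef h1 h2 h3 =>
    obtain ⟨n, g, hg, he⟩ := PureF.shorter h2
    have := split_shorter (csplit_cons (letterFam_mul_coefFam hφ h1)) hg
    rw [add_assoc, h3] at this
    refine ⟨_, .congr (fun e b U hb hU hUb => ?_) this⟩
    refine sum_congr rfl fun y hy => ?_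
    rw [mem_Ioo] at hy
    rw [he e b y hb hy.1 (by omega)]
    simp [mul_assoc]
  | add _ _ h1 h2 =>
    obtain ⟨n, hg⟩ := h1 hφ
    obtain ⟨n', hg'⟩ := h2 hφ
    refine ⟨max n n', .congr (fun e b U hb hU hUb => ?_)
      ((hg.mono (le_max_left _ _)).add (hg'.mono (le_max_right _ _)))⟩
    simp [mul_add, sum_add_distrib]
  | smul x _ h =>
    obtain ⟨n, hg⟩ := h hφ
    exact ⟨n, .congr (fun e b U hb hU hUb => by simp [smul_sum]) (hg.smul x)⟩
  | congr h _ h' =>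
    obtain ⟨n, hg⟩ := h' hφ
    refine ⟨n, .congr (fun e b U hb hU hUb => sum_congr rfl fun y hy => ?_) hg⟩
    rw [mem_Ioo] at hy
    rw [h _ _ (hb.cons (by omega)) hy.1]

theorem outF_strictSum {w : List (Letter (List ℕ) ℚ⟦X⟧)} {D} (hw : Deg letterFam distFam w D) :
    OutF D fun e b => strictSum w e b b := by
  refine out_strictSum (𝓛 := letterFam) (𝒞 := coefFam) (Ψ := distFam) (Dom := Below)
    ?_ ?_ ?_ ?_ ?_ ?_ hw
  · exact letterFam_le
  · exact coefFam_mul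
  · exact letterFam_mul_coefFam
  · exact fun _ _ _ h h' => h.mono h'
  · exact lsplit_mul
  · exact distFam_le_letterFam

/-- Summing a combination of nested sums over its smallest vertex. -/
theorem OutF.stage {d D f φ} (hf : OutF D f) (hφ : φ ∈ letterFam d) :
    OutF (d + D) fun e b => ∑ y ∈ Ioo 0 b, φ (b :: e) y * f (b :: e) y := by
  obtain ⟨n, hn⟩ := hf.shorter hφ
  exact Shorter.out (Dom := Below) (𝓛 := letterFam) (𝒦 := coefFam) (𝒞 := coefFam) (Ψ := distFam)
    (f := fun e b U => ∑ y ∈ Ioo 0 U, φ (b :: e) y * f (b :: e) y)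
    coefFam_mul (fun h => h) (fun _ hw => outF_strictSum hw) hn

/-! ### Summation of polynomials -/

theorem natDegree_bernoulli_le (n : ℕ) : (Polynomial.bernoulli n).natDegree ≤ n := by
  rw [Polynomial.bernoulli]
  exact Polynomial.natDegree_sum_le_of_forall_le _ _ fun i _ =>
    (Polynomial.natDegree_monomial_le _).trans (Nat.sub_le _ _)

/-- A combination of Bernoulli polynomials, by B_(s+1)(x + 1) - B_(s+1)(x) = (s + 1) x^s, normalised
to vanish at 0. -/
theorem exists_eval_succ_sub (p : ℚ[X]) : ∃ P : ℚ[X],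
    P.natDegree ≤ p.natDegree + 1 ∧ P.eval 0 = 0 ∧ ∀ x : ℚ, P.eval (x + 1) - P.eval x = p.eval x := by
  let Q : ℚ[X] := ∑ s ∈ range (p.natDegree + 1),
    (p.coeff s / (s + 1)) • Polynomial.bernoulli (s + 1)
  have hQ : Q.natDegree ≤ p.natDegree + 1 :=
    Polynomial.natDegree_sum_le_of_forall_le _ _ fun s hs =>
      (Polynomial.natDegree_smul_le _ _).trans ((natDegree_bernoulli_le _).trans (by simpa using hs))
  refine ⟨Q - Polynomial.C (Q.eval 0), ?_, by simp, fun x => ?_⟩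
  · rw [natDegree_sub_C]; exact hQ
  · simp only [Polynomial.eval_sub, eval_C, sub_sub_sub_cancel_right, Q,
      Polynomial.eval_finsetSum, Polynomial.eval_smul, ← sum_sub_distrib]
    conv_rhs => rw [eval_eq_sum_range]
    refine sum_congr rfl fun s _ => ?_
    rw [add_comm x 1, Polynomial.bernoulli_eval_one_add]
    have : (s : ℚ) + 1 ≠ 0 := by positivity
    simp only [smul_eq_mul, Nat.cast_add, Nat.cast_one, Nat.add_sub_cancel]
    field_simp
    ring

theorem exists_eval_sum_range (p : ℚ[X]) : ∃ P : ℚ[X],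
    P.natDegree ≤ p.natDegree + 1 ∧ P.eval 0 = 0 ∧
      ∀ n : ℕ, P.eval (n : ℚ) = ∑ k ∈ range n, p.eval (k : ℚ) := by
  obtain ⟨P, h1, h2, h3⟩ := exists_eval_succ_sub p
  refine ⟨P, h1, h2, fun n => ?_⟩
  induction n with
  | zero => simpa using h2
  | succ n ih =>
    rw [sum_range_succ, ← ih, ← h3]
    push_cast; ring

/-! ### The series `∑ p(v) q ^ (u v)` -/

/-- The series `∑ p(v) q ^ (u v)` over `v > 0`. -/
def polySer (u : ℕ) : ℚ[X] →ₗ[ℚ] ℚ⟦X⟧ where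
  toFun p := PowerSeries.mk fun n => if 0 < n ∧ u ∣ n then p.eval ((n / u : ℕ) : ℚ) else 0
  map_add' p p' := by
    ext n; simp only [coeff_mk, map_add, eval_add]
    split_ifs <;> simp
  map_smul' c p := by
    ext n; simp only [coeff_mk, map_smul, RingHom.id_apply]
    split_ifs <;> simp

theorem coeff_polySer (u n : ℕ) (p : ℚ[X]) : coeff n (polySer u p) =
    if 0 < n ∧ u ∣ n then p.eval ((n / u : ℕ) : ℚ) else 0 := by
  simp [polySer]

@[simp] theorem polySer_zero (p : ℚ[X]) : polySer 0 p = 0 := by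
  ext n
  rw [coeff_polySer, if_neg, map_zero]
  rintro ⟨h, h'⟩
  rw [zero_dvd_iff] at h'; omega

theorem polySer_one (u : ℕ) : polySer u 1 = tt u := by
  ext n; simp [coeff_polySer, tt]

theorem X_pow_dvd_polySer (u : ℕ) (p : ℚ[X]) : PowerSeries.X ^ u ∣ polySer u p := by
  rw [X_pow_dvd_iff]
  intro m hm
  rw [coeff_polySer, if_neg]
  rintro ⟨h, h'⟩
  exact absurd (Nat.le_of_dvd h h') (by omega)

/-- Multiplication by q^u / (1 - q^u) takes partial sums of the sequence v ↦ p(v); the new value at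
v sums over arguments below v, so it must be 0 at v = 1. -/
theorem tt_mul_polySer (u : ℕ) {p P : ℚ[X]} (h1 : P.eval 1 = 0)
    (h : ∀ x : ℚ, P.eval (x + 1) - P.eval x = p.eval x) : tt u * polySer u p = polySer u P := by
  rcases Nat.eq_zero_or_pos u with rfl | hu
  · simp
  refine mul_left_cancel₀ (one_sub_X_pow_ne hu) ?_
  rw [← mul_assoc, one_sub_mul_tt hu]
  ext n
  rw [sub_mul, one_mul, map_sub, coeff_X_pow_mul', coeff_X_pow_mul']
  by_cases hn : u ≤ n
  · rw [if_pos hn, if_pos hn, coeff_polySer, coeff_polySer, coeff_polySer]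
    simp only [Nat.dvd_sub_iff_left hn dvd_rfl]
    by_cases hd : u ∣ n
    · obtain ⟨k, rfl⟩ := hd
      obtain ⟨k, rfl⟩ : ∃ l, k = l + 1 := by
        refine ⟨k - 1, (Nat.sub_add_cancel ?_).symm⟩
        rcases Nat.eq_zero_or_pos k with rfl | h
        · omega
        · exact h
      have e1 : u * (k + 1) - u = u * k := by rw [mul_add, mul_one, Nat.add_sub_cancel]
      rw [e1, Nat.mul_div_cancel_left _ hu, Nat.mul_div_cancel_left _ hu]
      rcases Nat.eq_zero_or_pos k with rfl | hk
      · simp [hu, h1]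
      · have := h k
        have h5 : 0 < u * k := by positivity
        simp only [dvd_mul_right, and_true, h5, show 0 < u * (k + 1) by positivity, if_true]
        push_cast
        linarith
    · simp [hd]
  · have : ¬ (0 < n ∧ u ∣ n) := fun ⟨h1, h2⟩ => hn (Nat.le_of_dvd h1 h2)
    rw [if_neg hn, if_neg hn, coeff_polySer, if_neg this, sub_zero]

/-- Repeated partial summation, starting from the constant sequence 1; each time the constant is
adjusted so that the value at 1 is 0. -/
theorem exists_tt_pow (a : ℕ) : ∃ p : ℚ[X], p.natDegree ≤ a ∧
    ∀ u, tt u ^ (a + 1) = polySer u p := by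
  induction a with
  | zero => exact ⟨1, by simp, fun u => by rw [polySer_one, zero_add, pow_one]⟩
  | succ a ih =>
    obtain ⟨p, hp, h⟩ := ih
    obtain ⟨P, h1, h2, h3⟩ := exists_eval_succ_sub p
    refine ⟨P - Polynomial.C (P.eval 1), ?_, fun u => ?_⟩
    · rw [natDegree_sub_C]; omega
    · rw [pow_succ', h]
      exact tt_mul_polySer u (by simp) (fun x => by simpa using h3 x)

/-- For a = 0 the sequence is v ↦ v. Vanishing at 0 persists under partial summation: P(0) = 0 and
p(0) = 0 force P(1) = 0, the normalisation needed there. This is the origin of the condition s_1 >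
1. -/
theorem exists_tt_pow_kd (a : ℕ) : ∃ p : ℚ[X], p.natDegree ≤ a + 1 ∧ p.coeff 0 = 0 ∧
    ∀ u, tt u * (1 + tt u) * tt u ^ a = polySer u p := by
  induction a with
  | zero =>
    refine ⟨X, by simp, by simp, fun u => ?_⟩
    have : tt u * polySer u 1 = polySer u (X - 1) :=
      tt_mul_polySer u (by simp) (by simp)
    rw [polySer_one] at this
    rw [pow_zero, mul_one, mul_add, this, map_sub, polySer_one]; ring
  | succ a ih =>
    obtain ⟨p, hp, h0, h⟩ := ih
    obtain ⟨P, h1, h2, h3⟩ := exists_eval_succ_sub p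
    refine ⟨P, by omega, by rwa [Polynomial.coeff_zero_eq_eval_zero], fun u => ?_⟩
    rw [pow_succ', mul_left_comm, h, tt_mul_polySer u _ h3]
    have := h3 0
    rw [Polynomial.coeff_zero_eq_eval_zero] at h0
    rw [h0, h2] at this
    simpa using this

/-! ### Bracket letters and their nested sums. -/

/-- The letter `u ^ r ∑ v ^ k q ^ (u v)`. -/
def brLetter (l : ℕ × ℕ) (u : ℕ) : ℚ⟦X⟧ :=
  (u : ℚ⟦X⟧) ^ l.1 * polySer u (X ^ l.2)

theorem polySer_eq_sum (u : ℕ) {p : ℚ[X]} {d : ℕ} (h : p.natDegree ≤ d) :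
    polySer u p = ∑ k ∈ range (d + 1), p.coeff k • brLetter (0, k) u := by
  conv_lhs => rw [p.as_sum_range_C_mul_X_pow' (lt_succ_of_le h)]
  simp [← Polynomial.smul_eq_C_mul, brLetter]

theorem X_pow_dvd_brLetter (l : ℕ × ℕ) (u : ℕ) : PowerSeries.X ^ u ∣ brLetter l u :=
  (X_pow_dvd_polySer _ _).mul_left _

theorem nat_pow_mul_brLetter (s : ℕ) (l : ℕ × ℕ) (u : ℕ) :
    (u : ℚ⟦X⟧) ^ s * brLetter l u = brLetter (s + l.1, l.2) u := by
  rw [brLetter, brLetter, pow_add, mul_assoc]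

/-- The nested sum of bracket letters below `U`. -/
def brSum : List (ℕ × ℕ) → ℕ → ℚ⟦X⟧
  | [], _ => 1
  | l :: w, U => ∑ y ∈ Ioo 0 U, brLetter l y * brSum w y

/-- The weight of a word. -/
def wt (w : List (ℕ × ℕ)) : ℕ := (w.map fun l => l.1 + l.2 + 1).sum

@[simp] theorem wt_cons (l w) : wt (l :: w) = l.1 + l.2 + 1 + wt w := by simp [wt]

/-- The formal sum of a sequence of series over the positive integers. -/
def fsum : (ℕ → ℚ⟦X⟧) →ₗ[ℚ] ℚ⟦X⟧ where
  toFun F := PowerSeries.mk fun n => ∑ z ∈ Ioo 0 (n + 1), coeff n (F z)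
  map_add' F G := by ext n; simp [sum_add_distrib]
  map_smul' c F := by ext n; simp [mul_sum]

theorem coeff_fsum (F : ℕ → ℚ⟦X⟧) (n : ℕ) : coeff n (fsum F) =
    ∑ z ∈ Ioo 0 (n + 1), coeff n (F z) := by simp [fsum]

theorem fsum_congr {F G : ℕ → ℚ⟦X⟧} (h : ∀ z, 0 < z → F z = G z) : fsum F = fsum G := by
  ext n
  rw [coeff_fsum, coeff_fsum]
  exact sum_congr rfl fun z hz => by rw [h z (mem_Ioo.1 hz).1]

/-- The infinite nested sum of bracket letters. -/
def brTop : List (ℕ × ℕ) → ℚ⟦X⟧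
  | [] => 1
  | l :: w => fsum fun y => brLetter l y * brSum w y

/-- Combinations of infinite nested sums. -/
def topFam (W : ℕ) : Submodule ℚ ℚ⟦X⟧ :=
  span ℚ {f | ∃ w, wt w ≤ W ∧ f = brTop w}

/-- Combinations of infinite nested sums in which the outermost letter has positive second entry. -/
def qTopFam (W : ℕ) : Submodule ℚ ℚ⟦X⟧ :=
  span ℚ {f | ∃ w, wt w ≤ W ∧ (∀ l ∈ w.head?, 1 ≤ l.2) ∧ f = brTop w}

/-- Combinations of finite nested sums with powers of the end point as coefficients. -/
def sumFam (D : ℕ) : Submodule ℚ (ℕ → ℚ⟦X⟧) :=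
  span ℚ {f | ∃ r w, r + wt w ≤ D ∧ f = fun U : ℕ => (U : ℚ⟦X⟧) ^ r * brSum w U}

theorem mem_sumFam {r w D} (h : r + wt w ≤ D) :
    (fun U : ℕ => (U : ℚ⟦X⟧) ^ r * brSum w U) ∈ sumFam D :=
  subset_span ⟨r, w, h, rfl⟩

theorem eval_smul_eq {p : ℚ[X]} {d : ℕ} (h : p.natDegree ≤ d) (U : ℕ) (f : ℚ⟦X⟧) :
    p.eval (U : ℚ) • f = ∑ i ∈ range (d + 1), p.coeff i • ((U : ℚ⟦X⟧) ^ i * f) := by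
  rw [Polynomial.eval_eq_sum_range' (lt_succ_of_le h), sum_smul]
  refine sum_congr rfl fun i _ => ?_
  rw [mul_smul]
  congr 1
  rw [← cast_pow, ← cast_pow, Nat.cast_smul_eq_nsmul, nsmul_eq_mul]

theorem eval_smul_mem {p : ℚ[X]} {d : ℕ} (h : p.natDegree ≤ d) {w D} (hD : d + wt w ≤ D) :
    (fun U : ℕ => p.eval (U : ℚ) • brSum w U) ∈ sumFam D := by
  have : (fun U : ℕ => p.eval (U : ℚ) • brSum w U) =
      ∑ i ∈ range (d + 1), p.coeff i • fun U : ℕ => (U : ℚ⟦X⟧) ^ i * brSum w U := by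
    ext1 U
    rw [eval_smul_eq h, Finset.sum_apply]
    rfl
  rw [this]
  refine sum_mem fun i hi => smul_mem _ _ (mem_sumFam ?_)
  rw [mem_range] at hi; omega

theorem sumFam_mono {D D'} (h : D ≤ D') : sumFam D ≤ sumFam D' :=
  span_mono fun _ ⟨r, w, h', e⟩ => ⟨r, w, h'.trans h, e⟩

/-- Functions agreeing at positive arguments with a member of the family. -/
def SumPos (D : ℕ) (f : ℕ → ℚ⟦X⟧) : Prop := ∃ g ∈ sumFam D, ∀ U, 0 < U → f U = g U

theorem SumPos.add {D f g} (hf : SumPos D f) (hg : SumPos D g) : SumPos D (f + g) := by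
  obtain ⟨f', h1, h2⟩ := hf
  obtain ⟨g', h3, h4⟩ := hg
  exact ⟨_, add_mem h1 h3, fun U hU => by simp [h2 U hU, h4 U hU]⟩

theorem SumPos.smul {D f} (c : ℚ) (hf : SumPos D f) : SumPos D (c • f) := by
  obtain ⟨f', h1, h2⟩ := hf
  exact ⟨_, smul_mem _ c h1, fun U hU => by simp [h2 U hU]⟩

theorem SumPos.zero {D} : SumPos D 0 := ⟨0, zero_mem _, fun _ _ => rfl⟩

theorem SumPos.mono {D D' f} (h : D ≤ D') (hf : SumPos D f) : SumPos D' f := by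
  obtain ⟨f', h1, h2⟩ := hf
  exact ⟨_, sumFam_mono h h1, h2⟩

theorem SumPos.of_mem {D f} (hf : f ∈ sumFam D) : SumPos D f := ⟨f, hf, fun _ _ => rfl⟩

theorem SumPos.congr {D f g} (hf : SumPos D f) (h : ∀ U, 0 < U → g U = f U) : SumPos D g := by
  obtain ⟨f', h1, h2⟩ := hf
  exact ⟨f', h1, fun U hU => (h U hU).trans (h2 U hU)⟩

/-- Summation of a power times a nested sum. -/
theorem sum_nat_pow_mul_brSum (r : ℕ) (w) {D} (hD : r + 1 + wt w ≤ D) :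
    SumPos D fun U : ℕ => ∑ y ∈ Ioo 0 U, (y : ℚ⟦X⟧) ^ r * brSum w y := by
  obtain ⟨P, h1, h2, h3⟩ := exists_eval_sum_range (X ^ r)
  rw [natDegree_X_pow] at h1
  have hP : ∀ a b : ℕ, a ≤ b → ∑ y ∈ Ico a b, (y : ℚ⟦X⟧) ^ r =
      (P.eval (b : ℚ) - P.eval (a : ℚ)) • (1 : ℚ⟦X⟧) := by
    intro a b hab
    rw [h3, h3, ← Finset.sum_range_add_sum_Ico _ hab, add_sub_cancel_left, sum_smul]
    refine sum_congr rfl fun y _ => ?_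
    rw [eval_pow, eval_X, ← cast_pow, ← cast_pow,
      Nat.cast_smul_eq_nsmul, nsmul_eq_mul, mul_one]
  cases w with
  | nil =>
    refine SumPos.congr (.of_mem (eval_smul_mem (p := P - Polynomial.C (P.eval 1)) (w := [])
      (d := r + 1) ?_ hD)) fun U hU => ?_
    · rwa [natDegree_sub_C]
    · have := hP 1 U hU
      rw [show Ico 1 U = Ioo 0 U from rfl] at this
      simp only [brSum, mul_one]
      rw [this]; simp
  | cons l w =>
    rw [wt_cons] at hD
    have hQ : (P.comp (X + 1)).natDegree ≤ r + 1 := by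
      refine natDegree_comp_le.trans ?_
      have : (X + 1 : ℚ[X]).natDegree = 1 := natDegree_X_add_C 1
      rw [this, mul_one]; exact h1
    -- For a fixed outermost variable x of the word, the powers sum to P(U) - P(x + 1). The first
    -- term gives powers of the end point, the second is absorbed by the outermost letter.
    have k1 : SumPos D fun U : ℕ => P.eval (U : ℚ) • brSum (l :: w) U :=
      .of_mem (eval_smul_mem h1 (by rw [wt_cons]; omega))
    have k2 : SumPos D (∑ i ∈ range (r + 1 + 1), (P.comp (X + 1)).coeff i •
        fun U : ℕ => brSum ((i + l.1, l.2) :: w) U) := by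
      refine .of_mem (sum_mem fun i hi => smul_mem _ _ ?_)
      rw [mem_range] at hi
      convert mem_sumFam (r := 0) (w := (i + l.1, l.2) :: w) (D := D) (by simp; omega) using 1
      ext1; simp
    refine (k1.add (k2.smul (-1))).congr fun U hU => ?_
    simp only [Pi.add_apply, Pi.smul_apply, Finset.sum_apply, brSum]
    simp_rw [mul_sum]
    rw [sum_comm' (t' := Ioo 0 U) (s' := fun x => Ico (x + 1) U)
      (by intro x y; simp only [mem_Ioo, mem_Ico]; omega)]
    simp_rw [smul_sum]
    rw [sum_comm (s := range _), ← sum_add_distrib]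
    refine sum_congr rfl fun x hx => ?_
    rw [mem_Ioo] at hx
    rw [← sum_mul, hP _ _ hx.2, smul_mul_assoc, one_mul, sub_smul, sub_eq_add_neg]
    congr 1
    have h := eval_smul_eq hQ x (brLetter l x * brSum w x)
    rw [eval_comp] at h
    simp only [eval_add, eval_X, eval_one] at h
    push_cast
    rw [h, ← sum_neg_distrib]
    refine sum_congr rfl fun i _ => ?_
    rw [← mul_assoc, nat_pow_mul_brLetter]
    simp

/-- For a > 0 the power of `tt` is a combination of new letters; for a = 0 the sum is one of powers
and raises the degree by one. Thus a letter without `tt` costs as much as one with a single `tt`. -/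
theorem SumPos.sum {D f} (hf : SumPos D f) (s a : ℕ) :
    SumPos (D + max 1 a + s) fun U : ℕ =>
      ∑ y ∈ Ioo 0 U, (y : ℚ⟦X⟧) ^ s * tt y ^ a * f y := by
  obtain ⟨g, hg, he⟩ := hf
  have : ∀ U : ℕ, ∑ y ∈ Ioo 0 U, (y : ℚ⟦X⟧) ^ s * tt y ^ a * f y =
      ∑ y ∈ Ioo 0 U, (y : ℚ⟦X⟧) ^ s * tt y ^ a * g y := fun U =>
    sum_congr rfl fun y hy => by rw [he y (mem_Ioo.1 hy).1]
  simp_rw [this]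
  clear this he
  refine span_induction (p := fun g _ => SumPos (D + max 1 a + s) fun U : ℕ =>
      ∑ y ∈ Ioo 0 U, (y : ℚ⟦X⟧) ^ s * tt y ^ a * g y) ?_ ?_ ?_ ?_ hg
  · rintro _ ⟨r, w, h, rfl⟩
    rcases a with _ | a
    · refine (sum_nat_pow_mul_brSum (s + r) w (by simp; omega)).congr fun U _ =>
        sum_congr rfl fun y _ => ?_
      ring
    · obtain ⟨p, hp, hpe⟩ := exists_tt_pow a
      have : (∑ k ∈ range (a + 1), p.coeff k • fun U : ℕ =>
          brSum ((s + r, k) :: w) U) ∈ sumFam (D + max 1 (a + 1) + s) := by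
        refine sum_mem fun k hk => smul_mem _ _ ?_
        rw [mem_range] at hk
        convert mem_sumFam (r := 0) (w := (s + r, k) :: w) (D := D + max 1 (a + 1) + s)
          (by simp; omega) using 1
        ext1; simp
      refine (SumPos.of_mem this).congr fun U _ => ?_
      simp only [Finset.sum_apply, Pi.smul_apply, brSum, smul_sum]
      rw [sum_comm]
      refine sum_congr rfl fun y _ => ?_
      rw [hpe, polySer_eq_sum _ hp, mul_sum, sum_mul]
      refine sum_congr rfl fun k _ => ?_
      rw [show (s + r, k) = (s + r + (0, k).1, (0, k).2) from rfl, ← nat_pow_mul_brLetter]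
      rw [mul_smul_comm, smul_mul_assoc]
      ring_nf
  · exact SumPos.zero.congr fun _ _ => by simp
  · intro x y _ _ h1 h2
    exact (h1.add h2).congr fun _ _ => by simp [mul_add, sum_add_distrib]
  · intro c x _ h
    exact (h.smul c).congr fun _ _ => by simp [smul_sum]

/-! ### The largest vertex: empty environment and infinite sums. -/

theorem Mono.apply_nil {a φ} (h : Mono a φ) : ∃ c : ℚ, ∀ y, φ [] y = c • tt y ^ a := by
  induction h with
  | one => exact ⟨1, by simp⟩
  | self _ ih =>
    obtain ⟨c, hc⟩ := ih
    exact ⟨c, fun y => by show tt y * _ = _; rw [hc, mul_smul_comm, pow_succ']⟩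
  -- The environment is empty, so the entry reads as 0 and `tt 0 = 0`.
  | env j _ ih => exact ⟨0, by simp⟩

/-- The values of letters at the empty environment. -/
def endFam (m : ℕ) (d : ℕ) : Submodule ℚ (ℕ → ℚ⟦X⟧) :=
  span ℚ {f | ∃ a r : ℕ, max m a + r ≤ d ∧ f = fun y : ℕ => (y : ℚ⟦X⟧) ^ r * tt y ^ a}

theorem letterFam_apply_nil {d φ} (h : φ ∈ letterFam d) : φ [] ∈ endFam 1 d := by
  refine span_induction (p := fun φ _ => φ [] ∈ endFam 1 d) ?_ ?_ ?_ ?_ h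
  · rintro _ ⟨a, r, φ, h, hd, rfl⟩
    obtain ⟨c, hc⟩ := h.apply_nil
    convert smul_mem (endFam 1 d) c (subset_span ⟨a, r, hd, rfl⟩) using 1
    ext1 y; simp [hc]
  · exact zero_mem _
  · intro x y _ _ h1 h2; exact add_mem h1 h2
  · intro c x _ h; exact smul_mem _ c h

theorem coefFam_apply_nil {d φ} (h : φ ∈ coefFam d) : φ [] ∈ endFam 0 d := by
  refine span_induction (p := fun φ _ => φ [] ∈ endFam 0 d) ?_ ?_ ?_ ?_ h
  · rintro _ ⟨a, r, φ, h, hd, rfl⟩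
    obtain ⟨c, hc⟩ := h.apply_nil
    convert smul_mem (endFam 0 d) c
      (subset_span ⟨a, r, by simpa using hd, rfl⟩) using 1
    ext1 y; simp [hc]
  · exact zero_mem _
  · intro x y _ _ h1 h2; exact add_mem h1 h2
  · intro c x _ h; exact smul_mem _ c h

theorem PureF.sumPos {D f} (hf : PureF D f) : SumPos D (f []) := by
  induction hf with
  | one =>
    refine .of_mem ?_
    refine subset_span ⟨0, [], le_rfl, ?_⟩
    ext1; simp [brSum]
  | @cons φ d D f hφ hf ih =>
    refine span_induction (p := fun φ _ => SumPos (d + D)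
      fun U => ∑ y ∈ Ioo 0 U, φ y * f [] y) ?_ ?_ ?_ ?_ (letterFam_apply_nil hφ)
    · rintro _ ⟨a, r, h, rfl⟩
      exact (ih.sum r a).mono (by omega)
    · exact SumPos.zero.congr fun _ _ => by simp
    · intro x y _ _ h1 h2
      exact (h1.add h2).congr fun _ _ => by simp [add_mul, sum_add_distrib]
    · intro c x _ h
      exact (h.smul c).congr fun _ _ => by simp [smul_sum]
  | zero D => exact SumPos.zero
  | add _ _ h1 h2 => exact h1.add h2
  | smul x _ h => exact h.smul x
  | congr h _ h' => exact h'.congr fun U hU => (h [] U (by simp [Below]) hU).symm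

/-- Combinations of nested sums multiplied by letters at the end point. -/
def endSumFam (m W : ℕ) : Submodule ℚ (ℕ → ℚ⟦X⟧) :=
  span ℚ {f | ∃ a r w, r + max m a + wt w ≤ W ∧
    f = fun z : ℕ => (z : ℚ⟦X⟧) ^ r * tt z ^ a * brSum w z}

/-- Functions agreeing at positive arguments with a member of the family. -/
def EndSum (m W : ℕ) (f : ℕ → ℚ⟦X⟧) : Prop := ∃ g ∈ endSumFam m W, ∀ z, 0 < z → f z = g z

theorem EndSum.add {m W f g} (hf : EndSum m W f) (hg : EndSum m W g) : EndSum m W (f + g) := by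
  obtain ⟨f', h1, h2⟩ := hf
  obtain ⟨g', h3, h4⟩ := hg
  exact ⟨_, add_mem h1 h3, fun U hU => by simp [h2 U hU, h4 U hU]⟩

theorem EndSum.smul {m W f} (c : ℚ) (hf : EndSum m W f) : EndSum m W (c • f) := by
  obtain ⟨f', h1, h2⟩ := hf
  exact ⟨_, smul_mem _ c h1, fun U hU => by simp [h2 U hU]⟩

theorem EndSum.congr {m W f g} (hf : EndSum m W f) (h : ∀ U, 0 < U → g U = f U) :
    EndSum m W g := by
  obtain ⟨f', h1, h2⟩ := hf
  exact ⟨f', h1, fun U hU => (h U hU).trans (h2 U hU)⟩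

theorem SumPos.endSum {m d D φ f} (hφ : φ ∈ endFam m d) (hf : SumPos D f) :
    EndSum m (d + D) (φ * f) := by
  obtain ⟨g, hg, he⟩ := hf
  refine ⟨φ * g, ?_, fun z hz => by simp [he z hz]⟩
  refine span_induction₂ (p := fun x y _ _ => x * y ∈ endSumFam m (d + D))
    ?_ ?_ ?_ ?_ ?_ ?_ ?_ hφ hg
  · rintro _ _ ⟨a, r, h, rfl⟩ ⟨s, w, h', rfl⟩
    refine subset_span ⟨a, r + s, w, by omega, ?_⟩
    ext1 z; simp only [Pi.mul_apply]; ring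
  · intros; simp
  · intros; simp
  · intro x y z _ _ _ h1 h2; rw [add_mul]; exact add_mem h1 h2
  · intro x y z _ _ _ h1 h2; rw [mul_add]; exact add_mem h1 h2
  · intro c x y _ _ h; rw [smul_mul_assoc]; exact smul_mem _ _ h
  · intro c x y _ _ h; rw [mul_smul_comm]; exact smul_mem _ _ h

theorem OutF.endSum {d D φ f} (hφ : φ ∈ letterFam d) (hf : OutF D f) :
    EndSum 1 (d + D) fun z => φ [] z * f [] z := by
  induction hf with
  | pure h => exact SumPos.endSum (letterFam_apply_nil hφ) (PureF.sumPos h)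
  | coef h1 h2 h3 =>
    have := SumPos.endSum (letterFam_apply_nil (letterFam_mul_coefFam hφ h1)) (PureF.sumPos h2)
    rw [add_assoc, h3] at this
    exact this.congr fun _ _ => by simp [mul_assoc]
  | add _ _ h1 h2 => exact (h1.add h2).congr fun _ _ => by simp [mul_add]
  | smul x _ h => exact (h.smul x).congr fun _ _ => by simp
  | congr h _ h' => exact h'.congr fun U hU => by rw [h [] U (by simp [Below]) hU]

theorem OutF.endSum_coef {d D φ f} (hφ : φ ∈ coefFam d) (hf : OutF D f) :
    EndSum 0 (d + D) fun z => φ [] z * f [] z := by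
  induction hf with
  | pure h => exact SumPos.endSum (coefFam_apply_nil hφ) (PureF.sumPos h)
  | coef h1 h2 h3 =>
    have := SumPos.endSum (coefFam_apply_nil (coefFam_mul hφ h1)) (PureF.sumPos h2)
    rw [add_assoc, h3] at this
    exact this.congr fun _ _ => by simp [mul_assoc]
  | add _ _ h1 h2 => exact (h1.add h2).congr fun _ _ => by simp [mul_add]
  | smul x _ h => exact (h.smul x).congr fun _ _ => by simp
  | congr h _ h' => exact h'.congr fun U hU => by rw [h [] U (by simp [Below]) hU]

theorem brTop_mem {w W} (h : wt w ≤ W) : brTop w ∈ topFam W := subset_span ⟨w, h, rfl⟩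

theorem fsum_letter (r k : ℕ) (w) :
    (fsum fun z : ℕ => (z : ℚ⟦X⟧) ^ r * brLetter (0, k) z * brSum w z) = brTop ((r, k) :: w) := by
  simp [brTop, nat_pow_mul_brLetter]

theorem coeff_letter_mul {n y : ℕ} (h : n < y) (l w) :
    coeff n (brLetter l y * brSum w y) = 0 :=
  X_pow_dvd_iff.1 ((X_pow_dvd_brLetter l y).mul_right _) n h

/-- The finite sum is the infinite one minus its tail from z on, and of the tail only y ≤ n matter,
because the letter at y is divisible by q^y. -/
theorem coeff_brSum_cons (l w) (n z : ℕ) : coeff n (brSum (l :: w) z) =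
    coeff n (brTop (l :: w)) -
      ∑ y ∈ Icc z n, if 0 < y then coeff n (brLetter l y * brSum w y) else 0 := by
  rw [eq_sub_iff_add_eq, brTop, coeff_fsum, brSum, map_sum, ← sum_filter]
  rw [← sum_subset (s₁ := (Ioo 0 z).filter (· ≤ n)) (Finset.filter_subset _ _)]
  · rw [← Finset.sum_union]
    · refine sum_congr ?_ fun _ _ => rfl
      ext y; simp; omega
    · rw [disjoint_left]
      intro y; simp; omega
  · intro y hy hy'
    simp only [mem_filter, not_and, not_le] at hy'
    exact coeff_letter_mul (hy' hy) l w

/-- The part of a combination that can be summed directly, and the part that is polynomial in the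
end point. -/
theorem endSumFam_decomp {W G} (hG : G ∈ endSumFam 1 W) : ∃ H K : ℕ → ℚ⟦X⟧,
    (∀ z, G z = H z + K z) ∧ (∀ z n, n < z → coeff n (H z) = 0) ∧
    fsum H ∈ topFam W ∧
    ∀ n, ∃ p : ℚ[X], ∀ z : ℕ, coeff n (K z) = p.eval (z : ℚ) := by
  refine span_induction ?_ ?_ ?_ ?_ hG
  · rintro _ ⟨a, r, w, h, rfl⟩
    rcases a with _ | a
    · have hcoe : ∀ (z r : ℕ) (f : ℚ⟦X⟧) n, coeff n ((z : ℚ⟦X⟧) ^ r * f) =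
          (z : ℚ) ^ r * coeff n f := by
        intro z r f n
        rw [← cast_pow, ← nsmul_eq_mul, map_nsmul, nsmul_eq_mul, cast_pow]
      cases w with
      | nil =>
        refine ⟨0, _, fun z => (zero_add _).symm, by simp, by simp, fun n =>
          ⟨Polynomial.C (coeff n (1 : ℚ⟦X⟧)) * X ^ r, fun z => ?_⟩⟩
        simp only [pow_zero, mul_one, brSum]
        rw [← mul_one ((z : ℚ⟦X⟧) ^ r), hcoe]
        rw [Polynomial.eval_mul, eval_C, eval_pow, eval_X, mul_comm]
      | cons l w =>
        -- Subtracting the infinite sum leaves minus a tail, which has no coefficients below order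
        -- z; what is subtracted is polynomial in z.
        refine ⟨fun z => (z : ℚ⟦X⟧) ^ r * (brSum (l :: w) z - brTop (l :: w)),
          fun z => (z : ℚ⟦X⟧) ^ r * brTop (l :: w), fun z => ?_, fun z n hn => ?_, ?_, fun n =>
          ⟨Polynomial.C (coeff n (brTop (l :: w))) * X ^ r, fun z => ?_⟩⟩
        · ring
        · rw [hcoe, map_sub, coeff_brSum_cons, Finset.Icc_eq_empty (by omega)]
          simp
        · obtain ⟨P, h1, h2, h3⟩ := exists_eval_sum_range
            ((X ^ r).comp (X + 1))
          have hd : P.natDegree ≤ r + 1 := by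
            refine h1.trans (Nat.add_le_add_right (natDegree_comp_le.trans ?_) 1)
            have : (X + 1 : ℚ[X]).natDegree = 1 := natDegree_X_add_C 1
            rw [this, mul_one, natDegree_X_pow]
          have : (fsum fun z : ℕ => (z : ℚ⟦X⟧) ^ r * (brSum (l :: w) z - brTop (l :: w))) =
              ∑ i ∈ range (r + 1 + 1), (-P.coeff i) • brTop ((i + l.1, l.2) :: w) := by
            ext n
            rw [coeff_fsum, map_sum]
            simp_rw [hcoe, map_sub, map_smul, brTop, coeff_fsum]
            have : ∀ z, z ∈ Ioo 0 (n + 1) → (z : ℚ) ^ r *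
                (coeff n (brSum (l :: w) z) - ∑ z ∈ Ioo 0 (n + 1),
                  coeff n (brLetter l z * brSum w z)) =
                ∑ y ∈ Icc z n,
                  - ((z : ℚ) ^ r * coeff n (brLetter l y * brSum w y)) := by
              intro z hz
              rw [mem_Ioo] at hz
              rw [coeff_brSum_cons, brTop, coeff_fsum, sub_sub_cancel_left, sum_neg_distrib,
                ← mul_sum, mul_neg]
              congr 2
              refine sum_congr rfl fun y hy => if_pos ?_
              rw [mem_Icc] at hy; omega
            -- For fixed y the end point z runs through 1, ..., y, and the sum of z^r is a
            -- polynomial in y of degree at most r + 1, absorbed by the outermost letter.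
            rw [sum_congr rfl this, sum_comm' (t' := Ioo 0 (n + 1))
              (s' := fun y => Ico 1 (y + 1))
              (by intro x y; simp only [mem_Ioo, mem_Icc, mem_Ico]; omega)]
            simp_rw [smul_eq_mul, mul_sum]
            rw [sum_comm (s := range _)]
            refine sum_congr rfl fun y hy => ?_
            rw [sum_neg_distrib, ← sum_mul, Finset.sum_Ico_eq_sum_range]
            have h4 := h3 y
            simp only [eval_comp, eval_add, eval_X,
              eval_one, eval_pow] at h4
            simp only [Nat.add_sub_cancel, Nat.cast_add, Nat.cast_one]
            simp_rw [add_comm (1 : ℚ)]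
            rw [← h4, Polynomial.eval_eq_sum_range' (lt_succ_of_le hd), sum_mul,
              ← sum_neg_distrib]
            refine sum_congr rfl fun i _ => ?_
            rw [show ((i + l.1, l.2) : ℕ × ℕ) = (i + l.1, l.2) from rfl, ← nat_pow_mul_brLetter,
              mul_assoc ((y : ℚ⟦X⟧) ^ i), hcoe]
            ring
          rw [this]
          refine sum_mem fun i hi => smul_mem _ _ (brTop_mem ?_)
          rw [mem_range] at hi
          simp only [wt_cons] at h ⊢
          simp only [Nat.zero_le, max_eq_left] at h
          omega
        · rw [hcoe]
          simp; ring
    · obtain ⟨p, hp, hpe⟩ := exists_tt_pow a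
      refine ⟨_, 0, fun z => (add_zero _).symm, fun z n hn => ?_, ?_, fun n => ⟨0, by simp⟩⟩
      · refine X_pow_dvd_iff.1 ?_ n hn
        rw [hpe]
        exact ((X_pow_dvd_polySer _ _).mul_left _).mul_right _
      · have : (fun z : ℕ => (z : ℚ⟦X⟧) ^ r * tt z ^ (a + 1) * brSum w z) =
            ∑ k ∈ range (a + 1), p.coeff k • fun z : ℕ =>
              (z : ℚ⟦X⟧) ^ r * brLetter (0, k) z * brSum w z := by
          ext1 z
          rw [hpe, polySer_eq_sum _ hp, mul_sum, sum_mul, Finset.sum_apply]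
          exact sum_congr rfl fun k _ => by simp
        rw [this, map_sum]
        refine sum_mem fun k hk => ?_
        rw [map_smul, fsum_letter]
        refine smul_mem _ _ (brTop_mem ?_)
        rw [mem_range] at hk
        simp only [wt_cons]; omega
  · exact ⟨0, 0, by simp, by simp, by simp, fun n => ⟨0, by simp⟩⟩
  · rintro x y _ _ ⟨H, K, h1, h2, h3, h4⟩ ⟨H', K', h1', h2', h3', h4'⟩
    refine ⟨H + H', K + K', fun z => ?_, fun z n hn => ?_, ?_, fun n => ?_⟩
    · simp [h1, h1']; ring
    · simp [h2 z n hn, h2' z n hn]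
    · rw [map_add]; exact add_mem h3 h3'
    · obtain ⟨p, hp⟩ := h4 n
      obtain ⟨p', hp'⟩ := h4' n
      exact ⟨p + p', fun z => by simp [hp, hp']⟩
  · rintro c x _ ⟨H, K, h1, h2, h3, h4⟩
    refine ⟨c • H, c • K, fun z => ?_, fun z n hn => ?_, ?_, fun n => ?_⟩
    · simp [h1]
    · simp [h2 z n hn]
    · rw [map_smul]; exact smul_mem _ _ h3
    · obtain ⟨p, hp⟩ := h4 n
      exact ⟨c • p, fun z => by simp [hp]⟩

/-- In the decomposition G = H + K, the coefficient of q^n in G z and in H z vanishes for all large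
z. So the polynomial giving this coefficient of K has infinitely many zeros, and K = 0. -/
theorem EndSum.fsum_mem {W G} (hG : EndSum 1 W G) (hX : ∀ z, PowerSeries.X ^ z ∣ G z) :
    fsum G ∈ topFam W := by
  obtain ⟨G', hG', he⟩ := hG
  obtain ⟨H, K, h1, h2, h3, h4⟩ := endSumFam_decomp hG'
  rw [fsum_congr (G := H)]
  · exact h3
  intro z hz
  rw [he z hz, h1]
  suffices K z = 0 by rw [this, add_zero]
  ext n
  obtain ⟨p, hp⟩ := h4 n
  have hp0 : p = 0 := by
    refine Polynomial.eq_zero_of_infinite_isRoot p ?_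
    refine Set.infinite_of_injective_forall_mem (f := fun k : ℕ => ((n + 1 + k : ℕ) : ℚ))
      (fun a b h => by simpa using h) fun k => ?_
    rw [Set.mem_ofPred_eq, Polynomial.IsRoot.def, ← hp]
    have h5 := X_pow_dvd_iff.1 (hX (n + 1 + k)) n (by omega)
    rw [he _ (by omega), h1, map_add, h2 _ _ (by omega), zero_add] at h5
    exact h5
  rw [hp, hp0]; simp

/-- The factor t(1 + t) makes the sum converge by itself, and turns the outermost letter into
polynomials in v that vanish at 0. -/
theorem EndSum.fsum_kd_mem {W G} (hG : EndSum 0 W G) :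
    (fsum fun z => tt z * (1 + tt z) * G z) ∈ qTopFam (W + 2) := by
  obtain ⟨G', hG', he⟩ := hG
  rw [fsum_congr (G := (fun z => tt z * (1 + tt z)) * G') fun z hz => by rw [he z hz]; rfl]
  suffices endSumFam 0 W ≤ (qTopFam (W + 2)).comap
      (fsum ∘ₗ mulLeft ℚ (fun z => tt z * (1 + tt z))) from this hG'
  refine span_le.2 ?_
  · rintro _ ⟨a, r, w, h, rfl⟩
    obtain ⟨p, hp, h0, hpe⟩ := exists_tt_pow_kd a
    have : ((fun z => tt z * (1 + tt z)) * fun z : ℕ => (z : ℚ⟦X⟧) ^ r * tt z ^ a * brSum w z) =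
        ∑ k ∈ range (a + 1 + 1), p.coeff k • fun z : ℕ =>
          (z : ℚ⟦X⟧) ^ r * brLetter (0, k) z * brSum w z := by
      ext1 z
      have := hpe z
      rw [polySer_eq_sum _ hp] at this
      rw [Pi.mul_apply, show tt z * (1 + tt z) * ((z : ℚ⟦X⟧) ^ r * tt z ^ a * brSum w z) =
        (z : ℚ⟦X⟧) ^ r * (tt z * (1 + tt z) * tt z ^ a) * brSum w z by ring, this,
        mul_sum, sum_mul, Finset.sum_apply]
      exact sum_congr rfl fun k _ => by simp
    rw [SetLike.mem_coe, Submodule.mem_comap, LinearMap.comp_apply, LinearMap.mulLeft_apply, this,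
      map_sum]
    refine sum_mem fun k hk => ?_
    rw [map_smul, fsum_letter]
    rcases k with _ | k
    · rw [h0, zero_smul]; exact zero_mem _
    · refine smul_mem _ _ (subset_span ⟨_, ?_, ?_, rfl⟩)
      · rw [mem_range] at hk
        simp only [wt_cons]; omega
      · simp

/-! ### Comparison with bi-brackets -/

/-- Equality of series up to degree `B`. -/
def EqUpTo (B : ℕ) (f g : ℚ⟦X⟧) : Prop := ∀ n ≤ B, coeff n f = coeff n g

theorem EqUpTo.mul {B f g f' g'} (h : EqUpTo B f g) (h' : EqUpTo B f' g') :
    EqUpTo B (f * f') (g * g') := by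
  intro n hn
  rw [coeff_mul, coeff_mul]
  refine sum_congr rfl fun p hp => ?_
  rw [mem_antidiagonal] at hp
  rw [h _ (by omega), h' _ (by omega)]

theorem EqUpTo.sum {ι : Type*} {B} {s : Finset ι} {f g : ι → ℚ⟦X⟧} (h : ∀ i ∈ s, EqUpTo B (f i) (g i)) :
    EqUpTo B (∑ i ∈ s, f i) (∑ i ∈ s, g i) := by
  intro n hn
  rw [map_sum, map_sum]
  exact sum_congr rfl fun i hi => h i hi n hn

theorem brLetter_eqUpTo (l : ℕ × ℕ) {y : ℕ} (hy : 0 < y) (B : ℕ) : EqUpTo B (brLetter l y)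
    (∑ v ∈ Icc 1 B, PowerSeries.monomial (y * v) ((y : ℚ) ^ l.1 * (v : ℚ) ^ l.2)) := by
  intro n hn
  rw [brLetter, ← cast_pow, ← nsmul_eq_mul, map_nsmul, nsmul_eq_mul, cast_pow,
    coeff_polySer, map_sum]
  simp_rw [coeff_monomial]
  by_cases h : 0 < n ∧ y ∣ n
  · obtain ⟨hn0, k, rfl⟩ := h
    have hk : 0 < k := Nat.pos_of_mul_pos_left hn0 |> fun h => by
      rcases Nat.eq_zero_or_pos k with rfl | h
      · omega
      · exact h
    rw [if_pos ⟨hn0, dvd_mul_right _ _⟩, Nat.mul_div_cancel_left _ hy,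
      Finset.sum_eq_single k]
    · simp
    · intro v _ hv
      rw [if_neg]
      intro h
      exact hv (Nat.eq_of_mul_eq_mul_left hy h).symm
    · intro hk'
      exfalso
      apply hk'
      rw [mem_Icc]
      exact ⟨hk, (Nat.le_mul_of_pos_left k hy).trans hn⟩
  · rw [if_neg h, mul_zero, sum_eq_zero]
    intro v hv
    rw [if_neg]
    rintro rfl
    rw [mem_Icc] at hv
    exact h ⟨Nat.mul_pos hy hv.1, dvd_mul_right _ _⟩

/-- The term of a bi-bracket, without factorials. -/
def brTerm {l : ℕ} (w : Fin l → ℕ × ℕ) (u v : Fin l → ℕ) : ℚ⟦X⟧ :=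
  PowerSeries.monomial (∑ i, u i * v i) (∏ i, (u i : ℚ) ^ (w i).1 * (v i : ℚ) ^ (w i).2)

theorem sum_piFinset_succ {M : Type*} [AddCommMonoid M] {l : ℕ} (s : Finset ℕ)
    (f : (Fin (l + 1) → ℕ) → M) : ∑ u ∈ piFinset fun _ : Fin (l + 1) => s, f u =
      ∑ y ∈ s, ∑ u ∈ piFinset fun _ : Fin l => s, f (Fin.cons y u) := by
  rw [← Finset.sum_product']
  refine Finset.sum_nbij' (fun u => (u 0, Fin.tail u)) (fun p => Fin.cons p.1 p.2) ?_ ?_ ?_ ?_ ?_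
  · intro u hu
    rw [mem_piFinset] at hu
    rw [mem_product, mem_piFinset]
    exact ⟨hu 0, fun i => hu i.succ⟩
  · rintro ⟨y, u⟩ h
    rw [mem_product, mem_piFinset] at h
    rw [mem_piFinset]
    exact Fin.cases h.1 h.2
  · intro u _; simp
  · rintro ⟨y, u⟩ _; simp
  · intro u _; simp

theorem strictAnti_cons {l : ℕ} {y : ℕ} {u : Fin l → ℕ} :
    StrictAnti (Fin.cons y u : Fin (l + 1) → ℕ) ↔ StrictAnti u ∧ ∀ i, u i < y := by
  constructor
  · intro h
    refine ⟨fun i j hij => ?_, fun i => ?_⟩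
    · simpa using h (Fin.succ_lt_succ_iff.2 hij)
    · simpa using h (Fin.succ_pos i)
  · rintro ⟨h, h'⟩ i j hij
    induction i using Fin.cases with
    | zero =>
      induction j using Fin.cases with
      | zero => exact absurd hij (lt_irrefl _)
      | succ j => simpa using h' j
    | succ i =>
      induction j using Fin.cases with
      | zero => exact absurd hij (not_lt_of_gt (Fin.succ_pos i))
      | succ j => simpa using h (Fin.succ_lt_succ_iff.1 hij)

-- The term of u, v has order at least each u_i v_i, so up to degree B all entries may be restricted
-- to 1, ..., B.
open Classical in
theorem brSum_eqUpTo {l : ℕ} (w : Fin l → ℕ × ℕ) (B U : ℕ) : EqUpTo B (brSum (ofFn w) U)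
    (∑ u ∈ piFinset fun _ : Fin l => Icc 1 B,
      ∑ v ∈ piFinset fun _ : Fin l => Icc 1 B,
        if StrictAnti u ∧ ∀ i, u i < U then brTerm w u v else 0) := by
  induction l generalizing U with
  | zero =>
    intro n _
    rw [Fintype.piFinset_of_isEmpty, Finset.univ_unique, sum_singleton,
      sum_singleton, if_pos ⟨fun i => i.elim0, fun i => i.elim0⟩]
    simp [brSum, brTerm]
  | succ l ih =>
    have h1 : EqUpTo B (brSum (ofFn w) U) (∑ y ∈ (Icc 1 B).filter (· < U),
        (∑ v ∈ Icc 1 B, PowerSeries.monomial (y * v) ((y : ℚ) ^ (w 0).1 * (v : ℚ) ^ (w 0).2))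
        * ∑ u ∈ piFinset fun _ : Fin l => Icc 1 B,
          ∑ v ∈ piFinset fun _ : Fin l => Icc 1 B,
          if StrictAnti u ∧ ∀ i, u i < y then brTerm (fun i => w i.succ) u v else 0) := by
      rw [ofFn_succ, brSum]
      intro n hn
      rw [map_sum]
      rw [← sum_subset (s₁ := (Icc 1 B).filter (· < U)) (fun y hy => by
        simp at hy ⊢; omega), ← map_sum]
      · refine EqUpTo.sum (fun y hy => ?_) n hn
        refine EqUpTo.mul (brLetter_eqUpTo _ ?_ _) (ih _ _)
        simp at hy; omega
      · intro y hy hy'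
        refine coeff_letter_mul ?_ _ _
        simp at hy hy'
        by_contra h
        have := hy' (by omega) (by omega)
        omega
    intro n hn
    rw [h1 n hn]
    congr 1
    rw [sum_piFinset_succ, sum_filter]
    refine sum_congr rfl fun y hy => ?_
    refine Eq.trans ?_ (sum_congr rfl fun u _ => (sum_piFinset_succ _ _).symm)
    split_ifs with hU
    · rw [Finset.sum_mul_sum, sum_comm]
      refine sum_congr rfl fun u _ => sum_congr rfl fun v _ => ?_
      rw [mul_sum]
      refine sum_congr rfl fun v' _ => ?_
      have : (StrictAnti (Fin.cons y u : Fin (l + 1) → ℕ) ∧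
          ∀ i, (Fin.cons y u : Fin (l + 1) → ℕ) i < U) ↔ StrictAnti u ∧ ∀ i, u i < y := by
        rw [strictAnti_cons]
        constructor
        · exact fun h => h.1
        · intro h
          refine ⟨h, Fin.cases hU fun i => ?_⟩
          rw [Fin.cons_succ]
          exact (h.2 i).trans hU
      rw [if_congr this rfl rfl, mul_ite, mul_zero]
      refine if_congr Iff.rfl ?_ rfl
      simp only [brTerm, PowerSeries.monomial_mul_monomial, Fin.sum_univ_succ, Fin.prod_univ_succ,
        Fin.cons_zero, Fin.cons_succ]
    · refine (sum_eq_zero fun u _ => sum_eq_zero fun v _ =>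
        sum_eq_zero fun v' _ => if_neg fun h => hU ?_).symm
      simpa using h.2 0

/-- For the coefficient of q^n the infinite sum may be cut off at n + 1. A letter (r, k) corresponds
to the entries s = k + 1 and r, and the factorials are the normalisation of bi-brackets. -/
theorem brTop_ofFn {l : ℕ} (w : Fin l → ℕ × ℕ) : brTop (ofFn w) =
    (∏ i, ((w i).1.factorial * (w i).2.factorial : ℚ)) •
      biBracket (fun i => (w i).2 + 1) (fun i => (w i).1) := by
  classical
  ext n
  have h1 : coeff n (brTop (ofFn w)) =
      coeff n (brSum (ofFn w) (n + 1)) := by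
    cases l with
    | zero => simp [brTop, brSum]
    | succ l => rw [ofFn_succ, brTop, coeff_fsum, brSum, map_sum]
  rw [h1, brSum_eqUpTo w n (n + 1) n le_rfl, map_smul, biBracket, coeff_mk,
    map_sum, smul_sum]
  refine sum_congr rfl fun u hu => ?_
  rw [map_sum, smul_sum]
  refine sum_congr rfl fun v _ => ?_
  have hu' : ∀ i, u i < n + 1 := fun i => by
    have := (mem_piFinset.1 hu) i
    rw [mem_Icc] at this; omega
  by_cases h : StrictAnti u
  · rw [if_pos ⟨h, hu'⟩, brTerm, coeff_monomial]
    by_cases h2 : ∑ i, u i * v i = n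
    · rw [if_pos h2.symm, if_pos ⟨h, h2⟩, smul_eq_mul, ← Finset.prod_mul_distrib]
      refine prod_congr rfl fun i _ => ?_
      have h3 : ((w i).1.factorial : ℚ) ≠ 0 := by positivity
      have h4 : ((w i).2.factorial : ℚ) ≠ 0 := by positivity
      simp only [Nat.add_sub_cancel]
      field_simp
    · rw [if_neg fun h => h2 h.symm, if_neg fun h => h2 h.2, smul_zero]
  · rw [if_neg fun h' => h h'.1, if_neg fun h' => h h'.1, map_zero, smul_zero]

theorem exists_ofFn (w : List (ℕ × ℕ)) : ∃ (l : ℕ) (w' : Fin l → ℕ × ℕ), w = ofFn w' :=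
  ⟨_, w.get, (List.ofFn_get w).symm⟩

theorem wt_ofFn {l : ℕ} (w : Fin l → ℕ × ℕ) :
    wt (ofFn w) = ∑ i, ((w i).2 + 1 + (w i).1) := by
  rw [wt, List.map_ofFn, List.sum_ofFn]
  exact sum_congr rfl fun i _ => by simp only [comp]; omega

theorem topFam_le (W : ℕ) : topFam W ≤ BD W := by
  refine span_le.2 ?_
  rintro _ ⟨w, h, rfl⟩
  obtain ⟨l, w, rfl⟩ := exists_ofFn w
  rw [brTop_ofFn]
  refine smul_mem _ _ (subset_span ⟨l, _, _, fun i => by omega, ?_, rfl⟩)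
  rwa [wt_ofFn] at h

theorem qTopFam_le (W : ℕ) : qTopFam W ≤ qBD W := by
  refine span_le.2 ?_
  rintro _ ⟨w, h, h', rfl⟩
  obtain ⟨l, w, rfl⟩ := exists_ofFn w
  rw [brTop_ofFn]
  refine smul_mem _ _ (subset_span
    ⟨l, _, _, fun i => by omega, fun hl => ?_, ?_, rfl⟩)
  · obtain ⟨l, rfl⟩ : ∃ k, l = k + 1 := ⟨l - 1, by omega⟩
    rw [ofFn_succ] at h'
    have := h' (w 0) (by simp)
    show 1 < (w 0).2 + 1
    omega
  · rwa [wt_ofFn] at h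

/-! ### Chain sums of products attached to graphs -/

/-- The position of a vertex: the vertex `0` is at `0`, the others are at the places given by the
list. -/
def pos (xs : List ℕ) : ℕ → ℕ
  | 0 => 0
  | i + 1 => xs.getD i 0

@[simp] theorem pos_zero (xs) : pos xs 0 = 0 := rfl

/-- `tt` of the distance. -/
def ttDist (a b : ℕ) : ℚ⟦X⟧ := tt (a - b + (b - a))

theorem ttDist_comm (a b : ℕ) : ttDist a b = ttDist b a := by rw [ttDist, ttDist, add_comm]

theorem ttDist_of_le {a b : ℕ} (h : a ≤ b) : ttDist a b = tt (b - a) := by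
  rw [ttDist, Nat.sub_eq_zero_of_le h, zero_add]

/-- Factors of a product: an edge carrying the series `tt` of its length, an edge carrying `1`, or
the position of a vertex. -/
inductive Atom : Type
  | real (a b : ℕ)
  | virt (a b : ℕ)
  | pos (a : ℕ)

/-- The value of a factor. -/
def Atom.val (xs : List ℕ) : Atom → ℚ⟦X⟧
  | .real a b => ttDist (Nested.pos xs a) (Nested.pos xs b)
  | .virt _ _ => 1
  | .pos a => (Nested.pos xs a : ℚ⟦X⟧)

/-- All vertices are at most `n`. -/
def Atom.InRange (n : ℕ) : Atom → Prop
  | .real a b => a ≤ n ∧ b ≤ n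
  | .virt a b => a ≤ n ∧ b ≤ n
  | .pos a => a ≤ n

/-- The labelling is constant on the edge. -/
def Atom.Flat (f : ℕ → ℕ) : Atom → Prop
  | .real a b => f a = f b
  | .virt a b => f a = f b
  | .pos _ => True

/-- The value of a product. -/
def evalL (L : List Atom) (xs : List ℕ) : ℚ⟦X⟧ := (L.map (Atom.val xs)).prod

@[simp] theorem evalL_nil (xs) : evalL [] xs = 1 := rfl
@[simp] theorem evalL_cons (t L xs) : evalL (t :: L) xs = t.val xs * evalL L xs := by
  simp [evalL]
theorem evalL_append (L L' xs) : evalL (L ++ L') xs = evalL L xs * evalL L' xs := by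
  simp [evalL]

/-- The edges, and the edge between `0` and `n` if `m` is true, connect the vertices up to `n`. -/
def Conn (m : Bool) (L : List Atom) (n : ℕ) : Prop :=
  ∀ f : ℕ → ℕ, (∀ t ∈ L, t.Flat f) → (m = true → f n = f 0) → ∀ i ≤ n, f i = f 0

/-- Strictly increasing lists of positive integers of length `n`. -/
def Incr (n : ℕ) (xs : List ℕ) : Prop := xs.length = n ∧ (0 :: xs).Pairwise (· < ·)

theorem Incr.tail {n x xs} (h : Incr (n + 1) (x :: xs)) : Incr n xs := by
  obtain ⟨h1, h2⟩ := h
  rw [pairwise_cons, pairwise_cons] at h2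
  refine ⟨by simpa using h1, ?_⟩
  rw [pairwise_cons]
  exact ⟨fun y hy => h2.1 y (mem_cons_of_mem _ hy), h2.2.2⟩

theorem Incr.below {n x xs} (h : Incr n (x :: xs)) : Below xs x := by
  obtain ⟨h1, h2⟩ := h
  rw [pairwise_cons, pairwise_cons] at h2
  exact h2.2.1

theorem Incr.pos_head {n x xs} (h : Incr n (x :: xs)) : 0 < x := by
  obtain ⟨h1, h2⟩ := h
  rw [pairwise_cons] at h2
  exact h2.1 x (by simp)

theorem Incr.cons {n x y ys} (h : Incr n (y :: ys)) (h0 : 0 < x) (hxy : x < y) :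
    Incr (n + 1) (x :: y :: ys) := by
  obtain ⟨h1, h2⟩ := h
  refine ⟨by simp at h1 ⊢; exact h1, ?_⟩
  rw [pairwise_cons] at h2 ⊢
  refine ⟨fun z hz => ?_, ?_⟩
  · rcases mem_cons.1 hz with rfl | hz
    · exact h0
    · exact h2.1 z hz
  · rw [pairwise_cons]
    refine ⟨fun z hz => ?_, h2.2⟩
    rcases mem_cons.1 hz with rfl | hz
    · exact hxy
    · rw [pairwise_cons] at h2
      exact hxy.trans (h2.2.1 z hz)

theorem Incr.pos_lt {n xs} (h : Incr n xs) {i j : ℕ} (hij : i < j) (hj : j ≤ n) :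
    pos xs i < pos xs j := by
  obtain ⟨h1, h2⟩ := h
  subst h1
  have key : ∀ k (hk : k ≤ xs.length), pos xs k = (0 :: xs)[k]'(by simp; omega) := by
    intro k hk
    cases k with
    | zero => rfl
    | succ k => rw [pos, getD_eq_getElem _ _ (by omega)]; rfl
  rw [key i (by omega), key j hj]
  exact List.pairwise_iff_getElem.1 h2 i j _ _ hij

/-- Partial fractions in terms of distances. -/
theorem ttDist_mul_ttDist (n : ℕ) {a b : ℕ} (ha : a ≤ n) (hb : b ≤ n)
    (hab : a ≠ b) : ∃ c0 c1 c2 c3 c4 : ℚ, ∀ x xs, Incr (n + 1) (x :: xs) →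
      ttDist x (pos xs a) * ttDist x (pos xs b) =
        c0 • ttDist (pos xs a) (pos xs b) +
        c1 • (ttDist (pos xs a) (pos xs b) * ttDist x (pos xs a)) +
        c2 • (ttDist (pos xs a) (pos xs b) * ttDist x (pos xs b)) +
        c3 • ttDist x (pos xs a) + c4 • ttDist x (pos xs b) := by
  wlog h : a < b generalizing a b
  · obtain ⟨c0, c1, c2, c3, c4, hc⟩ := this hb ha hab.symm (by omega)
    refine ⟨c0, c2, c1, c4, c3, fun x xs hx => ?_⟩
    rw [mul_comm, hc x xs hx, ttDist_comm (pos xs b)]; abel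
  obtain ⟨b, rfl⟩ : ∃ c, b = c + 1 := ⟨b - 1, by omega⟩
  cases a with
  | zero =>
    -- Here x lies between 0 and the other vertex, so the two distances add up.
    refine ⟨1, 1, 1, 0, 0, fun x xs hx => ?_⟩
    have h0 := hx.pos_head
    have h1 : x < pos xs (b + 1) := hx.pos_lt (i := 1) (j := b + 2) (by omega) (by omega)
    rw [ttDist_comm x, pos_zero, ttDist_of_le (Nat.zero_le _), ttDist_of_le (Nat.zero_le _),
      ttDist_of_le h1.le]
    simp only [pos, Nat.sub_zero] at h1 ⊢
    have := tt_mul_tt h0 (show 0 < xs.getD b 0 - x by omega)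
    rw [show x + (xs.getD b 0 - x) = xs.getD b 0 by omega] at this
    rw [this]
    simp only [one_smul, zero_smul]
    ring
  | succ a =>
    -- Here x lies below both vertices, and the distance to the farther one is the sum of the other
    -- two distances.
    refine ⟨0, 1, -1, 0, -1, fun x xs hx => ?_⟩
    have h1 : x < pos xs (a + 1) := hx.pos_lt (i := 1) (j := a + 2) (by omega) (by omega)
    have h2 : pos xs (a + 1) < pos xs (b + 1) :=
      hx.tail.pos_lt (i := a + 1) (j := b + 1) (by omega) (by omega)
    rw [ttDist_of_le h1.le, ttDist_of_le h2.le, ttDist_of_le (h1.trans h2).le]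
    have := tt_mul_tt (show 0 < pos xs (a + 1) - x by omega)
      (show 0 < pos xs (b + 1) - pos xs (a + 1) by omega)
    rw [show pos xs (a + 1) - x + (pos xs (b + 1) - pos xs (a + 1)) = pos xs (b + 1) - x by omega]
      at this
    simp only [one_smul, zero_smul, neg_smul]
    linear_combination -this

/-- Combinations of letters at the first vertex times products over the other vertices. -/
inductive Elim (m : Bool) (n W : ℕ) : (List ℕ → ℕ → ℚ⟦X⟧) → Prop
  | mk {φ d L} : φ ∈ letterFam d → (∀ t ∈ L, Atom.InRange n t) → Conn m L n →
      d + L.length ≤ W → Elim m n W fun xs x => φ xs x * evalL L xs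
  | zero : Elim m n W 0
  | add {f g} : Elim m n W f → Elim m n W g → Elim m n W (f + g)
  | smul {f} (c : ℚ) : Elim m n W f → Elim m n W (c • f)
  | congr {f g} : (∀ xs x, Incr (n + 1) (x :: xs) → f xs x = g xs x) →
      Elim m n W f → Elim m n W g

/-- The product of the edges at the first vertex. -/
def starProd (E : List (Bool × ℕ)) (xs : List ℕ) (x : ℕ) : ℚ⟦X⟧ :=
  (E.map fun e => if e.1 then ttDist x (pos xs e.2) else 1).prod

@[simp] theorem starProd_nil (xs x) : starProd [] xs x = 1 := rfl
@[simp] theorem starProd_true (b E xs x) :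
    starProd ((true, b) :: E) xs x = ttDist x (pos xs b) * starProd E xs x := by simp [starProd]
@[simp] theorem starProd_false (b E xs x) :
    starProd ((false, b) :: E) xs x = starProd E xs x := by simp [starProd]

/-- A bundle of k parallel edges at the first vertex is a letter: edges to 0 are factors `tt x`,
edges to a larger vertex are factors of the environment. -/
theorem ttDist_pow_mem {n a : ℕ} (k r : ℕ) (ha : a ≤ n) :
    ∃ φ ∈ letterFam (max 1 k + r), ∀ xs x, Incr (n + 1) (x :: xs) →
      (x : ℚ⟦X⟧) ^ r * ttDist x (pos xs a) ^ k = φ xs x := by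
  cases a with
  | zero =>
    have h : ∀ k, Mono k fun _ x => tt x ^ k := by
      intro k
      induction k with
      | zero => convert Mono.one using 1; ext1; ext1; simp
      | succ k ih => convert ih.self using 1; ext1; ext1; ring
    refine ⟨_, mem_letterFam (h k) le_rfl, fun xs x _ => ?_⟩
    rw [ttDist_comm, pos_zero, ttDist_of_le (Nat.zero_le _)]; rfl
  | succ a =>
    have h : ∀ k, Mono k fun (xs : List ℕ) x => tt (xs.getD a 0 - x) ^ k := by
      intro k
      induction k with
      | zero => convert Mono.one using 1; ext1; ext1; simp
      | succ k ih => convert ih.env a using 1; ext1; ext1; ring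
    refine ⟨_, mem_letterFam (h k) le_rfl, fun xs x hx => ?_⟩
    have h1 : x < pos xs (a + 1) := hx.pos_lt (i := 1) (j := a + 2) (by omega) (by omega)
    rw [ttDist_of_le h1.le]; rfl

/-- Collecting all edges at the first vertex into a single bundle. -/
theorem elim_star {m : Bool} {n W : ℕ} (E : List (Bool × ℕ)) {a k r : ℕ} {L : List Atom}
    (ha : a ≤ n) (hL : ∀ t ∈ L, Atom.InRange n t) (hE : ∀ e ∈ E, e.2 ≤ n)
    (hc : ∀ f : ℕ → ℕ, (∀ t ∈ L, t.Flat f) → (m = true → f n = f 0) → (∀ e ∈ E, f e.2 = f a) →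
      ∀ i ≤ n, f i = f 0) (hW : max 1 k + r + L.length + E.length ≤ W) :
    Elim m n W fun xs x => (x : ℚ⟦X⟧) ^ r * ttDist x (pos xs a) ^ k * evalL L xs *
      starProd E xs x := by
  induction E generalizing a k L with
  | nil =>
    obtain ⟨φ, hφ, he⟩ := ttDist_pow_mem k r ha
    refine .congr (fun xs x hx => ?_) (.mk hφ hL (fun f h1 h2 => hc f h1 h2 (by simp)) hW)
    rw [he xs x hx, starProd_nil, mul_one]
  | cons e E ih =>
    obtain ⟨t, b⟩ := e
    have hb : b ≤ n := hE _ (mem_cons_self)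
    have hE' : ∀ e ∈ E, e.2 ≤ n := fun e he => hE e (mem_cons_of_mem _ he)
    rw [length_cons] at hW
    have hvirt : ∀ t ∈ Atom.virt a b :: L, Atom.InRange n t := by
      intro t ht
      rcases mem_cons.1 ht with rfl | ht
      · exact ⟨ha, hb⟩
      · exact hL t ht
    have hcons : ∀ (f : ℕ → ℕ), (∀ t ∈ L, t.Flat f) → (m = true → f n = f 0) → f a = f b →
        (∀ e ∈ E, f e.2 = f a) → ∀ i ≤ n, f i = f 0 := by
      intro f h1 h2 h3 h4
      refine hc f h1 h2 fun e he => ?_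
      rcases mem_cons.1 he with rfl | he
      · exact h3.symm
      · exact h4 e he
    cases t with
    -- An edge of value 1 at the first vertex is re-attached as a virtual edge between a and b,
    -- which preserves connectedness without the first vertex.
    | false =>
      refine .congr (fun xs x _ => ?_) (ih (a := a) (k := k) (L := .virt a b :: L) ha hvirt hE' ?_ ?_)
      · simp [Atom.val]
      · intro f h1 h2 h3
        exact hcons f (fun t ht => h1 t (mem_cons_of_mem _ ht)) h2 (h1 _ mem_cons_self) h3
      · simp only [length_cons]; omega
    | true =>
      by_cases hab : a = b
      · subst hab
        refine .congr (fun xs x _ => ?_) (ih (a := a) (k := k + 1) (L := L) ha hL hE' ?_ ?_)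
        · simp only [starProd_true]; ring
        · intro f h1 h2 h3
          exact hcons f h1 h2 rfl h3
        · omega
      -- products in which the other vertices already connect `a` and `b`
      have key : ∀ k (L : List Atom), (∀ t ∈ L, Atom.InRange n t) →
          (∀ (f : ℕ → ℕ), (∀ t ∈ L, t.Flat f) → (m = true → f n = f 0) →
            f a = f b ∧ ((∀ e ∈ E, f e.2 = f a) → ∀ i ≤ n, f i = f 0)) →
          k + 1 + r + L.length + E.length ≤ W →
          Elim m n W fun xs x => (x : ℚ⟦X⟧) ^ r * (ttDist x (pos xs a) ^ k *
            ttDist x (pos xs b)) * evalL L xs * starProd E xs x := by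
        intro k
        induction k with
        | zero =>
          intro L hL h1 h2
          refine .congr (fun xs x _ => ?_) (ih (a := b) (k := 1) (L := L) hb hL hE' ?_ ?_)
          · ring
          · intro f h3 h4 h5
            refine (h1 f h3 h4).2 fun e he => ?_
            rw [h5 e he, (h1 f h3 h4).1]
          · omega
        | succ k ihk =>
          intro L hL h1 h2
          obtain ⟨c0, c1, c2, c3, c4, hcs⟩ := ttDist_mul_ttDist n ha hb hab
          have hr : ∀ t ∈ Atom.real a b :: L, Atom.InRange n t := by
            intro t ht
            rcases mem_cons.1 ht with rfl | ht
            · exact ⟨ha, hb⟩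
            · exact hL t ht
          have hf : ∀ (f : ℕ → ℕ), (∀ t ∈ Atom.real a b :: L, t.Flat f) →
              (m = true → f n = f 0) →
              f a = f b ∧ ((∀ e ∈ E, f e.2 = f a) → ∀ i ≤ n, f i = f 0) :=
            fun f h3 h4 => h1 f (fun t ht => h3 t (mem_cons_of_mem _ ht)) h4
          have t0 := ih (a := a) (k := k) (L := .real a b :: L) ha hr hE'
            (fun f h3 h4 => (hf f h3 h4).2) (by simp only [length_cons]; omega)
          have t1 := ih (a := a) (k := k + 1) (L := .real a b :: L) ha hr hE'
            (fun f h3 h4 => (hf f h3 h4).2) (by simp only [length_cons]; omega)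
          have t2 := ihk (.real a b :: L) hr hf (by simp only [length_cons]; omega)
          have t3 := ih (a := a) (k := k + 1) (L := L) ha hL hE'
            (fun f h3 h4 => (h1 f h3 h4).2) (by omega)
          have t4 := ihk L hL h1 (by omega)
          refine .congr (fun xs x hx => ?_) (((((t0.smul c0).add (t1.smul c1)).add
            (t2.smul c2)).add (t3.smul c3)).add (t4.smul c4))
          have h5 := congrArg (fun z => (x : ℚ⟦X⟧) ^ r * ttDist x (pos xs a) ^ k * evalL L xs *
            starProd E xs x * z) (hcs x xs hx)
          simp only [Pi.add_apply, Pi.smul_apply, evalL_cons, Atom.val]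
          simp only [smul_eq_C_mul] at h5 ⊢
          linear_combination -h5
      -- With k = 0 the bundle at a has value 1; a virtual edge between a and b replaces it, and the
      -- bundle moves to b.
      cases k with
      | zero =>
        refine .congr (fun xs x _ => ?_) (key 0 (.virt a b :: L) hvirt ?_ ?_)
        · simp [Atom.val]; ring
        · intro f h1 h2
          have h3 : f a = f b := h1 _ mem_cons_self
          exact ⟨h3, hcons f (fun t ht => h1 t (mem_cons_of_mem _ ht)) h2 h3⟩
        · simp only [length_cons]; omega
      | succ k =>
        obtain ⟨c0, c1, c2, c3, c4, hcs⟩ := ttDist_mul_ttDist n ha hb hab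
        have hr : ∀ t ∈ Atom.real a b :: L, Atom.InRange n t := by
          intro t ht
          rcases mem_cons.1 ht with rfl | ht
          · exact ⟨ha, hb⟩
          · exact hL t ht
        have hf : ∀ (f : ℕ → ℕ), (∀ t ∈ Atom.real a b :: L, t.Flat f) → (m = true → f n = f 0) →
            f a = f b ∧ ((∀ e ∈ E, f e.2 = f a) → ∀ i ≤ n, f i = f 0) := by
          intro f h1 h2
          have h3 : f a = f b := h1 _ mem_cons_self
          exact ⟨h3, hcons f (fun t ht => h1 t (mem_cons_of_mem _ ht)) h2 h3⟩
        have hf' : ∀ (f : ℕ → ℕ), (∀ t ∈ Atom.virt a b :: L, t.Flat f) → (m = true → f n = f 0) →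
            f a = f b ∧ ((∀ e ∈ E, f e.2 = f a) → ∀ i ≤ n, f i = f 0) := by
          intro f h1 h2
          have h3 : f a = f b := h1 _ mem_cons_self
          exact ⟨h3, hcons f (fun t ht => h1 t (mem_cons_of_mem _ ht)) h2 h3⟩
        have t0 := ih (a := a) (k := k) (L := .real a b :: L) ha hr hE'
          (fun f h3 h4 => (hf f h3 h4).2) (by simp only [length_cons]; omega)
        have t1 := ih (a := a) (k := k + 1) (L := .real a b :: L) ha hr hE'
          (fun f h3 h4 => (hf f h3 h4).2) (by simp only [length_cons]; omega)
        -- The terms of the partial fractions without the factor of the edge between a and b,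
        -- treated in `t3` and `t4`, keep this link as a virtual edge of the same weight.
        have t2 := key k (.real a b :: L) hr hf (by simp only [length_cons]; omega)
        have t3 := ih (a := a) (k := k + 1) (L := .virt a b :: L) ha hvirt hE'
          (fun f h3 h4 => (hf' f h3 h4).2) (by simp only [length_cons]; omega)
        have t4 := key k (.virt a b :: L) hvirt hf' (by simp only [length_cons]; omega)
        refine .congr (fun xs x hx => ?_) (((((t0.smul c0).add (t1.smul c1)).add
          (t2.smul c2)).add (t3.smul c3)).add (t4.smul c4))
        have h5 := congrArg (fun z => (x : ℚ⟦X⟧) ^ r * ttDist x (pos xs a) ^ k * evalL L xs *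
          starProd E xs x * z) (hcs x xs hx)
        simp only [Pi.add_apply, Pi.smul_apply, evalL_cons, Atom.val, starProd_true]
        simp only [smul_eq_C_mul] at h5 ⊢
        linear_combination -h5

/-- The labelling of the longer list obtained from a labelling of the tail and a label of the first
vertex. -/
def liftLabel (f : ℕ → ℕ) (c : ℕ) : ℕ → ℕ
  | 0 => f 0
  | 1 => c
  | i + 2 => f (i + 1)

/-- The factors are sorted by whether they touch the vertex 1: its position gives r, its edges give
E, and all other factors are renumbered. A real loop at 1 kills the product, since `tt 0 = 0`; a
virtual one is harmless. -/
theorem exists_strip {n : ℕ} (L : List Atom) (hL : ∀ t ∈ L, Atom.InRange (n + 1) t) :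
    (∀ xs x, evalL L (x :: xs) = 0) ∨ ∃ (r : ℕ) (E : List (Bool × ℕ)) (L' : List Atom),
      (∀ xs x, evalL L (x :: xs) = (x : ℚ⟦X⟧) ^ r * evalL L' xs * starProd E xs x) ∧
      (∀ e ∈ E, e.2 ≤ n) ∧ (∀ t ∈ L', Atom.InRange n t) ∧ r + L'.length + E.length ≤ L.length ∧
      ∀ f c, (∀ t ∈ L', t.Flat f) → (∀ e ∈ E, f e.2 = c) → ∀ t ∈ L, t.Flat (liftLabel f c) := by
  induction L with
  | nil => exact .inr ⟨0, [], [], by simp⟩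
  | cons t L ih =>
    have ht := hL t mem_cons_self
    rcases ih fun t ht => hL t (mem_cons_of_mem _ ht) with h | ⟨r, E, L', h1, h2, h3, h4, h5⟩
    · exact .inl fun xs x => by rw [evalL_cons, h, mul_zero]
    have add : ∀ t' : Atom, t'.InRange n → (∀ xs x, t.val (x :: xs) = t'.val xs) →
        (∀ f c, t'.Flat f → t.Flat (liftLabel f c)) → ∃ (r : ℕ) (E : List (Bool × ℕ))
        (L' : List Atom), (∀ xs x, evalL (t :: L) (x :: xs) =
          (x : ℚ⟦X⟧) ^ r * evalL L' xs * starProd E xs x) ∧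
        (∀ e ∈ E, e.2 ≤ n) ∧ (∀ t ∈ L', Atom.InRange n t) ∧
        r + L'.length + E.length ≤ (t :: L).length ∧
        ∀ f c, (∀ t ∈ L', t.Flat f) → (∀ e ∈ E, f e.2 = c) →
          ∀ t' ∈ t :: L, t'.Flat (liftLabel f c) := by
      intro t' k1 k2 k3
      refine ⟨r, E, t' :: L', fun xs x => ?_, h2, ?_, ?_, ?_⟩
      · rw [evalL_cons, h1, evalL_cons, k2]; ring
      · simpa using ⟨k1, h3⟩
      · simp only [length_cons]; omega
      · intro f c k4 k5 s hs
        rcases mem_cons.1 hs with rfl | hs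
        · exact k3 f c (k4 _ mem_cons_self)
        · exact h5 f c (fun t ht => k4 t (mem_cons_of_mem _ ht)) k5 s hs
    have addE : ∀ e : Bool × ℕ, e.2 ≤ n →
        (∀ xs x, t.val (x :: xs) = if e.1 then ttDist x (pos xs e.2) else 1) →
        (∀ f c, f e.2 = c → t.Flat (liftLabel f c)) → ∃ (r : ℕ) (E : List (Bool × ℕ))
        (L' : List Atom), (∀ xs x, evalL (t :: L) (x :: xs) =
          (x : ℚ⟦X⟧) ^ r * evalL L' xs * starProd E xs x) ∧
        (∀ e ∈ E, e.2 ≤ n) ∧ (∀ t ∈ L', Atom.InRange n t) ∧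
        r + L'.length + E.length ≤ (t :: L).length ∧
        ∀ f c, (∀ t ∈ L', t.Flat f) → (∀ e ∈ E, f e.2 = c) →
          ∀ t' ∈ t :: L, t'.Flat (liftLabel f c) := by
      intro e k1 k2 k3
      refine ⟨r, e :: E, L', fun xs x => ?_, ?_, h3, ?_, ?_⟩
      · rw [evalL_cons, h1, k2, starProd, starProd, List.map_cons, List.prod_cons]; ring
      · intro e' he
        rcases mem_cons.1 he with rfl | he
        · exact k1
        · exact h2 e' he
      · simp only [length_cons]; omega
      · intro f c k4 k5 s hs
        rcases mem_cons.1 hs with rfl | hs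
        · exact k3 f c (k5 _ mem_cons_self)
        · exact h5 f c k4 (fun t ht => k5 t (mem_cons_of_mem _ ht)) s hs
    rcases t with ⟨a, b⟩ | ⟨a, b⟩ | a
    · obtain ⟨ha, hb⟩ := ht
      rcases a with _ | _ | a <;> rcases b with _ | _ | b
      · exact .inr (add (.real 0 0) ⟨by omega, by omega⟩ (fun _ _ => rfl) fun _ _ _ => rfl)
      · exact .inr (addE (true, 0) (by simp) (fun _ _ => ttDist_comm _ _) fun _ _ h => h)
      · exact .inr (add (.real 0 (b + 1)) ⟨by omega, by omega⟩ (fun _ _ => rfl) fun _ _ h => h)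
      · exact .inr (addE (true, 0) (by simp) (fun _ _ => rfl) fun _ _ h => h.symm)
      · refine .inl fun xs x => ?_
        rw [evalL_cons, Atom.val, ttDist_of_le le_rfl, Nat.sub_self, tt_zero, zero_mul]
      · exact .inr (addE (true, b + 1) (by simp; omega) (fun _ _ => rfl) fun _ _ h => h.symm)
      · exact .inr (add (.real (a + 1) 0) ⟨by omega, by omega⟩ (fun _ _ => rfl) fun _ _ h => h)
      · exact .inr (addE (true, a + 1) (by simp; omega) (fun _ _ => ttDist_comm _ _) fun _ _ h => h)
      · exact .inr (add (.real (a + 1) (b + 1)) ⟨by omega, by omega⟩ (fun _ _ => rfl)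
          fun _ _ h => h)
    · obtain ⟨ha, hb⟩ := ht
      rcases a with _ | _ | a <;> rcases b with _ | _ | b
      · exact .inr (add (.virt 0 0) ⟨by omega, by omega⟩ (fun _ _ => rfl) fun _ _ _ => rfl)
      · exact .inr (addE (false, 0) (by simp) (fun _ _ => rfl) fun _ _ h => h)
      · exact .inr (add (.virt 0 (b + 1)) ⟨by omega, by omega⟩ (fun _ _ => rfl) fun _ _ h => h)
      · exact .inr (addE (false, 0) (by simp) (fun _ _ => rfl) fun _ _ h => h.symm)
      · exact .inr (add (.virt 0 0) ⟨by omega, by omega⟩ (fun _ _ => rfl) fun _ _ _ => rfl)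
      · exact .inr (addE (false, b + 1) (by simp; omega) (fun _ _ => rfl) fun _ _ h => h.symm)
      · exact .inr (add (.virt (a + 1) 0) ⟨by omega, by omega⟩ (fun _ _ => rfl) fun _ _ h => h)
      · exact .inr (addE (false, a + 1) (by simp; omega) (fun _ _ => rfl) fun _ _ h => h)
      · exact .inr (add (.virt (a + 1) (b + 1)) ⟨by omega, by omega⟩ (fun _ _ => rfl)
          fun _ _ h => h)
    · have ha : a ≤ n + 1 := ht
      rcases a with _ | _ | a
      · exact .inr (add (.pos 0) (Nat.zero_le _) (fun _ _ => rfl) fun _ _ _ => trivial)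
      · refine .inr ⟨r + 1, E, L', fun xs x => ?_, h2, h3, ?_, ?_⟩
        · rw [evalL_cons, h1]; simp only [Atom.val, pos, List.getD_cons_zero]; ring
        · simp only [length_cons]; omega
        · intro f c k4 k5 s hs
          rcases mem_cons.1 hs with rfl | hs
          · trivial
          · exact h5 f c k4 k5 s hs
      · exact .inr (add (.pos (a + 1)) (show a + 1 ≤ n by omega) (fun _ _ => rfl)
          fun _ _ _ => trivial)

/-- Elimination of the first vertex. -/
theorem elim_evalL {m : Bool} {n : ℕ} {L : List Atom} (hL : ∀ t ∈ L, Atom.InRange (n + 1) t)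
    (hc : Conn m L (n + 1)) (hm : m = true → 0 < n) :
    Elim m n L.length fun xs x => evalL L (x :: xs) := by
  rcases exists_strip L hL with h | ⟨r, E, L', h1, h2, h3, h4, h5⟩
  · exact .congr (fun xs x _ => (h xs x).symm) .zero
  have hc' : ∀ (f : ℕ → ℕ) c, (∀ t ∈ L', t.Flat f) → (m = true → f n = f 0) →
      (∀ e ∈ E, f e.2 = c) → c = f 0 ∧ ∀ i ≤ n, f i = f 0 := by
    intro f c k1 k2 k3
    -- The extra edge joins 0 to the last vertex. By `hm` that is not the vertex being eliminated,
    -- so the edge survives.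
    have k4 := hc (liftLabel f c) (h5 f c k1 k3) fun h => by
      obtain ⟨k, rfl⟩ : ∃ k, n = k + 1 := ⟨n - 1, by have := hm h; omega⟩
      exact k2 h
    refine ⟨k4 1 (by omega), fun i hi => ?_⟩
    cases i with
    | zero => rfl
    | succ i => exact k4 (i + 2) (by omega)
  -- Without an edge at the first vertex, a labelling that singles it out would contradict
  -- connectedness.
  cases E with
  | nil =>
    have := (hc' (fun _ => 0) 1 (fun t _ => by cases t <;> simp [Atom.Flat]) (fun _ => rfl)
      (by simp)).1
    exact absurd this one_ne_zero
  | cons e E =>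
    obtain ⟨t, b⟩ := e
    have hb : b ≤ n := h2 _ mem_cons_self
    have hE : ∀ e ∈ E, e.2 ≤ n := fun e he => h2 e (mem_cons_of_mem _ he)
    have hcc : ∀ f : ℕ → ℕ, (∀ t ∈ L', t.Flat f) → (m = true → f n = f 0) →
        (∀ e ∈ E, f e.2 = f b) → ∀ i ≤ n, f i = f 0 := by
      intro f k1 k2 k3
      refine (hc' f (f b) k1 k2 fun e he => ?_).2
      rcases mem_cons.1 he with rfl | he
      · rfl
      · exact k3 e he
    rw [length_cons] at h4
    cases t with
    | false =>
      refine .congr (fun xs x _ => ?_) (elim_star E (a := b) (k := 0) (r := r) hb h3 hE hcc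
        (by omega))
      rw [h1, starProd_false]; ring
    | true =>
      refine .congr (fun xs x _ => ?_) (elim_star E (a := b) (k := 1) (r := r) hb h3 hE hcc
        (by omega))
      rw [h1, starProd_true]; ring

/-! ### Summation over all chains -/

/-- Summation over the `k` lowest vertices of a chain. -/
def lowSum : ℕ → (List ℕ → ℚ⟦X⟧) → List ℕ → ℚ⟦X⟧
  | 0, F, xs => F xs
  | k + 1, F, xs => ∑ x ∈ Ioo 0 (xs.headD 0), lowSum k F (x :: xs)

theorem lowSum_succ (k : ℕ) (F : List ℕ → ℚ⟦X⟧) (xs) :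
    lowSum (k + 1) F xs = lowSum k (lowSum 1 F) xs := by
  induction k generalizing xs with
  | zero => rfl
  | succ k ih =>
    rw [lowSum, lowSum]
    exact sum_congr rfl fun x _ => ih _

/-- Products over a chain whose lower part has been summed out. -/
inductive Stage (m : Bool) (n W : ℕ) : (List ℕ → ℚ⟦X⟧) → Prop
  | mk {f D L} : OutF D f → (∀ t ∈ L, Atom.InRange n t) → Conn m L n → D + L.length ≤ W →
      Stage m n W fun xs => f xs.tail (xs.headD 0) * evalL L xs
  | zero : Stage m n W 0
  | add {f g} : Stage m n W f → Stage m n W g → Stage m n W (f + g)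
  | smul {f} (c : ℚ) : Stage m n W f → Stage m n W (c • f)
  | congr {f g} : (∀ xs, Incr n xs → f xs = g xs) → Stage m n W f → Stage m n W g

theorem lowSum_one (F : List ℕ → ℚ⟦X⟧) (xs) :
    lowSum 1 F xs = ∑ x ∈ Ioo 0 (xs.headD 0), F (x :: xs) := rfl

theorem Elim.lowSum_one {m : Bool} {n W D f} {g : List ℕ → ℕ → ℚ⟦X⟧} (hf : OutF D f)
    (hg : Elim m (n + 1) W g) : Stage m (n + 1) (D + W)
      (lowSum 1 fun xs => f xs.tail (xs.headD 0) * g xs.tail (xs.headD 0)) := by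
  induction hg with
  | mk h1 h2 h3 h4 =>
    refine .congr (fun xs hx => ?_) (.mk (hf.stage h1) h2 h3 (by omega))
    rw [Nested.lowSum_one]
    obtain ⟨x, xs, rfl⟩ : ∃ y ys, xs = y :: ys := by
      cases xs with
      | nil => simp [Incr] at hx
      | cons y ys => exact ⟨y, ys, rfl⟩
    simp only [List.tail_cons, List.headD_cons, sum_mul]
    exact sum_congr rfl fun y _ => by ring
  | zero =>
    refine .congr (fun xs _ => ?_) .zero
    simp [Nested.lowSum_one]
  | add _ _ h1 h2 =>
    refine .congr (fun xs _ => ?_) (h1.add h2)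
    simp [Nested.lowSum_one, mul_add, sum_add_distrib]
  | smul c _ h =>
    refine .congr (fun xs _ => ?_) (h.smul c)
    simp [Nested.lowSum_one, smul_sum]
  | congr h _ h' =>
    refine .congr (fun xs hx => ?_) h'
    rw [Nested.lowSum_one, Nested.lowSum_one]
    refine sum_congr rfl fun x hx' => ?_
    rw [mem_Ioo] at hx'
    cases xs with
    | nil => simp [Incr] at hx
    | cons y ys => rw [List.headD_cons, List.tail_cons, h _ _ (hx.cons hx'.1 hx'.2)]

/-- One round of the elimination: the edges at the smallest vertex become a letter by `elim_evalL`,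
and `OutF.stage` sums the result over this vertex. The weight does not grow. -/
theorem Stage.lowSum_one {m : Bool} {n W F} (hF : Stage m (n + 2) W F) :
    Stage m (n + 1) W (lowSum 1 F) := by
  induction hF with
  | @mk f D L h1 h2 h3 h4 =>
    have h5 := (elim_evalL h2 h3 fun _ => Nat.succ_pos n).lowSum_one h1
    have h6 : ∀ W', W' ≤ W → ∀ {G}, Stage m (n + 1) W' G → Stage m (n + 1) W G := by
      intro W' hW G hG
      induction hG with
      | mk k1 k2 k3 k4 => exact .mk k1 k2 k3 (k4.trans hW)
      | zero => exact .zero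
      | add _ _ h1 h2 => exact h1.add h2
      | smul c _ h => exact h.smul c
      | congr h _ h' => exact h'.congr h
    refine .congr (fun xs _ => ?_) (h6 _ h4 h5)
    rw [Nested.lowSum_one, Nested.lowSum_one]
    rfl
  | zero =>
    refine .congr (fun xs _ => ?_) .zero
    simp [Nested.lowSum_one]
  | add _ _ h1 h2 =>
    refine .congr (fun xs _ => ?_) (h1.add h2)
    simp [Nested.lowSum_one, sum_add_distrib]
  | smul c _ h =>
    refine .congr (fun xs _ => ?_) (h.smul c)
    simp [Nested.lowSum_one, smul_sum]
  | congr h _ h' =>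
    refine .congr (fun xs hx => ?_) h'
    rw [Nested.lowSum_one, Nested.lowSum_one]
    refine sum_congr rfl fun x hx' => ?_
    rw [mem_Ioo] at hx'
    cases xs with
    | nil => simp [Incr] at hx
    | cons y ys => exact h _ (hx.cons hx'.1 hx'.2)

theorem Stage.lowSum {m : Bool} {n W F} (hF : Stage m (n + 1) W F) :
    Stage m 1 W (lowSum n F) := by
  induction n generalizing F with
  | zero => exact hF
  | succ n ih =>
    refine .congr (fun xs _ => (lowSum_succ _ _ _).symm) (ih hF.lowSum_one)

theorem EndSum.mono {m W W' f} (h : W ≤ W') (hf : EndSum m W f) : EndSum m W' f := by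
  obtain ⟨g, h1, h2⟩ := hf
  refine ⟨g, span_mono ?_ h1, h2⟩
  rintro _ ⟨a, r, w, h', rfl⟩
  exact ⟨a, r, w, h'.trans h, rfl⟩

theorem EndSum.zero {m W} : EndSum m W 0 := ⟨0, zero_mem _, fun _ _ => rfl⟩

theorem evalL_empty (L : List Atom) : ∃ c : ℚ, evalL L [] = c • 1 := by
  induction L with
  | nil => exact ⟨1, by simp⟩
  | cons t L ih =>
    obtain ⟨c, hc⟩ := ih
    have h : ∀ a, pos [] a = 0 := by rintro (_ | a) <;> rfl
    rcases t with ⟨a, b⟩ | ⟨a, b⟩ | a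
    · exact ⟨0, by simp [Atom.val, h, ttDist]⟩
    · exact ⟨c, by simp [Atom.val, hc]⟩
    · exact ⟨0, by simp [Atom.val, h]⟩

theorem incr_singleton {z : ℕ} (hz : 0 < z) : Incr 1 [z] := ⟨rfl, by simpa using hz⟩

/-- Connectedness gives the last vertex an edge to 0, real or virtual, and this edge pays for the
summation over that vertex; hence the index 1. -/
theorem Stage.endSum {W F} (hF : Stage false 1 W F) : EndSum 1 W fun z => F [z] := by
  induction hF with
  | @mk f D L h1 h2 h3 h4 =>
    have h5 := elim_evalL (n := 0) h2 h3 (by simp)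
    have h6 : ∀ {W'} {g : List ℕ → ℕ → ℚ⟦X⟧}, Elim false 0 W' g →
        EndSum 1 (D + W') fun z => f [] z * g [] z := by
      intro W' g hg
      induction hg with
      | @mk φ d L k1 k2 k3 k4 =>
        obtain ⟨c, hc⟩ := evalL_empty L
        refine (((OutF.endSum k1 h1).smul c).mono (by omega)).congr fun z _ => ?_
        simp only [Pi.smul_apply, hc, mul_smul_comm, mul_one, mul_comm]
      | zero => exact EndSum.zero.congr fun _ _ => by simp
      | add _ _ h1 h2 => exact (h1.add h2).congr fun _ _ => by simp [mul_add]
      | smul c _ h => exact (h.smul c).congr fun _ _ => by simp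
      | congr h _ h' => exact h'.congr fun z hz => by rw [h _ _ (incr_singleton hz)]
    exact ((h6 h5).mono (by omega)).congr fun z _ => rfl
  | zero => exact EndSum.zero.congr fun _ _ => by simp
  | add _ _ h1 h2 => exact (h1.add h2).congr fun _ _ => by simp
  | smul c _ h => exact (h.smul c).congr fun _ _ => by simp
  | congr h _ h' => exact h'.congr fun z hz => (h _ (incr_singleton hz)).symm

theorem evalL_singleton (L : List Atom) (hL : ∀ t ∈ L, Atom.InRange 1 t) :
    ∃ φ ∈ coefFam L.length, ∀ z, evalL L [z] = φ [] z := by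
  induction L with
  | nil => exact ⟨1, one_mem_coefFam, fun _ => by simp⟩
  | cons t L ih =>
    obtain ⟨φ, h1, h2⟩ := ih fun t ht => hL t (mem_cons_of_mem _ ht)
    have key : ∀ ψ ∈ coefFam 1, (∀ z, t.val [z] = ψ [] z) →
        ∃ φ ∈ coefFam (t :: L).length, ∀ z, evalL (t :: L) [z] = φ [] z := fun ψ hψ he =>
      ⟨φ * ψ, coefFam_mul h1 hψ, fun z => by simp [he, h2, mul_comm]⟩
    have h0 : (0 : List ℕ → ℕ → ℚ⟦X⟧) ∈ coefFam 1 := zero_mem _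
    have ht := letterFam_le tt_mem_letterFam
    have ht' := hL t mem_cons_self
    rcases t with ⟨a, b⟩ | ⟨a, b⟩ | a
    · obtain ⟨ha, hb⟩ := ht'
      interval_cases a <;> interval_cases b
      · exact key _ h0 fun z => by simp [Atom.val, ttDist]
      · exact key _ ht fun z => by simp [Atom.val, ttDist, pos]
      · exact key _ ht fun z => by simp [Atom.val, ttDist, pos]
      · exact key _ h0 fun z => by simp [Atom.val, ttDist]
    · exact key _ (coefFam_mono (Nat.zero_le 1) one_mem_coefFam) fun z => rfl
    · have ha : a ≤ 1 := ht'
      interval_cases a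
      · exact key _ h0 fun z => by simp [Atom.val]
      · exact key _ nat_mem_coefFam fun z => by simp [Atom.val, pos]

/-- Here the separate factor t(1 + t) will pay for the last summation, so no edge is needed and the
index is 0. -/
theorem Stage.endSum_coef {m W F} (hF : Stage m 1 W F) : EndSum 0 W fun z => F [z] := by
  induction hF with
  | @mk f D L h1 h2 h3 h4 =>
    obtain ⟨φ, hφ, he⟩ := evalL_singleton L h2
    exact ((OutF.endSum_coef hφ h1).mono (by omega)).congr fun z _ => by
      simp [he, mul_comm]
  | zero => exact EndSum.zero.congr fun _ _ => by simp
  | add _ _ h1 h2 => exact (h1.add h2).congr fun _ _ => by simp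
  | smul c _ h => exact (h.smul c).congr fun _ _ => by simp
  | congr h _ h' => exact h'.congr fun z hz => (h _ (incr_singleton hz)).symm

theorem Stage.of_evalL {m : Bool} {n : ℕ} {L : List Atom} (hL : ∀ t ∈ L, Atom.InRange n t)
    (hc : Conn m L n) : Stage m n L.length (evalL L) :=
  .congr (fun xs _ => by simp) (.mk (.pure .one) hL hc (by simp))

theorem lowSum_dvd {n : ℕ} {F : List ℕ → ℚ⟦X⟧} {z : ℕ}
    (h : ∀ xs, Incr (n + 1) xs → xs.getLastD 0 = z → PowerSeries.X ^ z ∣ F xs) (hz : 0 < z) :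
    PowerSeries.X ^ z ∣ lowSum n F [z] := by
  have key : ∀ k l ys, Incr (l + 1) ys → ys.getLastD 0 = z →
      (∀ xs, Incr (l + 1 + k) xs → xs.getLastD 0 = z → PowerSeries.X ^ z ∣ F xs) →
      PowerSeries.X ^ z ∣ lowSum k F ys := by
    intro k
    induction k with
    | zero => exact fun l ys h1 h2 h3 => h3 ys h1 h2
    | succ k ih =>
      intro l ys h1 h2 h3
      rw [Nested.lowSum]
      refine Finset.dvd_sum fun x hx => ?_
      rw [mem_Ioo] at hx
      cases ys with
      | nil => simp [Incr] at h1
      | cons y ys =>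
        refine ih (l + 1) (x :: y :: ys) (h1.cons hx.1 hx.2) ?_ fun xs hxs => h3 xs ?_
        · simpa using h2
        · rwa [show l + 1 + (k + 1) = l + 1 + 1 + k by omega]
  exact key n 0 [z] (incr_singleton hz) rfl (by rwa [show 0 + 1 + n = n + 1 by omega])

/-- The sum over all chains of a product attached to a connected graph. -/
theorem fsum_lowSum_mem {n : ℕ} {L : List Atom} (hL : ∀ t ∈ L, Atom.InRange (n + 1) t)
    (hc : Conn false L (n + 1))
    (hX : ∀ xs, Incr (n + 1) xs → PowerSeries.X ^ xs.getLastD 0 ∣ evalL L xs) :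
    (fsum fun z => lowSum n (evalL L) [z]) ∈ BD L.length := by
  refine topFam_le _ (EndSum.fsum_mem (Stage.of_evalL hL hc).lowSum.endSum fun z => ?_)
  rcases Nat.eq_zero_or_pos z with rfl | hz
  · simp
  · exact lowSum_dvd (fun xs h1 h2 => h2 ▸ hX xs h1) hz

/-- The sum over all chains of a product attached to a graph which becomes connected when the
extreme vertices are joined. -/
theorem fsum_lowSum_kd_mem {n : ℕ} {L : List Atom} (hL : ∀ t ∈ L, Atom.InRange (n + 1) t)
    (hc : Conn true L (n + 1)) :
    (fsum fun z => tt z * (1 + tt z) * lowSum n (evalL L) [z]) ∈ qBD (L.length + 2) :=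
  qTopFam_le _ (Stage.of_evalL hL hc).lowSum.endSum_coef.fsum_kd_mem

/-! ### Sums over position functions -/

/-- The increasing lists of `k` positive integers below `y`. -/
def chains : ℕ → ℕ → Finset (List ℕ)
  | 0, _ => {[]}
  | k + 1, y => (Ioo 0 y).biUnion fun x => (chains k x).image (· ++ [x])

theorem mem_chains {k y : ℕ} {xs : List ℕ} :
    xs ∈ chains k y ↔ Incr k xs ∧ ∀ x ∈ xs, x < y := by
  induction k generalizing y xs with
  | zero =>
    simp only [chains, Finset.mem_singleton, Incr, List.length_eq_zero_iff]
    constructor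
    · rintro rfl; simp
    · exact fun h => h.1.1
  | succ k ih =>
    simp only [chains, Finset.mem_biUnion, mem_image, mem_Ioo, ih, Incr]
    constructor
    · rintro ⟨x, ⟨h0, hy⟩, ys, ⟨⟨h1, h2⟩, h3⟩, rfl⟩
      rw [pairwise_cons] at h2
      refine ⟨⟨by simp [h1], ?_⟩, ?_⟩
      · rw [pairwise_cons, List.pairwise_append]
        refine ⟨fun z hz => ?_, h2.2, by simp, by simpa using h3⟩
        rcases mem_append.1 hz with hz | hz
        · exact h2.1 z hz
        · rw [List.mem_singleton] at hz; omega
      · intro z hz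
        rcases mem_append.1 hz with hz | hz
        · exact (h3 z hz).trans hy
        · rw [List.mem_singleton] at hz; omega
    · rintro ⟨⟨h1, h2⟩, h3⟩
      obtain ⟨ys, x, rfl⟩ : ∃ ys x, xs = ys ++ [x] := by
        rcases List.eq_nil_or_concat xs with rfl | ⟨ys, x, h⟩
        · simp at h1
        · exact ⟨ys, x, by simpa using h⟩
      rw [pairwise_cons, List.pairwise_append] at h2
      refine ⟨x, ⟨h2.1 x (by simp), h3 x (by simp)⟩, ys, ⟨⟨by simpa using h1, ?_⟩, ?_⟩, rfl⟩
      · rw [pairwise_cons]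
        exact ⟨fun z hz => h2.1 z (by simp [hz]), h2.2.1⟩
      · intro z hz
        exact h2.2.2.2 z hz x (by simp)

theorem sum_chains_succ {M : Type*} [AddCommMonoid M] (k y : ℕ) (f : List ℕ → M) :
    ∑ xs ∈ chains (k + 1) y, f xs =
      ∑ x ∈ Ioo 0 y, ∑ xs ∈ chains k x, f (xs ++ [x]) := by
  rw [chains, Finset.sum_biUnion]
  · refine sum_congr rfl fun x _ => ?_
    rw [Finset.sum_image]
    intro a _ b _ h
    exact List.append_cancel_right h
  · intro a _ b _ hab
    rw [onFun, disjoint_left]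
    intro xs h1 h2
    rw [mem_image] at h1 h2
    obtain ⟨u, -, rfl⟩ := h1
    obtain ⟨v, -, hv⟩ := h2
    have := List.append_inj_right' hv rfl
    simp at this
    exact hab this.symm

theorem lowSum_eq_sum (k : ℕ) (F : List ℕ → ℚ⟦X⟧) (y : ℕ) (ys : List ℕ) :
    lowSum k F (y :: ys) = ∑ xs ∈ chains k y, F (xs ++ y :: ys) := by
  induction k generalizing y ys with
  | zero => simp [chains, lowSum]
  | succ k ih =>
    rw [sum_chains_succ, lowSum]
    refine sum_congr rfl fun x _ => ?_
    rw [ih]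
    exact sum_congr rfl fun xs _ => by simp

theorem coeff_fsum_lowSum (k : ℕ) (c : ℕ → ℚ⟦X⟧) (F : List ℕ → ℚ⟦X⟧) (n : ℕ) :
    coeff n (fsum fun z => c z * lowSum k F [z]) =
      ∑ xs ∈ chains (k + 1) (n + 1), coeff n (c (xs.getLastD 0) * F xs) := by
  rw [coeff_fsum, sum_chains_succ]
  refine sum_congr rfl fun z _ => ?_
  rw [lowSum_eq_sum, mul_sum, map_sum]
  exact sum_congr rfl fun xs _ => by simp

theorem pos_eq_getD (xs : List ℕ) (i : ℕ) : pos xs i = (0 :: xs).getD i 0 := by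
  cases i <;> rfl

open Classical in
/-- The rank functions onto an initial segment. -/
def ranks (ι : Type*) [Fintype ι] [DecidableEq ι] (k : ℕ) : Finset (ι → ℕ) :=
  (piFinset fun _ => range (k + 1)).filter fun r => ∀ j ∈ Icc 1 k, ∃ i, r i = j

theorem mem_ranks {ι : Type*} [Fintype ι] [DecidableEq ι] {k : ℕ} {r : ι → ℕ} :
    r ∈ ranks ι k ↔ (∀ i, r i ≤ k) ∧ ∀ j, 1 ≤ j → j ≤ k → ∃ i, r i = j := by
  simp [ranks, mem_Icc]

/-- Grouping position functions by their order type. -/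
theorem sum_positions {ι M : Type*} [Fintype ι] [DecidableEq ι] [AddCommMonoid M] {y : ℕ}
    (hy : 0 < y) (Φ : (ι → ℕ) → M) :
    ∑ P ∈ piFinset (fun _ : ι => range y), Φ P =
      ∑ k ∈ range (card ι + 1), ∑ r ∈ ranks ι k, ∑ xs ∈ chains k y,
        Φ fun i => pos xs (r i) := by
  simp_rw [← Finset.sum_product']
  rw [Finset.sum_sigma']
  symm
  -- The nonzero values of P, sorted, form the chain; the rank of a point is the place of its value
  -- in this list with 0 put in front.
  let s : (ι → ℕ) → Finset ℕ := fun P => (univ.image P).erase 0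
  have hs : ∀ P, (0 :: (s P).sort (· ≤ ·)).Pairwise (· < ·) := by
    intro P
    rw [pairwise_cons]
    refine ⟨fun z hz => ?_, Finset.sortedLT_sort _ |>.pairwise⟩
    rw [mem_sort] at hz
    exact Nat.pos_of_ne_zero (Finset.ne_of_mem_erase hz)
  have hmem : ∀ P i, P i ∈ 0 :: (s P).sort (· ≤ ·) := by
    intro P i
    rw [mem_cons, mem_sort]
    by_cases h : P i = 0
    · exact .inl h
    · exact .inr (mem_erase.2 ⟨h, mem_image_of_mem _ (mem_univ _)⟩)
  refine Finset.sum_bij' (fun a _ => fun i => pos a.2.2 (a.2.1 i))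
    (fun P _ => ⟨(s P).card, fun i => (0 :: (s P).sort (· ≤ ·)).idxOf (P i),
      (s P).sort (· ≤ ·)⟩) ?_ ?_ ?_ ?_ ?_
  · rintro ⟨k, r, xs⟩ h
    simp only [mem_sigma, mem_product, mem_ranks, mem_chains] at h
    rw [mem_piFinset]
    intro i
    rw [mem_range, pos_eq_getD, getD_eq_getElem _ _ (by
      have := h.2.1.1 i; have := h.2.2.1.1; simp; omega)]
    rcases mem_cons.1 (getElem_mem _) with h' | h'
    · rw [h']; exact hy
    · exact h.2.2.2 _ h'
  · intro P hP
    rw [mem_piFinset] at hP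
    simp only [mem_sigma, mem_product, mem_ranks, mem_chains, mem_range]
    refine ⟨?_, ⟨fun i => ?_, fun j h1 h2 => ?_⟩, ⟨by simp, hs P⟩, ?_⟩
    · have := (Finset.card_le_card (Finset.erase_subset 0 (univ.image P))).trans
        card_image_le
      rw [card_univ] at this
      exact lt_succ_of_le this
    · have := List.idxOf_lt_length_of_mem (hmem P i)
      rw [length_cons, Finset.length_sort] at this
      omega
    · have hj : j < (0 :: (s P).sort (· ≤ ·)).length := by simp; omega
      have h3 : (0 :: (s P).sort (· ≤ ·))[j] ∈ (s P).sort (· ≤ ·) := by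
        obtain ⟨j, rfl⟩ : ∃ l, j = l + 1 := ⟨j - 1, by omega⟩
        rw [List.getElem_cons_succ]; exact getElem_mem _
      rw [mem_sort] at h3
      obtain ⟨i, -, hi⟩ := mem_image.1 (Finset.mem_of_mem_erase h3)
      refine ⟨i, ?_⟩
      rw [hi]
      exact List.Nodup.idxOf_getElem ((hs P).imp fun h => h.ne) j hj
    · intro x hx
      rw [mem_sort] at hx
      obtain ⟨i, -, rfl⟩ := mem_image.1 (Finset.mem_of_mem_erase hx)
      exact mem_range.1 (hP i)
  · rintro ⟨k, r, xs⟩ h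
    simp only [mem_sigma, mem_product, mem_ranks, mem_chains] at h
    obtain ⟨-, ⟨h1, h2⟩, ⟨h3, h4⟩, h5⟩ := h
    have e1 : s (fun i => pos xs (r i)) = xs.toFinset := by
      ext z
      simp only [s, mem_erase, mem_image, mem_univ, true_and,
        List.mem_toFinset]
      constructor
      · rintro ⟨hz, i, rfl⟩
        rw [pos_eq_getD, getD_eq_getElem _ _ (by have := h1 i; simp; omega)] at hz ⊢
        rcases mem_cons.1 (getElem_mem (l := 0 :: xs) (n := r i)
          (by have := h1 i; simp; omega)) with h' | h'
        · exact absurd h' hz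
        · exact h'
      · intro hz
        rw [pairwise_cons] at h4
        refine ⟨(h4.1 z hz).ne', ?_⟩
        obtain ⟨j, hj, rfl⟩ := List.getElem_of_mem hz
        obtain ⟨i, hi⟩ := h2 (j + 1) (by omega) (by omega)
        refine ⟨i, ?_⟩
        rw [hi, pos, getD_eq_getElem _ _ hj]
    have e2 : xs.toFinset.sort (· ≤ ·) = xs := by
      have h6 := pairwise_cons.1 h4
      refine List.Perm.eq_of_pairwise (le := (· < ·)) ?_ (Finset.sortedLT_sort _ |>.pairwise) h6.2 ?_
      · intro a b _ _ h h'; omega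
      · rw [← Multiset.coe_eq_coe, Finset.sort_eq]
        exact congrArg _ (List.dedup_eq_self.2 (h6.2.imp fun h => h.ne))
    have e3 : xs.toFinset.card = k := by
      rw [← Finset.length_sort (· ≤ ·), e2, h3]
    simp only [e1, e2, e3]
    congr 2
    ext i
    have hi : r i < (0 :: xs).length := by have := h1 i; simp; omega
    rw [pos_eq_getD, getD_eq_getElem _ _ hi]
    exact List.Nodup.idxOf_getElem (h4.imp fun h => h.ne) _ hi
  · intro P hP
    ext i
    have hi := List.idxOf_lt_length_of_mem (hmem P i)
    simp only []
    rw [pos_eq_getD, getD_eq_getElem _ _ hi, List.getElem_idxOf hi]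
  · intro a _; rfl

/-! ### Products attached to arcs between positions -/

/-- The value of `tt` at an integer, with `tt (-m) = -1 - tt m`. -/
def ttZ (m : ℤ) : ℚ⟦X⟧ := if 0 ≤ m then tt m.toNat else -1 - tt (-m).toNat

/-- Combinations of products of atoms with a given property. -/
inductive Comb (Q : List Atom → Prop) (k W : ℕ) : (List ℕ → ℚ⟦X⟧) → Prop
  | mk {L} : Q L → (∀ t ∈ L, Atom.InRange k t) → L.length ≤ W → Comb Q k W (evalL L)
  | zero : Comb Q k W 0
  | add {f g} : Comb Q k W f → Comb Q k W g → Comb Q k W (f + g)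
  | smul {f} (c : ℚ) : Comb Q k W f → Comb Q k W (c • f)
  | congr {f g} : (∀ xs, Incr k xs → f xs = g xs) → Comb Q k W f → Comb Q k W g

theorem Comb.mono {Q Q' : List Atom → Prop} {k W W' f} (hW : W ≤ W') (hQ : ∀ L, Q L → Q' L)
    (h : Comb Q k W f) : Comb Q' k W' f := by
  induction h with
  | mk h1 h2 h3 => exact .mk (hQ _ h1) h2 (h3.trans hW)
  | zero => exact .zero
  | add _ _ h1 h2 => exact h1.add h2
  | smul c _ h => exact h.smul c
  | congr h _ h' => exact h'.congr h

theorem Comb.mul {Q Q' Q'' : List Atom → Prop} {k W W' f g}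
    (hQ : ∀ L L', Q L → Q' L' → Q'' (L ++ L')) (hf : Comb Q k W f) (hg : Comb Q' k W' g) :
    Comb Q'' k (W + W') (f * g) := by
  induction hf with
  | @mk L h1 h2 h3 =>
    induction hg with
    | @mk L' k1 k2 k3 =>
      refine .congr (fun xs _ => evalL_append L L' xs) (.mk (hQ _ _ h1 k1) ?_ ?_)
      · intro t ht
        rcases mem_append.1 ht with h | h
        · exact h2 t h
        · exact k2 t h
      · rw [List.length_append]; omega
    | zero => rw [mul_zero]; exact .zero
    | add _ _ h1 h2 => rw [mul_add]; exact h1.add h2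
    | smul c _ h => rw [mul_smul_comm]; exact h.smul c
    | congr h _ h' => exact h'.congr fun xs hx => by simp [h xs hx]
  | zero => rw [zero_mul]; exact .zero
  | add _ _ h1 h2 => rw [add_mul]; exact h1.add h2
  | smul c _ h => rw [smul_mul_assoc]; exact h.smul c
  | congr h _ h' => exact h'.congr fun xs hx => by simp [h xs hx]

theorem Comb.sum {ι : Type*} {Q : List Atom → Prop} {k W} (s : Finset ι) {f : ι → List ℕ → ℚ⟦X⟧}
    (h : ∀ i ∈ s, Comb Q k W (f i)) : Comb Q k W (∑ i ∈ s, f i) := by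
  classical
  induction s using Finset.induction_on with
  | empty => exact .zero
  | insert a s ha ih =>
    rw [sum_insert ha]
    exact (h a (mem_insert_self _ _)).add
      (ih fun i hi => h i (Finset.mem_insert_of_mem hi))

theorem Comb.prod {ι : Type*} {Q : ι → List Atom → Prop} {k} (s : Finset ι) {W : ι → ℕ}
    {f : ι → List ℕ → ℚ⟦X⟧} (hQ : ∀ i L L', L ⊆ L' → Q i L → Q i L')
    (h : ∀ i ∈ s, Comb (Q i) k (W i) (f i)) :
    Comb (fun L => ∀ i ∈ s, Q i L) k (∑ i ∈ s, W i) (∏ i ∈ s, f i) := by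
  classical
  induction s using Finset.induction_on with
  | empty => exact .mk (L := []) (by simp) (by simp) (by simp)
  | insert a s ha ih =>
    rw [Finset.prod_insert ha, sum_insert ha]
    refine Comb.mul ?_ (h a (mem_insert_self _ _))
      (ih fun i hi => h i (Finset.mem_insert_of_mem hi))
    intro L L' h1 h2 i hi
    rcases Finset.mem_insert.1 hi with rfl | hi
    · exact hQ _ _ _ (by simp) h1
    · exact hQ _ _ _ (by simp) (h2 i hi)

theorem evalL_replicate (j : ℕ) (t : Atom) (xs) : evalL (replicate j t) xs = t.val xs ^ j := by
  simp [evalL]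

theorem ttZ_sub_of_le {a b : ℕ} (h : b ≤ a) : ttZ ((a : ℤ) - b) = ttDist a b := by
  rw [ttZ, if_pos (by omega), ttDist_comm, ttDist_of_le h]
  congr 1; omega

theorem ttZ_sub_of_lt {a b : ℕ} (h : a < b) : ttZ ((a : ℤ) - b) = -1 - ttDist a b := by
  rw [ttZ, if_neg (by omega), ttDist_of_le h.le]
  congr 2; omega

/-- A polynomial in the value of an arc, as a polynomial in the length of the arc. -/
theorem exists_aeval_ttZ {k a b : ℕ} (ha : a ≤ k) (hb : b ≤ k) (hab : a ≠ b) (g : ℚ[X]) :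
    ∃ g' : ℚ[X], g'.natDegree ≤ g.natDegree ∧ (b < a → g' = g) ∧ ∀ xs, Incr k xs →
      aeval (ttZ ((pos xs a : ℤ) - pos xs b)) g =
        aeval (ttDist (pos xs a) (pos xs b)) g' := by
  rcases Nat.lt_or_gt_of_ne hab with h | h
  · refine ⟨g.comp (-1 - X), ?_, fun h' => by omega, fun xs hx => ?_⟩
    · refine natDegree_comp_le.trans ?_
      have : (-1 - X : ℚ[X]).natDegree ≤ 1 := by
        refine (Polynomial.natDegree_sub_le _ _).trans ?_
        simp
      calc g.natDegree * _ ≤ g.natDegree * 1 := Nat.mul_le_mul_left _ this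
        _ = _ := mul_one _
    · rw [ttZ_sub_of_lt (hx.pos_lt h hb), Polynomial.aeval_comp]
      simp
  · exact ⟨g, le_rfl, fun _ => rfl, fun xs hx => by rw [ttZ_sub_of_le (hx.pos_lt h ha).le]⟩

theorem comb_aeval_ttDist {Q : List Atom → Prop} {k a b d : ℕ} {g : ℚ[X]}
    (hd : g.natDegree ≤ d) (h : ∀ j ≤ d, g.coeff j ≠ 0 → Comb Q k d (fun xs =>
      ttDist (pos xs a) (pos xs b) ^ j)) :
    Comb Q k d fun xs => aeval (ttDist (pos xs a) (pos xs b)) g := by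
  refine .congr (fun xs _ => ?_) (Comb.sum (range (d + 1)) (f := fun j =>
    g.coeff j • fun xs => ttDist (pos xs a) (pos xs b) ^ j) fun j hj => ?_)
  · rw [Polynomial.aeval_eq_sum_range' (lt_succ_of_le hd)]
    simp
  · by_cases h0 : g.coeff j = 0
    · rw [h0, zero_smul]; exact .zero
    · exact (h j (by simpa [Nat.lt_succ_iff] using hj) h0).smul _

/-- The property of a list to link two vertices. -/
def Links (a b : ℕ) (L : List Atom) : Prop :=
  ∀ f : ℕ → ℕ, (∀ t ∈ L, t.Flat f) → f a = f b

theorem links_of_mem {a b : ℕ} {L : List Atom} (h : Atom.real a b ∈ L ∨ Atom.virt a b ∈ L) :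
    Links a b L := by
  intro f hf
  rcases h with h | h
  · exact hf _ h
  · exact hf _ h

theorem Links.mono {a b : ℕ} {L L' : List Atom} (h : L ⊆ L') (hL : Links a b L) : Links a b L' :=
  fun f hf => hL f fun t ht => hf t (h ht)

/-- If b < a, the argument is the distance itself, and since X divides g every monomial contains a
real edge. If a < b, the substitution t ↦ -1 - t may create a constant term; it is kept as a virtual
edge, which fits because a nonzero g has degree at least 1. -/
theorem comb_arc {k a b : ℕ} (ha : a ≤ k) (hb : b ≤ k) (hab : a ≠ b) {g : ℚ[X]}
    (hg : X ∣ g) :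
    Comb (fun L => Links a b L ∧ (b < a → Atom.real a b ∈ L)) k g.natDegree
      fun xs => aeval (ttZ ((pos xs a : ℤ) - pos xs b)) g := by
  by_cases h0 : g = 0
  · subst h0; exact .congr (fun xs _ => by simp) .zero
  have hd : 1 ≤ g.natDegree := by
    obtain ⟨h, rfl⟩ := hg
    rw [natDegree_mul X_ne_zero (right_ne_zero_of_mul h0)]
    simp
  obtain ⟨g', h1, h2, h3⟩ := exists_aeval_ttZ ha hb hab g
  refine .congr (fun xs hx => (h3 xs hx).symm) (comb_aeval_ttDist h1 fun j hj hj0 => ?_)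
  rcases Nat.eq_zero_or_pos j with rfl | hj1
  · refine .congr (fun xs hx => ?_) (.mk (L := [.virt a b]) ⟨links_of_mem (by simp), ?_⟩ ?_ ?_)
    · simp [Atom.val]
    · intro h
      exfalso
      rw [h2 h, ← Polynomial.X_dvd_iff.1 hg] at hj0
      exact hj0 rfl
    · simpa using ⟨ha, hb⟩
    · simpa using hd
  · have hm : Atom.real a b ∈ replicate j (Atom.real a b) := by simp; omega
    refine .congr (fun xs hx => ?_) (.mk (L := replicate j (.real a b))
      ⟨links_of_mem (.inl hm), fun _ => hm⟩ ?_ ?_)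
    · rw [evalL_replicate]; rfl
    · intro t ht
      rw [List.eq_of_mem_replicate ht]; exact ⟨ha, hb⟩
    · simpa using hj

/-! ### Divisibility -/

theorem X_pow_dvd_tt (m : ℕ) : PowerSeries.X ^ m ∣ tt m := by
  rw [← polySer_one]; exact X_pow_dvd_polySer _ _

/-- A real edge is divisible by q to its length. Every gap between neighbouring places of the chain
is charged to one edge that covers it, and the gaps charged to an edge add up to at most its length.
-/
theorem X_pow_dvd_of_cover {k : ℕ} {L : List Atom} {xs : List ℕ} (hx : Incr k xs)
    (hL : ∀ t ∈ L, Atom.InRange k t)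
    (hc : ∀ t, 1 ≤ t → t ≤ k → ∃ a b, Atom.real a b ∈ L ∧ b < t ∧ t ≤ a) :
    PowerSeries.X ^ pos xs k ∣ evalL L xs := by
  classical
  have htel : ∀ b a, b ≤ a → a ≤ k →
      ∑ t ∈ Ioc b a, (pos xs t - pos xs (t - 1)) = pos xs a - pos xs b := by
    intro b a hba
    induction a, hba using Nat.le_induction with
    | base => simp
    | succ a hba ih =>
      intro ha
      rw [← Finset.insert_Ioc_right_eq_Ioc_add_one (by omega), sum_insert (by simp),
        ih (by omega)]
      have h1 := hx.pos_lt (Nat.lt_succ_self a) ha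
      have h2 : pos xs b ≤ pos xs a := by
        rcases hba.lt_or_eq with h | rfl
        · exact (hx.pos_lt h (by omega)).le
        · exact le_rfl
      simp only [Nat.add_sub_cancel, Nat.succ_eq_add_one] at h1 ⊢
      omega
  have key : ∀ L : List Atom, (∀ t ∈ L, Atom.InRange k t) → ∀ I : Finset ℕ,
      (∀ t ∈ I, ∃ a b, Atom.real a b ∈ L ∧ b < t ∧ t ≤ a) →
      PowerSeries.X ^ (∑ t ∈ I, (pos xs t - pos xs (t - 1))) ∣ evalL L xs := by
    intro L
    induction L with
    | nil =>
      intro _ I hI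
      have : I = ∅ := Finset.eq_empty_of_forall_notMem fun t ht => by
        obtain ⟨a, b, h, -⟩ := hI t ht
        simp at h
      simp [this]
    | cons s L ih =>
      intro hL I hI
      have ih' := fun J => ih (fun t ht => hL t (mem_cons_of_mem _ ht)) J
      have hs := hL s mem_cons_self
      rw [evalL_cons]
      have other : (∀ a b, s ≠ .real a b) →
          PowerSeries.X ^ (∑ t ∈ I, (pos xs t - pos xs (t - 1))) ∣ s.val xs * evalL L xs := by
        intro h
        refine (ih' I fun t ht => ?_).mul_left _
        obtain ⟨a, b, h1, h2⟩ := hI t ht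
        rcases mem_cons.1 h1 with h1 | h1
        · exact absurd h1.symm (h a b)
        · exact ⟨a, b, h1, h2⟩
      cases s with
      | virt a b => exact other (by simp)
      | pos a => exact other (by simp)
      | real a b =>
        rw [← Finset.sum_filter_add_sum_filter_not I fun t => b < t ∧ t ≤ a, pow_add]
        refine mul_dvd_mul ?_ (ih' _ fun t ht => ?_)
        · rcases Nat.lt_or_ge b a with h | h
          · refine (pow_dvd_pow _ ?_).trans (X_pow_dvd_tt _)
            refine (Finset.sum_le_sum_of_subset (t := Ioc b a) fun t ht => ?_).trans ?_
            · simpa using (mem_filter.1 ht).2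
            · rw [htel b a h.le hs.1]
              exact Nat.le_add_right _ _
          · rw [Finset.filter_false_of_mem]
            · simp
            · intro t _ h'; omega
        · rw [mem_filter] at ht
          obtain ⟨a', b', h1, h2⟩ := hI t ht.1
          rcases mem_cons.1 h1 with h1 | h1
          · simp only [Atom.real.injEq] at h1
            obtain ⟨rfl, rfl⟩ := h1
            exact absurd h2 ht.2
          · exact ⟨a', b', h1, h2⟩
  have := key L hL (Ioc 0 k) fun t ht => by
    rw [mem_Ioc] at ht
    exact hc t (by omega) ht.2
  rwa [htel 0 k (Nat.zero_le _) le_rfl, pos_zero, Nat.sub_zero] at this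

/-! ### Sums over chains of combinations of products. -/

theorem chains_mono {k n y : ℕ} (h : n ≤ y) : chains k n ⊆ chains k y := fun xs hx => by
  rw [mem_chains] at hx ⊢
  exact ⟨hx.1, fun x hx' => (hx.2 x hx').trans_le h⟩

theorem Incr.getLastD {k : ℕ} {xs : List ℕ} (h : Incr k xs) : xs.getLastD 0 = pos xs k := by
  obtain ⟨rfl, h⟩ := h
  rcases List.eq_nil_or_concat xs with rfl | ⟨ys, x, rfl⟩
  · rfl
  · rw [List.concat_eq_append, List.length_append, List.length_singleton, pos]
    simp

theorem Incr.le_pos {k : ℕ} {xs : List ℕ} (h : Incr k xs) {x : ℕ} (hx : x ∈ xs) : x ≤ pos xs k := by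
  obtain ⟨j, hj, rfl⟩ := List.getElem_of_mem hx
  have h1 : xs[j] = pos xs (j + 1) := by rw [pos, getD_eq_getElem _ _ hj]
  have h2 := h.1
  rw [h1]
  rcases Nat.lt_or_ge (j + 1) k with h3 | h3
  · exact (h.pos_lt h3 le_rfl).le
  · rw [show k = j + 1 by omega]

/-- Terms that are divisible by the power given by the last vertex only contribute to a coefficient
when the last vertex is small. -/
theorem sum_chains_eq {k n y : ℕ} (hy : n < y) {F : List ℕ → ℚ⟦X⟧}
    (hF : ∀ xs, Incr k xs → PowerSeries.X ^ pos xs k ∣ F xs) :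
    ∑ xs ∈ chains k y, coeff n (F xs) =
      ∑ xs ∈ chains k (n + 1), coeff n (F xs) := by
  refine (sum_subset (chains_mono hy) fun xs h1 h2 => ?_).symm
  rw [mem_chains] at h1 h2
  refine X_pow_dvd_iff.1 (hF xs h1.1) n ?_
  by_contra h
  exact h2 ⟨h1.1, fun x hx => by have := h1.1.le_pos hx; omega⟩

theorem one_mem_BD (W : ℕ) : (1 : ℚ⟦X⟧) ∈ BD W :=
  topFam_le _ (brTop_mem (w := []) (Nat.zero_le _))

/-- The sum over all chains of a combination of products attached to connected graphs. -/
theorem Comb.sum_chains_mem {Q : List Atom → Prop} {k W F} (hF : Comb Q k W F)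
    (hQ : ∀ L, Q L → Conn false L k ∧
      ∀ t, 1 ≤ t → t ≤ k → ∃ a b, Atom.real a b ∈ L ∧ b < t ∧ t ≤ a) :
    ∃ f ∈ BD W, ∀ n y, n < y →
      ∑ xs ∈ chains k y, coeff n (F xs) = coeff n f := by
  induction hF with
  | @mk L h1 h2 h3 =>
    obtain ⟨h4, h5⟩ := hQ L h1
    have hX : ∀ xs, Incr k xs → PowerSeries.X ^ pos xs k ∣ evalL L xs :=
      fun xs hx => X_pow_dvd_of_cover hx h2 h5
    cases k with
    | zero =>
      obtain ⟨c, hc⟩ := evalL_empty L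
      exact ⟨c • 1, smul_mem _ _ (one_mem_BD W), fun n y _ => by simp [chains, hc]⟩
    | succ k =>
      refine ⟨fsum fun z => lowSum k (evalL L) [z], ?_, fun n y hn => ?_⟩
      · refine span_mono ?_ (fsum_lowSum_mem h2 h4 fun xs hx => ?_)
        · rintro _ ⟨l, s, r, k1, k2, rfl⟩
          exact ⟨l, s, r, k1, k2.trans h3, rfl⟩
        · rw [hx.getLastD]; exact hX xs hx
      · rw [sum_chains_eq hn hX]
        have := coeff_fsum_lowSum k (fun _ => 1) (evalL L) n
        simp only [one_mul] at this
        exact this.symm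
  | zero => exact ⟨0, zero_mem _, by simp⟩
  | add _ _ h1 h2 =>
    obtain ⟨f, k1, k2⟩ := h1
    obtain ⟨f', k1', k2'⟩ := h2
    exact ⟨f + f', add_mem k1 k1', fun n y h => by
      simp [sum_add_distrib, k2 n y h, k2' n y h]⟩
  | smul c _ h =>
    obtain ⟨f, k1, k2⟩ := h
    exact ⟨c • f, smul_mem _ c k1, fun n y h => by
      simp [← mul_sum, k2 n y h]⟩
  | congr h _ h' =>
    obtain ⟨f, k1, k2⟩ := h'
    refine ⟨f, k1, fun n y hn => ?_⟩
    rw [← k2 n y hn]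
    exact sum_congr rfl fun xs hx => by rw [h xs (mem_chains.1 hx).1]

/-! ### Conditions on the order type. -/

/-- A condition depending on the order type only. -/
def OrderInv {ι : Type*} (C : (ι → ℕ) → Prop) : Prop :=
  ∀ P P' : ι → ℕ, (∀ x y, P x < P y ↔ P' x < P' y) → (∀ x, P x = 0 ↔ P' x = 0) → C P → C P'

theorem Incr.pos_lt_iff {k : ℕ} {xs : List ℕ} (h : Incr k xs) {i j : ℕ} (hi : i ≤ k) (hj : j ≤ k) :
    pos xs i < pos xs j ↔ i < j := by
  constructor
  · intro h1
    by_contra h2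
    rcases (not_lt.1 h2).lt_or_eq with h3 | h3
    · exact absurd h1 (h.pos_lt h3 hi).not_gt
    · rw [h3] at h1; exact lt_irrefl _ h1
  · exact fun h1 => h.pos_lt h1 hj

theorem Incr.pos_eq_zero_iff {k : ℕ} {xs : List ℕ} (h : Incr k xs) {i : ℕ} (hi : i ≤ k) :
    pos xs i = 0 ↔ i = 0 := by
  rw [← not_iff_not, ← ne_eq, ← ne_eq, ← Nat.pos_iff_ne_zero, ← Nat.pos_iff_ne_zero]
  exact h.pos_lt_iff (Nat.zero_le _) hi

theorem OrderInv.iff {ι : Type*} {C : (ι → ℕ) → Prop} (hC : OrderInv C) {k : ℕ} {xs : List ℕ}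
    (hx : Incr k xs) {r : ι → ℕ} (hr : ∀ i, r i ≤ k) : C (fun i => pos xs (r i)) ↔ C r :=
  ⟨hC _ _ (fun x y => hx.pos_lt_iff (hr x) (hr y)) fun x => hx.pos_eq_zero_iff (hr x),
    hC _ _ (fun x y => (hx.pos_lt_iff (hr x) (hr y)).symm) fun x =>
      (hx.pos_eq_zero_iff (hr x)).symm⟩

open Classical in
/-- Grouping a conditional sum over position functions. -/
theorem sum_positions_cond {ι : Type*} [Fintype ι] {C : (ι → ℕ) → Prop}
    (hC : OrderInv C) (Φ : (ι → ℕ) → ℚ⟦X⟧) {S : Submodule ℚ ℚ⟦X⟧}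
    (h : ∀ k, ∀ r ∈ ranks ι k, C r → ∃ f ∈ S, ∀ n y, n < y →
      ∑ xs ∈ chains k y, coeff n (Φ fun i => pos xs (r i)) = coeff n f) :
    ∃ f ∈ S, ∀ n y, n < y → ∑ P ∈ piFinset (fun _ : ι => range y),
      (if C P then coeff n (Φ P) else 0) = coeff n f := by
  choose! f hf hf' using h
  refine ⟨∑ k ∈ range (card ι + 1), ∑ r ∈ ranks ι k, if C r then f k r else 0,
    ?_, fun n y hn => ?_⟩
  · refine sum_mem fun k _ => sum_mem fun r hr => ?_
    split_ifs with h
    · exact hf k r hr h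
    · exact zero_mem _
  · rw [sum_positions (by omega), map_sum]
    refine sum_congr rfl fun k _ => ?_
    rw [map_sum]
    refine sum_congr rfl fun r hr => ?_
    have h1 : ∀ xs ∈ chains k y, (C (fun i => pos xs (r i)) ↔ C r) := fun xs hx =>
      hC.iff (mem_chains.1 hx).1 (mem_ranks.1 hr).1
    split_ifs with h
    · rw [← hf' k r hr h n y hn]
      exact sum_congr rfl fun xs hx => by rw [if_pos ((h1 xs hx).2 h)]
    · rw [map_zero]
      exact sum_eq_zero fun xs hx => by rw [if_neg fun h' => h ((h1 xs hx).1 h')]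

/-- The product of the values of arcs. -/
def arcProd {ι J : Type*} [Fintype J] (a b : J → ι) (g : J → ℚ[X])
    (P : ι → ℕ) : ℚ⟦X⟧ := ∏ j, aeval (ttZ ((P (a j) : ℤ) - P (b j))) (g j)

/-- Virtual edges tie the given vertices to 0, at the price of one unit of weight each. -/
theorem comb_virt (k : ℕ) (s : Finset ℕ) (hs : ∀ v ∈ s, v ≤ k) :
    Comb (fun L => ∀ v ∈ s, Links 0 v L) k s.card 1 := by
  refine .congr (fun xs _ => ?_) (.mk (L := s.toList.map (Atom.virt 0)) (fun v hv => ?_) ?_ ?_)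
  · rw [evalL, map_map]
    refine List.prod_eq_one fun x hx => ?_
    obtain ⟨v, -, rfl⟩ := mem_map.1 hx
    rfl
  · exact links_of_mem (.inr (mem_map.2 ⟨v, Finset.mem_toList.2 hv, rfl⟩))
  · intro t ht
    obtain ⟨v, hv, rfl⟩ := mem_map.1 ht
    exact ⟨Nat.zero_le _, hs v (Finset.mem_toList.1 hv)⟩
  · simp

open Classical in
/-- Sums over position functions of products of arcs which cover everything. -/
theorem sum_arcProd_mem {ι J : Type*} [Fintype ι] [Fintype J] {C : (ι → ℕ) → Prop}
    (hC : OrderInv C) {o : ι} {a b : J → ι} {g : J → ℚ[X]} {S : Finset ι} {W : ℕ}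
    (h0 : ∀ P, C P → P o = 0) (hg : ∀ j, X ∣ g j)
    (hne : ∀ P, C P → ∀ j, P (a j) ≠ P (b j))
    (hconn : ∀ P, C P → ∀ f : ι → ℕ, (∀ x y, P x = P y → f x = f y) →
      (∀ j, f (a j) = f (b j)) → (∀ v ∈ S, f v = f o) → ∀ x, f x = f o)
    (hcov : ∀ P, C P → ∀ t, 1 ≤ t → (∃ x, t ≤ P x) → ∃ j, P (b j) < t ∧ t ≤ P (a j))
    (hW : ∀ P, C P → ∑ j, (g j).natDegree + (S.filter fun v => P v ≠ 0).card ≤ W) :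
    ∃ f ∈ BD W, ∀ n y, n < y → ∑ P ∈ piFinset (fun _ : ι => range y),
      (if C P then coeff n (arcProd a b g P) else 0) = coeff n f := by
  refine sum_positions_cond hC _ fun k r hr hCr => ?_
  rw [mem_ranks] at hr
  obtain ⟨hr1, hr2⟩ := hr
  have hr0 := h0 r hCr
  have c1 := Comb.prod univ (f := fun j xs =>
      aeval (ttZ ((pos xs (r (a j)) : ℤ) - pos xs (r (b j)))) (g j))
    (W := fun j => (g j).natDegree) (fun j L L' hL h => ⟨Links.mono hL h.1, fun h' => hL (h.2 h')⟩)
    fun j _ => comb_arc (hr1 (a j)) (hr1 (b j)) (hne r hCr j) (hg j)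
  -- Vertices already at place 0 need no virtual edge, which is why only nonzero places enter the
  -- weight.
  have c2 := comb_virt k ((S.filter fun v => r v ≠ 0).image r) (fun v hv => by
    obtain ⟨i, -, rfl⟩ := mem_image.1 hv
    exact hr1 i)
  have c3 := Comb.mul (Q'' := fun L => (∀ j, Links (r (a j)) (r (b j)) L ∧
      (r (b j) < r (a j) → Atom.real (r (a j)) (r (b j)) ∈ L)) ∧
      ∀ v ∈ (S.filter fun v => r v ≠ 0).image r, Links 0 v L)
    (fun L L' h1 h2 => ⟨fun j => ⟨Links.mono (by simp) (h1 j (mem_univ _)).1, fun h =>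
        List.mem_append_left _ ((h1 j (mem_univ _)).2 h)⟩,
      fun v hv => Links.mono (by simp) (h2 v hv)⟩) c1 c2
  have hle : ∑ j, (g j).natDegree + ((S.filter fun v => r v ≠ 0).image r).card ≤ W :=
    (Nat.add_le_add_left card_image_le _).trans (hW r hCr)
  have c4 := (c3.mono hle fun _ h => h).sum_chains_mem (fun L hL => ⟨?_, ?_⟩)
  · obtain ⟨f, hf, hf'⟩ := c4
    refine ⟨f, hf, fun n y hn => ?_⟩
    rw [← hf' n y hn]
    refine sum_congr rfl fun xs _ => ?_
    rw [mul_one, Finset.prod_apply]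
    rfl
  · intro f hf _ i hi
    have h1 := hconn r hCr (fun x => f (r x)) (fun x y h => by rw [h])
      (fun j => (hL.1 j).1 f hf) (fun v hv => by
        by_cases h : r v = 0
        · rw [h, hr0]
        · rw [hr0]
          exact (hL.2 _ (mem_image_of_mem _ (mem_filter.2 ⟨hv, h⟩)) f hf).symm)
    rcases Nat.eq_zero_or_pos i with rfl | hi0
    · rfl
    · obtain ⟨x, rfl⟩ := hr2 i hi0 hi
      rw [h1 x, hr0]
  · intro t ht1 ht2
    obtain ⟨x, hx⟩ := hr2 t ht1 ht2
    obtain ⟨j, h1, h2⟩ := hcov r hCr t ht1 ⟨x, hx.ge⟩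
    exact ⟨_, _, (hL.1 j).2 (by omega), h1, h2⟩

/-! ### Products of edges carrying `t * (1 + t)` -/

/-- The edge factor `t * (1 + t)`, where `t` is `tt` of the distance. -/
def kd (a b : ℕ) : ℚ⟦X⟧ := ttDist a b * (1 + ttDist a b)

theorem kd_comm (a b : ℕ) : kd a b = kd b a := by rw [kd, kd, ttDist_comm]

/-- The factor which is left when two adjacent edges are replaced by one edge. -/
def kdRho (m : Bool) (s t : ℚ⟦X⟧) : ℚ⟦X⟧ :=
  if m then (1 + s + t) ^ 2 else (s - t) ^ 2

/-- With x, y the short edges and z the long one, partial fractions read xy = z(1 + x + y), and also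
(1 + x)(1 + y) = (1 + z)(1 + x + y); their product is the first identity. The other two follow from
the same relation solved for x - z and y - z. -/
theorem kd_mul_kd_of_lt {a b c : ℕ} (h1 : a < b) (h2 : b < c) :
    kd a b * kd b c = kd a c * (1 + ttDist a b + ttDist b c) ^ 2 ∧
    kd a c * kd a b = kd b c * (ttDist a c - ttDist a b) ^ 2 ∧
    kd a c * kd b c = kd a b * (ttDist a c - ttDist b c) ^ 2 := by
  have h := tt_mul_tt (a := b - a) (b := c - b) (by omega) (by omega)
  simp only [kd, ttDist_of_le h1.le, ttDist_of_le h2.le, ttDist_of_le (h1.trans h2).le]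
  rw [show b - a + (c - b) = c - a by omega] at h
  generalize tt (b - a) = x at *
  generalize tt (c - b) = y at *
  generalize tt (c - a) = z at *
  -- `(1 + x) * (1 + y) = (1 + z) * (1 + x + y)`
  have h' : (1 + x) * (1 + y) = (1 + z) * (1 + x + y) := by linear_combination h
  have e1 : y * (x - z) = z * (1 + x) := by linear_combination h
  have e2 : (1 + y) * (x - z) = x * (1 + z) := by linear_combination h
  have e3 : x * (y - z) = z * (1 + y) := by linear_combination h
  have e4 : (1 + x) * (y - z) = y * (1 + z) := by linear_combination h
  refine ⟨?_, ?_, ?_⟩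
  · linear_combination (1 + x) * (1 + y) * h + z * (1 + x + y) * h'
  · linear_combination -(x * (1 + z)) * e1 - y * (x - z) * e2
  · linear_combination -(y * (1 + z)) * e3 - x * (y - z) * e4

/-- The order of the three places is fixed along all chains, and m records whether w lies between u
and v. -/
theorem exists_kd_mul_kd {k u w v : ℕ} (hu : u ≤ k) (hw : w ≤ k) (hv : v ≤ k) (h1 : u ≠ w)
    (h2 : w ≠ v) (h3 : u ≠ v) : ∃ m, ∀ xs, Incr k xs →
      kd (pos xs u) (pos xs w) * kd (pos xs w) (pos xs v) = kd (pos xs u) (pos xs v) *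
        kdRho m (ttDist (pos xs u) (pos xs w)) (ttDist (pos xs w) (pos xs v)) := by
  refine ⟨decide (u < w ∧ w < v ∨ v < w ∧ w < u), fun xs hx => ?_⟩
  rcases Nat.lt_or_gt_of_ne h1 with h1 | h1 <;> rcases Nat.lt_or_gt_of_ne h2 with h2 | h2 <;>
    rcases Nat.lt_or_gt_of_ne h3 with h3 | h3
  · obtain ⟨e1, e2, e3⟩ := kd_mul_kd_of_lt (hx.pos_lt h1 hw) (hx.pos_lt h2 hv)
    rw [kdRho, if_pos (by simp; omega)]
    linear_combination e1
  · omega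
  · obtain ⟨e1, e2, e3⟩ := kd_mul_kd_of_lt (hx.pos_lt h3 hv) (hx.pos_lt h2 hw)
    rw [kd_comm (pos xs w) (pos xs v),
      ttDist_comm (pos xs w) (pos xs v)]
    rw [kdRho, if_neg (by simp; omega)]
    linear_combination e3
  · obtain ⟨e1, e2, e3⟩ := kd_mul_kd_of_lt (hx.pos_lt h3 hu) (hx.pos_lt h1 hw)
    rw [kd_comm (pos xs w) (pos xs v), kd_comm (pos xs u) (pos xs v),
      ttDist_comm (pos xs w) (pos xs v)]
    rw [kdRho, if_neg (by simp; omega)]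
    linear_combination e3
  · obtain ⟨e1, e2, e3⟩ := kd_mul_kd_of_lt (hx.pos_lt h1 hu) (hx.pos_lt h3 hv)
    rw [kd_comm (pos xs u) (pos xs w),
      ttDist_comm (pos xs u) (pos xs w)]
    rw [kdRho, if_neg (by simp; omega)]
    linear_combination e2
  · obtain ⟨e1, e2, e3⟩ := kd_mul_kd_of_lt (hx.pos_lt h2 hv) (hx.pos_lt h3 hu)
    rw [kd_comm (pos xs u) (pos xs w), kd_comm (pos xs u) (pos xs v),
      ttDist_comm (pos xs u) (pos xs w)]
    rw [kdRho, if_neg (by simp; omega)]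
    linear_combination e2
  · omega
  · obtain ⟨e1, e2, e3⟩ := kd_mul_kd_of_lt (hx.pos_lt h2 hw) (hx.pos_lt h1 hu)
    rw [kd_comm (pos xs u) (pos xs w), kd_comm (pos xs w) (pos xs v), kd_comm (pos xs u) (pos xs v),
      ttDist_comm (pos xs u) (pos xs w), ttDist_comm (pos xs w) (pos xs v)]
    rw [kdRho, if_pos (by simp; omega)]
    linear_combination e1

theorem comb_kd {k u v : ℕ} (hu : u ≤ k) (hv : v ≤ k) :
    Comb (Links u v) k 2 fun xs => kd (pos xs u) (pos xs v) := by
  refine .congr (fun xs _ => ?_)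
    (.add (.mk (L := [.real u v, .virt u v]) (links_of_mem (by simp)) (by simp [Atom.InRange, hu, hv]) le_rfl)
      (.mk (L := [.real u v, .real u v]) (links_of_mem (by simp)) (by simp [Atom.InRange, hu, hv]) le_rfl))
  simp [kd, Atom.val]; ring

/-- Products over lists of edges. -/
def kdProd (A : List (ℕ × ℕ)) (xs : List ℕ) : ℚ⟦X⟧ :=
  (A.map fun e => kd (pos xs e.1) (pos xs e.2)).prod

theorem comb_kdProd {k : ℕ} (A : List (ℕ × ℕ)) (hA : ∀ e ∈ A, e.1 ≤ k ∧ e.2 ≤ k) :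
    Comb (fun L => ∀ e ∈ A, Links e.1 e.2 L) k (2 * A.length) (kdProd A) := by
  induction A with
  | nil => exact .congr (fun xs _ => by simp [kdProd]) (.mk (L := []) (by simp) (by simp) (by simp))
  | cons e A ih =>
    have he := hA e (by simp)
    refine .congr (fun xs _ => ?_) ((Comb.mul (Q'' := fun L => ∀ e' ∈ e :: A, Links e'.1 e'.2 L) ?_
      (comb_kd he.1 he.2) (ih fun e' h => hA e' (mem_cons_of_mem _ h))).mono ?_ fun _ h => h)
    · simp [kdProd]
    · intro L L' h1 h2 e' he'
      rcases mem_cons.1 he' with rfl | h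
      · exact h1.mono (by simp)
      · exact (h2 e' h).mono (by simp)
    · simp; omega

/-- Expanding the square gives products of two factors, each containing an edge at w, a virtual one
where the factor is 1. Any such edge ties w to u or to v, hence to both once u and v are joined. -/
theorem comb_kdRho {k u w v : ℕ} (hu : u ≤ k) (hw : w ≤ k) (hv : v ≤ k) (m : Bool) :
    Comb (fun L => ∀ f : ℕ → ℕ, (∀ t ∈ L, t.Flat f) → f u = f v → f u = f w) k 2
      fun xs => kdRho m (ttDist (pos xs u) (pos xs w)) (ttDist (pos xs w) (pos xs v)) := by
  have key : ∀ s t : Atom, (s = .real u w ∨ s = .virt u w ∨ s = .real w v ∨ s = .virt w v) →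
      t.InRange k →
      Comb (fun L => ∀ f : ℕ → ℕ, (∀ t ∈ L, t.Flat f) → f u = f v → f u = f w) k 2
        fun xs => s.val xs * t.val xs := by
    intro s t hs ht
    refine .congr (fun xs _ => ?_) (.mk (L := [s, t]) ?_ ?_ le_rfl)
    · simp
    · intro f hf h
      have := hf s (by simp)
      rcases hs with rfl | rfl | rfl | rfl <;> simp only [Atom.Flat] at this <;> omega
    · intro t' ht'
      rcases List.mem_pair.1 ht' with rfl | rfl
      · rcases hs with rfl | rfl | rfl | rfl <;> exact ⟨by assumption, by assumption⟩
      · exact ht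
  have r1 : (Atom.real u w).InRange k := ⟨hu, hw⟩
  have r2 : (Atom.virt u w).InRange k := ⟨hu, hw⟩
  have r3 : (Atom.real w v).InRange k := ⟨hw, hv⟩
  have k1 := key (.virt u w) (.virt u w) (by simp) r2
  have k2 := key (.real u w) (.virt u w) (by simp) r2
  have k3 := key (.real w v) (.virt u w) (by simp) r2
  have k4 := key (.real u w) (.real u w) (by simp) r1
  have k5 := key (.real u w) (.real w v) (by simp) r3
  have k6 := key (.real w v) (.real w v) (by simp) r3
  cases m with
  | true =>
    refine .congr (fun xs _ => ?_) (k1.add ((k2.smul 2).add ((k3.smul 2).add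
      (k4.add ((k5.smul 2).add k6)))))
    simp only [Pi.add_apply, Pi.smul_apply, Atom.val, kdRho, if_true]
    simp only [smul_def, map_ofNat]
    ring
  | false =>
    refine .congr (fun xs _ => ?_) (k4.add ((k5.smul (-2)).add k6))
    simp only [Pi.add_apply, Pi.smul_apply, Atom.val, kdRho, Bool.false_eq_true, if_false]
    simp only [smul_def, map_ofNat, map_neg]
    ring

/-- An edge out of `u` whose other end is linked to `v` by the edges that do not touch `u`. -/
theorem exists_edge {A : List (ℕ × ℕ)} {u v : ℕ} (huv : u ≠ v)
    (h : ∀ f : ℕ → ℕ, (∀ e ∈ A, f e.1 = f e.2) → f u = f v) :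
    ∃ w, w ≠ u ∧ ((u, w) ∈ A ∨ (w, u) ∈ A) ∧
      ∀ f : ℕ → ℕ, (∀ e ∈ A, e.1 ≠ u → e.2 ≠ u → f e.1 = f e.2) → f w = f v := by
  classical
  by_contra hcon
  push Not at hcon
  -- This is the component of v when all edges at u are deleted. If no edge from u led into it, its
  -- indicator would separate u from v.
  let κ : Set ℕ := {x | ∀ f : ℕ → ℕ, (∀ e ∈ A, e.1 ≠ u → e.2 ≠ u → f e.1 = f e.2) → f x = f v}
  have hu : u ∉ κ := fun hu => by
    have := hu (fun x => if x = u then 1 else 0) (fun e _ h1 h2 => by simp [h1, h2])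
    simp [huv.symm] at this
  have hA : ∀ w, ((u, w) ∈ A ∨ (w, u) ∈ A) → w ∉ κ := by
    intro w hw hwκ
    by_cases hwu : w = u
    · exact hu (hwu ▸ hwκ)
    · obtain ⟨f, h1, h2⟩ := hcon w hwu hw
      exact h2 (hwκ f h1)
  have := h (fun x => if x ∈ κ then 1 else 0) fun e he => by
    by_cases h1 : e.1 = u
    · have : e.2 ∉ κ := hA e.2 (.inl (by rw [← h1]; exact he))
      rw [if_neg this, if_neg (h1 ▸ hu)]
    by_cases h2 : e.2 = u
    · have : e.1 ∉ κ := hA e.1 (.inr (by rw [← h2]; exact he))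
      rw [if_neg this, if_neg (h2 ▸ hu)]
    have : e.1 ∈ κ ↔ e.2 ∈ κ :=
      ⟨fun h3 f hf => by rw [← h3 f hf, hf e he h1 h2], fun h3 f hf => by rw [← h3 f hf, hf e he h1 h2]⟩
    simp only [this]
  have hv : v ∈ κ := fun f _ => rfl
  simp [hu, hv] at this

theorem kdProd_append (A B : List (ℕ × ℕ)) (xs) : kdProd (A ++ B) xs = kdProd A xs * kdProd B xs := by
  simp [kdProd]

/-- If two vertices are linked by edges, then the edge between them may be split off. -/
theorem exists_kdProd {k : ℕ} (d : ℕ) (A : List (ℕ × ℕ)) (hd : A.length = d)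
    (hA : ∀ e ∈ A, e.1 ≤ k ∧ e.2 ≤ k)
    {u v : ℕ} (hu : u ≤ k) (hv : v ≤ k) (huv : u ≠ v)
    (h : ∀ f : ℕ → ℕ, (∀ e ∈ A, f e.1 = f e.2) → f u = f v) :
    ∃ F, Comb (fun L => ∀ f : ℕ → ℕ, (∀ t ∈ L, t.Flat f) → f u = f v → ∀ e ∈ A, f e.1 = f e.2)
        k (2 * d - 2) F ∧
      ∀ xs, Incr k xs → kdProd A xs = kd (pos xs u) (pos xs v) * F xs := by
  induction d generalizing A u v with
  | zero =>
    rw [List.length_eq_zero_iff] at hd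
    subst hd
    have := h (fun x => if x = u then 1 else 0) (by simp)
    simp [huv.symm] at this
  | succ d ih =>
    -- Remove an edge between u and w, split off the edge between w and v from the remaining ones by
    -- induction, and replace these two edges by the one between u and v times a square.
    obtain ⟨w, hwu, hw, hl⟩ := exists_edge huv h
    obtain ⟨e, heA, he⟩ : ∃ e ∈ A, e = (u, w) ∨ e = (w, u) := by
      rcases hw with hw | hw
      · exact ⟨_, hw, .inl rfl⟩
      · exact ⟨_, hw, .inr rfl⟩
    obtain ⟨A1, A2, rfl⟩ := List.append_of_mem heA
    have hwk : w ≤ k := by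
      rcases he with rfl | rfl
      · exact (hA _ heA).2
      · exact (hA _ heA).1
    have hlen : (A1 ++ A2).length = d := by simp at hd ⊢; omega
    have hA' : ∀ e ∈ A1 ++ A2, e.1 ≤ k ∧ e.2 ≤ k := fun e' h' => hA e' (by
      rcases mem_append.1 h' with h' | h' <;> simp [h'])
    have hprod : ∀ xs, kdProd (A1 ++ e :: A2) xs =
        kd (pos xs u) (pos xs w) * kdProd (A1 ++ A2) xs := by
      intro xs
      rw [kdProd_append, kdProd_append, ← List.singleton_append, kdProd_append]
      have : kdProd [e] xs = kd (pos xs u) (pos xs w) := by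
        rcases he with rfl | rfl
        · simp [kdProd]
        · simp [kdProd, kd_comm]
      rw [this]; ring
    have hflat : ∀ f : ℕ → ℕ, f u = f w → (∀ e ∈ A1 ++ A2, f e.1 = f e.2) →
        ∀ e' ∈ A1 ++ e :: A2, f e'.1 = f e'.2 := by
      intro f h1 h2 e' he'
      by_cases hee : e' = e
      · subst hee
        rcases he with rfl | rfl
        · exact h1
        · exact h1.symm
      · refine h2 e' ?_
        simp [hee] at he' ⊢
        exact he'
    by_cases hwv : w = v
    · subst hwv
      refine ⟨kdProd (A1 ++ A2), (comb_kdProd _ hA').mono (by omega) fun L hL f hf hfu => ?_,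
        fun xs _ => hprod xs⟩
      exact hflat f hfu fun e he => hL e he f hf
    · obtain ⟨F, hF, hF'⟩ := ih (A1 ++ A2) hlen hA' hwk hv hwv (fun f hf => hl f fun e' h1 h2 h3 => by
        refine hf e' ?_
        have : e' ≠ e := by
          rintro rfl
          rcases he with rfl | rfl
          · exact h2 rfl
          · exact h3 rfl
        simp [this] at h1 ⊢
        exact h1)
      obtain ⟨m, hm⟩ := exists_kd_mul_kd hu hwk hv hwu.symm hwv huv
      have hd0 : 0 < d := by
        rcases Nat.eq_zero_or_pos d with rfl | h0
        · rw [List.length_eq_zero_iff] at hlen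
          exfalso
          have := hl (fun x => if x = w then 1 else 0) (fun e' h1 h2 h3 => by
            exfalso
            have : e' ∈ A1 ++ A2 := by
              have : e' ≠ e := by
                rintro rfl
                rcases he with rfl | rfl
                · exact h2 rfl
                · exact h3 rfl
              simp [this] at h1 ⊢
              exact h1
            rw [hlen] at this
            simp at this)
          simp [Ne.symm hwv] at this
        · exact h0
      refine ⟨_, (Comb.mul (Q'' := fun L => ∀ f : ℕ → ℕ, (∀ t ∈ L, t.Flat f) → f u = f v →
        ∀ e' ∈ A1 ++ e :: A2, f e'.1 = f e'.2) ?_ (comb_kdRho hu hwk hv m) hF).mono (by omega)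
        fun _ h => h, fun xs hx => ?_⟩
      · intro L L' h1 h2 f hf hfu
        have h3 := h1 f (fun t ht => hf t (List.mem_append_left _ ht)) hfu
        exact hflat f h3 (h2 f (fun t ht => hf t (List.mem_append_right _ ht)) (by rw [← h3, hfu]))
      · rw [hprod, hF' xs hx, ← mul_assoc, hm xs hx, Pi.mul_apply]
        ring

theorem one_mem_qBD (W : ℕ) : (1 : ℚ⟦X⟧) ∈ qBD W :=
  qTopFam_le _ (subset_span ⟨[], Nat.zero_le _, by simp, rfl⟩)

/-- The sum over all chains of a combination of products attached to graphs that become connected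
when the extreme vertices are joined by an edge with factor `t * (1 + t)`. -/
theorem Comb.sum_chains_kd_mem {Q : List Atom → Prop} {k W F} (hF : Comb Q (k + 1) W F)
    (hQ : ∀ L, Q L → Conn true L (k + 1)) :
    ∃ f ∈ qBD (W + 2), ∀ n y, n < y → ∑ xs ∈ chains (k + 1) y,
      coeff n (kd 0 (pos xs (k + 1)) * F xs) = coeff n f := by
  induction hF with
  | @mk L h1 h2 h3 =>
    refine ⟨fsum fun z => tt z * (1 + tt z) * lowSum k (evalL L) [z], ?_, fun n y hn => ?_⟩
    · refine span_mono ?_ (fsum_lowSum_kd_mem h2 (hQ L h1))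
      rintro _ ⟨l, s, r, k1, k2, k3, rfl⟩
      exact ⟨l, s, r, k1, k2, k3.trans (by omega), rfl⟩
    · have hX : ∀ xs, Incr (k + 1) xs →
          PowerSeries.X ^ pos xs (k + 1) ∣ kd 0 (pos xs (k + 1)) * evalL L xs := by
        intro xs _
        rw [kd, ttDist_of_le (Nat.zero_le _), Nat.sub_zero, mul_assoc]
        exact (X_pow_dvd_tt _).mul_right _
      rw [sum_chains_eq hn hX, coeff_fsum_lowSum]
      refine sum_congr rfl fun xs hxs => ?_
      rw [(mem_chains.1 hxs).1.getLastD, kd, ttDist_of_le (Nat.zero_le _), Nat.sub_zero]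
  | zero => exact ⟨0, zero_mem _, by simp⟩
  | add _ _ h1 h2 =>
    obtain ⟨f, k1, k2⟩ := h1
    obtain ⟨f', k1', k2'⟩ := h2
    exact ⟨f + f', add_mem k1 k1', fun n y h => by
      simp [sum_add_distrib, mul_add, k2 n y h, k2' n y h]⟩
  | smul c _ h =>
    obtain ⟨f, k1, k2⟩ := h
    exact ⟨c • f, smul_mem _ c k1, fun n y h => by
      simp [← mul_sum, k2 n y h]⟩
  | congr h _ h' =>
    obtain ⟨f, k1, k2⟩ := h'
    refine ⟨f, k1, fun n y hn => ?_⟩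
    rw [← k2 n y hn]
    exact sum_congr rfl fun xs hx => by rw [h xs (mem_chains.1 hx).1]

theorem comb_aeval_ttZ {k a b : ℕ} (ha : a ≤ k) (hb : b ≤ k) (hab : a ≠ b) (g : ℚ[X]) :
    Comb (fun _ => True) k g.natDegree
      fun xs => aeval (ttZ ((pos xs a : ℤ) - pos xs b)) g := by
  obtain ⟨g', h1, -, h3⟩ := exists_aeval_ttZ ha hb hab g
  refine .congr (fun xs hx => (h3 xs hx).symm) (comb_aeval_ttDist h1 fun j hj _ => ?_)
  refine .congr (fun xs hx => ?_) (.mk (L := replicate j (.real a b)) trivial ?_ ?_)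
  · rw [evalL_replicate]; rfl
  · intro t ht
    rw [List.eq_of_mem_replicate ht]; exact ⟨ha, hb⟩
  · simpa using hj

/-- The map t ↦ -1 - t preserves t(1 + t), so the direction of an arc does not matter. -/
theorem ttZ_mul_one_add_ttZ (a b : ℕ) :
    ttZ ((a : ℤ) - b) * (1 + ttZ ((a : ℤ) - b)) = kd a b := by
  rcases Nat.lt_or_ge a b with h | h
  · rw [ttZ_sub_of_lt h, kd]; ring
  · rw [ttZ_sub_of_le h, kd]

/-- The sum over all chains of a product of edges with factors divisible by `t * (1 + t)` which
connect everything, times a monomial in the positions. -/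
theorem sum_chains_arcProd_mem {ι J : Type*} [Fintype J] {a b : J → ι} {g : J → ℚ[X]}
    (hg : ∀ j, X * (1 + X) ∣ g j) {k : ℕ} {r : ι → ℕ} (hr : ∀ i, r i ≤ k)
    (hconn : ∀ f : ℕ → ℕ, (∀ j, f (r (a j)) = f (r (b j))) → ∀ i ≤ k, f i = f 0)
    (l : List ι) {W : ℕ} (hW : ∑ j, (g j).natDegree + l.length ≤ W) :
    ∃ f ∈ qBD W, ∀ n y, n < y → ∑ xs ∈ chains k y,
      coeff n ((l.map fun i => (pos xs (r i) : ℚ)).prod •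
        arcProd a b g fun i => pos xs (r i)) = coeff n f := by
  classical
  rcases Nat.eq_zero_or_pos k with rfl | hk
  · obtain ⟨c, hc⟩ : ∃ c : ℚ, arcProd a b g (fun _ => 0) = c • 1 := by
      refine ⟨∏ j, (g j).eval 0, ?_⟩
      rw [arcProd, smul_def, mul_one, map_prod]
      refine prod_congr rfl fun j _ => ?_
      have : ttZ (((0 : ℕ) : ℤ) - (0 : ℕ)) = algebraMap ℚ ℚ⟦X⟧ 0 := by simp [ttZ]
      rw [this, Polynomial.aeval_algebraMap_apply, Polynomial.coe_aeval_eq_eval]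
    have hr0 : ∀ i, r i = 0 := fun i => Nat.le_zero.1 (hr i)
    refine ⟨(l.map fun _ => ((0 : ℕ) : ℚ)).prod • c • 1, smul_mem _ _
      (smul_mem _ _ (one_mem_qBD W)), fun n y _ => ?_⟩
    simp only [chains, sum_singleton, hr0, pos_zero, hc]
  obtain ⟨k, rfl⟩ : ∃ k', k = k' + 1 := ⟨k - 1, by omega⟩
  by_cases hloop : ∃ j, r (a j) = r (b j)
  · obtain ⟨j, hj⟩ := hloop
    refine ⟨0, zero_mem _, fun n y _ => ?_⟩
    rw [map_zero]
    refine sum_eq_zero fun xs _ => ?_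
    have : arcProd a b g (fun i => pos xs (r i)) = 0 := by
      refine Finset.prod_eq_zero (mem_univ j) ?_
      obtain ⟨h, hh⟩ := hg j
      simp [hj, hh, ttZ]
    rw [this, smul_zero, map_zero]
  push Not at hloop
  by_cases hz : ∃ j, g j = 0
  · obtain ⟨j, hj⟩ := hz
    refine ⟨0, zero_mem _, fun n y _ => ?_⟩
    rw [map_zero]
    refine sum_eq_zero fun xs _ => ?_
    have : arcProd a b g (fun i => pos xs (r i)) = 0 :=
      Finset.prod_eq_zero (mem_univ j) (by simp [hj])
    rw [this, smul_zero, map_zero]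
  push Not at hz
  choose h hh using hg
  have hdeg : ∀ j, (g j).natDegree = 2 + (h j).natDegree := fun j => by
    have h0 : h j ≠ 0 := fun h0 => hz j (by rw [hh, h0, mul_zero])
    have h1 : (1 + X : ℚ[X]) ≠ 0 := by
      rw [add_comm]; exact Polynomial.X_add_C_ne_zero 1
    have h2 : (1 + X : ℚ[X]).natDegree = 1 := by
      rw [add_comm]; exact natDegree_X_add_C 1
    rw [hh j, natDegree_mul (mul_ne_zero X_ne_zero h1) h0,
      natDegree_mul X_ne_zero h1, h2, Polynomial.natDegree_X]
  let A : List (ℕ × ℕ) := univ.toList.map fun j => (r (a j), r (b j))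
  have hA : ∀ e ∈ A, e.1 ≤ k + 1 ∧ e.2 ≤ k + 1 := by
    intro e he
    obtain ⟨j, -, rfl⟩ := mem_map.1 he
    exact ⟨hr _, hr _⟩
  have hflat : ∀ f : ℕ → ℕ, (∀ e ∈ A, f e.1 = f e.2) → ∀ j, f (r (a j)) = f (r (b j)) :=
    fun f hf j => hf (r (a j), r (b j)) (mem_map.2 ⟨j, by simp, rfl⟩)
  -- The edge from 0 to the largest vertex is split off; it is the factor t(1 + t) of the outermost
  -- letter.
  obtain ⟨F, hF, hF'⟩ := exists_kdProd (k := k + 1) (card J) A (by simp [A]) hA (u := 0)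
    (v := k + 1) (Nat.zero_le _) le_rfl (by omega)
    fun f hf => (hconn f (hflat f hf) (k + 1) le_rfl).symm
  have hJ : 1 ≤ card J := by
    by_contra h0
    have h0 : card J = 0 := by omega
    have := hconn id (fun j => (Fintype.card_eq_zero_iff.1 h0).elim j) 1 (by omega)
    simp at this
  have c1 := Comb.prod univ (Q := fun _ _ => True) (k := k + 1) (f := fun j xs =>
      aeval (ttZ ((pos xs (r (a j)) : ℤ) - pos xs (r (b j)))) (h j))
    (W := fun j => (h j).natDegree) (fun _ _ _ _ _ => trivial)
    fun j _ => comb_aeval_ttZ (hr (a j)) (hr (b j)) (hloop j) (h j)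
  have c2 : Comb (fun _ => True) (k + 1) l.length
      fun xs => algebraMap ℚ ℚ⟦X⟧ (l.map fun i => (pos xs (r i) : ℚ)).prod := by
    refine .congr (fun xs _ => ?_) (.mk (L := l.map fun i => .pos (r i)) trivial ?_ (by simp))
    · rw [evalL, map_map, map_list_prod, map_map]
      congr 2
    · intro t ht
      obtain ⟨i, -, rfl⟩ := mem_map.1 ht
      exact hr i
  have c3 := Comb.mul (Q'' := fun L => Conn true L (k + 1)) ?_ hF
    (Comb.mul (Q'' := fun _ => True) (fun _ _ _ _ => trivial) c1 c2)
  · have hsum : ∑ j, (g j).natDegree = 2 * card J + ∑ j, (h j).natDegree := by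
      simp [hdeg, sum_add_distrib, mul_comm]
    obtain ⟨f, hf, hf'⟩ := Comb.sum_chains_kd_mem c3 fun _ h => h
    refine ⟨f, ?_, fun n y hn => ?_⟩
    · refine span_mono ?_ hf
      rintro _ ⟨l', s, r', k1, k2, k3, rfl⟩
      exact ⟨l', s, r', k1, k2, k3.trans (by omega), rfl⟩
    · rw [← hf' n y hn]
      refine sum_congr rfl fun xs hxs => ?_
      congr 1
      have hk := hF' xs (mem_chains.1 hxs).1
      simp only [Pi.mul_apply, Finset.prod_apply]
      rw [← mul_assoc, ← mul_assoc, mul_comm _ (algebraMap _ _ _), ← smul_def]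
      congr 1
      rw [pos_zero] at hk
      rw [← hk]
      unfold arcProd
      rw [kdProd, map_map, Finset.prod_map_toList]
      rw [← Finset.prod_mul_distrib]
      refine prod_congr rfl fun j _ => ?_
      rw [hh j, map_mul]
      congr 1
      rw [Function.comp_apply, ← ttZ_mul_one_add_ttZ]
      simp
  -- The split-off edge identifies 0 with the last vertex; given this, F forces the labelling to be
  -- constant along all original edges.
  · intro L L' h1 _ f hf hf0
    have := h1 f (fun t ht => hf t (List.mem_append_left _ ht)) (hf0 rfl).symm
    exact hconn f (hflat f this)

/-! ### Polynomial functions -/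

/-- Polynomial functions of bounded degree. -/
def PolyFun (ι : Type*) (d : ℕ) : Submodule ℚ ((ι → ℚ) → ℚ) :=
  span ℚ {f | ∃ l : List ι, l.length ≤ d ∧ f = fun X => (l.map X).prod}

section PolyFun

variable {ι : Type*}

theorem PolyFun.mono {d e : ℕ} (h : d ≤ e) : PolyFun ι d ≤ PolyFun ι e := by
  refine span_mono ?_
  rintro _ ⟨l, hl, rfl⟩
  exact ⟨l, hl.trans h, rfl⟩

theorem PolyFun.one_mem : (1 : (ι → ℚ) → ℚ) ∈ PolyFun ι 0 :=
  subset_span ⟨[], le_rfl, by ext; simp⟩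

theorem PolyFun.coord_mem (i : ι) : (fun X => X i) ∈ PolyFun ι 1 :=
  subset_span ⟨[i], le_rfl, by ext; simp⟩

theorem PolyFun.mul_mem {d e : ℕ} {f g : (ι → ℚ) → ℚ} (hf : f ∈ PolyFun ι d)
    (hg : g ∈ PolyFun ι e) : f * g ∈ PolyFun ι (d + e) := by
  have h := Submodule.mul_mem_mul hf hg
  rw [PolyFun, PolyFun, Submodule.span_mul_span] at h
  refine span_mono ?_ h
  rintro _ ⟨_, ⟨l, hl, rfl⟩, _, ⟨l', hl', rfl⟩, rfl⟩
  exact ⟨l ++ l', by simp; omega, by ext; simp⟩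

theorem PolyFun.pow_coord_mem (i : ι) (k : ℕ) : (fun X => X i ^ k) ∈ PolyFun ι k :=
  subset_span ⟨replicate k i, by simp, by ext; simp⟩

theorem PolyFun.eval_mem (i : ι) (p : ℚ[X]) :
    (fun X => p.eval (X i)) ∈ PolyFun ι p.natDegree := by
  have : (fun X : ι → ℚ => p.eval (X i)) =
      ∑ k ∈ range (p.natDegree + 1), p.coeff k • fun X => X i ^ k := by
    ext X
    rw [eval_eq_sum_range]
    simp
  rw [this]
  refine sum_mem fun k hk => smul_mem _ _ (mono ?_ (pow_coord_mem i k))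
  rw [mem_range] at hk
  omega

open Classical in
/-- Translation of the coordinates in a set. -/
def shiftBy {R : Type*} [AddMonoidWithOne R] (B : Set ι) (X : ι → R) : ι → R :=
  fun i => X i + if i ∈ B then 1 else 0

/-- Polynomials in one coordinate whose coefficients are invariant under translation. -/
def InvSpan (B : Set ι) (b : ι) (d : ℕ) : Submodule ℚ ((ι → ℚ) → ℚ) :=
  span ℚ {f | ∃ c k e, c ∈ PolyFun ι e ∧ e + k ≤ d ∧ (∀ X, c (shiftBy B X) = c X) ∧
    f = fun X => c X * X b ^ k}

theorem InvSpan.mul_coord {B : Set ι} {b : ι} {d : ℕ} {f} (hf : f ∈ InvSpan B b d) :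
    (fun X => X b) * f ∈ InvSpan B b (d + 1) := by
  have : InvSpan B b d ≤ (InvSpan B b (d + 1)).comap (mulLeft ℚ fun X => X b) := by
    refine span_le.2 ?_
    rintro _ ⟨c, k, e, h1, h2, h3, rfl⟩
    exact subset_span ⟨c, k + 1, e, h1, by omega, h3, by
      ext X; simp [pow_succ]; ring⟩
  exact this hf

theorem InvSpan.mul_inv {B : Set ι} {b : ι} {d : ℕ} {f u} (hu : u ∈ PolyFun ι 1)
    (hu' : ∀ X, u (shiftBy B X) = u X) (hf : f ∈ InvSpan B b d) :
    u * f ∈ InvSpan B b (d + 1) := by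
  have : InvSpan B b d ≤ (InvSpan B b (d + 1)).comap (mulLeft ℚ u) := by
    refine span_le.2 ?_
    rintro _ ⟨c, k, e, h1, h2, h3, rfl⟩
    exact subset_span ⟨u * c, k, 1 + e, PolyFun.mul_mem hu h1, by omega,
      fun X => by simp [hu', h3], by ext X; simp [mul_assoc]⟩
  exact this hf

theorem InvSpan.mono {B : Set ι} {b : ι} {d e : ℕ} (h : d ≤ e) : InvSpan B b d ≤ InvSpan B b e := by
  refine span_mono ?_
  rintro _ ⟨c, k, e, h1, h2, h3, rfl⟩
  exact ⟨c, k, e, h1, by omega, h3, rfl⟩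

/-- For i in B write X_i = (X_i - X_b) + X_b: the difference is invariant under the translation.
Coordinates outside B are invariant anyway. -/
theorem polyFun_le_invSpan {B : Set ι} {b : ι} (hb : b ∈ B) (d : ℕ) :
    PolyFun ι d ≤ InvSpan B b d := by
  refine span_le.2 ?_
  rintro _ ⟨l, hl, rfl⟩
  refine InvSpan.mono hl ?_
  clear hl
  induction l with
  | nil => exact subset_span ⟨1, 0, 0, PolyFun.one_mem, le_rfl, by simp, by ext; simp⟩
  | cons i l ih =>
    have e1 : (fun X : ι → ℚ => ((i :: l).map X).prod) =
        (fun X => X i) * fun X => (l.map X).prod := by ext; simp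
    rw [length_cons, e1]
    by_cases hi : i ∈ B
    · have e2 : (fun X : ι → ℚ => X i) = (fun X => X i - X b) + fun X => X b := by ext; simp
      rw [e2, add_mul]
      refine add_mem (InvSpan.mul_inv ?_ ?_ ih) (InvSpan.mul_coord ih)
      · exact sub_mem (PolyFun.coord_mem i) (PolyFun.coord_mem b)
      · intro X; simp [shiftBy, hi, hb]
    · exact InvSpan.mul_inv (PolyFun.coord_mem i) (fun X => by simp [shiftBy, hi]) ih

/-- Polynomial functions are differences of polynomial functions with respect to a translation. -/
theorem PolyFun.exists_shift_sub {B : Set ι} {b : ι} (hb : b ∈ B) {d : ℕ} {f}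
    (hf : f ∈ PolyFun ι d) : ∃ h ∈ PolyFun ι (d + 1), ∀ X, h (shiftBy B X) - h X = f X := by
  have := polyFun_le_invSpan hb d hf
  clear hf
  induction this using span_induction with
  | mem f hf =>
    obtain ⟨c, k, e, h1, h2, h3, rfl⟩ := hf
    -- As c is invariant, only the power of `X b` needs a discrete antiderivative.
    obtain ⟨p, hp, -, hp'⟩ := exists_eval_succ_sub (X ^ k)
    rw [natDegree_X_pow] at hp
    refine ⟨c * fun X => p.eval (X b), mono (by omega)
      (mul_mem h1 (mono hp (eval_mem b p))), fun X => ?_⟩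
    have := hp' (X b)
    simp only [eval_pow, eval_X] at this
    simp only [Pi.mul_apply, h3, ← this]
    simp [shiftBy, hb]; ring
  | zero => exact ⟨0, zero_mem _, by simp⟩
  | add f g _ _ h1 h2 =>
    obtain ⟨f', k1, k2⟩ := h1
    obtain ⟨g', k1', k2'⟩ := h2
    refine ⟨f' + g', add_mem k1 k1', fun X => ?_⟩
    simp only [Pi.add_apply, ← k2, ← k2']; ring
  | smul c f _ h =>
    obtain ⟨f', k1, k2⟩ := h
    refine ⟨c • f', smul_mem _ c k1, fun X => ?_⟩
    simp only [Pi.smul_apply, ← k2, smul_eq_mul]; ring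

end PolyFun

/-! ### Order types of positions -/

/-- The same order type, including the place of zero. -/
def SameOrder {ι : Type*} (P P' : ι → ℕ) : Prop :=
  (∀ x y, P x < P y ↔ P' x < P' y) ∧ ∀ x, P x = 0 ↔ P' x = 0

theorem SameOrder.trans {ι : Type*} {P P' P'' : ι → ℕ} (h : SameOrder P P')
    (h' : SameOrder P' P'') : SameOrder P P'' :=
  ⟨fun x y => (h.1 x y).trans (h'.1 x y), fun x => (h.2 x).trans (h'.2 x)⟩

theorem Incr.sameOrder {ι : Type*} {k : ℕ} {xs : List ℕ} (h : Incr k xs) {r : ι → ℕ}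
    (hr : ∀ i, r i ≤ k) : SameOrder (fun i => pos xs (r i)) r :=
  ⟨fun x y => h.pos_lt_iff (hr x) (hr y), fun x => h.pos_eq_zero_iff (hr x)⟩

open Classical in
/-- The positions of a given order type as chains. -/
theorem sum_sameOrder {ι M : Type*} [Fintype ι] [AddCommMonoid M] {k y : ℕ} (hy : 0 < y)
    {r : ι → ℕ} (hr : r ∈ ranks ι k) (F : (ι → ℕ) → M) :
    ∑ P ∈ piFinset (fun _ : ι => range y), (if SameOrder P r then F P else 0) =
      ∑ xs ∈ chains k y, F fun i => pos xs (r i) := by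
  rw [mem_ranks] at hr
  obtain ⟨hr1, hr2⟩ := hr
  rw [← sum_filter]
  symm
  refine Finset.sum_bij (fun xs _ i => pos xs (r i)) (fun xs hxs => ?_) (fun xs h xs' h' he => ?_)
    (fun P hP => ?_) (fun _ _ => rfl)
  · rw [mem_chains] at hxs
    rw [mem_filter, mem_piFinset]
    refine ⟨fun i => ?_, hxs.1.sameOrder hr1⟩
    rw [mem_range]
    rcases Nat.eq_zero_or_pos (r i) with h | h
    · rw [h, pos_zero]; exact hy
    · obtain ⟨j, hj⟩ : ∃ j, r i = j + 1 := ⟨r i - 1, by omega⟩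
      have := hr1 i
      have := hxs.1.1
      rw [hj, pos, getD_eq_getElem _ _ (by omega)]
      exact hxs.2 _ (getElem_mem _)
  · rw [mem_chains] at h h'
    refine List.ext_getElem (by rw [h.1.1, h'.1.1]) fun j h1 h2 => ?_
    obtain ⟨i, hi⟩ := hr2 (j + 1) (by omega) (by have := h.1.1; omega)
    have := congrFun he i
    simp only [hi, pos] at this
    rwa [getD_eq_getElem _ _ h1, getD_eq_getElem _ _ h2] at this
  · rw [mem_filter, mem_piFinset] at hP
    obtain ⟨hP1, hP2⟩ := hP
    have hr3 : ∀ j : ℕ, ∃ v, j < k → ∃ i, r i = j + 1 ∧ P i = v := fun j => by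
      by_cases hj : j < k
      · obtain ⟨i, hi⟩ := hr2 (j + 1) (by omega) (by omega)
        exact ⟨P i, fun _ => ⟨i, hi, rfl⟩⟩
      · exact ⟨0, fun h => absurd h hj⟩
    choose v hv using hr3
    have hinc : Incr k ((List.range k).map v) := by
      refine ⟨by simp, ?_⟩
      rw [pairwise_cons]
      constructor
      · intro z hz
        obtain ⟨j, hj, rfl⟩ := mem_map.1 hz
        rw [List.mem_range] at hj
        obtain ⟨i, h1, h2⟩ := hv j hj
        refine Nat.pos_of_ne_zero fun h => ?_
        have := (hP2.2 i).1 (h2.trans h)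
        omega
      · rw [List.pairwise_map]
        refine List.Pairwise.imp_of_mem ?_ List.pairwise_lt_range
        intro i j hi hj hij
        rw [List.mem_range] at hi hj
        obtain ⟨x, h1, h2⟩ := hv i hi
        obtain ⟨x', h1', h2'⟩ := hv j hj
        rw [← h2, ← h2', hP2.1, h1, h1']
        omega
    refine ⟨(List.range k).map v, mem_chains.2 ⟨hinc, fun x hx => ?_⟩, ?_⟩
    · obtain ⟨j, hj, rfl⟩ := mem_map.1 hx
      obtain ⟨i, -, h⟩ := hv j (List.mem_range.1 hj)
      rw [← h]
      exact mem_range.1 (hP1 _)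
    · ext i
      rcases Nat.eq_zero_or_pos (r i) with h | h
      · rw [h, pos_zero, (hP2.2 i).2 h]
      · obtain ⟨j, hj⟩ : ∃ j, r i = j + 1 := ⟨r i - 1, by omega⟩
        have hjk : j < k := by have := hr1 i; omega
        obtain ⟨x, h3, h4⟩ := hv j hjk
        have h1 := hP2.1 i x
        have h2 := hP2.1 x i
        rw [hj, pos, getD_eq_getElem _ _ (by simpa using hjk)]
        simp only [List.getElem_map, List.getElem_range]
        omega

/-! ### Sums over all positions with a condition -/

open Classical in
/-- The sum over all position functions with a condition exists coefficientwise, and its value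
lies in `S`. -/
def EvSum {ι : Type*} [Fintype ι] (S : Submodule ℚ ℚ⟦X⟧) (C : (ι → ℕ) → Prop)
    (Φ : (ι → ℕ) → ℚ⟦X⟧) : Prop :=
  ∃ f ∈ S, ∀ n y, n < y → ∑ P ∈ piFinset (fun _ : ι => range y),
    (if C P then coeff n (Φ P) else 0) = coeff n f

section EvSum

variable {ι J : Type*} {S : Submodule ℚ ℚ⟦X⟧}

open Classical in
theorem EvSum.of_sameOrder [Fintype ι] {C : (ι → ℕ) → Prop} (hC : OrderInv C) {Φ : (ι → ℕ) → ℚ⟦X⟧}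
    (h : ∀ k, ∀ r ∈ ranks ι k, C r → EvSum S (SameOrder · r) Φ) : EvSum S C Φ := by
  refine sum_positions_cond hC Φ fun k r hr hCr => ?_
  obtain ⟨f, hf, hf'⟩ := h k r hr hCr
  refine ⟨f, hf, fun n y hn => ?_⟩
  rw [← hf' n y hn, ← sum_sameOrder (by omega) hr fun P => coeff n (Φ P)]

variable {a b : J → ι} {g : J → ℚ[X]}

/-- Every position step up to the largest position is covered by an arc. -/
def Covered (a b : J → ι) (P : ι → ℕ) : Prop :=
  ∀ t, 1 ≤ t → (∃ x, t ≤ P x) → ∃ j, P (b j) < t ∧ t ≤ P (a j) ∨ P (a j) < t ∧ t ≤ P (b j)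

/-- Every unit step up to p is assigned to one factor that covers it, and a factor receives at most
`hi - lo` steps. -/
theorem X_pow_dvd_prod_of_cover [Fintype J] {Φ : J → ℚ⟦X⟧} {lo hi : J → ℕ} {p : ℕ}
    (hΦ : ∀ j, PowerSeries.X ^ (hi j - lo j) ∣ Φ j)
    (hcov : ∀ t, 1 ≤ t → t ≤ p → ∃ j, lo j < t ∧ t ≤ hi j) : PowerSeries.X ^ p ∣ ∏ j, Φ j := by
  classical
  have h : ∀ t : ℕ, ∃ j : Option J, t ∈ Ioc 0 p → ∃ j', j = some j' ∧ lo j' < t ∧ t ≤ hi j' := by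
    intro t
    by_cases ht : t ∈ Ioc 0 p
    · rw [mem_Ioc] at ht
      obtain ⟨j, hj⟩ := hcov t (by omega) ht.2
      exact ⟨some j, fun _ => ⟨j, rfl, hj⟩⟩
    · exact ⟨none, fun h => absurd h ht⟩
  choose j hj using h
  have h1 : p = ∑ i, ((Ioc 0 p).filter fun t => j t = some i).card := by
    rw [← Finset.card_biUnion]
    · conv_lhs => rw [← Nat.sub_zero p, ← Nat.card_Ioc]
      congr 1
      ext t
      simp only [Finset.mem_biUnion, mem_univ, true_and, mem_filter]
      constructor
      · intro ht
        obtain ⟨j', h1, -⟩ := hj t ht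
        exact ⟨j', ht, h1⟩
      · rintro ⟨_, ht, -⟩; exact ht
    · intro i _ i' _ hii
      rw [onFun, disjoint_left]
      intro t ht ht'
      rw [mem_filter] at ht ht'
      exact hii (Option.some.inj (ht.2.symm.trans ht'.2))
  rw [h1, ← Finset.prod_pow_eq_pow_sum]
  refine Finset.prod_dvd_prod_of_dvd _ _ fun i _ => (pow_dvd_pow _ ?_).trans (hΦ i)
  rw [← Nat.card_Ioc]
  refine Finset.card_le_card fun t ht => ?_
  rw [mem_filter] at ht
  obtain ⟨j', h1, h2⟩ := hj t ht.1
  obtain rfl := Option.some.inj (ht.2.symm.trans h1)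
  exact mem_Ioc.2 h2

/-- Factors divisible by t(1 + t) are divisible by q to the length of the arc in either direction.
-/
theorem X_pow_dvd_arcProd [Fintype J] (hg : ∀ j, X * (1 + X) ∣ g j) {P : ι → ℕ}
    (hP : Covered a b P) (x : ι) : PowerSeries.X ^ P x ∣ arcProd a b g P := by
  refine X_pow_dvd_prod_of_cover (lo := fun j => min (P (a j)) (P (b j)))
    (hi := fun j => max (P (a j)) (P (b j))) (fun i => ?_) fun t h1 ht => ?_
  · obtain ⟨h, hh⟩ := hg i
    have e1 : aeval (ttZ ((P (a i) : ℤ) - P (b i))) (g i) =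
        kd (P (a i)) (P (b i)) * aeval (ttZ ((P (a i) : ℤ) - P (b i))) h := by
      rw [hh, map_mul, ← ttZ_mul_one_add_ttZ]; simp
    rw [e1, kd, ttDist, mul_assoc]
    refine ((pow_dvd_pow _ ?_).trans (X_pow_dvd_tt _)).mul_right _
    omega
  · obtain ⟨j, hj⟩ := hP t h1 ⟨x, ht⟩
    exact ⟨j, by omega⟩

/-- Divisibility by t alone helps only for arcs with b below a: in the other direction the value is
-1 - t. So the cover must consist of arcs of the first kind. -/
theorem X_pow_dvd_arcProd_of_lt [Fintype J] (hg : ∀ j, X ∣ g j) {P : ι → ℕ} {x : ι}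
    (hP : ∀ t, 1 ≤ t → t ≤ P x → ∃ j, P (b j) < t ∧ t ≤ P (a j)) :
    PowerSeries.X ^ P x ∣ arcProd a b g P := by
  refine X_pow_dvd_prod_of_cover (lo := fun j => P (b j)) (hi := fun j => P (a j)) (fun i => ?_) hP
  rcases le_or_gt (P (b i)) (P (a i)) with h | h
  · obtain ⟨r, hr⟩ := hg i
    rw [hr, map_mul, Polynomial.aeval_X, ttZ_sub_of_le h, ttDist_comm, ttDist_of_le h]
    exact (X_pow_dvd_tt _).mul_right _
  · rw [Nat.sub_eq_zero_of_le h.le, pow_zero]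
    exact one_dvd _

/-- Vertices at the same place and the ends of an arc are identified. -/
def cls (a b : J → ι) (P : ι → ℕ) : Setoid ι :=
  Relation.EqvGen.setoid fun x y => P x = P y ∨ ∃ j, x = a j ∧ y = b j

theorem cls_le {P : ι → ℕ} {s : Setoid ι} (h1 : ∀ x y, P x = P y → s x y)
    (h2 : ∀ j, s (a j) (b j)) {x y : ι} (h : cls a b P x y) : s x y := by
  have : cls a b P ≤ s := Setoid.eqvGen_le fun x y h => by
    rcases h with h | ⟨j, rfl, rfl⟩
    · exact h1 _ _ h
    · exact h2 j
  exact this h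

theorem cls_of_eq {P : ι → ℕ} {x y : ι} (h : P x = P y) : cls a b P x y :=
  Relation.EqvGen.rel _ _ (.inl h)

theorem cls_arc (P : ι → ℕ) (j : J) : cls a b P (a j) (b j) :=
  Relation.EqvGen.rel _ _ (.inr ⟨j, rfl, rfl⟩)

theorem card_quotient_lt [Finite ι] {s t : Setoid ι} (h : s ≤ t) {x y : ι} (h1 : t x y) (h2 : ¬ s x y) :
    Nat.card (Quotient t) < Nat.card (Quotient s) := by
  classical
  have : Fintype (Quotient s) := ofFinite _
  have : Fintype (Quotient t) := ofFinite _
  rw [Nat.card_eq_fintype_card, Nat.card_eq_fintype_card]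
  let F : Quotient s → Quotient t := Quotient.map' id fun _ _ h' => h h'
  refine Fintype.card_lt_of_surjective_not_injective F ?_ fun hinj => h2 ?_
  · intro q
    induction q using Quotient.inductionOn' with
    | h z => exact ⟨Quotient.mk'' z, rfl⟩
  · have : F (Quotient.mk'' x) = F (Quotient.mk'' y) := Quotient.sound' h1
    exact Quotient.exact' (hinj this)

/-- The product of arcs times a polynomial function. -/
def wProd [Fintype J] (a b : J → ι) (g : J → ℚ[X]) (φ : (ι → ℚ) → ℚ) (P : ι → ℕ) :
    ℚ⟦X⟧ := φ (fun i => P i) • arcProd a b g P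

open Classical in
/-- The sum over the positions of an order type which the arcs connect. -/
theorem evSum_of_connected [Fintype ι] [Fintype J] (hg : ∀ j, X * (1 + X) ∣ g j) {o : ι} {k : ℕ}
    {r : ι → ℕ} (hr : r ∈ ranks ι k) (hr0 : r o = 0) (hc : ∀ x, cls a b r x o) {d : ℕ}
    {φ : (ι → ℚ) → ℚ} (hφ : φ ∈ PolyFun ι d) {W : ℕ} (hW : ∑ j, (g j).natDegree + d ≤ W) :
    EvSum (qBD W) (SameOrder · r) (wProd a b g φ) := by
  classical
  have hr' := mem_ranks.1 hr
  suffices h : ∃ f ∈ qBD W, ∀ n y, n < y → ∑ xs ∈ chains k y,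
      coeff n (wProd a b g φ fun i => pos xs (r i)) = coeff n f by
    obtain ⟨f, hf, hf'⟩ := h
    refine ⟨f, hf, fun n y hn => ?_⟩
    rw [← hf' n y hn, ← sum_sameOrder (by omega) hr fun P => coeff n (wProd a b g φ P)]
  induction hφ using span_induction with
  | mem f hf =>
    obtain ⟨l, hl, rfl⟩ := hf
    refine sum_chains_arcProd_mem hg hr'.1 (fun f hf i hi => ?_) l (by omega)
    have key : ∀ x, f (r x) = f (r o) := fun x =>
      cls_le (s := Setoid.ker fun x => f (r x)) (fun x y h => by simp [h])
        (fun j => hf j) (hc x)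
    rcases Nat.eq_zero_or_pos i with rfl | h
    · rfl
    · obtain ⟨x, rfl⟩ := hr'.2 i h hi
      rw [key x, hr0]
  | zero => exact ⟨0, zero_mem _, by simp [wProd]⟩
  | add f f' _ _ h1 h2 =>
    obtain ⟨F, k1, k2⟩ := h1
    obtain ⟨F', k1', k2'⟩ := h2
    exact ⟨F + F', add_mem k1 k1', fun n y h => by
      simp only [map_add, ← k2 n y h, ← k2' n y h, ← sum_add_distrib]
      simp [wProd, add_mul]⟩
  | smul c f _ h =>
    obtain ⟨F, k1, k2⟩ := h
    exact ⟨c • F, smul_mem _ c k1, fun n y h => by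
      rw [map_smul, ← k2 n y h, smul_sum]
      simp [wProd, mul_assoc]⟩

end EvSum

/-! ### Sliding a component of an order type. -/

section Slide

variable {ι J : Type*} {a b : J → ι} {g : J → ℚ[X]}

/-- Monotone in `r`, and strictly so except for pairs satisfying `T`. -/
def WeakOrder (o : ι) (r : ι → ℕ) (T : ι → ι → Prop) (P : ι → ℕ) : Prop :=
  (∀ x y, (r x = r y → P x = P y) ∧ (r x < r y → P x ≤ P y ∧ (¬ T x y → P x < P y))) ∧ P o = 0

theorem sameOrder_iff {o : ι} {r : ι → ℕ} (hr0 : r o = 0) {P : ι → ℕ} :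
    SameOrder P r ↔ (∀ x y, (r x = r y → P x = P y) ∧ (r x < r y → P x < P y)) ∧ P o = 0 := by
  constructor
  · rintro ⟨h1, h2⟩
    refine ⟨fun x y => ⟨fun h => ?_, fun h => (h1 x y).2 h⟩, (h2 o).2 hr0⟩
    have h3 := h1 x y
    have h4 := h1 y x
    omega
  · rintro ⟨h1, h2⟩
    refine ⟨fun x y => ⟨fun h => ?_, fun h => (h1 x y).2 h⟩, fun x => ?_⟩
    · have h3 := h1 x y
      have h4 := h1 y x
      by_contra h5
      omega
    · have h3 := h1 x o
      have h4 := h1 o x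
      omega

theorem WeakOrder.of_sameOrder {o : ι} {r : ι → ℕ} (hr0 : r o = 0) {T : ι → ι → Prop} {P : ι → ℕ}
    (h : SameOrder P r) : WeakOrder o r T P := by
  obtain ⟨h1, h2⟩ := (sameOrder_iff hr0).1 h
  exact ⟨fun x y => ⟨(h1 x y).1, fun h => ⟨((h1 x y).2 h).le, fun _ => (h1 x y).2 h⟩⟩, h2⟩

theorem WeakOrder.mono {o : ι} {r : ι → ℕ} {T : ι → ι → Prop} {P : ι → ℕ}
    (h : WeakOrder o r T P) {x y : ι} (hxy : r x ≤ r y) : P x ≤ P y := by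
  rcases hxy.lt_or_eq with h1 | h1
  · exact ((h.1 x y).2 h1).1
  · exact ((h.1 x y).1 h1).le

theorem orderInv_weakOrder (o : ι) (r : ι → ℕ) (T : ι → ι → Prop) :
    OrderInv fun P => WeakOrder o r T P ∧ ¬ SameOrder P r := by
  rintro P P' h1 h2 ⟨⟨h3, h4⟩, h5⟩
  refine ⟨⟨fun x y => ?_, (h2 o).1 h4⟩, fun h => h5 (SameOrder.trans ⟨h1, h2⟩ h)⟩
  have e1 := h1 x y
  have e2 := h1 y x
  obtain ⟨k1, k2⟩ := h3 x y
  refine ⟨fun h => ?_, fun h => ⟨?_, fun hT => ?_⟩⟩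
  · have := k1 h; omega
  · have := (k2 h).1; omega
  · have := (k2 h).2 hT; omega

/-- Take the lowest rank that is placed at t or higher. All lower ranks lie below t, so the arc that
covers this rank in r covers t in P. -/
theorem WeakOrder.covered {o : ι} {r : ι → ℕ} (hr0 : r o = 0) {T : ι → ι → Prop} {P : ι → ℕ}
    (h : WeakOrder o r T P) (hr : Covered a b r) : Covered a b P := by
  intro t ht ⟨x, hx⟩
  -- the first rank whose position is at least `t`
  have hex : ∃ m, ∃ x, r x = m ∧ t ≤ P x := ⟨_, x, rfl, hx⟩
  classical
  obtain ⟨z, hz, hzt⟩ := Nat.find_spec hex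
  have hmin : ∀ y, r y < r z → P y < t := fun y hy => by
    by_contra hcon
    rw [hz] at hy
    exact Nat.find_min hex hy ⟨y, rfl, by omega⟩
  have hz1 : 1 ≤ r z := by
    by_contra h0
    have h1 := (h.1 z o).1 (by omega)
    have h2 := h.2
    omega
  obtain ⟨j, hj⟩ := hr (r z) hz1 ⟨z, le_rfl⟩
  refine ⟨j, ?_⟩
  rcases hj with ⟨h1, h2⟩ | ⟨h1, h2⟩
  · exact .inl ⟨hmin _ h1, hzt.trans (h.mono h2)⟩
  · exact .inr ⟨hmin _ h1, hzt.trans (h.mono h2)⟩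

variable [Fintype ι] [Fintype J]

/-- Identifications made by r persist in P. If P is not of the strict order type, some pair with
different ranks coincides in P; it satisfies T, hence joins two classes. -/
theorem WeakOrder.card_lt {o : ι} {r : ι → ℕ} (hr0 : r o = 0) {T : ι → ι → Prop} {P : ι → ℕ}
    (h : WeakOrder o r T P) (hT : ∀ x y, T x y → ¬ cls a b r x y) (hP : ¬ SameOrder P r) :
    Nat.card (Quotient (cls a b P)) < Nat.card (Quotient (cls a b r)) := by
  have h1 : ∃ x y, r x < r y ∧ ¬ P x < P y := by
    by_contra hcon
    push Not at hcon
    exact hP ((sameOrder_iff hr0).2 ⟨fun x y => ⟨(h.1 x y).1, fun h => hcon x y h⟩, h.2⟩)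
  obtain ⟨x, y, h1, h2⟩ := h1
  obtain ⟨h3, h4⟩ := (h.1 x y).2 h1
  have hTxy : T x y := by
    by_contra hcon
    exact h2 (h4 hcon)
  refine card_quotient_lt (s := cls a b r) (t := cls a b P) (fun u v huv => ?_) (x := x) (y := y)
    (cls_of_eq (by omega)) (hT x y hTxy)
  exact cls_le (fun u v h' => cls_of_eq ((h.1 u v).1 h')) (fun j => cls_arc P j) huv

theorem arcProd_shiftBy {B : Set ι} (hB : ∀ j, a j ∈ B ↔ b j ∈ B) (P : ι → ℕ) :
    arcProd a b g (shiftBy B P) = arcProd a b g P := by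
  refine prod_congr rfl fun j _ => ?_
  have := hB j
  congr 2
  by_cases h : b j ∈ B
  · simp [shiftBy, h, this.2 h]
  · simp [shiftBy, h, this]

/-- Moving B up by one makes the weak inequalities from the complement up to B strict, and the
strict ones from B up to the complement weak. -/
theorem weakOrder_shiftBy {o : ι} {r : ι → ℕ} {B : Set ι} (ho : o ∉ B)
    (hB : ∀ x y, r x = r y → (x ∈ B ↔ y ∈ B)) (P : ι → ℕ) :
    WeakOrder o r (fun x y => x ∈ B ∧ y ∉ B) (shiftBy B P) ↔
      WeakOrder o r (fun x y => x ∉ B ∧ y ∈ B) P := by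
  classical
  have ho' : shiftBy B P o = P o := by simp [shiftBy, ho]
  unfold WeakOrder
  rw [ho']
  refine and_congr_left fun _ => forall_congr' fun x => forall_congr' fun y => ?_
  have := hB x y
  by_cases hx : x ∈ B <;> by_cases hy : y ∈ B <;> simp [shiftBy, hx, hy] at this ⊢ <;> omega

-- The shift is a bijection between the two ranges of summation as far as nonzero terms go:
-- positions at y or beyond contribute nothing to the coefficient of q^n by divisibility, and in the
-- second range members of B have positive places, being strictly above o.
open Classical in
theorem sum_weakOrder_shiftBy (hg : ∀ j, X * (1 + X) ∣ g j) {o : ι}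
    {r : ι → ℕ} (hr0 : r o = 0) (hr : Covered a b r) {B : Set ι} (ho : o ∉ B)
    (hB : ∀ x y, r x = r y → (x ∈ B ↔ y ∈ B)) (h : (ι → ℚ) → ℚ) {n y : ℕ} (hn : n < y) :
    ∑ P ∈ (piFinset fun _ : ι => range y) with
        WeakOrder o r (fun x y => x ∉ B ∧ y ∈ B) P,
      coeff n (wProd a b g h (shiftBy B P)) =
    ∑ P ∈ (piFinset fun _ : ι => range y) with
        WeakOrder o r (fun x y => x ∈ B ∧ y ∉ B) P,
      coeff n (wProd a b g h P) := by
  refine Finset.sum_bij_ne_zero (fun P _ _ => shiftBy B P) (fun P hP hne => ?_)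
    (fun P _ _ P' _ _ he => ?_) (fun P hP hne => ?_) (fun _ _ _ => rfl)
  · rw [mem_filter] at hP ⊢
    have hw := (weakOrder_shiftBy ho hB P).2 hP.2
    refine ⟨?_, hw⟩
    rw [mem_piFinset]
    intro x
    rw [mem_range]
    by_contra hcon
    refine hne ?_
    have hdvd := X_pow_dvd_arcProd hg (hw.covered hr0 hr) x
    rw [wProd, map_smul, X_pow_dvd_iff.1 hdvd n (by omega), smul_zero]
  · ext x
    have := congrFun he x
    simp only [shiftBy] at this
    omega
  · rw [mem_filter, mem_piFinset] at hP
    have hpos : ∀ x ∈ B, 0 < P x := by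
      intro x hx
      have h0 : r o < r x := by
        rw [hr0]
        refine Nat.pos_of_ne_zero fun h0 => ho ((hB o x (by rw [hr0, h0])).2 hx)
      have := ((hP.2.1 o x).2 h0).2 fun h => ho h.1
      omega
    have hs : shiftBy B (fun x => P x - if x ∈ B then 1 else 0) = P := by
      ext x
      by_cases hx : x ∈ B
      · have := hpos x hx
        simp [shiftBy, hx]; omega
      · simp [shiftBy, hx]
    refine ⟨fun x => P x - if x ∈ B then 1 else 0, ?_, ?_, hs⟩
    · rw [mem_filter, mem_piFinset]
      refine ⟨fun x => ?_, ?_⟩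
      · have := mem_range.1 (hP.1 x)
        rw [mem_range]; omega
      · rw [← weakOrder_shiftBy ho hB, hs]; exact hP.2
    · rw [hs]; exact hne

/-- The sum over the positions of an order type. -/
theorem evSum_sameOrder (hg : ∀ j, X * (1 + X) ∣ g j) (o : ι) (c : ℕ) :
    ∀ (k : ℕ) (r : ι → ℕ), (∀ [DecidableEq ι], r ∈ ranks ι k) → r o = 0 → Covered a b r →
      Nat.card (Quotient (cls a b r)) ≤ c + 1 → ∀ (d : ℕ) (φ : (ι → ℚ) → ℚ), φ ∈ PolyFun ι d →
      ∀ W, ∑ j, (g j).natDegree + d + c ≤ W →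
      EvSum (qBD W) (SameOrder · r) (wProd a b g φ) := by
  classical
  induction c with
  | zero =>
    intro k r hr hr0 hcov hcard d φ hφ W hW
    refine evSum_of_connected hg (k := k) (by convert hr) hr0 (fun x => ?_) hφ (by omega)
    have : Subsingleton (Quotient (cls a b r)) := Finite.card_le_one_iff_subsingleton.1 hcard
    exact Quotient.exact' (Subsingleton.elim (Quotient.mk'' x) (Quotient.mk'' o))
  | succ c ih =>
    intro k r hr hr0 hcov hcard d φ hφ W hW
    by_cases hc : ∀ x, cls a b r x o
    · exact evSum_of_connected hg (k := k) (by convert hr) hr0 hc hφ (by omega)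
    push Not at hc
    obtain ⟨z, hz⟩ := hc
    -- A component that does not contain o: no arc ties it to the rest, so it can be moved as a
    -- whole without changing any arc.
    let B : Set ι := {x | cls a b r x z}
    have hzB : z ∈ B := (cls a b r).refl z
    have ho : o ∉ B := fun h => hz ((cls a b r).symm h)
    have hcl : ∀ x y, cls a b r x y → (x ∈ B ↔ y ∈ B) := fun x y h =>
      ⟨fun h' => (cls a b r).trans ((cls a b r).symm h) h', fun h' => (cls a b r).trans h h'⟩
    have hB : ∀ x y, r x = r y → (x ∈ B ↔ y ∈ B) := fun x y h => hcl x y (cls_of_eq h)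
    -- With φ the difference of ψ under the shift, the sum of φ over the places of B telescopes.
    obtain ⟨ψ, hψ, hψ'⟩ := PolyFun.exists_shift_sub hzB hφ
    -- the boundary terms
    have key : ∀ T : ι → ι → Prop, (∀ x y, T x y → ¬ (x ∈ B ↔ y ∈ B)) → ∀ d' φ',
        φ' ∈ PolyFun ι d' → d' ≤ d + 1 →
        EvSum (qBD W) (fun P => WeakOrder o r T P ∧ ¬ SameOrder P r)
          (wProd a b g φ') := by
      intro T hT d' φ' hφ' hd'
      refine EvSum.of_sameOrder (orderInv_weakOrder o r T) fun k' r' hr' hw => ?_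
      -- A boundary order type has at least one class less, while ψ has a degree bound larger by
      -- one; together they stay within W.
      have h1 := hw.1.card_lt hr0 (fun x y h h' => hT x y h (hcl x y h')) hw.2
      exact ih k' r' (by intro _; convert hr') hw.1.2 (hw.1.covered hr0 hcov) (by omega) d' φ' hφ' W
        (by omega)
    obtain ⟨f1, hf1, e1⟩ := key (fun x y => x ∉ B ∧ y ∈ B) (by tauto) d φ hφ (by omega)
    obtain ⟨f2, hf2, e2⟩ := key (fun x y => x ∉ B ∧ y ∈ B) (by tauto) (d + 1) ψ hψ le_rfl
    obtain ⟨f3, hf3, e3⟩ := key (fun x y => x ∈ B ∧ y ∉ B) (by tauto) (d + 1) ψ hψ le_rfl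
    refine ⟨f3 - f2 - f1, sub_mem (sub_mem hf3 hf2) hf1, fun n y hn => ?_⟩
    have split : ∀ (T : ι → ι → Prop) (φ' : (ι → ℚ) → ℚ),
        ∑ P ∈ (piFinset fun _ : ι => range y) with WeakOrder o r T P,
          coeff n (wProd a b g φ' P) =
        ∑ P ∈ piFinset (fun _ : ι => range y),
          (if SameOrder P r then coeff n (wProd a b g φ' P) else 0) +
        ∑ P ∈ piFinset (fun _ : ι => range y),
          (@ite _ (WeakOrder o r T P ∧ ¬ SameOrder P r) (Classical.propDecidable _)
            (coeff n (wProd a b g φ' P)) 0) := by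
      intro T φ'
      rw [sum_filter, ← sum_add_distrib]
      refine sum_congr rfl fun P _ => ?_
      by_cases h1 : SameOrder P r
      · simp [h1, WeakOrder.of_sameOrder hr0 h1]
      · simp [h1]
    -- When the strict order type is split off from the three sums, the two contributions of ψ
    -- cancel, and the sum of φ is expressed by boundary terms.
    have hshift : ∑ P ∈ (piFinset fun _ : ι => range y) with
          WeakOrder o r (fun x y => x ∉ B ∧ y ∈ B) P, coeff n (wProd a b g φ P) =
        ∑ P ∈ (piFinset fun _ : ι => range y) with
          WeakOrder o r (fun x y => x ∈ B ∧ y ∉ B) P, coeff n (wProd a b g ψ P) -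
        ∑ P ∈ (piFinset fun _ : ι => range y) with
          WeakOrder o r (fun x y => x ∉ B ∧ y ∈ B) P, coeff n (wProd a b g ψ P) := by
      rw [← sum_weakOrder_shiftBy hg hr0 hcov ho hB ψ hn, ← sum_sub_distrib]
      refine sum_congr rfl fun P _ => ?_
      rw [← map_sub]
      congr 1
      rw [wProd, wProd, wProd, arcProd_shiftBy fun j => hcl _ _ (cls_arc r j), ← sub_smul, ← hψ']
      congr 3
      ext x
      simp only [shiftBy]
      split_ifs <;> simp
    rw [split, split, split] at hshift
    have e1' := e1 n y hn
    have e2' := e2 n y hn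
    have e3' := e3 n y hn
    beta_reduce at e1' e2' e3' ⊢
    rw [map_sub, map_sub, ← e1', ← e2', ← e3']
    linear_combination hshift

/-- Sums over position functions of products of arcs with factors divisible by `t * (1 + t)`. -/
theorem evSum_arcProd_kd {C : (ι → ℕ) → Prop} (hC : OrderInv C) {o : ι}
    (hg : ∀ j, X * (1 + X) ∣ g j) {S : Finset ι} {W : ℕ}
    (h0 : ∀ P, C P → P o = 0)
    (hconn : ∀ P, C P → ∀ f : ι → ℕ, (∀ x y, P x = P y → f x = f y) →
      (∀ j, f (a j) = f (b j)) → (∀ v ∈ S, f v = f o) → ∀ x, f x = f o)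
    (hcov : ∀ P, C P → Covered a b P)
    (hW : ∀ P, C P → ∑ j, (g j).natDegree + (S.filter fun v => P v ≠ 0).card ≤ W) :
    EvSum (qBD W) C (arcProd a b g) := by
  classical
  have e : arcProd a b g = wProd a b g 1 := by ext1 P; simp [wProd]
  rw [e]
  refine EvSum.of_sameOrder hC fun k r hr hCr => ?_
  refine evSum_sameOrder hg o (S.filter fun v => r v ≠ 0).card k r (by intro _; convert hr)
    (h0 r hCr) (hcov r hCr) ?_ 0 1 PolyFun.one_mem W (by have := hW r hCr; omega)
  -- Each class contains o or a member of S at a nonzero place; otherwise its indicator would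
  -- contradict `hconn`. This bounds the number of classes.
  let T : Finset (Quotient (cls a b r)) :=
    insert (Quotient.mk'' o) ((S.filter fun v => r v ≠ 0).image Quotient.mk'')
  have hT : ∀ q, q ∈ T := by
    intro q
    by_contra hq
    induction q using Quotient.inductionOn' with
    | h x =>
      let f : ι → ℕ := fun y => if cls a b r y x then 1 else 0
      have hf : ∀ y z, cls a b r y z → f y = f z := fun y z h => by
        have : cls a b r y x ↔ cls a b r z x :=
          ⟨fun h' => (cls a b r).trans ((cls a b r).symm h) h', fun h' => (cls a b r).trans h h'⟩
        simp only [f, this]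
      have hfo : f o = 0 := by
        simp only [f, ite_eq_right_iff, one_ne_zero, imp_false]
        intro h
        refine hq ?_
        rw [← Quotient.sound' h]
        exact mem_insert_self _ _
      have := hconn r hCr f (fun y z h => hf y z (cls_of_eq h)) (fun j => hf _ _ (cls_arc r j))
        (fun v hv => by
          by_cases hrv : r v = 0
          · exact hf v o (cls_of_eq (by rw [hrv, h0 r hCr]))
          · rw [hfo]
            simp only [f, ite_eq_right_iff, one_ne_zero, imp_false]
            intro h
            refine hq ?_
            rw [← Quotient.sound' h]
            exact Finset.mem_insert_of_mem (mem_image_of_mem _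
              (mem_filter.2 ⟨hv, hrv⟩))) x
      rw [hfo] at this
      simp only [f, if_pos ((cls a b r).refl x)] at this
      omega
  have h1 : T = (univ : Finset (Quotient (cls a b r))) := by
    ext q; simp [hT q]
  rw [Nat.card_eq_fintype_card, ← card_univ, ← h1]
  exact (Finset.card_insert_le _ _).trans (Nat.succ_le_succ card_image_le)

end Slide

end

end Nested

namespace Residue
noncomputable section

open scoped Polynomial
open Algebra (adjoin smul_def)
open BiBracket (BD qBD)
open Fin (cons_succ last)
open Finset (finsuppAntidiag induction_on mem_filter mem_image mem_image_of_mem mem_insert_self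
  mem_product mem_range mem_sdiff mem_sigma mem_union mem_univ mul_sum prod_congr range smul_sum
  sum_add_distrib sum_congr sum_eq_single sum_eq_zero sum_mul sum_neg_distrib sum_sub_distrib univ)
open Finset.HasAntidiagonal (antidiagonal mem_antidiagonal)
open Finsupp (finsetSum_apply single_apply single_zero weight weight_single)
open Fintype (mem_piFinset piFinset)
open Function (comp_apply update update_of_ne update_self)
open LinearMap (fst ker proj snd)
open MvPowerSeries (X_pow_eq coeff coeff_C coeff_X coeff_monomial coeff_mul coeff_one
  coeff_zero_eq_constantCoeff_apply constantCoeff constantCoeff_X constantCoeff_inv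
  monomial_mul_monomial)
open Nat (add_eq_zero_iff lt_succ_self succ_ne_zero)
open Polynomial (C_1 X X_comp X_dvd_iff aeval_C aeval_X aeval_algHom_apply aeval_eq_sum_range
  coeff_zero_eq_eval_zero mul_comp natDegree_X_add_C natDegree_X_le natDegree_add_le
  natDegree_mul_le natDegree_neg)
open PowerSeries (coe_substAlgHom coeff_map coeff_mk coeff_subst coeff_succ_mul_X coeff_trunc log
  mapAlgHom_apply mk smul_eq_C_mul substAlgHom substAlgHom_X trunc)
open Submodule (smul_mem span_induction span_le subset_span)
open Trace (Pair Ser Var coeffY0 expVar fpow lexp poch qy qyExp ratio sum_Ici_single yInvq yy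
  yyInvq zvExp)

open Polynomial (aeval)
open Nested (tt ttZ arcProd EvSum)

/-! ### Expansion of a pole in the local parameter of another one -/

section Psi

variable {R : Type*} [CommRing R]

/-- The series `c / (1 + (1 + c) w)`. -/
def psi (c : R) : R⟦X⟧ := mk fun d => c * (-(1 + c)) ^ d

theorem psi_mul (c : R) : psi c * (1 + PowerSeries.C (1 + c) * PowerSeries.X) = PowerSeries.C c := by
  ext d
  rw [mul_add, mul_one, map_add, ← mul_assoc]
  cases d with
  | zero => simp [psi]
  | succ d =>
    rw [coeff_succ_mul_X, mul_comm (psi c), PowerSeries.coeff_C_mul, PowerSeries.coeff_C,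
      if_neg (succ_ne_zero d)]
    simp only [psi, coeff_mk]
    ring

theorem isUnit_one_add (c : R) : IsUnit (1 + PowerSeries.C c * PowerSeries.X : R⟦X⟧) := by
  rw [PowerSeries.isUnit_iff_constantCoeff]; simp

theorem psi_eq (c : R) : psi c = PowerSeries.C c - PowerSeries.C (1 + c) * PowerSeries.X * psi c := by
  rw [← psi_mul]; ring

/-- Over the common denominator (1 + (1 + c)w)(1 + (1 + d)w) this becomes an identity of numerators,
which the two hypotheses supply. -/
theorem psi_mul_psi {c d x y : R} (hxy : x + y = -1) (h : c * d = x * c + y * d) :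
    psi c * psi d = x • psi c + y • psi d := by
  have hc := psi_mul c
  have hd := psi_mul d
  refine ((isUnit_one_add (1 + c)).mul (isUnit_one_add (1 + d))).mul_left_injective ?_
  have h' := congrArg (PowerSeries.C (R := R)) h
  have hxy' := congrArg (PowerSeries.C (R := R)) hxy
  simp only [map_mul, map_add, map_neg, map_one] at h' hxy' hc hd
  simp only [smul_eq_C_mul]
  simp only [map_add, map_one]
  generalize PowerSeries.C (R := R) c = c' at *
  generalize PowerSeries.C (R := R) d = d' at *
  generalize PowerSeries.C (R := R) x = x' at *
  generalize PowerSeries.C (R := R) y = y' at *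
  generalize psi c = p at *
  generalize psi d = r at *
  linear_combination (r * (1 + (1 + d') * PowerSeries.X) - x' * (1 + (1 + d') * PowerSeries.X)) * hc
    + (c' - y' * (1 + (1 + c') * PowerSeries.X)) * hd + (1 + PowerSeries.X) * h' - c' * d' * PowerSeries.X * hxy'

end Psi

/-- The coefficients of `p (c / (1 + (1 + c) w))` as polynomials in `c`. -/
def tay (p : ℚ[X]) (d : ℕ) : ℚ[X] :=
  PowerSeries.coeff d (aeval (psi (X : ℚ[X])) p)

theorem coeff_aeval_psi {R : Type*} [CommRing R] [Algebra ℚ R] (c : R) (p : ℚ[X]) (d : ℕ) :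
    PowerSeries.coeff d (aeval (psi c) p) = aeval c (tay p d) := by
  have h : psi c = PowerSeries.mapAlgHom (aeval c : ℚ[X] →ₐ[ℚ] R) (psi X) := by
    ext d
    rw [mapAlgHom_apply, coeff_map]
    simp [psi]
  rw [h, aeval_algHom_apply, tay, mapAlgHom_apply,
    coeff_map]
  rfl

/-- The coefficient of w^d in `psi` has degree at most d + 1 in c, so in a product of m copies it
has degree at most m + d. -/
theorem natDegree_tay_le (p : ℚ[X]) (d : ℕ) : (tay p d).natDegree ≤ p.natDegree + d := by
  have hone : (1 + X : ℚ[X]).natDegree ≤ 1 := by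
    rw [add_comm]; exact (natDegree_X_add_C 1).le
  have hpow : ∀ m d, (PowerSeries.coeff d (psi (X : ℚ[X]) ^ m)).natDegree ≤ m + d := by
    intro m
    induction m with
    | zero =>
      intro d
      rw [pow_zero, PowerSeries.coeff_one]
      split_ifs <;> simp
    | succ m ih =>
      intro d
      rw [pow_succ, PowerSeries.coeff_mul]
      refine Polynomial.natDegree_sum_le_of_forall_le _ _ fun x hx => ?_
      rw [mem_antidiagonal] at hx
      refine natDegree_mul_le.trans ?_
      have h1 := ih x.1
      have h2 : (PowerSeries.coeff x.2 (psi (X : ℚ[X]))).natDegree ≤ 1 + x.2 := by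
        rw [psi, coeff_mk]
        refine natDegree_mul_le.trans (Nat.add_le_add natDegree_X_le ?_)
        refine Polynomial.natDegree_pow_le.trans ?_
        rw [natDegree_neg]
        exact (Nat.mul_le_mul_left _ hone).trans (by simp)
      omega
  rw [tay, aeval_eq_sum_range, map_sum]
  refine Polynomial.natDegree_sum_le_of_forall_le _ _ fun i hi => ?_
  rw [mem_range] at hi
  rw [PowerSeries.coeff_smul]
  refine (Polynomial.natDegree_smul_le _ _).trans ((hpow i d).trans ?_)
  omega

theorem dvd_coeff_mul {R : Type*} [CommRing R] {a : R} {f g : R⟦X⟧}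
    (h : ∀ d, a ∣ PowerSeries.coeff d f) (d : ℕ) : a ∣ PowerSeries.coeff d (f * g) := by
  rw [PowerSeries.coeff_mul]
  exact Finset.dvd_sum fun x _ => (h x.1).mul_right _

theorem X_dvd_tay {p : ℚ[X]} (h : X ∣ p) (d : ℕ) : X ∣ tay p d := by
  obtain ⟨r, rfl⟩ := h
  rw [tay, map_mul, aeval_X]
  exact dvd_coeff_mul (fun d => by simp [psi]) d

/-- One has 1 + psi = (1 + c)(1 + w) / (1 + (1 + c)w), so every coefficient is divisible by 1 + c.
-/
theorem one_add_X_dvd_tay {p : ℚ[X]} (h : 1 + X ∣ p) (d : ℕ) :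
    1 + X ∣ tay p d := by
  obtain ⟨r, rfl⟩ := h
  rw [tay, map_mul, map_add, map_one, aeval_X]
  refine dvd_coeff_mul (fun d => ?_) d
  rw [map_add]
  cases d with
  | zero => simp [psi]
  | succ d =>
    rw [PowerSeries.coeff_one, if_neg (succ_ne_zero d), zero_add, psi, coeff_mk, pow_succ]
    exact Dvd.intro (X * (-(1 + X)) ^ d * -1) (by ring)

/-! ### Sums over residues -/

section Laurent

variable {R : Type*} [CommRing R]

/-- Laurent series. -/
def Lau (R : Type*) [CommRing R] : Type _ := HahnSeries ℤ R

instance : CommRing (Lau R) := inferInstanceAs (CommRing (HahnSeries ℤ R))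

instance {S : Type*} [CommRing S] [Algebra S R] : Algebra S (Lau R) :=
  HahnSeries.instAlgebra

/-- Power series as Laurent series. -/
def ofPS : R⟦X⟧ →+* Lau R := HahnSeries.ofPowerSeries ℤ R

/-- The inverse of the variable. -/
def winv : Lau R := (HahnSeries.single (-1) 1 : HahnSeries ℤ R)

/-- The coefficient of `w ^ (-1)`. -/
def coeffNegOne : Lau R →ₗ[R] R where
  toFun l := HahnSeries.coeff (Γ := ℤ) (R := R) l (-1)
  map_add' _ _ := rfl
  map_smul' _ _ := rfl

theorem coeffNegOne_winv_pow_mul (j : ℕ) (f : R⟦X⟧) :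
    coeffNegOne (winv ^ j * ofPS f) = if j = 0 then 0 else PowerSeries.coeff (j - 1) f := by
  have h : (winv : Lau R) ^ j = (HahnSeries.single (-(j : ℤ)) 1 : HahnSeries ℤ R) := by
    change (HahnSeries.single (-1 : ℤ) (1 : R)) ^ j = _
    rw [HahnSeries.single_pow]; simp
  rw [h]
  change HahnSeries.coeff (HahnSeries.single (-(j : ℤ)) (1 : R) * HahnSeries.ofPowerSeries ℤ R f) (-1) = _
  rw [HahnSeries.coeff_single_mul, one_mul, PowerSeries.coeff_coe]
  split_ifs with h1 h2 h2
  · rfl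
  · omega
  · omega
  · congr 2
    omega

theorem winv_mul_X : (winv : Lau R) * ofPS PowerSeries.X = 1 := by
  change HahnSeries.single (-1 : ℤ) (1 : R) * HahnSeries.ofPowerSeries ℤ R PowerSeries.X = 1
  rw [HahnSeries.ofPowerSeries_X, HahnSeries.single_mul_single]
  simp

theorem ofPS_C (x : R) : ofPS (PowerSeries.C x) = algebraMap R (Lau R) x := by
  change HahnSeries.ofPowerSeries ℤ R _ = HahnSeries.C x
  rw [HahnSeries.ofPowerSeries_C]

theorem smul_ofPS (x : R) (f : R⟦X⟧) : ofPS (x • f) = x • ofPS f := by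
  rw [smul_eq_C_mul, map_mul, ofPS_C, smul_def]

/-- The residue of `- f dw / (1 + w)` at `0`. -/
def res : Lau R →ₗ[R] R :=
  -coeffNegOne ∘ₗ LinearMap.mulRight R (ofPS (mk fun d => (-1) ^ d))

theorem res_winv_pow_mul (j : ℕ) (f : R⟦X⟧) :
    res (winv ^ j * ofPS f) =
      if j = 0 then 0 else -PowerSeries.coeff (j - 1) (f * mk fun d => (-1) ^ d) := by
  have : res (winv ^ j * ofPS f) =
    -coeffNegOne (winv ^ j * ofPS f * ofPS (mk fun d => (-1) ^ d)) := rfl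
  rw [this, mul_assoc, ← map_mul, coeffNegOne_winv_pow_mul]
  split_ifs <;> simp

theorem res_ofPS (f : R⟦X⟧) : res (ofPS f) = 0 := by
  simpa using res_winv_pow_mul 0 f

/-- The same value (-1)^j as the constant term of the j-th power of a simple pole expanded in
negative powers; this agreement makes the sum over residues correct. -/
theorem res_winv_pow {j : ℕ} (hj : j ≠ 0) : res ((winv : Lau R) ^ j) = (-1) ^ j := by
  have := res_winv_pow_mul (R := R) j 1
  rw [map_one ofPS, mul_one, if_neg hj, one_mul, coeff_mk] at this
  rw [this]
  obtain ⟨k, rfl⟩ : ∃ k, j = k + 1 := ⟨j - 1, by omega⟩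
  rw [Nat.add_sub_cancel, pow_succ]; ring

open Classical in
/-- The expansions of the values `Z` at the pole `Y`. -/
def theta {ι : Type*} (c : ι → ι → R) (Y Z : ι) : Lau R :=
  if Z = Y then winv else ofPS (psi (c Y Z))

theorem theta_self {ι : Type*} (c : ι → ι → R) (Y : ι) : theta c Y Y = winv :=
  if_pos rfl

theorem theta_of_ne {ι : Type*} (c : ι → ι → R) {Y Z : ι} (h : Z ≠ Y) :
    theta c Y Z = ofPS (psi (c Y Z)) := if_neg h

theorem winv_mul_psi {c d : R} (h : c + d = -1) :
    winv * ofPS (psi c) = c • winv + d • ofPS (psi c) := by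
  have hd : 1 + c = -d := by linear_combination h
  conv_lhs => rw [psi_eq c, hd]
  rw [map_sub, map_mul, map_mul, ofPS_C, ofPS_C, smul_def, smul_def, map_neg]
  linear_combination (algebraMap R (Lau R) d * ofPS (psi c)) * winv_mul_X (R := R)

/-- The expansions at any pole satisfy the same quadratic relations as the simple poles themselves,
so that both can be reduced to powers in parallel. -/
theorem theta_mul_theta {ι : Type*} {c : ι → ι → R}
    (hc : ∀ Z Z', Z ≠ Z' → c Z Z' + c Z' Z = -1)
    (hc3 : ∀ Y Z Z', Z ≠ Y → Z' ≠ Y → Z ≠ Z' →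
      c Y Z * c Y Z' = c Z Z' * c Y Z + c Z' Z * c Y Z') (Y : ι) {Z Z' : ι} (h : Z ≠ Z') :
    theta c Y Z * theta c Y Z' = c Z Z' • theta c Y Z + c Z' Z • theta c Y Z' := by
  by_cases h1 : Z = Y
  · subst h1
    rw [theta_self, theta_of_ne c h.symm, winv_mul_psi (hc Z Z' h)]
  by_cases h2 : Z' = Y
  · subst h2
    rw [theta_self, theta_of_ne c h, mul_comm, winv_mul_psi (hc Z' Z h.symm), add_comm]
  rw [theta_of_ne c h1, theta_of_ne c h2, ← map_mul, psi_mul_psi (hc Z Z' h) (hc3 Y Z Z' h1 h2 h),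
    map_add, smul_ofPS, smul_ofPS]

/-- A functional vanishes on products if it vanishes on powers. -/
theorem eq_zero_of_mem_adjoin {ι A : Type*} [CommRing A] [Algebra R A] {T : ι → A} {c : ι → ι → R}
    (hT : ∀ Z Z', Z ≠ Z' → T Z * T Z' = c Z Z' • T Z + c Z' Z • T Z') {Λ : A →ₗ[R] R}
    (h1 : Λ 1 = 0) (hΛ : ∀ Z m, Λ (T Z ^ (m + 1)) = 0) {x : A}
    (hx : x ∈ adjoin R (Set.range T)) : Λ x = 0 := by
  let M : Submodule R A := Submodule.span R ({1} ∪ {x | ∃ Z m, x = T Z ^ (m + 1)})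
  have hM1 : (1 : A) ∈ M := subset_span (.inl rfl)
  have hMp : ∀ Z m, T Z ^ (m + 1) ∈ M := fun Z m => subset_span (.inr ⟨Z, m, rfl⟩)
  have hmul1 : ∀ Z Z' m, T Z * T Z' ^ (m + 1) ∈ M := by
    intro Z Z' m
    by_cases h : Z = Z'
    · subst h
      rw [← pow_succ']
      exact hMp Z (m + 1)
    · induction m with
      | zero =>
        rw [zero_add, pow_one, hT Z Z' h]
        have := fun Z => hMp Z 0
        simp only [zero_add, pow_one] at this
        exact add_mem (smul_mem _ _ (this Z)) (smul_mem _ _ (this Z'))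
      | succ m ih =>
        rw [pow_succ', ← mul_assoc, hT Z Z' h, add_mul, smul_mul_assoc, smul_mul_assoc, ← pow_succ']
        exact add_mem (smul_mem _ _ ih) (smul_mem _ _ (hMp Z' (m + 1)))
  have hmul : ∀ Z, ∀ x ∈ M, T Z * x ∈ M := by
    intro Z
    have : M ≤ M.comap (LinearMap.mulLeft R (T Z)) := by
      refine span_le.2 ?_
      rintro x (rfl | ⟨Z', m, rfl⟩)
      · have := hMp Z 0
        simpa using this
      · exact hmul1 Z Z' m
    exact this
  have hadj : ∀ x ∈ adjoin R (Set.range T), ∀ y ∈ M, x * y ∈ M := by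
    intro x hx
    induction hx using Algebra.adjoin_induction with
    | mem x hx =>
      obtain ⟨Z, rfl⟩ := hx
      exact hmul Z
    | algebraMap r =>
      intro y hy
      rw [← smul_def]
      exact smul_mem _ _ hy
    | add x y _ _ h1 h2 => intro z hz; rw [add_mul]; exact add_mem (h1 z hz) (h2 z hz)
    | mul x y _ _ h1 h2 => intro z hz; rw [mul_assoc]; exact h1 _ (h2 z hz)
  have hker : M ≤ ker Λ := by
    refine span_le.2 ?_
    rintro x (rfl | ⟨Z, m, rfl⟩)
    · exact h1
    · exact hΛ Z m
  have := hadj x hx 1 hM1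
  rw [mul_one] at this
  exact hker this

/-- A functional on products of simple poles is a sum over residues. -/
theorem sum_res {ι A B : Type*} [Fintype ι] [DecidableEq ι] [CommRing A] [Algebra R A] [CommRing B] [Algebra R B]
    [Algebra ℚ R] [Algebra ℚ A] [Algebra ℚ B] [IsScalarTower ℚ R A] [IsScalarTower ℚ R B]
    {P : ι → Prop} [DecidablePred P] {L : A →ₗ[R] R} {ρ : B →ₗ[R] R} {t : ι → A} {θ : ι → ι → B}
    {c : ι → ι → R} (hrel : ∀ Z Z', Z ≠ Z' → t Z * t Z' = c Z Z' • t Z + c Z' Z • t Z')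
    (hθ : ∀ Y Z Z', Z ≠ Z' → θ Y Z * θ Y Z' = c Z Z' • θ Y Z + c Z' Z • θ Y Z')
    (h1 : L 1 = 1) (hL : ∀ Z m, m ≠ 0 → L (t Z ^ m) = if P Z then (-1) ^ m else 0)
    (hρ1 : ρ 1 = 0) (hρ : ∀ Y Z m, m ≠ 0 → ρ (θ Y Z ^ m) = if Z = Y then (-1) ^ m else 0)
    {E : Type*} (s : Finset E) (p : E → ℚ[X]) (Z : E → ι) :
    L (∏ e ∈ s, aeval (t (Z e)) (p e)) = algebraMap ℚ R (∏ e ∈ s, (p e).eval 0) +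
      ∑ Y with P Y, ρ (∏ e ∈ s, aeval (θ Y (Z e)) (p e)) := by
  classical
  -- The function, its value at 0 and all its expansions are put into one product algebra. The
  -- generators satisfy the quadratic relations there, and the difference of the two sides is a
  -- functional vanishing on 1 and on powers.
  let T : ι → A × R × (ι → B) := fun Z => (t Z, 0, fun Y => θ Y Z)
  let Λ : A × R × (ι → B) →ₗ[R] R :=
    L ∘ₗ fst R _ _ - (fst R R _ ∘ₗ snd R A _ +
      ∑ Y with P Y, ρ ∘ₗ proj Y ∘ₗ snd R R _ ∘ₗ snd R A _)
  have hmem : ∏ e ∈ s, aeval (T (Z e)) (p e) ∈ adjoin R (Set.range T) := by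
    refine prod_mem fun e _ => ?_
    rw [aeval_eq_sum_range]
    refine sum_mem fun i _ => ?_
    rw [← algebraMap_smul R ((p e).coeff i)]
    exact Subalgebra.smul_mem _ (pow_mem (Algebra.subset_adjoin (Set.mem_range_self (Z e))) i) _
  have key := eq_zero_of_mem_adjoin (c := c) (Λ := Λ) (T := T) (fun Z Z' h => ?_) ?_
    (fun Z m => ?_) hmem
  · have e1 : (∏ e ∈ s, aeval (T (Z e)) (p e)).1 = ∏ e ∈ s, aeval (t (Z e)) (p e) := by
      change AlgHom.fst ℚ A (R × (ι → B)) _ = _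
      rw [map_prod]
      exact prod_congr rfl fun e _ => (aeval_algHom_apply _ _ _).symm
    have e2 : (∏ e ∈ s, aeval (T (Z e)) (p e)).2.1 = algebraMap ℚ R (∏ e ∈ s, (p e).eval 0) := by
      change ((AlgHom.fst ℚ R (ι → B)).comp (AlgHom.snd ℚ A (R × (ι → B)))) _ = _
      rw [map_prod, map_prod]
      refine prod_congr rfl fun e _ => (aeval_algHom_apply _ _ _).symm.trans ?_
      rw [← coeff_zero_eq_eval_zero, Polynomial.coeff_zero_eq_aeval_zero']
      rfl
    have e3 : ∀ Y, (∏ e ∈ s, aeval (T (Z e)) (p e)).2.2 Y = ∏ e ∈ s, aeval (θ Y (Z e)) (p e) := by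
      intro Y
      change ((Pi.evalAlgHom ℚ (fun _ : ι => B) Y).comp
        ((AlgHom.snd ℚ R (ι → B)).comp (AlgHom.snd ℚ A (R × (ι → B))))) _ = _
      rw [map_prod]
      exact prod_congr rfl fun e _ => (aeval_algHom_apply _ _ _).symm
    simp only [Λ, LinearMap.sub_apply, LinearMap.add_apply, LinearMap.comp_apply, LinearMap.fst_apply,
      LinearMap.snd_apply, LinearMap.sum_apply, LinearMap.proj_apply, e1, e2, e3] at key
    exact sub_eq_zero.1 key
  · refine Prod.ext (hrel Z Z' h) (Prod.ext ?_ (funext fun Y => hθ Y Z Z' h))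
    simp [T]
  · simp [Λ, h1, hρ1]
  · simp [Λ, T, hL Z (m + 1) (succ_ne_zero m), hρ _ Z (m + 1) (succ_ne_zero m),
      Finset.sum_ite_eq]

/-- The residue of a product. -/
theorem res_prod {ι E : Type*} [DecidableEq ι] [DecidableEq E] [Algebra ℚ R] (c : ι → ι → R) (Y : ι)
    (s : Finset E) (p : E → ℚ[X]) (Z : E → ι) :
    res (∏ e ∈ s, aeval (theta c Y (Z e)) (p e)) =
      ∑ a ∈ range (∏ e ∈ s with Z e = Y, p e).natDegree, ∑ x ∈ antidiagonal a,
        ∑ κ ∈ finsuppAntidiag (s.filter fun e => Z e ≠ Y) x.1,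
          (-((∏ e ∈ s with Z e = Y, p e).coeff (a + 1) * (-1) ^ x.2)) •
            ∏ e ∈ s with Z e ≠ Y, aeval (c Y (Z e)) (tay (p e) (κ e)) := by
  have e1 : ∏ e ∈ s, aeval (theta c Y (Z e)) (p e) =
      aeval (winv : Lau R) (∏ e ∈ s with Z e = Y, p e) *
        ofPS (∏ e ∈ s with Z e ≠ Y, aeval (psi (c Y (Z e))) (p e)) := by
    rw [← Finset.prod_filter_mul_prod_filter_not s fun e => Z e = Y, map_prod, map_prod]
    congr 1
    · refine prod_congr rfl fun e he => ?_
      rw [(mem_filter.1 he).2, theta_self]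
    · refine prod_congr rfl fun e he => ?_
      rw [theta_of_ne c (mem_filter.1 he).2]
      exact aeval_algHom_apply (ofPS (R := R)).toRatAlgHom _ _
  rw [e1, aeval_eq_sum_range, sum_mul, map_sum, Finset.sum_range_succ']
  have e2 : ∀ j, res ((∏ e ∈ s with Z e = Y, p e).coeff j • winv ^ j *
      ofPS (∏ e ∈ s with Z e ≠ Y, aeval (psi (c Y (Z e))) (p e))) =
      (∏ e ∈ s with Z e = Y, p e).coeff j • res (winv ^ j *
        ofPS (∏ e ∈ s with Z e ≠ Y, aeval (psi (c Y (Z e))) (p e))) := by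
    intro j
    rw [smul_mul_assoc, ← algebraMap_smul R, map_smul, algebraMap_smul]
  simp only [e2, res_winv_pow_mul, succ_ne_zero, if_false, if_true, smul_zero, add_zero,
    Nat.add_sub_cancel]
  refine sum_congr rfl fun a _ => ?_
  rw [PowerSeries.coeff_mul, ← sum_neg_distrib, smul_sum]
  refine sum_congr rfl fun x _ => ?_
  rw [PowerSeries.coeff_prod, coeff_mk, sum_mul, ← sum_neg_distrib,
    smul_sum]
  refine sum_congr rfl fun κ _ => ?_
  simp only [coeff_aeval_psi]
  rw [neg_smul, ← smul_neg, mul_smul]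
  congr 1
  rw [smul_def]
  simp
  ring

end Laurent

/-! ### Gradings of power series -/

section Grading

variable {σ : Type*}

/-- All monomials have degree at least `m`. -/
def GE (δ : (σ →₀ ℕ) →+ ℤ) (m : ℤ) (f : MvPowerSeries σ ℚ) : Prop :=
  ∀ β, coeff β f ≠ 0 → m ≤ δ β

variable {δ : (σ →₀ ℕ) →+ ℤ} {m m' : ℤ} {f g : MvPowerSeries σ ℚ}

theorem GE.mono (h : m ≤ m') (hf : GE δ m' f) : GE δ m f := fun β hβ => h.trans (hf β hβ)

theorem GE.add (hf : GE δ m f) (hg : GE δ m g) : GE δ m (f + g) := fun β hβ => by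
  by_cases h : coeff β f = 0
  · exact hg β fun h' => hβ (by rw [map_add, h, h', add_zero])
  · exact hf β h

theorem GE.smul (c : ℚ) (hf : GE δ m f) : GE δ m (c • f) := fun β hβ =>
  hf β fun h => hβ (by rw [map_smul, h, smul_zero])

theorem GE.zero : GE δ m (0 : MvPowerSeries σ ℚ) := fun β hβ => absurd (map_zero _) hβ

theorem GE.one : GE δ 0 (1 : MvPowerSeries σ ℚ) := fun β hβ => by
  classical
  rw [coeff_one] at hβ
  have : β = 0 := by by_contra h; simp [h] at hβ
  rw [this, map_zero]

theorem GE.mul (hf : GE δ m f) (hg : GE δ m' g) : GE δ (m + m') (f * g) := fun β hβ => by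
  classical
  rw [coeff_mul] at hβ
  obtain ⟨x, hx, hne⟩ := Finset.exists_ne_zero_of_sum_ne_zero hβ
  rw [mem_antidiagonal] at hx
  rw [← hx, map_add]
  exact add_le_add (hf _ (left_ne_zero_of_mul hne)) (hg _ (right_ne_zero_of_mul hne))

theorem GE.prod {ι : Type*} (s : Finset ι) {f : ι → MvPowerSeries σ ℚ} (h : ∀ i ∈ s, GE δ 0 (f i)) :
    GE δ 0 (∏ i ∈ s, f i) := by
  classical
  induction s using induction_on with
  | empty => exact GE.one
  | insert a s ha ih =>
    rw [Finset.prod_insert ha]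
    exact (h a (mem_insert_self _ _)).mul (ih fun i hi => h i (Finset.mem_insert_of_mem hi))

theorem GE.pow (hf : GE δ 0 f) (k : ℕ) : GE δ 0 (f ^ k) := by
  have := GE.prod (range k) fun _ _ => hf
  rwa [Finset.prod_const, Finset.card_range] at this

theorem GE.aeval (hf : GE δ 0 f) (p : ℚ[X]) : GE δ 0 (aeval f p) := by
  rw [aeval_eq_sum_range]
  exact Finset.sum_induction _ (GE δ 0) (fun _ _ => GE.add) GE.zero fun i _ => (hf.pow i).smul _

theorem GE.aeval_of_dvd (hf : GE δ 1 f) {p : ℚ[X]} (hp : X ∣ p) :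
    GE δ 1 (Polynomial.aeval f p) := by
  obtain ⟨r, rfl⟩ := hp
  rw [map_mul, aeval_X]
  simpa using hf.mul ((hf.mono zero_le_one).aeval r)

/-- The geometric series `x / (1 - x)` for a monomial `x`. -/
def geo (α : σ →₀ ℕ) : MvPowerSeries σ ℚ :=
  MvPowerSeries.monomial α 1 * (1 - MvPowerSeries.monomial α 1)⁻¹

theorem geo_mul {α : σ →₀ ℕ} (hα : α ≠ 0) :
    geo α * (1 - MvPowerSeries.monomial α 1) = MvPowerSeries.monomial α (1 : ℚ) := by
  classical
  rw [geo, mul_assoc, MvPowerSeries.inv_mul_cancel, mul_one]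
  rw [map_sub, map_one, ← coeff_zero_eq_constantCoeff_apply,
    coeff_monomial, if_neg hα.symm]
  simp

theorem exists_of_coeff_geo_ne_zero {α : σ →₀ ℕ} (hα : α ≠ 0) (β : σ →₀ ℕ)
    (h : coeff β (geo α) ≠ 0) : ∃ d : ℕ, β = (d + 1) • α := by
  classical
  have hrec : geo α = MvPowerSeries.monomial α 1 + MvPowerSeries.monomial α 1 * geo α := by
    linear_combination geo_mul hα
  induction hβ : β.degree using Nat.strong_induction_on generalizing β with
  | _ n ih =>
    rw [hrec, map_add, coeff_monomial, MvPowerSeries.coeff_monomial_mul] at h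
    by_cases h1 : β = α
    · exact ⟨0, by simp [h1]⟩
    rw [if_neg h1, zero_add] at h
    by_cases h2 : α ≤ β
    · rw [if_pos h2, one_mul] at h
      have h3 : β = (β - α) + α := (tsub_add_cancel_of_le h2).symm
      have h4 : β.degree = (β - α).degree + α.degree := by rw [← map_add, ← h3]
      have h5 : 0 < α.degree := Nat.pos_of_ne_zero fun h0 => hα ((Finsupp.degree_eq_zero_iff _).1 h0)
      obtain ⟨d, hd⟩ := ih _ (by omega) (β - α) h rfl
      exact ⟨d + 1, by rw [h3, hd, ← succ_nsmul]⟩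
    · rw [if_neg h2] at h
      exact absurd rfl h

theorem GE.geo {α : σ →₀ ℕ} (hα : α ≠ 0) (h0 : 0 ≤ δ α) (hm : m ≤ δ α) : GE δ m (geo α) := by
  intro β hβ
  obtain ⟨d, rfl⟩ := exists_of_coeff_geo_ne_zero hα β hβ
  rw [map_nsmul, succ_nsmul, nsmul_eq_mul]
  have : 0 ≤ (d : ℤ) * δ α := by positivity
  omega

variable (δ) in
/-- The series of degree zero. -/
def degZero : Subalgebra ℚ (MvPowerSeries σ ℚ) where
  carrier := {f | GE δ 0 f ∧ GE (-δ) 0 f}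
  mul_mem' h h' := ⟨by simpa using h.1.mul h'.1, by simpa using h.2.mul h'.2⟩
  add_mem' h h' := ⟨h.1.add h'.1, h.2.add h'.2⟩
  algebraMap_mem' c := by
    rw [Algebra.algebraMap_eq_smul_one]
    exact ⟨GE.one.smul c, GE.one.smul c⟩

theorem mem_degZero : f ∈ degZero δ ↔ ∀ β, coeff β f ≠ 0 → δ β = 0 := by
  change GE δ 0 f ∧ GE (-δ) 0 f ↔ _
  constructor
  · rintro ⟨h1, h2⟩ β hβ
    have h3 := h1 β hβ
    have h4 := h2 β hβ
    rw [AddMonoidHom.neg_apply] at h4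
    omega
  · intro h
    refine ⟨fun β hβ => (h β hβ).ge, fun β hβ => ?_⟩
    rw [AddMonoidHom.neg_apply, h β hβ, neg_zero]

/-- The part of degree zero of a series. -/
def partZero (δ : (σ →₀ ℕ) →+ ℤ) (f : MvPowerSeries σ ℚ) : MvPowerSeries σ ℚ :=
  fun β => if δ β = 0 then coeff β f else 0

theorem coeff_partZero (f : MvPowerSeries σ ℚ) (β) :
    coeff β (partZero δ f) = if δ β = 0 then coeff β f else 0 := rfl

variable (δ) in
/-- The part of degree zero of a series, as a linear map. -/
def projZero : MvPowerSeries σ ℚ →ₗ[degZero δ] degZero δ where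
  toFun f := ⟨partZero δ f, mem_degZero.2 fun β hβ => by
    rw [coeff_partZero] at hβ
    by_contra h
    simp [h] at hβ⟩
  map_add' f g := by
    refine Subtype.ext (MvPowerSeries.ext fun β => ?_)
    change coeff β (partZero δ _) = coeff β (partZero δ _ + partZero δ _)
    rw [map_add, coeff_partZero, coeff_partZero, coeff_partZero]
    split_ifs <;> simp
  map_smul' c f := by
    classical
    refine Subtype.ext (MvPowerSeries.ext fun β => ?_)
    change coeff β (partZero δ (c.1 * f)) = coeff β (c.1 * partZero δ f)
    rw [coeff_partZero, coeff_mul, coeff_mul]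
    have hc := mem_degZero.1 c.2
    have key : ∀ x ∈ antidiagonal β, coeff x.1 c.1 *
        coeff x.2 (partZero δ f) =
        if δ β = 0 then coeff x.1 c.1 * coeff x.2 f else 0 := by
      intro x hx
      rw [mem_antidiagonal] at hx
      rw [coeff_partZero]
      by_cases h0 : coeff x.1 c.1 = 0
      · simp [h0]
      · have : δ β = δ x.2 := by rw [← hx, map_add, hc _ h0, zero_add]
        rw [this]; split_ifs <;> simp
    rw [sum_congr rfl key]
    split_ifs <;> simp

theorem coeff_projZero {β : σ →₀ ℕ} (hβ : δ β = 0) (f : MvPowerSeries σ ℚ) :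
    coeff β (projZero δ f : MvPowerSeries σ ℚ) = coeff β f := by
  change coeff β (partZero δ f) = _
  rw [coeff_partZero, if_pos hβ]

theorem projZero_eq_zero (hf : GE δ 1 f) : projZero δ f = 0 := by
  refine Subtype.ext (MvPowerSeries.ext fun β => ?_)
  change coeff β (partZero δ f) = coeff β 0
  rw [coeff_partZero, map_zero, ite_eq_right_iff]
  intro h
  by_contra h'
  have := hf β h'
  omega

theorem projZero_eq_zero' (hf : GE (-δ) 1 f) : projZero δ f = 0 := by
  refine Subtype.ext (MvPowerSeries.ext fun β => ?_)
  change coeff β (partZero δ f) = coeff β 0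
  rw [coeff_partZero, map_zero, ite_eq_right_iff]
  intro h
  by_contra h'
  have := hf β h'
  rw [AddMonoidHom.neg_apply] at this
  omega

theorem projZero_one : projZero δ 1 = 1 := by
  classical
  refine Subtype.ext (MvPowerSeries.ext fun β => ?_)
  change coeff β (partZero δ 1) = coeff β 1
  rw [coeff_partZero, ite_eq_left_iff, coeff_one]
  intro h
  rw [if_neg]
  rintro rfl
  exact h (map_zero δ)

end Grading

variable {N : ℕ}

/-! ### The monomials -/

/-- A product of powers of the variables `w`. -/
def wexp (f : Fin (N + 1) → ℕ) : Var N →₀ ℕ :=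
  ∑ u, Finsupp.single (Trace.Var.w u) (f u)

theorem wexp_apply (f : Fin (N + 1) → ℕ) (u : Fin (N + 1)) : wexp f (.w u) = f u := by
  classical
  rw [wexp, finsetSum_apply, sum_eq_single u]
  · simp
  · intro v _ hv
    rw [single_apply, if_neg]
    simpa using hv
  · simp

theorem wexp_add (f g : Fin (N + 1) → ℕ) : wexp f + wexp g = wexp (f + g) := by
  simp [wexp, ← sum_add_distrib]

theorem wexp_injective {f g : Fin (N + 1) → ℕ} (h : wexp f = wexp g) : f = g := by
  funext u
  rw [← wexp_apply f, h, wexp_apply]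

theorem qyExp_eq (k : ℤ) (e : Fin N → ℤ) :
    qyExp k e = wexp fun u => (lexp k e u).toNat := rfl

/-- The indicator of `u ≤ j`. -/
def ind (u j : Fin (N + 1)) : ℤ := if u ≤ j then 1 else 0

/-- The monomial `q ^ h * w_0 * ⋯ * w_j`. -/
def ymon (j : Fin (N + 1)) (h : ℕ) : Ser N :=
  MvPowerSeries.monomial (wexp fun u => h + (ind u j).toNat) 1

/-- The exponents of `q ^ n * y_j / y_i`. -/
def xexp (i j : Fin (N + 1)) (n : ℤ) : Var N →₀ ℕ :=
  wexp fun u => (n + ind u j - ind u i).toNat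

/-- The Laurent monomial `q ^ n * y_j / y_i` is a product of variables `w`. -/
def IsPos (i j : Fin (N + 1)) (n : ℤ) : Prop := 0 < n ∨ i < j ∧ 0 ≤ n

instance (i j : Fin (N + 1)) (n : ℤ) : Decidable (IsPos i j n) := inferInstanceAs (Decidable (_ ∨ _))

/-- The expansion of `x / (1 - x)` for `x = q ^ n * y_j / y_i`. -/
def pole (i j : Fin (N + 1)) (n : ℤ) : Ser N :=
  if IsPos i j n then geo (xexp i j n) else -1 - geo (xexp j i (-n))

/-- The monomial `q ^ n * y_j / y_i` is not `1`. -/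
def Proper (i j : Fin (N + 1)) (n : ℤ) : Prop := ¬ (i = j ∧ n = 0)

theorem ind_nonneg (u j : Fin (N + 1)) : 0 ≤ ind u j := by unfold ind; split_ifs <;> simp
theorem ind_le_one (u j : Fin (N + 1)) : ind u j ≤ 1 := by unfold ind; split_ifs <;> simp
theorem ind_self (u : Fin (N + 1)) : ind u u = 1 := if_pos le_rfl
theorem ind_mono (u : Fin (N + 1)) {i j} (h : i ≤ j) : ind u i ≤ ind u j := by
  unfold ind
  split_ifs with h1 h2
  · exact le_rfl
  · exact absurd (h1.trans h) h2
  · simp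
  · exact le_rfl

theorem IsPos.nonneg {i j : Fin (N + 1)} {n : ℤ} (h : IsPos i j n) (u) : 0 ≤ n + ind u j - ind u i := by
  have h1 := ind_nonneg u j
  have h2 := ind_le_one u i
  rcases h with h | ⟨h, h0⟩
  · omega
  · have := ind_mono u h.le
    omega

theorem IsPos.symm {i j : Fin (N + 1)} {n : ℤ} (h : ¬ IsPos i j n) (hp : Proper i j n) :
    IsPos j i (-n) := by
  unfold IsPos Proper at *
  push Not at h
  rcases lt_trichotomy i j with h1 | h1 | h1
  · have := h.2 h1
    left; omega
  · have : n ≠ 0 := fun h' => hp ⟨h1, h'⟩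
    left; omega
  · by_cases h2 : n = 0
    · right; exact ⟨h1, by omega⟩
    · left; omega

theorem IsPos.not_symm {i j : Fin (N + 1)} {n : ℤ} (h : IsPos i j n) : ¬ IsPos j i (-n) := by
  unfold IsPos at *
  rintro (h1 | ⟨h1, h2⟩)
  · rcases h with h | ⟨h, h'⟩ <;> omega
  · rcases h with h | ⟨h, h'⟩
    · omega
    · exact lt_asymm h h1

theorem pole_symm {i j : Fin (N + 1)} {n : ℤ} (hp : Proper i j n) : pole i j n = -1 - pole j i (-n) := by
  by_cases h : IsPos i j n
  · rw [pole, if_pos h, pole, if_neg h.not_symm, neg_neg]; ring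
  · rw [pole, if_neg h, pole, if_pos (IsPos.symm h hp)]

theorem pole_loop (i j : Fin (N + 1)) (n : ℤ) : pole i i n = pole j j n := by
  unfold pole xexp IsPos
  simp

theorem xexp_ne_zero {i j : Fin (N + 1)} {n : ℤ} (h : IsPos i j n) : xexp i j n ≠ 0 := by
  intro h0
  have h1 : ∀ u, (n + ind u j - ind u i).toNat = 0 := fun u => by
    have := DFunLike.congr_fun h0 (.w u)
    rwa [xexp, wexp_apply] at this
  have h2 := h1 0
  have h3 := h1 j
  have e1 : ind 0 j = 1 := if_pos (Fin.zero_le _)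
  have e2 : ind 0 i = 1 := if_pos (Fin.zero_le _)
  rw [e1, e2] at h2
  rw [ind_self] at h3
  rcases h with h | ⟨h, h'⟩
  · omega
  · have e3 : ind j i = 0 := if_neg (not_le.2 h)
    rw [e3] at h3
    omega

theorem ymon_injective {i j : Fin (N + 1)} {a b : ℕ} (h : ymon i a = ymon j b) : i = j ∧ a = b := by
  classical
  have h1 : (fun u => a + (ind u i).toNat) = fun u => b + (ind u j).toNat := by
    have h2 := congrArg (coeff (wexp fun u => a + (ind u i).toNat)) h
    rw [ymon, ymon, coeff_monomial, coeff_monomial, if_pos rfl] at h2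
    refine wexp_injective ?_
    by_contra h3
    rw [if_neg h3] at h2
    exact one_ne_zero h2
  have e1 : ∀ i : Fin (N + 1), ind 0 i = 1 := fun i => if_pos (Fin.zero_le _)
  have h2 := congrFun h1 0
  simp only [e1] at h2
  have hab : a = b := by omega
  subst hab
  refine ⟨?_, rfl⟩
  have h3 : ∀ u, ind u i = ind u j := fun u => by
    have := congrFun h1 u
    have k1 := ind_nonneg u i
    have k2 := ind_nonneg u j
    omega
  have h4 := h3 i
  have h5 := h3 j
  rw [ind_self] at h4 h5
  unfold ind at h4 h5
  refine le_antisymm ?_ ?_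
  · by_contra h; simp [h] at h4
  · by_contra h; simp [h] at h5

/-- Both `ymon` monomials carry the same extra factor w_0, so their quotient is q^n y_j / y_i and
the defining equation of x / (1 - x) is stated without denominators. -/
theorem pole_mul {i j : Fin (N + 1)} {n : ℤ} (hp : Proper i j n) {a b : ℕ} (hab : (b : ℤ) - a = n) :
    pole i j n * (ymon i a - ymon j b) = ymon j b := by
  have key : ∀ {i j : Fin (N + 1)} {n : ℤ} {a b : ℕ}, IsPos i j n → (b : ℤ) - a = n →
      geo (xexp i j n) * (ymon i a - ymon j b) = ymon j b := by
    intro i j n a b h hab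
    have h1 : MvPowerSeries.monomial (xexp i j n) (1 : ℚ) * ymon i a = ymon j b := by
      rw [ymon, monomial_mul_monomial, one_mul, xexp, wexp_add, ymon]
      congr 2
      refine congrArg wexp (funext fun u => ?_)
      have h1 := h.nonneg u
      have h2 := ind_nonneg u i
      have h3 := ind_nonneg u j
      simp only [Pi.add_apply]
      omega
    linear_combination ymon i a * geo_mul (xexp_ne_zero h) + (1 + geo (xexp i j n)) * h1
  by_cases h : IsPos i j n
  · rw [pole, if_pos h, key h hab]
  · rw [pole, if_neg h]
    have := key (IsPos.symm h hp) (a := b) (b := a) (by omega)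
    linear_combination this

/-- Partial fractions. -/
theorem partial_fractions {R : Type*} [CommRing R] [IsDomain R] {A B C t t' c c' : R}
    (hAB : B - A ≠ 0) (hAC : C - A ≠ 0) (hBC : C - B ≠ 0) (h1 : t * (B - A) = A)
    (h2 : t' * (C - A) = A) (h3 : c * (C - B) = B) (h4 : c' * (B - C) = C) :
    t * t' = c * t + c' * t' := by
  refine mul_right_cancel₀ (mul_ne_zero (mul_ne_zero hAB hAC) hBC) ?_
  linear_combination (t' * (C - A) * (C - B) - c * (C - A) * (C - B)) * h1 +
    (A * (C - B) - c' * (B - A) * (C - B)) * h2 - A * (C - A) * h3 + A * (B - A) * h4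

/-! ### The degree in one of the variables -/

/-- The degree in `y_v`. -/
def ydeg (v : Fin (N + 1)) : (Var N →₀ ℕ) →+ ℤ where
  toFun α := (α (.w v) : ℤ) - α (.w (v + 1))
  map_zero' := by simp
  map_add' α β := by simp; ring

theorem ind_sub_ind (v j : Fin (N + 1)) :
    ind v j - ind (v + 1) j = (if v = j then 1 else 0) - if v = last N then 1 else 0 := by
  unfold ind
  by_cases h : v = last N
  · subst h
    have : (last N + 1 : Fin (N + 1)) = 0 := by simp
    rw [this, if_pos (Fin.zero_le j), if_pos rfl]
    simp only [Fin.last_le_iff, eq_comm]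
  · have hv : (v + 1 : Fin (N + 1)).val = v.val + 1 := Fin.val_add_one_of_lt (Fin.lt_last_iff_ne_last.2 h)
    rw [if_neg h]
    simp only [Fin.le_def, hv, Fin.ext_iff]
    split_ifs <;> omega

theorem ydeg_wexp (v : Fin (N + 1)) (f) : ydeg v (wexp f) = (f v : ℤ) - f (v + 1) := by
  rw [ydeg, AddMonoidHom.coe_mk, ZeroHom.coe_mk, wexp_apply, wexp_apply]

theorem ydeg_xexp {i j : Fin (N + 1)} {n : ℤ} (h : IsPos i j n) (v : Fin (N + 1)) :
    ydeg v (xexp i j n) = (if v = j then 1 else 0) - if v = i then 1 else 0 := by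
  rw [xexp, ydeg_wexp]
  have h1 := h.nonneg v
  have h2 := h.nonneg (v + 1)
  have h3 := ind_sub_ind v i
  have h4 := ind_sub_ind v j
  rw [Int.toNat_of_nonneg h1, Int.toNat_of_nonneg h2]
  linarith

theorem ydeg_qyExp (v : Fin (N + 1)) (k : ℕ) : ydeg v (qyExp (k : ℤ) 0) = 0 := by
  have : ∀ u, lexp (k : ℤ) (0 : Fin N → ℤ) u = k := by
    intro u
    refine Fin.cases ?_ (fun u => ?_) u <;> simp [lexp]
  rw [qyExp_eq, ydeg_wexp]
  simp [this]

theorem GE_pole {δ : (Var N →₀ ℕ) →+ ℤ} {i j : Fin (N + 1)} {n : ℤ} {m : ℤ} (h : IsPos i j n)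
    (h0 : 0 ≤ m) (hm : m ≤ δ (xexp i j n)) : GE δ m (pole i j n) := by
  rw [pole, if_pos h]
  exact GE.geo (xexp_ne_zero h) (h0.trans hm) hm

theorem pole_mem_degZero {i j v : Fin (N + 1)} (n : ℤ) (hp : Proper i j n) (h : v = i ↔ v = j) :
    pole i j n ∈ degZero (ydeg v) := by
  have key : ∀ {i j : Fin (N + 1)} {n : ℤ}, IsPos i j n → (v = i ↔ v = j) →
      pole i j n ∈ degZero (ydeg v) := by
    intro i j n hpos h
    have h0 : ydeg v (xexp i j n) = 0 := by rw [ydeg_xexp hpos]; simp [h]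
    exact ⟨GE_pole hpos le_rfl h0.ge, GE_pole hpos le_rfl (by simp [h0])⟩
  by_cases hpos : IsPos i j n
  · exact key hpos h
  · rw [pole_symm hp]
    exact sub_mem (neg_mem (one_mem _)) (key (IsPos.symm hpos hp) h.symm)

/-- The values of the projection on powers of a simple pole. -/
theorem projZero_pole_pow {i v : Fin (N + 1)} (hlt : i < v) (h : ℤ) {m : ℕ} (hm : m ≠ 0) :
    projZero (ydeg v) (pole i v (-h) ^ m) =
      if 1 ≤ h then (-1) ^ m else 0 := by
  have hiv := hlt.ne
  obtain ⟨k, rfl⟩ : ∃ k, m = k + 1 := ⟨m - 1, by omega⟩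
  have hp : Proper i v (-h) := fun h' => hiv h'.1
  have hpow : ∀ {δ : (Var N →₀ ℕ) →+ ℤ} {f : Ser N}, GE δ 1 f → GE δ 1 (f ^ (k + 1)) := by
    intro δ f hf
    have := (hf.mono zero_le_one).pow k |>.mul hf
    rwa [zero_add, ← pow_succ] at this
  split_ifs with hc
  · have hpos : IsPos v i (- -h) := by
      rw [neg_neg]
      exact .inl (by omega)
    -- For h ≥ 1 the expansion is in negative powers of y_v, up to the constant -1; hence the
    -- constant term (-1)^m. Otherwise only positive powers of y_v occur.
    rw [pole_symm hp]
    have h1 : GE (-ydeg v) 1 (pole v i (- -h)) := by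
      refine GE_pole hpos zero_le_one ?_
      rw [AddMonoidHom.neg_apply, ydeg_xexp hpos]
      simp [hiv.symm]
    have h2 : ∃ g : Ser N, GE (-ydeg v) 1 g ∧
        (-1 - pole v i (- -h)) ^ (k + 1) = (-1) ^ (k + 1) + g := by
      generalize pole v i (- -h) = T at h1
      refine ⟨(-1 - T) ^ (k + 1) - (-1) ^ (k + 1), ?_, by ring⟩
      have h3 : aeval T ((-1 - X) ^ (k + 1) - (-1) ^ (k + 1) : ℚ[X]) =
        (-1 - T) ^ (k + 1) - (-1) ^ (k + 1) := by simp
      rw [← h3]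
      refine h1.aeval_of_dvd ?_
      rw [X_dvd_iff, coeff_zero_eq_eval_zero]
      simp
    obtain ⟨g, hg, e⟩ := h2
    rw [e, map_add, projZero_eq_zero' hg, add_zero]
    have : ((-1) ^ (k + 1) : Ser N) = ((-1) ^ (k + 1) : degZero (ydeg v)) • (1 : Ser N) := by
      rw [smul_def, mul_one]; simp
    rw [this, map_smul, projZero_one, smul_eq_mul, mul_one]
  · have hpos : IsPos i v (-h) := by
      by_contra hcon
      have := IsPos.symm hcon hp
      rw [neg_neg] at this
      rcases this with h' | ⟨h', h''⟩
      · omega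
      · exact lt_asymm h' hlt
    refine projZero_eq_zero (hpow (GE_pole hpos zero_le_one ?_))
    rw [ydeg_xexp hpos]
    simp [hiv.symm]

section

variable {E : Type*} [DecidableEq E]

/-! ### Contraction of a vertex -/

/-- The constant term of a product of poles attached to the edges of a graph. -/
def cval (S : Finset E) (s t : E → Fin (N + 1)) (g : E → ℚ[X]) (n : E → ℤ)
    (k : ℕ) : ℚ :=
  coeff (qyExp (k : ℤ) 0) (∏ e ∈ S, aeval (pole (s e) (t e) (n e)) (g e))

/-- The edge touches the vertex and is not a loop. -/
def Touch (s t : E → Fin (N + 1)) (v : Fin (N + 1)) (e : E) : Prop :=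
  s e ≠ t e ∧ (s e = v ∨ t e = v)

instance (s t : E → Fin (N + 1)) (v : Fin (N + 1)) : DecidablePred (Touch s t v) := fun _ =>
  inferInstanceAs (Decidable (_ ∧ _))

/-- The edges touching a vertex. -/
def star (S : Finset E) (s t : E → Fin (N + 1)) (v : Fin (N + 1)) : Finset E :=
  S.filter (Touch s t v)

/-- The other end of an edge at `v`. -/
def other (s t : E → Fin (N + 1)) (v : Fin (N + 1)) (e : E) : Fin (N + 1) :=
  if t e = v then s e else t e

/-- The height of the pole of an edge at `v`. -/
def height (t : E → Fin (N + 1)) (v : Fin (N + 1)) (n : E → ℤ) (e : E) : ℤ :=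
  if t e = v then -n e else n e

/-- The factor of an edge at `v` in terms of the simple pole. -/
def inward (t : E → Fin (N + 1)) (v : Fin (N + 1)) (g : E → ℚ[X]) (e : E) :
    ℚ[X] := if t e = v then g e else (g e).comp (-1 - X)

/-- The ends of the edges after contraction of `v` to `i`. -/
def moveTo (v i : Fin (N + 1)) (s : E → Fin (N + 1)) (e : E) : Fin (N + 1) :=
  if s e = v then i else s e

/-- The labels of the edges after contraction of `v` with height `h`. -/
def relabel (s t : E → Fin (N + 1)) (v : Fin (N + 1)) (h : ℤ) (n : E → ℤ) (e : E) : ℤ :=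
  n e + (if t e = v then h else 0) - if s e = v then h else 0

/-- The factors of the edges after contraction of `v`. -/
def refactor (s t : E → Fin (N + 1)) (v : Fin (N + 1)) (g : E → ℚ[X])
    (κ : E →₀ ℕ) (e : E) : ℚ[X] :=
  if Touch s t v e then
    if t e = v then tay (g e) (κ e)
    else (tay ((g e).comp (-1 - X)) (κ e)).comp (-1 - X)
  else g e

theorem aeval_comp_neg {A : Type*} [CommRing A] [Algebra ℚ A] (x : A) (p : ℚ[X]) :
    aeval x (p.comp (-1 - X)) = aeval (-1 - x) p := by
  rw [Polynomial.aeval_comp]; simp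

section

variable {s t : E → Fin (N + 1)} {v : Fin (N + 1)} {n : E → ℤ} {g : E → ℚ[X]}

theorem aeval_pole_touch {e : E} (he : Touch s t v e) :
    aeval (pole (s e) (t e) (n e)) (g e) =
      aeval (pole (other s t v e) v (-height t v n e)) (inward t v g e) := by
  unfold other height inward
  by_cases h : t e = v
  · rw [if_pos h, if_pos h, if_pos h, neg_neg, h]
  · have hs : s e = v := he.2.resolve_right h
    simp only [if_neg h]
    rw [aeval_comp_neg, hs, pole_symm fun h' => h h'.1.symm]

/-- Once v is placed at the point (i, h), the factor of an edge whose pole lies elsewhere depends on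
the difference of the two points. The hypothesis `hne` excludes an edge that would become a loop
labelled 0. -/
theorem aeval_pole_contract {e : E} (he : Touch s t v e) (κ : E →₀ ℕ) {i : Fin (N + 1)}
    {h : ℤ} (hne : (other s t v e, height t v n e) ≠ (i, h)) :
    aeval (pole (moveTo v i s e) (moveTo v i t e) (relabel s t v h n e)) (refactor s t v g κ e) =
      aeval (pole (other s t v e) i (h - height t v n e)) (tay (inward t v g e) (κ e)) := by
  rw [refactor, if_pos he]
  unfold other height inward moveTo relabel at *
  by_cases hv : t e = v
  · have hs : s e ≠ v := fun hs => he.1 (hs.trans hv.symm)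
    simp only [if_pos hv, if_neg hs]
    congr 2
    ring
  · have hs : s e = v := he.2.resolve_right hv
    simp only [if_neg hv, if_pos hs] at hne ⊢
    rw [aeval_comp_neg, pole_symm (i := t e)]
    · congr 3
      ring
    · rintro ⟨h1, h2⟩
      refine hne ?_
      rw [h1, show n e = h by omega]

theorem pole_contract_of_not_touch {e : E} (he : ¬ Touch s t v e) (i : Fin (N + 1)) (h : ℤ) :
    pole (moveTo v i s e) (moveTo v i t e) (relabel s t v h n e) = pole (s e) (t e) (n e) := by
  unfold moveTo relabel
  unfold Touch at he
  by_cases hs : s e = v <;> by_cases ht : t e = v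
  · simp only [if_pos hs, if_pos ht]
    rw [hs, ht, add_sub_cancel_right, pole_loop]
  · exact absurd ⟨fun h => ht (h ▸ hs), .inl hs⟩ he
  · exact absurd ⟨fun h => hs (h ▸ ht), .inr ht⟩ he
  · simp [hs, ht]

end

/-! ### Partial fractions of poles -/

/-- The simple pole `T (A / B)` of two points `q ^ h * y_i`. -/
def frac (A B : Fin (N + 1) × ℤ) : Ser N := pole B.1 A.1 (A.2 - B.2)

theorem frac_add_frac {A B : Fin (N + 1) × ℤ} (h : A ≠ B) : frac A B + frac B A = -1 := by
  unfold frac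
  rw [pole_symm (i := B.1) (j := A.1), neg_sub]
  · ring
  · rintro ⟨h1, h2⟩
    exact h (Prod.ext h1.symm (by omega))

/-- This is `partial_fractions` for three points q^h y_i in the domain of power series. -/
theorem frac_mul_frac {A B C : Fin (N + 1) × ℤ} (hAB : A ≠ B) (hAC : A ≠ C) (hBC : B ≠ C) :
    frac A B * frac A C = frac B C * frac A B + frac C B * frac A C := by
  -- A common shift makes all heights natural numbers without changing any quotient.
  obtain ⟨K, hA, hB, hC⟩ : ∃ K : ℤ, 0 ≤ K + A.2 ∧ 0 ≤ K + B.2 ∧ 0 ≤ K + C.2 :=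
    ⟨|A.2| + |B.2| + |C.2|, by
      have h1 := neg_abs_le A.2
      have h2 := neg_abs_le B.2
      have h3 := neg_abs_le C.2
      have h4 := abs_nonneg A.2
      have h5 := abs_nonneg B.2
      have h6 := abs_nonneg C.2
      refine ⟨?_, ?_, ?_⟩ <;> linarith⟩
  have hpole : ∀ {A B : Fin (N + 1) × ℤ}, A ≠ B → 0 ≤ K + A.2 → 0 ≤ K + B.2 →
      frac A B * (ymon B.1 (K + B.2).toNat - ymon A.1 (K + A.2).toNat) = ymon A.1 (K + A.2).toNat := by
    intro A B h hA hB
    refine pole_mul ?_ ?_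
    · rintro ⟨h1, h2⟩
      exact h (Prod.ext h1.symm (by omega))
    · omega
  have hne : ∀ {A B : Fin (N + 1) × ℤ}, A ≠ B → 0 ≤ K + A.2 → 0 ≤ K + B.2 →
      ymon B.1 (K + B.2).toNat - ymon A.1 (K + A.2).toNat ≠ 0 := by
    intro A B h hA hB h'
    have := ymon_injective (sub_eq_zero.1 h')
    exact h (Prod.ext this.1.symm (by omega))
  have : IsDomain (Ser N) := NoZeroDivisors.to_isDomain _
  exact partial_fractions (hne hAB hA hB) (hne hAC hA hC) (hne hBC hB hC) (hpole hAB hA hB)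
    (hpole hAC hA hC) (hpole hBC hB hC) (hpole hBC.symm hC hB)

instance {R : Type*} [CommRing R] [Algebra ℚ R] : IsScalarTower ℚ R (Lau R) :=
  IsScalarTower.of_algebraMap_eq fun x => by
    change HahnSeries.C (algebraMap ℚ R x) = HahnSeries.C (algebraMap R R (algebraMap ℚ R x))
    rfl

/-- The point at which the pole of an edge at `v` lies. -/
def point (s t : E → Fin (N + 1)) (v : Fin (N + 1)) (n : E → ℤ) (e : E) : Fin (N + 1) × ℤ :=
  (other s t v e, height t v n e)

/-- The edges at `v` with pole at a given point. -/
def fiber (S : Finset E) (s t : E → Fin (N + 1)) (v : Fin (N + 1)) (n : E → ℤ)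
    (Y : Fin (N + 1) × ℤ) : Finset E := (star S s t v).filter fun e => point s t v n e = Y

-- The constant term in y_v is computed by `projZero (ydeg v)`, for which the edges not touching v
-- are scalars. The factors at v are polynomials in simple poles, so `sum_res` and `res_prod` give a
-- sum over the poles with positive height; since v exceeds the other ends, the direction of
-- expansion depends on the height only. The Taylor coefficients are the factors of the contracted
-- graph, and the edge e₀ makes the remaining constant term vanish.
set_option maxHeartbeats 1000000 in
theorem cval_contract {S : Finset E} {s t : E → Fin (N + 1)} {v : Fin (N + 1)} {n : E → ℤ}
    {g : E → ℚ[X]} (hv : ∀ e ∈ star S s t v, other s t v e < v)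
    (hl : ∀ e ∈ S, s e = t e → n e ≠ 0) {e₀ : E} (he₀ : e₀ ∈ S) (ht : t e₀ = v) (hs : s e₀ ≠ v)
    (hX : X ∣ g e₀) (k : ℕ) :
    cval S s t g n k = ∑ Y ∈ ((star S s t v).image (point s t v n)).filter (fun Y => 1 ≤ Y.2),
      ∑ a ∈ range (∏ e ∈ fiber S s t v n Y, inward t v g e).natDegree,
        ∑ x ∈ antidiagonal a,
          ∑ κ ∈ finsuppAntidiag (star S s t v \ fiber S s t v n Y) x.1,
            -((∏ e ∈ fiber S s t v n Y, inward t v g e).coeff (a + 1) * (-1) ^ x.2) *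
              cval (S \ fiber S s t v n Y) (moveTo v Y.1 s) (moveTo v Y.1 t) (refactor s t v g κ)
                (relabel s t v Y.2 n) k := by
  classical
  have hstar : e₀ ∈ star S s t v := mem_filter.2 ⟨he₀, fun h => hs (h.trans ht), .inr ht⟩
  set D := degZero (ydeg v) with hD
  let T := (star S s t v).image (point s t v n)
  have hT : ∀ Z : T, Z.1.1 < v := by
    rintro ⟨Z, hZ⟩
    obtain ⟨e, he, rfl⟩ := mem_image.1 hZ
    exact hv e he
  let Z : E → T := fun e => if h : e ∈ star S s t v then ⟨_, mem_image_of_mem _ h⟩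
    else ⟨_, mem_image_of_mem _ hstar⟩
  have hZ : ∀ e ∈ star S s t v, (Z e).1 = point s t v n e := fun e he => by simp [Z, he]
  have hcD : ∀ Y Z : T, Y ≠ Z → frac Y.1 Z.1 ∈ D := fun Y Z h => by
    refine pole_mem_degZero _ ?_ ?_
    · rintro ⟨h1, h2⟩
      exact h (Subtype.ext (Prod.ext h1.symm (by omega)))
    · exact ⟨fun h => absurd h (hT Z).ne', fun h => absurd h (hT Y).ne'⟩
  -- Only distinct points matter, and for these the value has degree zero in y_v because neither
  -- point lies at v; the default value is never used.
  let c : T → T → D := fun Y Z => if h : frac Y.1 Z.1 ∈ D then ⟨_, h⟩ else 0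
  have hc : ∀ Y Z : T, Y ≠ Z → (c Y Z : Ser N) = frac Y.1 Z.1 := fun Y Z h => by
    simp only [c]
    rw [dif_pos (hcD Y Z h)]
  have hne : ∀ Z : T, ((v, 0) : Fin (N + 1) × ℤ) ≠ Z.1 := fun Z h =>
    (hT Z).ne (congrArg Prod.fst h).symm
  have hne' : ∀ {Z Z' : T}, Z ≠ Z' → Z.1 ≠ Z'.1 := fun h h' => h (Subtype.ext h')
  have hc1 : ∀ Z Z' : T, Z ≠ Z' → c Z Z' + c Z' Z = -1 := fun Z Z' h => by
    refine Subtype.ext ?_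
    rw [AddMemClass.coe_add, hc _ _ h, hc _ _ h.symm, frac_add_frac (hne' h)]
    rfl
  have hc3 : ∀ Y Z Z' : T, Z ≠ Y → Z' ≠ Y → Z ≠ Z' →
      c Y Z * c Y Z' = c Z Z' * c Y Z + c Z' Z * c Y Z' := fun Y Z Z' h1 h2 h3 => by
    refine Subtype.ext ?_
    rw [AddMemClass.coe_add, MulMemClass.coe_mul, MulMemClass.coe_mul, MulMemClass.coe_mul,
      hc _ _ h1.symm, hc _ _ h2.symm, hc _ _ h3, hc _ _ h3.symm]
    exact frac_mul_frac (hne' h1.symm) (hne' h2.symm) (hne' h3)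
  have hsum := sum_res (R := D) (L := projZero (ydeg v)) (ρ := res) (t := fun Z : T => frac (v, 0) Z.1)
    (θ := theta c) (c := c) (P := fun Z : T => 1 ≤ Z.1.2)
    (fun Z Z' h => by
      rw [smul_def, smul_def]
      change _ = (c Z Z' : Ser N) * _ + (c Z' Z : Ser N) * _
      rw [hc _ _ h, hc _ _ h.symm]
      exact frac_mul_frac (hne Z) (hne Z') (hne' h))
    (fun Y Z Z' h => theta_mul_theta hc1 hc3 Y h) projZero_one
    (fun Z m hm => by
      have := projZero_pole_pow (hT Z) Z.1.2 hm
      rw [← zero_sub] at this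
      exact this)
    (by
      have := res_ofPS (1 : D⟦X⟧)
      rwa [map_one] at this)
    (fun Y Z m hm => by
      by_cases h : Z = Y
      · rw [if_pos h, h, theta_self, res_winv_pow hm]
      · rw [if_neg h, theta_of_ne c h, ← map_pow, res_ofPS])
    (star S s t v) (inward t v g) Z
  have hu : ∏ e ∈ S with ¬ Touch s t v e, aeval (pole (s e) (t e) (n e)) (g e) ∈ D := by
    refine prod_mem fun e he => ?_
    obtain ⟨he, hne⟩ := mem_filter.1 he
    have hmem : pole (s e) (t e) (n e) ∈ D := by
      refine pole_mem_degZero _ (fun h => hl e he h.1 h.2) ?_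
      by_cases hst : s e = t e
      · rw [hst]
      · exact ⟨fun h => absurd ⟨hst, .inl h.symm⟩ hne, fun h => absurd ⟨hst, .inr h.symm⟩ hne⟩
    exact Polynomial.aeval_mem_adjoin_singleton ℚ _ |> fun h =>
      Algebra.adjoin_le (Set.singleton_subset_iff.2 hmem) h
  set u : D := ⟨_, hu⟩ with hudef
  have hprod : ∏ e ∈ S, aeval (pole (s e) (t e) (n e)) (g e) =
      u • ∏ e ∈ star S s t v, aeval (frac (v, 0) (Z e).1) (inward t v g e) := by
    rw [smul_def, ← Finset.prod_filter_mul_prod_filter_not S (Touch s t v), mul_comm]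
    refine congrArg (_ * ·) (prod_congr rfl fun e he => ?_)
    rw [aeval_pole_touch (mem_filter.1 he).2, hZ e he]
    unfold frac point
    rw [zero_sub]
  -- The edge e₀ enters v, so its factor is g e₀ itself and vanishes at 0.
  have h0 : (algebraMap ℚ D) (∏ e ∈ star S s t v, (inward t v g e).eval 0) = 0 := by
    rw [Finset.prod_eq_zero hstar, map_zero]
    rw [inward, if_pos ht, ← coeff_zero_eq_eval_zero]
    exact X_dvd_iff.1 hX
  rw [h0, zero_add] at hsum
  rw [cval, hprod, ← coeff_projZero (ydeg_qyExp v k), map_smul, hsum, smul_eq_mul, mul_sum,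
    AddSubmonoidClass.coe_finsetSum, map_sum]
  have hfib : ∀ Y : T, ((star S s t v).filter fun e => Z e = Y) = fiber S s t v n Y.1 := by
    intro Y
    refine Finset.filter_congr fun e he => ?_
    rw [← Subtype.coe_inj, hZ e he]
  have hfib' : ∀ Y : T, ((star S s t v).filter fun e => Z e ≠ Y) =
      star S s t v \ fiber S s t v n Y.1 := by
    intro Y
    rw [← hfib, Finset.filter_not]
  refine (Finset.sum_bij (fun Y _ => Y.1) ?_ ?_ ?_ ?_)
  · intro Y hY
    exact mem_filter.2 ⟨Y.2, (mem_filter.1 hY).2⟩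
  · intro Y _ Y' _ h
    exact Subtype.ext h
  · intro Y hY
    obtain ⟨h1, h2⟩ := mem_filter.1 hY
    exact ⟨⟨Y, h1⟩, mem_filter.2 ⟨mem_univ _, h2⟩, rfl⟩
  · intro Y hY
    rw [res_prod]
    simp only [hfib, hfib', mul_sum, AddSubmonoidClass.coe_finsetSum, map_sum]
    refine sum_congr rfl fun a _ => sum_congr rfl fun x _ =>
      sum_congr rfl fun κ _ => ?_
    rw [mul_smul_comm]
    change coeff _ (_ • (u * ∏ e ∈ star S s t v \ fiber S s t v n Y.1,
      aeval (c Y (Z e)) (tay (inward t v g e) (κ e)) : D).1) = _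
    rw [map_smul, smul_eq_mul]
    congr 1
    rw [cval]
    congr 1
    have hS : S \ fiber S s t v n Y.1 = (S.filter fun e => ¬ Touch s t v e) ∪
        (star S s t v \ fiber S s t v n Y.1) := by
      ext e
      simp only [star, fiber, mem_sdiff, mem_filter, mem_union]
      tauto
    have hdis : Disjoint (S.filter fun e => ¬ Touch s t v e)
        (star S s t v \ fiber S s t v n Y.1) := by
      rw [Finset.disjoint_left]
      intro e he he'
      exact (mem_filter.1 he).2 (mem_filter.1 (mem_sdiff.1 he').1).2
    rw [hS, Finset.prod_union hdis, MulMemClass.coe_mul, hudef]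
    congr 1
    · refine prod_congr rfl fun e he => ?_
      have hnt := (mem_filter.1 he).2
      rw [pole_contract_of_not_touch hnt, refactor, if_neg hnt]
    · rw [SubmonoidClass.coe_finsetProd]
      refine prod_congr rfl fun e he => ?_
      obtain ⟨he, hef⟩ := mem_sdiff.1 he
      have hpt : point s t v n e ≠ Y.1 := fun h => hef (mem_filter.2 ⟨he, h⟩)
      have hYZ : Y ≠ Z e := fun h => hpt (by rw [h, hZ e he])
      rw [aeval_pole_contract (mem_filter.1 he).2 κ hpt]
      have h3 : ((aeval (c Y (Z e)) (tay (inward t v g e) (κ e)) : D) : Ser N) =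
          aeval (c Y (Z e) : Ser N) (tay (inward t v g e) (κ e)) :=
        (aeval_algHom_apply D.val _ _).symm
      rw [h3, hc Y (Z e) hYZ, hZ e he]
      rfl

/-! ### Series in `q` -/

theorem qyExp_zero (k : ℕ) : qyExp (k : ℤ) (0 : Fin N → ℤ) = wexp fun _ => k := by
  have : ∀ u, lexp (k : ℤ) (0 : Fin N → ℤ) u = k := by
    intro u
    refine Fin.cases ?_ (fun u => ?_) u <;> simp [lexp]
  rw [qyExp_eq]
  simp [this]

theorem q_pow (n : ℕ) : Trace.q N ^ n = MvPowerSeries.monomial (wexp fun _ => n) 1 := by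
  have h := qyExp_zero (N := N) 1
  rw [Nat.cast_one] at h
  rw [Trace.q, qy, MvPowerSeries.monomial_pow, one_pow, h]
  congr 2
  ext1 v
  simp [wexp, smul_sum]

theorem hasSubst_q : PowerSeries.HasSubst (Trace.q N) := by
  classical
  refine PowerSeries.HasSubst.of_constantCoeff_zero ?_
  rw [← pow_one (Trace.q N), q_pow, ← coeff_zero_eq_constantCoeff_apply,
    coeff_monomial, if_neg]
  intro h
  have := wexp_apply (fun _ : Fin (N + 1) => 1) 0
  rw [← h] at this
  simp at this

/-- The series in `q`. -/
def qSer : ℚ⟦X⟧ →ₐ[ℚ] Ser N := substAlgHom hasSubst_q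

theorem coeff_qSer (f : ℚ⟦X⟧) (k : ℕ) :
    coeff (qyExp (k : ℤ) 0) (qSer f : Ser N) = PowerSeries.coeff k f := by
  classical
  rw [qSer, coe_substAlgHom, coeff_subst hasSubst_q, finsum_eq_single _ k]
  · rw [q_pow, qyExp_zero, coeff_monomial, if_pos rfl, smul_eq_mul, mul_one]
  · intro d hd
    rw [q_pow, qyExp_zero, coeff_monomial, if_neg, smul_zero]
    intro h
    exact hd (congrFun (wexp_injective h) 0).symm

theorem qSer_X_pow (n : ℕ) : (qSer (PowerSeries.X ^ n) : Ser N) = Trace.q N ^ n := by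
  rw [map_pow, qSer, substAlgHom_X]

theorem qSer_tt {n : ℕ} (hn : 0 < n) (i : Fin (N + 1)) : (qSer (tt n) : Ser N) = pole i i n := by
  have : IsDomain (Ser N) := NoZeroDivisors.to_isDomain _
  have hpos : IsPos i i (n : ℤ) := .inl (by omega)
  have hx : xexp i i n = wexp fun _ => n := by simp [xexp]
  rw [pole, if_pos hpos, hx]
  have h1 := congrArg (qSer (N := N)) (Nested.one_sub_mul_tt hn)
  rw [map_mul, map_sub, map_one, qSer_X_pow, q_pow] at h1
  have h2 := geo_mul (xexp_ne_zero hpos)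
  rw [hx] at h2
  have h3 : (1 : Ser N) - MvPowerSeries.monomial (wexp fun _ => n) 1 ≠ 0 := by
    intro h
    rw [h, zero_mul] at h1
    rw [← h1, sub_zero] at h
    exact one_ne_zero h
  refine mul_left_cancel₀ h3 (h1.trans ?_)
  rw [mul_comm, h2]

theorem qSer_ttZ {n : ℤ} (hn : n ≠ 0) (i : Fin (N + 1)) : (qSer (ttZ n) : Ser N) = pole i i n := by
  rw [ttZ]
  split_ifs with h
  · rw [qSer_tt (by omega : 0 < n.toNat) i, Int.toNat_of_nonneg h]
  · rw [map_sub, map_neg, map_one, qSer_tt (by omega : 0 < (-n).toNat) i,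
      Int.toNat_of_nonneg (by omega : 0 ≤ -n), ← pole_symm (fun h' => hn h'.2)]

/-- A loop carries the monomial q^n whatever its vertex is, so the product is a series in q alone.
-/
theorem cval_of_loops {S : Finset E} {s t : E → Fin (N + 1)} {n : E → ℤ} (g : E → ℚ[X])
    (hl : ∀ e ∈ S, s e = t e) (hn : ∀ e ∈ S, n e ≠ 0) (k : ℕ) :
    cval S s t g n k = PowerSeries.coeff k (∏ e ∈ S, aeval (ttZ (n e)) (g e)) := by
  rw [← coeff_qSer (N := N), cval, map_prod qSer]
  congr 1
  refine prod_congr rfl fun e he => ?_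
  rw [← hl e he, ← qSer_ttZ (hn e he) (s e)]
  exact aeval_algHom_apply qSer _ _

/-! ### Sums over heights of vertices -/

/-- The summation conditions on the heights `η` of the vertices. -/
def Heights (S F : Finset E) (s t : E → Fin (N + 1)) (C : (Fin (N + 1) → ℕ) → Prop) (n : E → ℤ) :
    Set (Fin (N + 1) → ℕ) :=
  {η | C η ∧ ∀ e ∈ S, n e + η (t e) - η (s e) = 0 ↔ e ∈ F}

/-- A set of vertices is closed under the edges. -/
def Closed (S : Finset E) (s t : E → Fin (N + 1)) (A : Set (Fin (N + 1))) : Prop :=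
  ∀ e ∈ S, s e ∈ A ↔ t e ∈ A

/-- No loop is labelled by `0`. -/
def ProperOn (S : Finset E) (s t : E → Fin (N + 1)) (n : E → ℤ) : Prop :=
  ∀ e ∈ S, s e = t e → n e ≠ 0

/-- The number of vertices of nonzero height. -/
def numPos (η : Fin (N + 1) → ℕ) : ℕ := (univ.filter fun v => η v ≠ 0).card

/-- A sum over heights of products over the edges that are not contracted. -/
structure IsHeightSum (S : Finset E) (s t : E → Fin (N + 1)) (g : E → ℚ[X])
    (F : Finset E) (g' : E → ℚ[X]) (C : (Fin (N + 1) → ℕ) → Prop) : Prop where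
  subset : F ⊆ S
  loop : ∀ e ∈ F, s e ≠ t e
  order : Nested.OrderInv C
  zero : ∀ η, C η → η 0 = 0
  exists_zero : ∀ η, C η → ∀ A : Set (Fin (N + 1)), A.Nonempty → Closed S s t A → ∃ u ∈ A, η u = 0
  finite : ∀ n, ProperOn S s t n → (Heights S F s t C n).Finite
  degree : ∀ η, C η → ∑ e ∈ S \ F, (g' e).natDegree + numPos η ≤ ∑ e ∈ S, (g e).natDegree
  X_dvd : ∀ e ∈ S \ F, X ∣ g e → X ∣ g' e
  kd_dvd : ∀ e ∈ S \ F, X * (1 + X) ∣ g e →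
    X * (1 + X) ∣ g' e

/-- The span of the sums over heights. -/
def heightSpan (S : Finset E) (s t : E → Fin (N + 1)) (g : E → ℚ[X]) :
    Submodule ℚ ({n : E → ℤ // ProperOn S s t n} → ℕ → ℚ) :=
  Submodule.span ℚ {Φ | ∃ F g' C, IsHeightSum S s t g F g' C ∧ Φ = fun n k =>
    ∑ᶠ η ∈ Heights S F s t C n.1, PowerSeries.coeff k
      (∏ e ∈ S \ F, aeval (ttZ (n.1 e + η (t e) - η (s e))) (g' e))}

section Contract

variable {S F : Finset E} {s t : E → Fin (N + 1)} {v i : Fin (N + 1)} {n : E → ℤ} {g : E → ℚ[X]}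

theorem height_eq_iff {e : E} (he : Touch s t v e) (η : Fin (N + 1) → ℕ) :
    n e + η (t e) - η (s e) = 0 ↔ height t v n e = η v - η (other s t v e) := by
  unfold height other
  by_cases h : t e = v
  · rw [if_pos h, if_pos h, h]; omega
  · rw [if_neg h, if_neg h, he.2.resolve_right h]; omega

/-- With h the height of v above i, the lengths of edges in the contracted graph, where v has been
forgotten, agree with the original ones. -/
theorem relabel_add_sub (hi : i ≠ v) {h : ℤ} {η : Fin (N + 1) → ℕ} (hη : h = η v - η i) (e : E) :
    relabel s t v h n e + (update η v 0 (moveTo v i t e) : ℕ) -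
      (update η v 0 (moveTo v i s e) : ℕ) = n e + η (t e) - η (s e) := by
  unfold relabel moveTo
  by_cases h1 : s e = v <;> by_cases h2 : t e = v <;>
    simp [h1, h2, update_of_ne, hi] <;> omega

theorem moveTo_ne (hi : i ≠ v) (e : E) : moveTo v i s e ≠ v := by
  unfold moveTo
  split_ifs with h
  · exact hi
  · exact h

theorem natDegree_comp_neg_le (p : ℚ[X]) :
    (p.comp (-1 - X)).natDegree ≤ p.natDegree := by
  refine Polynomial.natDegree_comp_le.trans ?_
  have : (-1 - X : ℚ[X]).natDegree ≤ 1 := by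
    have : (-1 - X : ℚ[X]) = -(X + Polynomial.C 1) := by
      rw [C_1]; ring
    rw [this, natDegree_neg]
    exact (natDegree_X_add_C 1).le
  exact (Nat.mul_le_mul_left _ this).trans (mul_one _).le

theorem natDegree_inward_le (e : E) : (inward t v g e).natDegree ≤ (g e).natDegree := by
  unfold inward
  split_ifs
  · exact le_rfl
  · exact natDegree_comp_neg_le _

theorem natDegree_refactor_le (κ : E →₀ ℕ) (e : E) : (refactor s t v g κ e).natDegree ≤
    (g e).natDegree + if Touch s t v e then κ e else 0 := by
  unfold refactor
  split_ifs
  · exact natDegree_tay_le _ _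
  · refine (natDegree_comp_neg_le _).trans ((natDegree_tay_le _ _).trans ?_)
    gcongr
    exact natDegree_comp_neg_le _
  · simp

theorem one_add_X_dvd_comp {p : ℚ[X]} (h : X ∣ p) :
    1 + X ∣ p.comp (-1 - X) := by
  obtain ⟨r, rfl⟩ := h
  rw [mul_comp, X_comp]
  exact Dvd.intro (-r.comp (-1 - X)) (by ring)

theorem X_dvd_comp {p : ℚ[X]} (h : 1 + X ∣ p) :
    X ∣ p.comp (-1 - X) := by
  obtain ⟨r, rfl⟩ := h
  rw [mul_comp, Polynomial.add_comp, Polynomial.one_comp, X_comp]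
  exact Dvd.intro (-r.comp (-1 - X)) (by ring)

theorem X_dvd_refactor (κ : E →₀ ℕ) {e : E} (h : X ∣ g e) :
    X ∣ refactor s t v g κ e := by
  unfold refactor
  split_ifs
  · exact X_dvd_tay h _
  · exact X_dvd_comp (one_add_X_dvd_tay (one_add_X_dvd_comp h) _)
  · exact h

/-- X and 1 + X are coprime, and Taylor coefficients inherit divisibility by either; reversing an
edge exchanges the two. -/
theorem kd_dvd_refactor (κ : E →₀ ℕ) {e : E} (h : X * (1 + X) ∣ g e) :
    X * (1 + X) ∣ refactor s t v g κ e := by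
  have hc : IsCoprime (X : ℚ[X]) (1 + X) := ⟨-1, 1, by ring⟩
  refine hc.mul_dvd (X_dvd_refactor κ (dvd_of_mul_right_dvd h)) ?_
  have h := dvd_of_mul_left_dvd h
  unfold refactor
  split_ifs
  · exact one_add_X_dvd_tay h _
  · exact one_add_X_dvd_comp (X_dvd_tay (X_dvd_comp h) _)
  · exact h

/-- The edges of `F` are the edges from `v` to a common point. -/
def Contracts (S F : Finset E) (s t : E → Fin (N + 1)) (v : Fin (N + 1)) (e₁ : E) (n : E → ℤ) : Prop :=
  1 ≤ height t v n e₁ ∧ fiber S s t v n (point s t v n e₁) = F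

/-- An edge that becomes a loop labelled 0 had its pole at the point of contraction, hence belongs
to F and has been removed. -/
theorem Contracts.properOn {e₁ : E} (hi : i = other s t v e₁) (h : Contracts S F s t v e₁ n)
    (hn : ProperOn S s t n) : ProperOn (S \ F) (moveTo v i s) (moveTo v i t)
      (relabel s t v (height t v n e₁) n) := by
  intro e he hst h0
  obtain ⟨he, heF⟩ := mem_sdiff.1 he
  by_cases hloop : s e = t e
  · refine hn e he hloop ?_
    unfold relabel at h0
    rw [hloop] at h0
    omega
  · refine heF ?_
    rw [← h.2]
    have ht : Touch s t v e := by
      refine ⟨hloop, ?_⟩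
      by_contra hc
      push Not at hc
      unfold moveTo at hst
      rw [if_neg hc.1, if_neg hc.2] at hst
      exact hloop hst
    refine mem_filter.2 ⟨mem_filter.2 ⟨he, ht⟩, ?_⟩
    unfold point
    rw [Prod.mk.injEq, ← hi]
    unfold moveTo at hst
    unfold relabel at h0
    unfold other
    rw [height]
    by_cases h1 : t e = v
    · have h2 : s e ≠ v := fun h2 => hloop (h2.trans h1.symm)
      rw [if_pos h1] at hst h0
      rw [if_neg h2] at hst h0
      rw [if_pos h1, if_pos h1]
      exact ⟨hst, by omega⟩
    · have h2 : s e = v := ht.2.resolve_right h1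
      rw [if_neg h1] at hst h0
      rw [if_pos h2] at hst h0
      rw [if_neg h1, if_neg h1]
      exact ⟨hst.symm, by omega⟩

theorem numPos_le (η : Fin (N + 1) → ℕ) (v : Fin (N + 1)) :
    numPos η ≤ numPos (update η v 0) + 1 := by
  unfold numPos
  refine (Finset.card_le_card (t := insert v (univ.filter fun u =>
    update η v 0 u ≠ 0)) fun u hu => ?_).trans (Finset.card_insert_le _ _)
  rw [Finset.mem_insert, mem_filter]
  by_cases h : u = v
  · exact .inl h
  · rw [update_of_ne h]
    exact .inr (mem_filter.1 hu)

/-- The condition on heights after undoing a contraction. -/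
def lift (v i : Fin (N + 1)) (C : (Fin (N + 1) → ℕ) → Prop) (η : Fin (N + 1) → ℕ) : Prop :=
  C (update η v 0) ∧ η i < η v

theorem OrderInv.lift {C : (Fin (N + 1) → ℕ) → Prop} (h : Nested.OrderInv C) :
    Nested.OrderInv (lift v i C) := by
  intro P P' h1 h2 ⟨h3, h4⟩
  refine ⟨h _ _ (fun x y => ?_) (fun x => ?_) h3, (h1 i v).1 h4⟩
  · by_cases hx : x = v <;> by_cases hy : y = v
    · simp [hx, hy]
    · subst hx
      rw [update_self, update_self, update_of_ne hy,
        update_of_ne hy]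
      have := h2 y
      omega
    · subst hy
      rw [update_self, update_self]
      simp
    · rw [update_of_ne hx, update_of_ne hx, update_of_ne hy,
        update_of_ne hy]
      exact h1 x y
  · by_cases hx : x = v
    · simp [hx]
    · rw [update_of_ne hx, update_of_ne hx]
      exact h2 x

variable {e₁ : E} {F' : Finset E} {C : (Fin (N + 1) → ℕ) → Prop}

/-- An edge between v and i has height η v - η i exactly when it lies in F ∪ F'. Edges of F' are not
loops after the contraction, so they do not join v and i; hence F is the whole fiber. -/
theorem contracts_of_mem_heights (hF : F ⊆ star S s t v) (he₁ : e₁ ∈ F)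
    (hall : ∀ e ∈ F, other s t v e = i) (hloop : ∀ e ∈ F', moveTo v i s e ≠ moveTo v i t e)
    {η : Fin (N + 1) → ℕ} (hη : η ∈ Heights S (F ∪ F') s t (lift v i C) n) :
    Contracts S F s t v e₁ n ∧ height t v n e₁ = η v - η i := by
  have hh : ∀ e ∈ star S s t v, other s t v e = i →
      (height t v n e = η v - η i ↔ e ∈ F ∪ F') := fun e he ho => by
    rw [← ho, ← height_eq_iff (mem_filter.1 he).2]
    exact hη.2 e (mem_filter.1 he).1
  have h1 := (hh e₁ (hF he₁) (hall e₁ he₁)).2 (Finset.mem_union_left _ he₁)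
  have h2 := hη.1.2
  refine ⟨⟨by omega, ?_⟩, h1⟩
  ext e
  unfold fiber point
  rw [mem_filter, Prod.mk.injEq, hall e₁ he₁, h1]
  constructor
  · rintro ⟨he, ho, hhe⟩
    refine (mem_union.1 ((hh e he ho).1 hhe)).resolve_right fun heF' => hloop e heF' ?_
    unfold other at ho
    unfold moveTo
    obtain ⟨hne, ht⟩ := (mem_filter.1 he).2
    by_cases h : t e = v
    · rw [if_pos h] at ho
      rw [if_pos h, if_neg (fun h' => hne (h'.trans h.symm)), ho]
    · rw [if_neg h] at ho
      rw [if_neg h, if_pos (ht.resolve_right h), ho]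
  · intro he
    exact ⟨hF he, hall e he, (hh e (hF he) (hall e he)).2 (Finset.mem_union_left _ he)⟩

/-- The inverse map places v at height η i + h, where h is the height of the contracted edges. -/
theorem bijOn_heights (hF : F ⊆ star S s t v) (he₁ : e₁ ∈ F) (hiv : i ≠ v)
    (hall : ∀ e ∈ F, other s t v e = i) (hloop : ∀ e ∈ F', moveTo v i s e ≠ moveTo v i t e)
    (hv : ∀ η, C η → η v = 0) (hc : Contracts S F s t v e₁ n) :
    Set.BijOn (fun η => update η v 0) (Heights S (F ∪ F') s t (lift v i C) n)
      (Heights (S \ F) F' (moveTo v i s) (moveTo v i t) C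
        (relabel s t v (height t v n e₁) n)) := by
  refine ⟨fun η hη => ?_, fun η hη η' hη' h => ?_, fun η hη => ?_⟩
  · obtain ⟨-, h1⟩ := contracts_of_mem_heights hF he₁ hall hloop hη
    refine ⟨hη.1.1, fun e he => ?_⟩
    obtain ⟨he, heF⟩ := mem_sdiff.1 he
    rw [relabel_add_sub hiv h1, hη.2 e he, mem_union, or_iff_right heF]
  · obtain ⟨-, h1⟩ := contracts_of_mem_heights hF he₁ hall hloop hη
    obtain ⟨-, h2⟩ := contracts_of_mem_heights hF he₁ hall hloop hη'
    have h3 : ∀ u, u ≠ v → η u = η' u := fun u hu => by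
      have := congrFun h u
      simpa [hu] using this
    funext u
    by_cases hu : u = v
    · subst hu
      have := h3 i hiv
      omega
    · exact h3 u hu
  · have hup : update (update η v (η i + (height t v n e₁).toNat)) v 0 = η := by
      rw [Function.update_idem, ← hv η hη.1, Function.update_eq_self]
    have hh : height t v n e₁ = (update η v (η i + (height t v n e₁).toNat) v : ℕ) -
        (update η v (η i + (height t v n e₁).toNat) i : ℕ) := by
      rw [update_self, update_of_ne hiv]
      have := hc.1
      omega
    refine ⟨_, ⟨⟨?_, ?_⟩, fun e he => ?_⟩, hup⟩
    · rw [hup]; exact hη.1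
    · have := hc.1
      omega
    · by_cases heF : e ∈ F
      · have := (mem_filter.1 (hF heF)).2
        rw [height_eq_iff this, hall e heF, ← hh]
        simp only [mem_union, heF, true_or, iff_true]
        rw [← hc.2] at heF
        exact congrArg Prod.snd (mem_filter.1 heF).2
      · rw [← relabel_add_sub hiv hh e, hup, hη.2 e (mem_sdiff.2 ⟨he, heF⟩), mem_union,
          or_iff_right heF]

end Contract

section Contract

variable {S F : Finset E} {s t : E → Fin (N + 1)} {v i : Fin (N + 1)} {g : E → ℚ[X]}
  {e₁ : E} {F' : Finset E} {C : (Fin (N + 1) → ℕ) → Prop} {g' : E → ℚ[X]}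

/-- A vertex touched by no edge is a closed set on its own. -/
theorem IsHeightSum.untouched (h : IsHeightSum S s t g F g' C) {v : Fin (N + 1)}
    (hs : ∀ e ∈ S, s e ≠ v) (ht : ∀ e ∈ S, t e ≠ v) {η : Fin (N + 1) → ℕ} (hη : C η) : η v = 0 := by
  obtain ⟨u, hu, h0⟩ := h.exists_zero η hη {v} (Set.singleton_nonempty v)
    fun e he => by simp [hs e he, ht e he]
  rwa [Set.mem_singleton_iff.1 hu] at h0

/-- By `hκ` the degrees gained through Taylor expansion are at least one less than the degree lost
with F. The spare unit pays for v, the only vertex whose height may become positive. -/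
theorem IsHeightSum.lift (hF : F ⊆ star S s t v) (he₁ : e₁ ∈ F) (hiv : i ≠ v)
    (hall : ∀ e ∈ F, other s t v e = i) (hv0 : v ≠ 0) {κ : E →₀ ℕ}
    (hκ : ∑ e ∈ star S s t v \ F, κ e + 1 ≤ ∑ e ∈ F, (g e).natDegree)
    (h : IsHeightSum (S \ F) (moveTo v i s) (moveTo v i t) (refactor s t v g κ) F' g' C) :
    IsHeightSum S s t g (F ∪ F') g' (lift v i C) := by
  have hFS : F ⊆ S := hF.trans (Finset.filter_subset _ _)
  have hv : ∀ η, C η → η v = 0 := fun η hη =>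
    h.untouched (fun e _ => moveTo_ne hiv e) (fun e _ => moveTo_ne hiv e) hη
  have hsd : S \ (F ∪ F') = (S \ F) \ F' := by
    ext e; simp only [mem_sdiff, mem_union]; tauto
  refine ⟨?_, ?_, OrderInv.lift h.order, ?_, ?_, ?_, ?_, ?_, ?_⟩
  · exact Finset.union_subset hFS (h.subset.trans Finset.sdiff_subset)
  · intro e he
    rcases mem_union.1 he with he | he
    · exact (mem_filter.1 (hF he)).2.1
    · intro hst
      refine h.loop e he ?_
      unfold moveTo
      rw [hst]
  · intro η hη
    have := h.zero _ hη.1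
    rwa [update_of_ne hv0.symm] at this
  · intro η hη A hA hcl
    have hiA : v ∈ A ↔ i ∈ A := by
      have h1 := hcl e₁ (hFS he₁)
      have h2 := hall e₁ he₁
      unfold other at h2
      by_cases ht : t e₁ = v
      · rw [if_pos ht] at h2
        rw [← ht, ← h1, h2]
      · rw [if_neg ht] at h2
        rw [← (mem_filter.1 (hF he₁)).2.2.resolve_right ht, h1, h2]
    have hmv : ∀ (f : E → Fin (N + 1)) e, moveTo v i f e ∈ A \ {v} ↔ f e ∈ A := by
      intro f e
      unfold moveTo
      split_ifs with hf
      · rw [hf, hiA]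
        exact ⟨fun h => h.1, fun h => ⟨h, hiv⟩⟩
      · exact ⟨fun h => h.1, fun h => ⟨h, hf⟩⟩
    obtain ⟨u, hu, h0⟩ := h.exists_zero _ hη.1 (A \ {v}) (by
      obtain ⟨u, hu⟩ := hA
      by_cases huv : u = v
      · exact ⟨i, hiA.1 (huv ▸ hu), hiv⟩
      · exact ⟨u, hu, huv⟩) fun e he => by
        rw [hmv, hmv]
        exact hcl e (mem_sdiff.1 he).1
    exact ⟨u, hu.1, by rwa [update_of_ne hu.2] at h0⟩
  · intro n hn
    by_cases hc : Contracts S F s t v e₁ n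
    · exact (bijOn_heights hF he₁ hiv hall h.loop hv hc).finite_iff_finite.2
        (h.finite _ (hc.properOn (hall e₁ he₁).symm hn))
    · convert Set.finite_empty
      refine Set.eq_empty_of_forall_notMem fun η hη => hc ?_
      exact (contracts_of_mem_heights hF he₁ hall h.loop hη).1
  · intro η hη
    have h1 := h.degree _ hη.1
    have h2 := numPos_le η v
    have h3 : ∑ e ∈ S \ F, (refactor s t v g κ e).natDegree ≤
        ∑ e ∈ S \ F, (g e).natDegree + ∑ e ∈ star S s t v \ F, κ e := by
      refine (Finset.sum_le_sum fun e _ => natDegree_refactor_le κ e).trans ?_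
      rw [sum_add_distrib, ← Finset.sum_filter]
      refine Nat.add_le_add_left (le_of_eq (sum_congr ?_ fun _ _ => rfl)) _
      ext e
      simp only [star, mem_filter, mem_sdiff]
      tauto
    rw [hsd, ← Finset.sum_sdiff hFS]
    omega
  · rw [hsd]
    exact fun e he hX => h.X_dvd e he (X_dvd_refactor κ hX)
  · rw [hsd]
    exact fun e he hX => h.kd_dvd e he (kd_dvd_refactor κ hX)

-- Extension by zero needs no new kind of sum: if the labels do not satisfy `Contracts`, the lifted
-- set of heights is empty.
open Classical in
theorem mem_heightSpan_of_contract (hF : F ⊆ star S s t v) (he₁ : e₁ ∈ F) (hiv : i ≠ v)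
    (hall : ∀ e ∈ F, other s t v e = i) (hv0 : v ≠ 0) {κ : E →₀ ℕ}
    (hκ : ∑ e ∈ star S s t v \ F, κ e + 1 ≤ ∑ e ∈ F, (g e).natDegree)
    {Ψ : {n // ProperOn (S \ F) (moveTo v i s) (moveTo v i t) n} → ℕ → ℚ}
    (hΨ : Ψ ∈ heightSpan (S \ F) (moveTo v i s) (moveTo v i t) (refactor s t v g κ)) :
    (fun n k => if hc : Contracts S F s t v e₁ n.1 then
      Ψ ⟨_, hc.properOn (hall e₁ he₁).symm n.2⟩ k else 0) ∈ heightSpan S s t g := by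
  unfold heightSpan at hΨ
  induction hΨ using span_induction with
  | mem Ψ hΨ =>
    obtain ⟨F', g', C, h, rfl⟩ := hΨ
    refine subset_span ⟨F ∪ F', g', Residue.lift v i C, h.lift hF he₁ hiv hall hv0 hκ, ?_⟩
    have hsd : S \ (F ∪ F') = (S \ F) \ F' := by
      ext e; simp only [mem_sdiff, mem_union]; tauto
    have hv : ∀ η, C η → η v = 0 := fun η hη =>
      h.untouched (fun e _ => moveTo_ne hiv e) (fun e _ => moveTo_ne hiv e) hη
    funext n k
    split_ifs with hc
    · symm
      refine finsum_mem_eq_of_bijOn _ (bijOn_heights hF he₁ hiv hall h.loop hv hc) fun η hη => ?_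
      have h1 := (contracts_of_mem_heights hF he₁ hall h.loop hη).2
      rw [hsd]
      congr 1
      refine prod_congr rfl fun e _ => ?_
      rw [relabel_add_sub hiv h1]
    · have : Heights S (F ∪ F') s t (Residue.lift v i C) n.1 = ∅ :=
        Set.eq_empty_of_forall_notMem fun η hη => hc
          (contracts_of_mem_heights hF he₁ hall h.loop hη).1
      rw [this, finsum_mem_empty]
  | zero =>
    convert Submodule.zero_mem _ using 1
    funext n k
    split_ifs <;> rfl
  | add Ψ Ψ' _ _ h1 h2 =>
    convert add_mem h1 h2 using 1
    funext n k
    simp only [Pi.add_apply]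
    split_ifs <;> simp
  | smul c Ψ _ h1 =>
    convert smul_mem _ c h1 using 1
    funext n k
    simp only [Pi.smul_apply]
    split_ifs <;> simp

end Contract

/-- Every set of vertices without `0` that has an outgoing edge has an incoming edge. -/
def Balanced (S : Finset E) (s t : E → Fin (N + 1)) : Prop :=
  ∀ A : Set (Fin (N + 1)), 0 ∉ A → (∃ e ∈ S, s e ∈ A ∧ t e ∉ A) → ∃ e ∈ S, s e ∉ A ∧ t e ∈ A

/-- Apply balance to the preimage of A under the contraction. Edges of F have both ends in it or
none, so the entering edge is not removed. -/
theorem Balanced.contract {S F : Finset E} {s t : E → Fin (N + 1)} {v i : Fin (N + 1)}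
    (h : Balanced S s t) (hF : F ⊆ star S s t v) (hall : ∀ e ∈ F, other s t v e = i) (hv0 : v ≠ 0) :
    Balanced (S \ F) (moveTo v i s) (moveTo v i t) := by
  intro A hA ⟨e, he, h1, h2⟩
  obtain ⟨e', he', h1, h2⟩ := h {u | (if u = v then i else u) ∈ A}
    (by simpa [hv0.symm] using hA) ⟨e, (mem_sdiff.1 he).1, h1, h2⟩
  refine ⟨e', mem_sdiff.2 ⟨he', fun heF => ?_⟩, h1, h2⟩
  have ho := hall e' heF
  have hst := (mem_filter.1 (hF heF)).2
  simp only [Set.mem_ofPred_eq] at h1 h2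
  unfold other at ho
  by_cases ht : t e' = v
  · have hs : s e' ≠ v := fun hs => hst.1 (hs.trans ht.symm)
    rw [if_pos ht] at ho h2
    rw [if_neg hs, ho] at h1
    exact h1 h2
  · rw [if_neg ht] at ho h2
    rw [if_pos (hst.2.resolve_right ht), ← ho] at h1
    exact h1 h2

theorem isHeightSum_empty {S : Finset E} {s t : E → Fin (N + 1)} (g : E → ℚ[X]) :
    IsHeightSum S s t g ∅ g fun η => ∀ u, η u = 0 := by
  refine ⟨Finset.empty_subset _, by simp, fun P P' _ h2 h x => (h2 x).1 (h x), fun η h => h 0,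
    fun η h A hA _ => hA.imp fun u hu => ⟨hu, h u⟩, fun n _ => ?_, fun η h => ?_, fun _ _ h => h,
    fun _ _ h => h⟩
  · refine (Set.finite_singleton (0 : Fin (N + 1) → ℕ)).subset fun η hη => ?_
    exact funext hη.1
  · simp [numPos, h]

/-- Constant terms of products of poles as sums over heights. -/
theorem cval_mem_heightSpan (S : Finset E) (s t : E → Fin (N + 1)) (g : E → ℚ[X])
    (hX : ∀ e ∈ S, X ∣ g e) (hB : Balanced S s t) :
    (fun n k => cval S s t g n.1 k) ∈ heightSpan S s t g := by
  classical
  -- M bounds the vertices of all edges that are not loops; the vertex M - 1 is contracted at each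
  -- step until only loops are left.
  suffices H : ∀ (M : ℕ) (S : Finset E) (s t : E → Fin (N + 1)) (g : E → ℚ[X]),
      (∀ e ∈ S, X ∣ g e) → Balanced S s t →
      (∀ e ∈ S, s e ≠ t e → (s e).val < M ∧ (t e).val < M) →
      (fun n k => cval S s t g n.1 k) ∈ heightSpan S s t g from
    H (N + 1) S s t g hX hB fun e _ _ => ⟨(s e).2, (t e).2⟩
  intro M
  induction M with
  | zero =>
    intro S s t g hX hB hM
    have hl : ∀ e ∈ S, s e = t e := fun e he => by
      by_contra h
      exact absurd (hM e he h).1 (Nat.not_lt_zero _)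
    refine subset_span ⟨∅, g, _, isHeightSum_empty g, ?_⟩
    funext n k
    rw [cval_of_loops g hl (fun e he => n.2 e he (hl e he))]
    have hH : Heights S ∅ s t (fun η => ∀ u, η u = 0) n.1 = {0} := by
      ext η
      simp only [Set.mem_singleton_iff]
      refine ⟨fun h => funext h.1, ?_⟩
      rintro rfl
      refine ⟨fun _ => rfl, fun e he => ?_⟩
      simp [n.2 e he (hl e he)]
    rw [hH, finsum_mem_singleton, Finset.sdiff_empty]
    simp
  | succ M ih =>
    intro S s t g hX hB hM
    by_cases hex : ∃ e ∈ S, s e ≠ t e ∧ ((s e).val = M ∨ (t e).val = M)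
    swap
    · refine ih S s t g hX hB fun e he hst => ?_
      have h1 := hM e he hst
      have h2 : (s e).val ≠ M := fun h => hex ⟨e, he, hst, .inl h⟩
      have h3 : (t e).val ≠ M := fun h => hex ⟨e, he, hst, .inr h⟩
      omega
    obtain ⟨v, hvM, e', he', hst', hv'⟩ : ∃ v : Fin (N + 1), v.val = M ∧ ∃ e ∈ S, s e ≠ t e ∧
        (s e = v ∨ t e = v) := by
      obtain ⟨e, he, hst, h | h⟩ := hex
      · exact ⟨s e, h, e, he, hst, .inl rfl⟩
      · exact ⟨t e, h, e, he, hst, .inr rfl⟩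
    have hlt : ∀ e ∈ star S s t v, other s t v e < v := by
      intro e he
      obtain ⟨he, hst, hv⟩ := mem_filter.1 he
      have h1 := hM e he hst
      rw [Fin.lt_def, hvM]
      unfold other
      split_ifs with ht
      · have : (s e).val ≠ M := fun h => hst (ht ▸ Fin.ext (h.trans hvM.symm))
        omega
      · have : (t e).val ≠ M := fun h => ht (Fin.ext (h.trans hvM.symm))
        omega
    have hv0 : v ≠ 0 := by
      rintro rfl
      exact absurd (hlt e' (mem_filter.2 ⟨he', hst', hv'⟩)) (Fin.not_lt_zero _)
    -- If the known edge at v leaves v, balance applied to the set {v} supplies an entering one.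
    obtain ⟨e₀, he₀, hs₀, ht₀⟩ : ∃ e ∈ S, s e ≠ v ∧ t e = v := by
      rcases hv' with h | h
      · have := hB {v} hv0.symm ⟨e', he', h, fun h' => hst' (h.trans (Set.mem_singleton_iff.1 h').symm)⟩
        exact this
      · exact ⟨e', he', fun h' => hst' (h'.trans h.symm), h⟩
    let G : Finset E → Fin (N + 1) × ℤ → (E → ℤ) → ℕ → ℚ := fun F Y n k =>
      ∑ a ∈ range (∏ e ∈ F, inward t v g e).natDegree,
        ∑ x ∈ antidiagonal a,
          ∑ κ ∈ finsuppAntidiag (star S s t v \ F) x.1,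
            -((∏ e ∈ F, inward t v g e).coeff (a + 1) * (-1) ^ x.2) *
              cval (S \ F) (moveTo v Y.1 s) (moveTo v Y.1 t) (refactor s t v g κ)
                (relabel s t v Y.2 n) k
    -- The poles depend on the labels, so they are grouped by the set F of edges that share a pole;
    -- the range of F does not depend on the labels.
    have hmain : (fun (n : {n : E → ℤ // ProperOn S s t n}) k => cval S s t g n.1 k) =
        ∑ F ∈ (star S s t v).powerset, fun (n : {n : E → ℤ // ProperOn S s t n}) k =>
          ∑ Y ∈ ((star S s t v).image (point s t v n.1)).filter (fun Y => 1 ≤ Y.2),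
            if fiber S s t v n.1 Y = F then G F Y n.1 k else 0 := by
      funext n k
      rw [cval_contract hlt n.2 he₀ ht₀ hs₀ (hX e₀ he₀), Finset.sum_apply, Finset.sum_apply,
        Finset.sum_comm]
      refine sum_congr rfl fun Y _ => ?_
      rw [Finset.sum_ite_eq, if_pos (Finset.mem_powerset.2
        (show fiber S s t v n.1 Y ⊆ _ from Finset.filter_subset _ _))]
    rw [hmain]
    refine sum_mem fun F hF => ?_
    rw [Finset.mem_powerset] at hF
    have hzero : ∀ ψ : {n : E → ℤ // ProperOn S s t n} → ℕ → ℚ, (∀ n k, ψ n k = 0) →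
        ψ ∈ heightSpan S s t g := fun ψ h => by
      convert Submodule.zero_mem _
      funext n k
      exact h n k
    by_cases hne : F.Nonempty
    swap
    · refine hzero _ fun n k => sum_eq_zero fun Y hY => if_neg fun h => hne ?_
      obtain ⟨e, he, rfl⟩ := mem_image.1 (mem_filter.1 hY).1
      exact h ▸ ⟨e, mem_filter.2 ⟨he, rfl⟩⟩
    obtain ⟨e₁, he₁⟩ := hne
    by_cases hall : ∀ e ∈ F, other s t v e = other s t v e₁
    swap
    · refine hzero _ fun n k => sum_eq_zero fun Y hY => if_neg fun h => hall fun e he => ?_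
      have h1 : ∀ e ∈ F, point s t v n.1 e = Y := fun e he => by
        rw [← h] at he
        exact (mem_filter.1 he).2
      exact congrArg Prod.fst ((h1 e he).trans (h1 e₁ he₁).symm)
    have hiv : other s t v e₁ ≠ v := (hlt e₁ (hF he₁)).ne
    have hφ : (fun (n : {n : E → ℤ // ProperOn S s t n}) k =>
        ∑ Y ∈ ((star S s t v).image (point s t v n.1)).filter (fun Y => 1 ≤ Y.2),
            if fiber S s t v n.1 Y = F then G F Y n.1 k else 0) =
        ∑ a ∈ range (∏ e ∈ F, inward t v g e).natDegree,
        ∑ x ∈ antidiagonal a,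
          ∑ κ ∈ finsuppAntidiag (star S s t v \ F) x.1,
            (-((∏ e ∈ F, inward t v g e).coeff (a + 1) * (-1) ^ x.2)) •
              fun (n : {n : E → ℤ // ProperOn S s t n}) k =>
                if hc : Contracts S F s t v e₁ n.1 then
                  (fun (n : {n // ProperOn (S \ F) (moveTo v (other s t v e₁) s)
                    (moveTo v (other s t v e₁) t) n}) k =>
                    cval (S \ F) (moveTo v (other s t v e₁) s) (moveTo v (other s t v e₁) t)
                      (refactor s t v g κ) n.1 k) ⟨_, hc.properOn rfl n.2⟩ k
                else 0 := by
      funext n k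
      simp only [Finset.sum_apply, Pi.smul_apply, smul_eq_mul]
      have hpt : ∀ Y, fiber S s t v n.1 Y = F → Y = point s t v n.1 e₁ := fun Y h => by
        rw [← h] at he₁
        exact (mem_filter.1 he₁).2.symm
      by_cases hc : Contracts S F s t v e₁ n.1
      · rw [sum_eq_single (point s t v n.1 e₁) (fun Y _ hY => if_neg fun h => hY (hpt Y h))
          (fun h => absurd (mem_filter.2 ⟨mem_image_of_mem (point s t v n.1) (hF he₁), hc.1⟩ :
            point s t v n.1 e₁ ∈ ((star S s t v).image (point s t v n.1)).filter fun Y => 1 ≤ Y.2) h),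
          if_pos hc.2]
        simp only [dif_pos hc]
        rfl
      · simp only [dif_neg hc, mul_zero, Finset.sum_const_zero]
        refine sum_eq_zero fun Y hY => if_neg fun h => hc ?_
        obtain rfl := hpt Y h
        exact ⟨(mem_filter.1 hY).2, h⟩
    rw [hφ]
    refine sum_mem fun a ha => sum_mem fun x hx => Submodule.sum_mem _
      fun κ hκ => smul_mem _ _ ?_
    refine mem_heightSpan_of_contract hF he₁ hiv hall hv0 ?_ (ih _ _ _ _ ?_ ?_ ?_)
    · rw [Finset.mem_finsuppAntidiag] at hκ
      rw [mem_antidiagonal] at hx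
      have h1 := mem_range.1 ha
      have h2 := Polynomial.natDegree_prod_le F (inward t v g)
      have h3 : ∑ e ∈ F, (inward t v g e).natDegree ≤ ∑ e ∈ F, (g e).natDegree :=
        Finset.sum_le_sum fun e _ => natDegree_inward_le e
      have h4 : ∑ e ∈ star S s t v \ F, κ e = x.1 := hκ.1
      omega
    · exact fun e he => X_dvd_refactor κ (hX e (mem_sdiff.1 he).1)
    · exact hB.contract hF hall hv0
    · intro e he hst
      obtain ⟨he, -⟩ := mem_sdiff.1 he
      have hne : s e ≠ t e := fun h => hst (by unfold moveTo; rw [h])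
      have h1 := hM e he hne
      have h2 : (other s t v e₁).val < M := hvM ▸ hlt e₁ (hF he₁)
      have h3 : ∀ f : E → Fin (N + 1), (f e).val < M + 1 → (moveTo v (other s t v e₁) f e).val < M := by
        intro f hf
        unfold moveTo
        split_ifs with h
        · exact h2
        · have : (f e).val ≠ M := fun h' => h (Fin.ext (h'.trans hvM.symm))
          omega
      exact ⟨h3 s h1.1, h3 t h1.2⟩

/-- Count minus the degree in the variables of A. As no edge enters A, every pole has nonnegative
degree, and the factor of a leaving edge has degree at least 1, so there is no constant term. -/
theorem cval_eq_zero_of_not_balanced {S : Finset E} {s t : E → Fin (N + 1)} {g : E → ℚ[X]}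
    {n : E → ℤ} (hpos : ∀ e ∈ S, IsPos (s e) (t e) (n e)) (hX : ∀ e ∈ S, X ∣ g e)
    (hB : ¬ Balanced S s t) (k : ℕ) : cval S s t g n k = 0 := by
  classical
  unfold Balanced at hB
  push Not at hB
  obtain ⟨A, -, ⟨e₀, he₀, hs₀, ht₀⟩, hin⟩ := hB
  let δ : (Var N →₀ ℕ) →+ ℤ := -∑ v with v ∈ A, ydeg v
  have hδ : ∀ e ∈ S, δ (xexp (s e) (t e) (n e)) = (if s e ∈ A then 1 else 0) -
      if t e ∈ A then 1 else 0 := fun e he => by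
    simp only [δ, AddMonoidHom.neg_apply, AddMonoidHom.finsetSum_apply, ydeg_xexp (hpos e he),
      sum_sub_distrib, Finset.sum_ite_eq', mem_filter, mem_univ, true_and]
    ring
  have hge : ∀ e ∈ S, GE δ 0 (aeval (pole (s e) (t e) (n e)) (g e)) := fun e he => by
    refine GE.aeval (GE_pole (hpos e he) le_rfl ?_) _
    rw [hδ e he]
    by_cases h1 : t e ∈ A
    · rw [if_pos h1, if_pos (by by_contra h; exact hin e he h h1)]; simp
    · rw [if_neg h1]
      split_ifs <;> simp
  have hprod : GE δ 1 (∏ e ∈ S, aeval (pole (s e) (t e) (n e)) (g e)) := by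
    rw [← Finset.mul_prod_erase _ _ he₀, ← add_zero (1 : ℤ)]
    refine GE.mul (GE.aeval_of_dvd (GE_pole (hpos e₀ he₀) zero_le_one ?_) (hX e₀ he₀))
      (GE.prod _ fun e he => hge e (Finset.mem_of_mem_erase he))
    rw [hδ e₀ he₀, if_pos hs₀, if_neg ht₀]
    simp
  by_contra h
  have := hprod _ h
  simp [δ, AddMonoidHom.neg_apply, AddMonoidHom.finsetSum_apply, ydeg_qyExp] at this

/-! ### From heights to positions. -/

section Place

variable {s t : E → Fin (N + 1)} {ε : E → ℕ} {F : Finset E} {C : (Fin (N + 1) → ℕ) → Prop}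

/-- The conditions on the positions of vertices and edges in a sum over heights. -/
def Place (s t : E → Fin (N + 1)) (ε : E → ℕ) (F : Finset E) (C : (Fin (N + 1) → ℕ) → Prop)
    (P : Fin (N + 1) ⊕ E → ℕ) : Prop :=
  C (P ∘ Sum.inl) ∧ (∀ e, P (.inl (t e)) ≤ P (.inr e) ∧ (ε e ≠ 0 → P (.inl (t e)) < P (.inr e))) ∧
    ∀ e, P (.inr e) = P (.inl (s e)) ↔ e ∈ F

theorem orderInv_place (hC : Nested.OrderInv C) : Nested.OrderInv (Place s t ε F C) := by
  rintro P P' h1 h2 ⟨h3, h4, h5⟩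
  refine ⟨hC _ _ (fun x y => h1 _ _) (fun x => h2 _) h3, fun e => ⟨?_, fun he => ?_⟩, fun e => ?_⟩
  · rw [← not_lt, ← h1, not_lt]
    exact (h4 e).1
  · rw [← h1]
    exact (h4 e).2 he
  · rw [← h5]
    have k1 := h1 (.inr e) (.inl (s e))
    have k2 := h1 (.inl (s e)) (.inr e)
    omega

/-- The labels of the edges. -/
def label (ε m : E → ℕ) (e : E) : ℤ := (m e + ε e : ℕ)

variable [Fintype E] {g g' : E → ℚ[X]}

/-- If some vertex reaches r, an edge enters the set of vertices that do, by balance or because a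
closed set contains a vertex of height 0; its position is at least r and its source is below r. If
no vertex does, an edge position does, and its source lies below. Such an edge is not in F, where
the arcs have length 0. -/
theorem Place.cover (h : IsHeightSum univ s t g F g' C) (hB : Balanced univ s t)
    {P : Fin (N + 1) ⊕ E → ℕ} (hP : Place s t ε F C P) {r : ℕ} (hr : 1 ≤ r) (hx : ∃ x, r ≤ P x) :
    ∃ j : {e // e ∉ F}, P (.inl (s j.1)) < r ∧ r ≤ P (.inr j.1) := by
  have key : ∀ e, P (.inl (s e)) < r → r ≤ P (.inr e) →
      ∃ j : {e // e ∉ F}, P (.inl (s j.1)) < r ∧ r ≤ P (.inr j.1) := fun e h1 h2 =>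
    ⟨⟨e, fun he => by have := (hP.2.2 e).2 he; omega⟩, h1, h2⟩
  by_cases hv : ∃ v, r ≤ P (.inl v)
  · let A : Set (Fin (N + 1)) := {v | r ≤ P (.inl v)}
    have h0 : (0 : Fin (N + 1)) ∉ A := fun h0 => by
      have h1 : P (.inl 0) = 0 := h.zero _ hP.1
      have h2 : r ≤ P (.inl 0) := h0
      omega
    have hin : ∃ e ∈ (univ : Finset E), s e ∉ A ∧ t e ∈ A := by
      by_contra hno
      obtain ⟨u, hu, hu0⟩ := h.exists_zero _ hP.1 A hv fun e _ => by
        constructor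
        · intro hs
          by_contra ht
          exact hno (hB A h0 ⟨e, mem_univ _, hs, ht⟩)
        · intro ht
          by_contra hs
          exact hno ⟨e, mem_univ _, hs, ht⟩
      have h1 : r ≤ P (.inl u) := hu
      have h2 : P (.inl u) = 0 := hu0
      omega
    obtain ⟨e, -, hs, ht⟩ := hin
    have ht : r ≤ P (.inl (t e)) := ht
    exact key e (not_le.1 hs) (ht.trans (hP.2.1 e).1)
  · push Not at hv
    obtain ⟨x | e, hx⟩ := hx
    · exact absurd hx (not_le.2 (hv x))
    · exact key e (hv _) hx

-- Replacing the label of e by the position η (t e) + label turns lengths into differences of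
-- positions, and labels can be recovered from positions. Positions beyond k contribute nothing to
-- the coefficient of q^k by `Place.cover`, so any cut-off D > k gives the same sum.
open Classical in
theorem sum_heights_eq (h : IsHeightSum univ s t g F g' C) (hst : ∀ e, s e ≠ t e)
    (hε : ∀ e, ε e ≤ 1) (hX : ∀ e, X ∣ g e) (hB : Balanced univ s t) {k D : ℕ}
    (hk : k < D) :
    ∑ m ∈ piFinset (fun _ : E => range D),
      ∑ᶠ η ∈ Heights univ F s t C (label ε m), PowerSeries.coeff k
        (∏ e ∈ univ \ F, aeval (ttZ (label ε m e + η (t e) - η (s e))) (g' e)) =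
    ∑ P ∈ piFinset (fun _ : Fin (N + 1) ⊕ E => range (k + 1)),
      if Place s t ε F C P then PowerSeries.coeff k (arcProd (J := {e // e ∉ F})
        (fun j => .inr j.1) (fun j => .inl (s j.1)) (fun j => g' j.1) P) else 0 := by
  have hfin : ∀ m : E → ℕ, (Heights univ F s t C (label ε m)).Finite := fun m =>
    h.finite _ fun e _ he => absurd he (hst e)
  simp only [fun m : E → ℕ => finsum_mem_eq_finite_toFinset_sum
    (fun η : Fin (N + 1) → ℕ => PowerSeries.coeff k
        (∏ e ∈ univ \ F, aeval (ttZ (label ε m e + η (t e) - η (s e))) (g' e))) (hfin m)]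
  rw [Finset.sum_sigma', ← Finset.sum_filter]
  have hprod : ∀ (m : E → ℕ) (η : Fin (N + 1) → ℕ),
      ∏ e ∈ univ \ F, aeval (ttZ (label ε m e + η (t e) - η (s e))) (g' e) =
      arcProd (J := {e // e ∉ F}) (fun j => .inr j.1) (fun j => .inl (s j.1)) (fun j => g' j.1)
        (Sum.elim η fun e => η (t e) + m e + ε e) := fun m η => by
    rw [arcProd, Finset.prod_subtype (p := fun e => e ∉ F) _ (fun e => by simp)]
    refine prod_congr rfl fun j _ => ?_
    simp only [Sum.elim_inl, Sum.elim_inr, label]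
    congr 3
    push_cast
    ring
  have hplace : ∀ (m : E → ℕ) (η : Fin (N + 1) → ℕ), η ∈ Heights univ F s t C (label ε m) →
      Place s t ε F C (Sum.elim η fun e => η (t e) + m e + ε e) := fun m η hη => by
    refine ⟨hη.1, fun e => ⟨?_, fun he => ?_⟩, fun e => ?_⟩
    · simp only [Sum.elim_inl, Sum.elim_inr]; omega
    · simp only [Sum.elim_inl, Sum.elim_inr]; omega
    · rw [← hη.2 e (mem_univ _)]
      simp only [Sum.elim_inl, Sum.elim_inr, label]; omega
  refine Finset.sum_bij_ne_zero (fun x _ _ => Sum.elim x.2 fun e => x.2 (t e) + x.1 e + ε e) ?_ ?_ ?_ ?_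
  · rintro ⟨m, η⟩ hx hne
    simp only [mem_sigma, Set.Finite.mem_toFinset] at hx
    have hP := hplace m η hx.2
    rw [mem_filter, mem_piFinset]
    refine ⟨fun x => mem_range.2 (Nat.lt_succ_of_le ?_), hP⟩
    by_contra hlt
    rw [not_le] at hlt
    refine hne ?_
    simp only [hprod]
    refine PowerSeries.X_pow_dvd_iff.1 (Nested.X_pow_dvd_arcProd_of_lt (x := x) (fun j => ?_) ?_) k hlt
    · exact h.X_dvd j.1 (by simpa using j.2) (hX j.1)
    · exact fun r hr hrx => hP.cover h hB hr ⟨x, hrx⟩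
  · rintro ⟨m, η⟩ hx _ ⟨m', η'⟩ hx' _ heq
    have h1 : η = η' := funext fun v => congrFun heq (.inl v)
    subst h1
    have h2 : m = m' := funext fun e => by
      have := congrFun heq (.inr e)
      simp only [Sum.elim_inr] at this
      omega
    rw [h2]
  · intro P hP hne
    rw [mem_filter, mem_piFinset] at hP
    obtain ⟨hPr, hC, hle, hF⟩ := hP
    have he : ∀ e, P (.inl (t e)) + ε e ≤ P (.inr e) := fun e => by
      have h1 := hle e
      have h2 := hε e
      by_cases h0 : ε e = 0
      · omega
      · have := h1.2 h0
        omega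
    have hPe : (Sum.elim (P ∘ Sum.inl) fun e => (P ∘ Sum.inl) (t e) +
        (P (.inr e) - P (.inl (t e)) - ε e) + ε e) = P := by
      funext x
      rcases x with v | e
      · rfl
      · have := he e
        simp only [Sum.elim_inr, comp_apply]
        omega
    refine ⟨⟨fun e => P (.inr e) - P (.inl (t e)) - ε e, P ∘ Sum.inl⟩, ?_, ?_, hPe⟩
    · rw [mem_sigma, mem_piFinset, Set.Finite.mem_toFinset]
      refine ⟨fun e => mem_range.2 ?_, hC, fun e _ => ?_⟩
      · have := mem_range.1 (hPr (.inr e))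
        simp only
        omega
      · rw [← hF e]
        have := he e
        simp only [label, comp_apply]
        omega
    · simp only [hprod]
      rw [hPe]
      exact hne
  · rintro ⟨m, η⟩ hx hne
    simp only [hprod]

/-- Sums of constant terms of products of poles over all labels. -/
theorem exists_sum_cval (hst : ∀ e, s e ≠ t e) (hε : ∀ e, ε e ≤ 1) (hpos : ∀ e, ε e = 0 → s e < t e)
    (hX : ∀ e, X ∣ g e) {𝒮 : Submodule ℚ ℚ⟦X⟧}
    (H : Balanced univ s t → ∀ F g' C, IsHeightSum univ s t g F g' C →
      EvSum 𝒮 (Place s t ε F C) (arcProd (J := {e // e ∉ F})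
        (fun j => .inr j.1) (fun j => .inl (s j.1)) (fun j => g' j.1))) :
    ∃ f ∈ 𝒮, ∀ k D, k < D → ∑ m ∈ piFinset (fun _ : E => range D),
      cval univ s t g (label ε m) k = PowerSeries.coeff k f := by
  classical
  by_cases hB : Balanced univ s t
  · have hprop : ∀ n : E → ℤ, ProperOn univ s t n := fun n e _ he => absurd he (hst e)
    suffices h : ∀ Ψ ∈ heightSpan univ s t g, ∃ f ∈ 𝒮, ∀ k D, k < D →
        ∑ m ∈ piFinset (fun _ : E => range D), Ψ ⟨label ε m, hprop _⟩ k =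
          PowerSeries.coeff k f from
      h _ (cval_mem_heightSpan univ s t g (fun e _ => hX e) hB)
    intro Ψ hΨ
    unfold heightSpan at hΨ
    induction hΨ using span_induction with
    | mem Ψ hΨ =>
      obtain ⟨F, g', C, h, rfl⟩ := hΨ
      obtain ⟨f, hf, hf'⟩ := H hB F g' C h
      refine ⟨f, hf, fun k D hk => ?_⟩
      rw [← hf' k (k + 1) (lt_succ_self k)]
      refine (sum_heights_eq h hst hε hX hB hk).trans (sum_congr ?_ fun _ _ => rfl)
      congr!
    | zero => exact ⟨0, zero_mem _, fun k D _ => by simp⟩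
    | add Ψ Ψ' _ _ h1 h2 =>
      obtain ⟨f, hf, hf'⟩ := h1
      obtain ⟨f₂, hf₂, hf₂'⟩ := h2
      refine ⟨f + f₂, add_mem hf hf₂, fun k D hk => ?_⟩
      rw [map_add, ← hf' k D hk, ← hf₂' k D hk, ← sum_add_distrib]
      rfl
    | smul c Ψ _ h1 =>
      obtain ⟨f, hf, hf'⟩ := h1
      refine ⟨c • f, smul_mem _ _ hf, fun k D hk => ?_⟩
      rw [map_smul, ← hf' k D hk, smul_sum]
      rfl
  · refine ⟨0, zero_mem _, fun k D _ => ?_⟩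
    rw [map_zero]
    refine sum_eq_zero fun m _ => cval_eq_zero_of_not_balanced (fun e _ => ?_)
      (fun e _ => hX e) hB k
    unfold IsPos label
    have h1 := hε e
    by_cases h0 : ε e = 0
    · exact .inr ⟨hpos e h0, by omega⟩
    · exact .inl (by omega)

/-- All vertices are tied to 0 by assumption. An edge in F sits at the place of its source, and any
other edge is linked to its source by its arc. -/
theorem place_conn {F : Finset E} {P : Fin (N + 1) ⊕ E → ℕ} (hP : Place s t ε F C P)
    (f : Fin (N + 1) ⊕ E → ℕ) (h1 : ∀ x y, P x = P y → f x = f y)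
    (h2 : ∀ j : {e // e ∉ F}, f (.inr j.1) = f (.inl (s j.1)))
    (h3 : ∀ v ∈ univ.map ⟨(Sum.inl : Fin (N + 1) → Fin (N + 1) ⊕ E), Sum.inl_injective⟩,
      f v = f (.inl 0)) (x) : f x = f (.inl 0) := by
  have h4 : ∀ v, f (.inl v) = f (.inl 0) := fun v =>
    h3 _ (Finset.mem_map.2 ⟨v, mem_univ _, rfl⟩)
  rcases x with v | e
  · exact h4 v
  · by_cases he : e ∈ F
    · rw [h1 _ _ ((hP.2.2 e).2 he), h4]
    · rw [h2 ⟨e, he⟩, h4]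

theorem place_weight (h : IsHeightSum univ s t g F g' C) {P : Fin (N + 1) ⊕ E → ℕ}
    (hP : Place s t ε F C P) :
    ∑ j : {e // e ∉ F}, (g' j.1).natDegree +
      ((univ.map ⟨(Sum.inl : Fin (N + 1) → Fin (N + 1) ⊕ E), Sum.inl_injective⟩).filter
        fun v => P v ≠ 0).card ≤ ∑ e, (g e).natDegree := by
  refine le_trans (le_of_eq ?_) (h.degree _ hP.1)
  rw [Finset.sum_subtype (p := fun e => e ∉ F) (univ \ F) (fun e => by simp), Finset.filter_map,
    Finset.card_map]
  rfl

theorem exists_sum_cval_BD (hst : ∀ e, s e ≠ t e) (hε : ∀ e, ε e ≤ 1)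
    (hpos : ∀ e, ε e = 0 → s e < t e) (hX : ∀ e, X ∣ g e) {W : ℕ}
    (hW : ∑ e, (g e).natDegree ≤ W) :
    ∃ f ∈ BD W, ∀ k D, k < D → ∑ m ∈ piFinset (fun _ : E => range D),
      cval univ s t g (label ε m) k = PowerSeries.coeff k f := by
  classical
  refine exists_sum_cval hst hε hpos hX fun hB F g' C h => ?_
  refine Nested.sum_arcProd_mem (orderInv_place h.order) (o := .inl 0)
    (S := univ.map ⟨Sum.inl, Sum.inl_injective⟩) (fun P hP => h.zero _ hP.1)
    (fun j => h.X_dvd j.1 (by simpa using j.2) (hX j.1)) (fun P hP j hj => j.2 ((hP.2.2 _).1 hj))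
    (fun P hP => place_conn hP) (fun P hP r hr hx => hP.cover h hB hr hx)
    (fun P hP => (place_weight h hP).trans hW)

theorem exists_sum_cval_qBD (hst : ∀ e, s e ≠ t e) (hε : ∀ e, ε e ≤ 1)
    (hpos : ∀ e, ε e = 0 → s e < t e) (hX : ∀ e, X * (1 + X) ∣ g e) {W : ℕ}
    (hW : ∑ e, (g e).natDegree ≤ W) :
    ∃ f ∈ qBD W, ∀ k D, k < D → ∑ m ∈ piFinset (fun _ : E => range D),
      cval univ s t g (label ε m) k = PowerSeries.coeff k f := by
  classical
  refine exists_sum_cval hst hε hpos (fun e => dvd_of_mul_right_dvd (hX e)) fun hB F g' C h => ?_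
  refine Nested.evSum_arcProd_kd (orderInv_place h.order) (o := .inl 0)
    (S := univ.map ⟨Sum.inl, Sum.inl_injective⟩) ?_ ?_ ?_ ?_ ?_
  · exact fun j => h.kd_dvd j.1 (by simpa using j.2) (hX j.1)
  · exact fun P hP => h.zero _ hP.1
  · exact fun P hP => place_conn hP
  · intro P hP r hr hx
    obtain ⟨j, hj⟩ := hP.cover h hB hr hx
    exact ⟨j, .inl hj⟩
  · exact fun P hP => (place_weight h hP).trans hW

end Place

end

/-! ### Substitution into power series of one variable -/

section Subst

variable {σ : Type*}

/-- As G has no constant term, its powers from the M-th on have order above the degree of β. -/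
theorem coeff_subst_eq_aeval (p : ℚ⟦X⟧) {G : MvPowerSeries σ ℚ}
    (hG : constantCoeff G = 0) {β : σ →₀ ℕ} {M : ℕ} (hM : β.degree < M) :
    coeff β (p.subst G) = coeff β (aeval G (trunc M p)) := by
  rw [coeff_subst (PowerSeries.HasSubst.of_constantCoeff_zero hG),
    Polynomial.aeval_eq_sum_range' (n := M) ?_, map_sum,
    finsum_eq_sum_of_support_subset (s := range M)]
  rotate_left
  rotate_left
  · obtain ⟨M, rfl⟩ : ∃ M', M = M' + 1 := ⟨M - 1, by omega⟩
    exact PowerSeries.natDegree_trunc_lt p M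
  · refine sum_congr rfl fun d hd => ?_
    rw [coeff_trunc, if_pos (mem_range.1 hd), map_smul]
  · intro d hd
    rw [Finset.coe_range, Set.mem_Iio]
    by_contra hlt
    refine hd ?_
    simp only
    rw [MvPowerSeries.coeff_of_lt_order, smul_zero]
    refine lt_of_lt_of_le ?_ (MvPowerSeries.le_order_pow_of_constantCoeff_eq_zero d hG)
    exact_mod_cast hM.trans_le (not_lt.1 hlt)

variable (wt : σ → ℕ)

/-- The Euler derivation for given weights of the variables. -/
def euler : Derivation ℚ (MvPowerSeries σ ℚ) (MvPowerSeries σ ℚ) :=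
  Derivation.mk'
    { toFun := fun F β => (weight wt β : ℚ) * coeff β F
      map_add' := fun F G => by
        funext β
        change _ * coeff β (F + G) = _ + _
        rw [map_add, mul_add]
      map_smul' := fun c F => by
        funext β
        change _ * coeff β (c • F) = c * _
        rw [map_smul, smul_eq_mul, mul_left_comm] } (fun F G => by
    classical
    refine MvPowerSeries.ext fun β => ?_
    change (weight wt β : ℚ) * coeff β (F * G) = _
    rw [smul_eq_mul, smul_eq_mul, map_add, coeff_mul, mul_comm G, coeff_mul,
      coeff_mul, mul_sum, ← sum_add_distrib]
    refine sum_congr rfl fun x hx => ?_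
    rw [← mem_antidiagonal.1 hx, map_add]
    change _ = _ * (_ * coeff x.2 G) + (_ * coeff x.1 F) * _
    push_cast
    ring)

theorem coeff_euler (β : σ →₀ ℕ) (F : MvPowerSeries σ ℚ) :
    coeff β (euler wt F) = (weight wt β : ℚ) * coeff β F := rfl

/-- The chain rule for polynomials, applied coefficientwise to truncations of p that are long
enough. -/
theorem euler_subst (p : ℚ⟦X⟧) {G : MvPowerSeries σ ℚ} (hG : constantCoeff G = 0) :
    euler wt (p.subst G) = (PowerSeries.derivative ℚ p).subst G * euler wt G := by
  classical
  refine MvPowerSeries.ext fun β => ?_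
  have h1 : trunc (β.degree + 1) (PowerSeries.derivative ℚ p) =
      Polynomial.derivative (trunc (β.degree + 2) p) := by
    ext d
    rw [coeff_trunc, Polynomial.coeff_derivative, coeff_trunc,
      PowerSeries.coeff_derivative]
    split_ifs <;> first | rfl | omega | simp
  rw [coeff_euler, coeff_subst_eq_aeval p hG (show β.degree < β.degree + 2 by omega), ← coeff_euler,
    Derivation.map_aeval, smul_eq_mul, ← h1, coeff_mul, coeff_mul]
  refine sum_congr rfl fun x hx => ?_
  rw [coeff_subst_eq_aeval _ hG]
  have := congrArg Finsupp.degree (mem_antidiagonal.1 hx)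
  rw [map_add] at this
  omega

/-- If an ideal is determined by coefficients, substitution respects congruences modulo the ideal. -/
theorem subst_sub_mem {I : Ideal (MvPowerSeries σ ℚ)} {B : Set (σ →₀ ℕ)}
    (hI : ∀ F, F ∈ I ↔ ∀ β ∈ B, coeff β F = 0) (p : ℚ⟦X⟧) {G G' : MvPowerSeries σ ℚ}
    (hG : constantCoeff G = 0) (hG' : constantCoeff G' = 0)
    (h : G - G' ∈ I) : p.subst G - p.subst G' ∈ I := by
  rw [hI]
  intro β hβ
  rw [map_sub, coeff_subst_eq_aeval p hG (lt_succ_self _),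
    coeff_subst_eq_aeval p hG' (lt_succ_self _), ← map_sub]
  refine (hI _).1 ?_ β hβ
  refine I.mem_of_dvd ?_ h
  have := Polynomial.sub_dvd_eval_sub G G' ((trunc (β.degree + 1) p).map (algebraMap ℚ _))
  rwa [Polynomial.eval_map_algebraMap, Polynomial.eval_map_algebraMap] at this

theorem constantCoeff_subst (p : ℚ⟦X⟧) {G : MvPowerSeries σ ℚ}
    (hG : constantCoeff G = 0) :
    constantCoeff (p.subst G) = PowerSeries.constantCoeff p := by
  rw [← coeff_zero_eq_constantCoeff_apply, coeff_subst_eq_aeval p hG (M := 1) (by simp),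
    PowerSeries.trunc_one_left, aeval_C, coeff_zero_eq_constantCoeff_apply]
  simp [MvPowerSeries.algebraMap_apply]

end Subst

/-! ### Formal powers -/

section Power

variable {wt : Var N → ℕ}

/-- Differentiate exp(c log F): the derivation kills c, and the derivative of log F is h. -/
theorem euler_fpow {F c h : Ser N} (hF : constantCoeff F = 1)
    (hh : euler wt F = F * h) (hc : euler wt c = 0) :
    euler wt (fpow F c) = fpow F c * (c * h) := by
  have h1 : constantCoeff (F - 1) = 0 := by rw [map_sub, hF, map_one, sub_self]
  have hs := PowerSeries.HasSubst.of_constantCoeff_zero h1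
  have h2 : constantCoeff (c * (log ℚ).subst (F - 1)) = 0 := by
    rw [map_mul, constantCoeff_subst _ h1]; simp
  have h3 : (PowerSeries.derivative ℚ (log ℚ)).subst (F - 1) * F = 1 := by
    have h4 : PowerSeries.derivative ℚ (log ℚ) * (1 + PowerSeries.X) = 1 := by
      rw [PowerSeries.deriv_log]
      ext n
      rcases n with _ | n
      · simp
      · rw [mul_add, mul_one, map_add, coeff_succ_mul_X]
        simp [pow_succ, PowerSeries.coeff_one]
    have h5 := congrArg (substAlgHom hs) h4
    rw [map_mul, map_add, map_one, substAlgHom_X, coe_substAlgHom] at h5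
    rwa [add_sub_cancel] at h5
  have h6 : euler wt ((log ℚ).subst (F - 1)) = h := by
    rw [euler_subst wt _ h1, map_sub, Derivation.map_one_eq_zero, sub_zero, hh, ← mul_assoc, h3, one_mul]
  rw [fpow, euler_subst wt _ h2, PowerSeries.derivative_exp, Derivation.leibniz, hc, h6]
  simp

theorem fpow_sub_mem {I : Ideal (Ser N)} {B : Set (Var N →₀ ℕ)}
    (hI : ∀ F, F ∈ I ↔ ∀ β ∈ B, coeff β F = 0) {F F' c : Ser N}
    (hF : constantCoeff F = 1) (hF' : constantCoeff F' = 1)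
    (h : F - F' ∈ I) : fpow F c - fpow F' c ∈ I := by
  have h1 : constantCoeff (F - 1) = 0 := by rw [map_sub, hF, map_one, sub_self]
  have h1' : constantCoeff (F' - 1) = 0 := by rw [map_sub, hF', map_one, sub_self]
  refine subst_sub_mem hI _ (by rw [map_mul, constantCoeff_subst _ h1]; simp)
    (by rw [map_mul, constantCoeff_subst _ h1']; simp) ?_
  rw [← mul_sub]
  refine I.mul_mem_left _ (subst_sub_mem hI _ h1 h1' ?_)
  simpa using h

theorem subst_zero_eq (p : ℚ⟦X⟧) : (p.subst (0 : Ser N)) = MvPowerSeries.C (PowerSeries.constantCoeff p) := by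
  classical
  refine MvPowerSeries.ext fun β => ?_
  rw [coeff_subst_eq_aeval p (map_zero _) (lt_succ_self _), ← Polynomial.coeff_zero_eq_aeval_zero',
    coeff_trunc]
  simp [MvPowerSeries.algebraMap_apply]

theorem fpow_one (c : Ser N) : fpow 1 c = 1 := by
  rw [fpow, sub_self, subst_zero_eq, PowerSeries.constantCoeff_log, map_zero, mul_zero, subst_zero_eq]
  simp

end Power

/-! ### Slices -/

/-- The weights for the degree in the variables `z`, `v`. -/
def zWt : Var N → ℕ
  | .pz _ _ => 1
  | .pv _ _ => 1
  | .z _ => 1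
  | .v _ => 1
  | _ => 0

/-- The weights for the degree in the variables `z_i`, `v_i`, minus the degree in `a`, `b`. -/
def rWt : Var N → ℤ
  | .z _ => 1
  | .v _ => 1
  | .a => -1
  | .b => -1
  | _ => 0

/-- The degree in the variables `z`, `v`. -/
def zdeg : (Var N →₀ ℕ) →+ ℕ := weight zWt

/-- The degree in the variables `z_i`, `v_i`, minus the degree in `a`, `b`. -/
def rdeg : (Var N →₀ ℕ) →+ ℤ := weight rWt

/-- The variable is one of the variables `w`. -/
def IsW : Var N → Prop
  | .w _ => True
  | _ => False

instance : DecidablePred (IsW (N := N)) := fun x => by cases x <;> unfold IsW <;> infer_instance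

/-- Only the variables `w` occur. -/
def WOnly (β : Var N →₀ ℕ) : Prop := ∀ x, ¬ IsW x → β x = 0

/-- No variable `w` occurs. -/
def WFree (β : Var N →₀ ℕ) : Prop := ∀ x, IsW x → β x = 0

theorem WOnly.of_add {β γ : Var N →₀ ℕ} (h : WOnly (β + γ)) : WOnly β ∧ WOnly γ :=
  ⟨fun x hx => (add_eq_zero_iff.1 (h x hx)).1, fun x hx => (add_eq_zero_iff.1 (h x hx)).2⟩

theorem WFree.of_add {β γ : Var N →₀ ℕ} (h : WFree (β + γ)) : WFree β ∧ WFree γ :=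
  ⟨fun x hx => (add_eq_zero_iff.1 (h x hx)).1, fun x hx => (add_eq_zero_iff.1 (h x hx)).2⟩

theorem WOnly.add {β γ : Var N →₀ ℕ} (h : WOnly β) (h' : WOnly γ) : WOnly (β + γ) :=
  fun x hx => by rw [Finsupp.add_apply, h x hx, h' x hx]

theorem WFree.zero : WFree (0 : Var N →₀ ℕ) := fun _ _ => rfl

theorem WOnly.wexp (f : Fin (N + 1) → ℕ) : WOnly (wexp f) := fun x hx => by
  classical
  rw [Residue.wexp, finsetSum_apply]
  refine sum_eq_zero fun u _ => ?_
  rw [single_apply, if_neg]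
  rintro rfl
  exact hx trivial

theorem eq_of_add_eq {γ γ' ω ω' : Var N →₀ ℕ} (h1 : WFree γ) (h2 : WFree γ') (h3 : WOnly ω)
    (h4 : WOnly ω') (h : γ + ω = γ' + ω') : γ = γ' ∧ ω = ω' := by
  have h5 : ∀ x, γ x + ω x = γ' x + ω' x := fun x => DFunLike.congr_fun h x
  constructor
  · ext x
    by_cases hx : IsW x
    · rw [h1 x hx, h2 x hx]
    · have := h5 x
      rw [h3 x hx, h4 x hx] at this
      exact this
  · ext x
    by_cases hx : IsW x
    · have := h5 x
      rw [h1 x hx, h2 x hx] at this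
      omega
    · rw [h3 x hx, h4 x hx]

/-- The part without variables `w`. -/
def freePart (β : Var N →₀ ℕ) : Var N →₀ ℕ := β.filter fun x => ¬ IsW x

/-- The part in the variables `w`. -/
def wPart (β : Var N →₀ ℕ) : Var N →₀ ℕ := β.filter fun x => IsW x

theorem wFree_freePart (β : Var N →₀ ℕ) : WFree (freePart β) := fun x hx =>
  Finsupp.filter_apply_neg (fun x => ¬ IsW x) β (not_not.2 hx)

theorem wOnly_wPart (β : Var N →₀ ℕ) : WOnly (wPart β) := fun x hx =>
  Finsupp.filter_apply_neg (fun x => IsW x) β hx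

theorem freePart_add_wPart (β : Var N →₀ ℕ) : freePart β + wPart β = β := by
  rw [add_comm]
  exact Finsupp.filter_add_filter_not β _

theorem zdeg_of_wOnly {ω : Var N →₀ ℕ} (h : WOnly ω) : zdeg ω = 0 := by
  rw [zdeg, Finsupp.weight_apply, Finsupp.sum]
  refine sum_eq_zero fun x _ => ?_
  by_cases hx : IsW x
  · cases x <;> first | exact absurd hx id | simp [zWt]
  · rw [h x hx, zero_smul]

open Classical in
/-- The part of a series with given powers of the variables other than `w`. -/
def slice (γ : Var N →₀ ℕ) : Ser N →ₗ[ℚ] Ser N where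
  toFun F ω := if WOnly ω then coeff (γ + ω) F else 0
  map_add' F G := by
    funext ω
    change (if WOnly ω then coeff (γ + ω) (F + G) else 0) =
      (if WOnly ω then coeff (γ + ω) F else 0) +
        (if WOnly ω then coeff (γ + ω) G else 0)
    split_ifs
    · exact map_add _ _ _
    · exact (add_zero 0).symm
  map_smul' c F := by
    funext ω
    change (if WOnly ω then coeff (γ + ω) (c • F) else 0) =
      c * (if WOnly ω then coeff (γ + ω) F else 0)
    split_ifs
    · exact map_smul _ _ _
    · exact (mul_zero c).symm

theorem coeff_slice (γ : Var N →₀ ℕ) (F : Ser N) {ω : Var N →₀ ℕ} (h : WOnly ω) :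
    coeff ω (slice γ F) = coeff (γ + ω) F := if_pos h

theorem coeff_slice_of_not (γ : Var N →₀ ℕ) (F : Ser N) {ω : Var N →₀ ℕ}
    (h : ¬ WOnly ω) : coeff ω (slice γ F) = 0 := if_neg h

-- Exponent vectors split uniquely into a part without w and a part in the w, so the splittings of a
-- sum form a product.
open Classical in
theorem slice_mul {γ : Var N →₀ ℕ} (hγ : WFree γ) (F G : Ser N) :
    slice γ (F * G) = ∑ x ∈ antidiagonal γ, slice x.1 F * slice x.2 G := by
  refine MvPowerSeries.ext fun ω => ?_
  rw [map_sum]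
  simp only [coeff_mul]
  by_cases h : WOnly ω
  · rw [coeff_slice γ _ h, coeff_mul, ← Finset.sum_product']
    symm
    refine Finset.sum_bij' (fun x _ => (x.1.1 + x.2.1, x.1.2 + x.2.2))
      (fun x _ => ((freePart x.1, freePart x.2), (wPart x.1, wPart x.2))) ?_ ?_ ?_ ?_ ?_
    · intro x hx
      rw [mem_product, mem_antidiagonal,
        mem_antidiagonal] at hx
      rw [mem_antidiagonal, ← hx.1, ← hx.2]
      exact add_add_add_comm _ _ _ _
    · intro x hx
      rw [mem_antidiagonal] at hx
      have hx' := eq_of_add_eq (γ := freePart x.1 + freePart x.2) (ω := wPart x.1 + wPart x.2)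
        (γ' := γ) (ω' := ω) ?_ hγ ?_ h ?_
      · rw [mem_product, mem_antidiagonal,
          mem_antidiagonal]
        exact hx'
      · intro v hv
        rw [Finsupp.add_apply, wFree_freePart _ v hv, wFree_freePart _ v hv]
      · exact (wOnly_wPart _).add (wOnly_wPart _)
      · rw [add_add_add_comm, freePart_add_wPart, freePart_add_wPart, hx]
    · rintro ⟨⟨γ₁, γ₂⟩, ω₁, ω₂⟩ hx
      rw [mem_product, mem_antidiagonal,
        mem_antidiagonal] at hx
      have h1 := WFree.of_add (hx.1 ▸ hγ)
      have h2 := WOnly.of_add (hx.2 ▸ h)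
      have key : ∀ {γ ω : Var N →₀ ℕ}, WFree γ → WOnly ω →
          freePart (γ + ω) = γ ∧ wPart (γ + ω) = ω := fun hγ hω =>
        eq_of_add_eq (wFree_freePart _) hγ (wOnly_wPart _) hω (freePart_add_wPart _)
      have k1 := key h1.1 h2.1
      have k2 := key h1.2 h2.2
      simp only at k1 k2 ⊢
      rw [k1.1, k1.2, k2.1, k2.2]
    · rintro ⟨β₁, β₂⟩ _
      simp only [freePart_add_wPart]
    · rintro ⟨⟨γ₁, γ₂⟩, ω₁, ω₂⟩ hx
      rw [mem_product, mem_antidiagonal,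
        mem_antidiagonal] at hx
      have h2 := WOnly.of_add (hx.2 ▸ h)
      simp only [coeff_slice _ _ h2.1, coeff_slice _ _ h2.2]
  · rw [coeff_slice_of_not _ _ h]
    symm
    refine sum_eq_zero fun x _ => sum_eq_zero fun y hy => ?_
    rw [mem_antidiagonal] at hy
    by_cases h1 : WOnly y.1
    · rw [coeff_slice_of_not x.2 _ (fun h2 => h (hy ▸ h1.add h2)), mul_zero]
    · rw [coeff_slice_of_not x.1 _ h1, zero_mul]

/-- A series in the variables `w`. -/
def WSer (F : Ser N) : Prop := ∀ β, coeff β F ≠ 0 → WOnly β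

theorem WSer.slice_zero {F : Ser N} (hF : WSer F) : slice 0 F = F := by
  refine MvPowerSeries.ext fun ω => ?_
  by_cases h : WOnly ω
  · rw [coeff_slice 0 F h, zero_add]
  · rw [coeff_slice_of_not 0 F h]
    by_contra h'
    exact h (hF ω (Ne.symm h'))

theorem WSer.slice_of_ne {F : Ser N} (hF : WSer F) {γ : Var N →₀ ℕ} (hγ : WFree γ)
    (h0 : γ ≠ 0) : slice γ F = 0 := by
  refine MvPowerSeries.ext fun ω => ?_
  rw [map_zero]
  by_cases h : WOnly ω
  · rw [coeff_slice γ F h]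
    by_contra h'
    refine h0 ?_
    ext x
    by_cases hx : IsW x
    · exact hγ x hx
    · exact (WOnly.of_add (hF _ h')).1 x hx
  · exact coeff_slice_of_not γ F h

theorem slice_mul_wSer {γ : Var N →₀ ℕ} (hγ : WFree γ) {G : Ser N} (hG : WSer G)
    (F : Ser N) : slice γ (F * G) = slice γ F * G := by
  classical
  rw [slice_mul hγ, sum_eq_single (γ, 0)]
  · rw [hG.slice_zero]
  · rintro ⟨γ₁, γ₂⟩ hx hne
    rw [mem_antidiagonal] at hx
    rw [hG.slice_of_ne (WFree.of_add (hx ▸ hγ)).2, mul_zero]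
    rintro rfl
    simp only [add_zero] at hx
    exact hne (by rw [hx])
  · intro h
    exact absurd (mem_antidiagonal.2 (add_zero γ)) h

theorem slice_of_wFree {F : Ser N} (hF : ∀ β, coeff β F ≠ 0 → WFree β)
    (γ : Var N →₀ ℕ) : slice γ F = MvPowerSeries.C (coeff γ F) := by
  classical
  refine MvPowerSeries.ext fun ω => ?_
  rw [coeff_C]
  by_cases h : WOnly ω
  · rw [coeff_slice γ F h]
    split_ifs with h0
    · rw [h0, add_zero]
    · by_contra h'
      refine h0 ?_
      ext x
      by_cases hx : IsW x
      · exact (WFree.of_add (hF _ h')).2 x hx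
      · exact h x hx
  · rw [coeff_slice_of_not γ F h, if_neg]
    rintro rfl
    exact h fun _ _ => rfl

theorem slice_euler {γ : Var N →₀ ℕ} (F : Ser N) :
    slice γ (euler zWt F) = (zdeg γ : ℚ) • slice γ F := by
  refine MvPowerSeries.ext fun ω => ?_
  rw [map_smul, smul_eq_mul]
  by_cases h : WOnly ω
  · rw [coeff_slice γ _ h, coeff_slice γ _ h, coeff_euler]
    change (zdeg (γ + ω) : ℚ) * _ = _
    rw [map_add, zdeg_of_wOnly h, add_zero]
  · rw [coeff_slice_of_not γ _ h, coeff_slice_of_not γ _ h, mul_zero]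

/-! ### Families with polynomial slices -/

/-- The slices of the series are polynomials, independent of `T`, in a series `T` in the
variables `w`. The numbers `s` and `r` control degrees. -/
def HasPoly (s : ℕ) (r : ℤ) (Φ : Ser N → Ser N) : Prop :=
  ∀ γ, WFree γ → ∃ p : ℚ[X], (p ≠ 0 → p.natDegree + s ≤ zdeg γ ∧ r ≤ rdeg γ) ∧
    ∀ T, WSer T → slice γ (Φ T) = aeval T p

theorem HasPoly.mono {s s' : ℕ} {r r' : ℤ} {Φ : Ser N → Ser N} (h : HasPoly s r Φ)
    (hs : s' ≤ s) (hr : r' ≤ r) : HasPoly s' r' Φ := fun γ hγ => by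
  obtain ⟨p, hp, h⟩ := h γ hγ
  refine ⟨p, fun h0 => ?_, h⟩
  have := hp h0
  omega

theorem HasPoly.add {s : ℕ} {r : ℤ} {Φ Ψ : Ser N → Ser N} (h : HasPoly s r Φ)
    (h' : HasPoly s r Ψ) : HasPoly s r fun T => Φ T + Ψ T := fun γ hγ => by
  obtain ⟨p, hp, h⟩ := h γ hγ
  obtain ⟨p', hp', h'⟩ := h' γ hγ
  refine ⟨p + p', fun h0 => ?_, fun T hT => by rw [map_add, h T hT, h' T hT, map_add]⟩
  by_cases hp0 : p = 0
  · rw [hp0, zero_add] at h0 ⊢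
    exact hp' h0
  · by_cases hp0' : p' = 0
    · rw [hp0', add_zero]
      exact hp hp0
    · have h1 := hp hp0
      have h2 := hp' hp0'
      have h3 := natDegree_add_le p p'
      exact ⟨by omega, h1.2⟩

theorem HasPoly.sum {s : ℕ} {r : ℤ} {ι : Type*} (t : Finset ι) {Φ : ι → Ser N → Ser N}
    {γ : Var N →₀ ℕ}
    (h : ∀ i ∈ t, ∃ p : ℚ[X], (p ≠ 0 → p.natDegree + s ≤ zdeg γ ∧ r ≤ rdeg γ) ∧
      ∀ T, WSer T → Φ i T = aeval T p) :
    ∃ p : ℚ[X], (p ≠ 0 → p.natDegree + s ≤ zdeg γ ∧ r ≤ rdeg γ) ∧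
      ∀ T, WSer T → ∑ i ∈ t, Φ i T = aeval T p := by
  classical
  induction t using induction_on with
  | empty => exact ⟨0, fun h => absurd rfl h, fun T _ => by simp⟩
  | insert i t hi ih =>
    obtain ⟨p, hp, h1⟩ := h i (mem_insert_self _ _)
    obtain ⟨p', hp', h2⟩ := ih fun j hj => h j (Finset.mem_insert_of_mem hj)
    refine ⟨p + p', fun h0 => ?_, fun T hT => by
      rw [Finset.sum_insert hi, h1 T hT, h2 T hT, map_add]⟩
    by_cases hp0 : p = 0
    · rw [hp0, zero_add] at h0 ⊢
      exact hp' h0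
    · by_cases hp0' : p' = 0
      · rw [hp0', add_zero]
        exact hp hp0
      · have h1 := hp hp0
        have h2 := hp' hp0'
        have h3 := natDegree_add_le p p'
        exact ⟨by omega, h1.2⟩

theorem HasPoly.mul {s s' : ℕ} {r r' : ℤ} {Φ Ψ : Ser N → Ser N} (h : HasPoly s r Φ)
    (h' : HasPoly s' r' Ψ) : HasPoly (s + s') (r + r') fun T => Φ T * Ψ T := fun γ hγ => by
  classical
  simp only [slice_mul hγ]
  refine HasPoly.sum _ fun x hx => ?_
  rw [mem_antidiagonal] at hx
  have hw := WFree.of_add (hx ▸ hγ)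
  obtain ⟨p, hp, h⟩ := h x.1 hw.1
  obtain ⟨p', hp', h'⟩ := h' x.2 hw.2
  refine ⟨p * p', fun h0 => ?_, fun T hT => by rw [h T hT, h' T hT, map_mul]⟩
  have h1 := hp (left_ne_zero_of_mul h0)
  have h2 := hp' (right_ne_zero_of_mul h0)
  have h3 := natDegree_mul_le (p := p) (q := p')
  rw [← hx, map_add, map_add]
  exact ⟨by omega, by omega⟩

theorem HasPoly.const {s : ℕ} {r : ℤ} {u : Ser N}
    (hu : ∀ β, coeff β u ≠ 0 → WFree β ∧ s ≤ zdeg β ∧ r ≤ rdeg β) :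
    HasPoly s r fun _ => u := fun γ _ => by
  refine ⟨Polynomial.C (coeff γ u), fun h0 => ?_, fun T _ => ?_⟩
  · rw [Polynomial.C_ne_zero] at h0
    rw [Polynomial.natDegree_C, zero_add]
    exact (hu γ h0).2
  · rw [slice_of_wFree fun β hβ => (hu β hβ).1, aeval_C]
    rfl

/-! ### Geometric series with polynomial slices -/

theorem constantCoeff_eq_coeff_slice (F : Ser N) :
    constantCoeff F = coeff 0 (slice 0 F) := by
  rw [coeff_slice 0 F (fun _ _ => rfl), add_zero, coeff_zero_eq_constantCoeff_apply]

theorem HasPoly.constantCoeff {r : ℤ} {Ψ : Ser N → Ser N} (h : HasPoly 1 r Ψ)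
    {T : Ser N} (hT : WSer T) : constantCoeff (Ψ T) = 0 := by
  obtain ⟨p, hp, h⟩ := h 0 WFree.zero
  have hp0 : p = 0 := by
    by_contra h0
    have := (hp h0).1
    rw [map_zero] at this
    omega
  rw [constantCoeff_eq_coeff_slice, h T hT, hp0, map_zero, map_zero]

theorem inv_one_sub_eq {u T : Ser N} (hu : constantCoeff u = 0) :
    (1 - u * T)⁻¹ = 1 + u * (1 - u * T)⁻¹ * T := by
  have : (1 - u * T)⁻¹ * (1 - u * T) = 1 :=
    MvPowerSeries.inv_mul_cancel _ (by simp [hu])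
  linear_combination this

/-- The inverse I satisfies I = 1 + ΨIT. Since Ψ has degree at least one in z, v, its slices are
determined recursively by slices of lower degree, and each further power of T is matched by one unit
of this degree. -/
theorem HasPoly.inv_one_sub {Ψ : Ser N → Ser N} (h : HasPoly 1 0 Ψ) :
    HasPoly 0 0 fun T => (1 - Ψ T * T)⁻¹ := by
  classical
  suffices H : ∀ M γ, WFree γ → zdeg γ < M → ∃ p : ℚ[X],
      (p ≠ 0 → p.natDegree + 0 ≤ zdeg γ ∧ 0 ≤ rdeg γ) ∧
        ∀ T, WSer T → slice γ ((1 - Ψ T * T)⁻¹) = aeval T p from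
    fun γ hγ => H _ γ hγ (lt_succ_self _)
  intro M
  induction M with
  | zero => exact fun γ _ hM => absurd hM (Nat.not_lt_zero _)
  | succ M ih =>
    intro γ hγ hM
    have h1 := HasPoly.sum (s := 1) (r := 0) (antidiagonal γ) (γ := γ)
      (Φ := fun x T => slice x.1 (Ψ T) * slice x.2 ((1 - Ψ T * T)⁻¹)) fun x hx => by
        rw [mem_antidiagonal] at hx
        have hw := WFree.of_add (hx ▸ hγ)
        obtain ⟨p, hp, hΨ⟩ := h x.1 hw.1
        by_cases hp0 : p = 0
        · exact ⟨0, fun h => absurd rfl h, fun T hT => by rw [hΨ T hT, hp0, map_zero, zero_mul]⟩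
        have h1 := hp hp0
        have h2 : zdeg γ = zdeg x.1 + zdeg x.2 := by rw [← hx, map_add]
        obtain ⟨p', hp', hi⟩ := ih x.2 hw.2 (by omega)
        refine ⟨p * p', fun h0 => ?_, fun T hT => by rw [hΨ T hT, hi T hT, map_mul]⟩
        have h3 := hp' (right_ne_zero_of_mul h0)
        have h4 := natDegree_mul_le (p := p) (q := p')
        have h5 : rdeg γ = rdeg x.1 + rdeg x.2 := by rw [← hx, map_add]
        exact ⟨by omega, by omega⟩
    obtain ⟨p, hp, h2⟩ := h1
    obtain ⟨p', hp', h3⟩ := (HasPoly.const (s := 0) (r := 0) (u := (1 : Ser N)) fun β hβ => by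
      have : β = 0 := by
        by_contra h0
        rw [coeff_one, if_neg h0] at hβ
        exact hβ rfl
      rw [this, map_zero, map_zero]
      exact ⟨WFree.zero, le_rfl, le_rfl⟩) γ hγ
    refine ⟨p' + p * X, fun h0 => ?_, fun T hT => ?_⟩
    · have hr : 0 ≤ rdeg γ := by
        by_cases hp0 : p = 0
        · rw [hp0, zero_mul, add_zero] at h0
          exact (hp' h0).2
        · exact (hp hp0).2
      refine ⟨?_, hr⟩
      refine (natDegree_add_le _ _).trans (max_le ?_ ?_)
      · by_cases hp0 : p' = 0
        · simp [hp0]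
        · exact (hp' hp0).1
      · by_cases hp0 : p = 0
        · simp [hp0]
        · rw [Polynomial.natDegree_mul_X hp0]
          exact (hp hp0).1
    · rw [inv_one_sub_eq (h.constantCoeff hT), map_add, slice_mul_wSer hγ hT, slice_mul hγ, h3 T hT,
        h2 T hT, map_add, map_mul, aeval_X]

/-! ### Exponentials of variables -/

theorem coeff_expVar_ne_zero {x : Var N} {β : Var N →₀ ℕ}
    (h : coeff β (expVar x) ≠ 0) : ∃ n, β = Finsupp.single x n := by
  classical
  rw [expVar, coeff_subst
    (PowerSeries.HasSubst.of_constantCoeff_zero (constantCoeff_X x))] at h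
  by_contra hne
  push Not at hne
  refine h (finsum_eq_zero_of_forall_eq_zero fun n => ?_)
  rw [X_pow_eq, coeff_monomial, if_neg (hne n), smul_zero]

theorem constantCoeff_expVar (x : Var N) : constantCoeff (expVar x) = 1 := by
  rw [expVar, constantCoeff_subst _ (constantCoeff_X x)]
  simp

theorem hasPoly_of_expVar {x : Var N} (hx : zWt x = 1) (hr : 0 ≤ rWt x) {u : Ser N}
    (hu : ∀ β, coeff β u ≠ 0 → β ≠ 0 ∧ coeff β (expVar x) ≠ 0) :
    HasPoly 1 (rWt x) fun _ => u := by
  refine HasPoly.const fun β hβ => ?_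
  obtain ⟨h0, h1⟩ := hu β hβ
  obtain ⟨n, rfl⟩ := coeff_expVar_ne_zero h1
  have hn : 1 ≤ n := by
    rw [Nat.one_le_iff_ne_zero]
    rintro rfl
    exact h0 (single_zero x)
  refine ⟨fun v hv => ?_, ?_, ?_⟩
  · classical
    rw [single_apply, if_neg]
    rintro rfl
    cases x <;> first | exact hv | simp [zWt] at hx
  · rw [zdeg, weight_single, hx, smul_eq_mul, mul_one]
    exact hn
  · rw [rdeg, weight_single, nsmul_eq_mul]
    nlinarith [(Nat.cast_le (α := ℤ)).2 hn]

theorem hasPoly_expVar_sub_one {x : Var N} (hx : zWt x = 1) (hr : 0 ≤ rWt x) :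
    HasPoly 1 (rWt x) fun _ => expVar x - 1 := by
  classical
  refine hasPoly_of_expVar hx hr fun β hβ => ?_
  rw [map_sub, coeff_one] at hβ
  by_cases h0 : β = 0
  · rw [h0, if_pos rfl, coeff_zero_eq_constantCoeff_apply, constantCoeff_expVar] at hβ
    exact absurd (sub_self 1) hβ
  · rw [if_neg h0, sub_zero] at hβ
    exact ⟨h0, hβ⟩

theorem hasPoly_euler_expVar {x : Var N} (hx : zWt x = 1) (hr : 0 ≤ rWt x) :
    HasPoly 1 (rWt x) fun _ => euler zWt (expVar x) := by
  refine hasPoly_of_expVar hx hr fun β hβ => ?_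
  rw [coeff_euler] at hβ
  refine ⟨?_, right_ne_zero_of_mul hβ⟩
  rintro rfl
  simp at hβ

/-! ### Logarithmic derivatives -/

theorem euler_of_wSer {Y : Ser N} (hY : WSer Y) : euler zWt Y = 0 := by
  refine MvPowerSeries.ext fun β => ?_
  rw [coeff_euler, map_zero]
  by_cases h : coeff β Y = 0
  · rw [h, mul_zero]
  · have : weight zWt β = 0 := zdeg_of_wOnly (hY β h)
    rw [this, Nat.cast_zero, zero_mul]

/-- `h` is the logarithmic derivative of `F`. -/
def LogDer (F h : Ser N) : Prop := euler zWt F = F * h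

theorem LogDer.mul {F G h k : Ser N} (hF : LogDer F h) (hG : LogDer G k) :
    LogDer (F * G) (h + k) := by
  unfold LogDer at *
  rw [Derivation.leibniz, hF, hG, smul_eq_mul, smul_eq_mul]
  ring

theorem LogDer.one : LogDer (1 : Ser N) 0 := by
  unfold LogDer
  rw [Derivation.map_one_eq_zero, mul_zero]

theorem LogDer.prod {ι : Type*} (s : Finset ι) {F h : ι → Ser N} (H : ∀ i ∈ s, LogDer (F i) (h i)) :
    LogDer (∏ i ∈ s, F i) (∑ i ∈ s, h i) := by
  classical
  induction s using induction_on with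
  | empty => exact LogDer.one
  | insert i s hi ih =>
    rw [Finset.prod_insert hi, Finset.sum_insert hi]
    exact (H i (mem_insert_self _ _)).mul (ih fun j hj => H j (Finset.mem_insert_of_mem hj))

theorem LogDer.inv {F h : Ser N} (hF : LogDer F h) (h0 : constantCoeff F ≠ 0) :
    LogDer F⁻¹ (-h) := by
  have h1 := MvPowerSeries.inv_mul_cancel F h0
  have h2 := congrArg (euler zWt) h1
  unfold LogDer at *
  rw [Derivation.leibniz, Derivation.map_one_eq_zero, hF, smul_eq_mul, smul_eq_mul] at h2
  linear_combination F⁻¹ * h2 + (-euler zWt F⁻¹ - h * F⁻¹) * h1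

/-- The contribution of a factor `1 - x * Y` to the logarithmic derivative, for
`T = Y / (1 - Y)`. -/
def simpleDer (x T : Ser N) : Ser N := euler zWt x * (1 - (x - 1) * T)⁻¹ * T

theorem inv_mul_one_sub {x : Ser N} (T : Ser N) (hx : constantCoeff x = 1) :
    (1 - (x - 1) * T)⁻¹ * (1 - (x - 1) * T) = 1 :=
  MvPowerSeries.inv_mul_cancel _ (by simp [hx])

/-- One has 1 - xY = (1 - Y)(1 - (x - 1)T), and the derivation kills Y and T. -/
theorem logDer_one_sub {x Y T : Ser N} (hx : constantCoeff x = 1) (hY : WSer Y)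
    (hT : T * (1 - Y) = Y) : LogDer (1 - x * Y) (-simpleDer x T) := by
  have h1 := inv_mul_one_sub T hx
  unfold LogDer simpleDer
  rw [map_sub, Derivation.map_one_eq_zero, Derivation.leibniz, euler_of_wSer hY, smul_eq_mul,
    smul_eq_mul, mul_zero, zero_sub, zero_add]
  generalize (1 - (x - 1) * T)⁻¹ = i at h1
  linear_combination (euler zWt x * T * (1 - Y)) * h1 + (euler zWt x + euler zWt x * i * (x - 1) * T) * hT

/-- The logarithmic derivative of a factor for a pair. -/
def pairDer (x x' T : Ser N) : Ser N :=
  euler zWt x * (x' - 1) * ((1 - (x * x' - 1) * T)⁻¹ * (1 - (x - 1) * T)⁻¹) +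
    euler zWt x' * (x - 1) * ((1 - (x * x' - 1) * T)⁻¹ * (1 - (x' - 1) * T)⁻¹)

/-- The left side vanishes at T = 0, and also at T = -1, where `simpleDer x` is minus the
logarithmic derivative of x and so additive in products. `pairDer` is minus the quotient by T(1 +
T). -/
theorem pairDer_eq {x x' : Ser N} (T : Ser N) (hx : constantCoeff x = 1)
    (hx' : constantCoeff x' = 1) :
    -simpleDer (x * x') T + simpleDer x T + simpleDer x' T = -pairDer x x' T * (T * (1 + T)) := by
  have h1 := inv_mul_one_sub T hx
  have h2 := inv_mul_one_sub T hx'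
  have h3 := inv_mul_one_sub (x := x * x') T (by rw [map_mul, hx, hx', one_mul])
  unfold simpleDer pairDer
  rw [Derivation.leibniz, smul_eq_mul, smul_eq_mul]
  generalize (1 - (x - 1) * T)⁻¹ = i at *
  generalize (1 - (x' - 1) * T)⁻¹ = i' at *
  generalize (1 - (x * x' - 1) * T)⁻¹ = j at *
  generalize euler zWt x = a
  generalize euler zWt x' = a'
  linear_combination (a * T * x' * j) * h1 + (a' * T * x * j) * h2 - (a * T * i + a' * T * i') * h3

/-! ### The kinds of factors of the trace -/

/-- The factors of the trace: for a pair or a single index, with `z` (`false`) or `v` (`true`). -/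
abbrev Kind (N : ℕ) : Type := (Pair N ⊕ Fin N) × Bool

/-- The index of the denominator of the Laurent monomial. -/
def Kind.src : Kind N → Fin (N + 1)
  | (.inl p, false) => p.1.1.succ
  | (.inl p, true) => p.1.2.succ
  | (.inr _, false) => 0
  | (.inr i, true) => i.succ

/-- The index of the numerator of the Laurent monomial. -/
def Kind.tgt : Kind N → Fin (N + 1)
  | (.inl p, false) => p.1.2.succ
  | (.inl p, true) => p.1.1.succ
  | (.inr i, false) => i.succ
  | (.inr _, true) => 0

/-- The power of `q` in the Laurent monomial. -/
def Kind.eps (e : Kind N) : ℕ := if e.2 then 1 else 0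

/-- The Laurent monomial. -/
def Kind.base : Kind N → Ser N
  | (.inl p, false) => yy p
  | (.inl p, true) => yyInvq p
  | (.inr i, false) => Trace.y i
  | (.inr i, true) => yInvq i

theorem Kind.src_ne_tgt (e : Kind N) : e.src ≠ e.tgt := by
  rcases e with ⟨p | i, _ | _⟩
  · exact fun h => p.2.ne (Fin.succ_injective _ h)
  · exact fun h => p.2.ne' (Fin.succ_injective _ h)
  · exact (Fin.succ_ne_zero i).symm
  · exact Fin.succ_ne_zero i

theorem Kind.eps_le (e : Kind N) : e.eps ≤ 1 := by unfold Kind.eps; split_ifs <;> simp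

theorem Kind.src_lt_tgt {e : Kind N} (h : e.eps = 0) : e.src < e.tgt := by
  rcases e with ⟨p | i, _ | _⟩
  · exact Fin.succ_lt_succ_iff.2 p.2
  · exact absurd h (by simp [Kind.eps])
  · exact Fin.succ_pos i
  · exact absurd h (by simp [Kind.eps])

theorem Kind.isPos (e : Kind N) (n : ℕ) : IsPos e.src e.tgt ((n + e.eps : ℕ) : ℤ) := by
  by_cases h : e.eps = 0
  · exact .inr ⟨e.src_lt_tgt h, by omega⟩
  · exact .inl (by omega)

theorem ind_zero_left (j : Fin (N + 1)) : ind 0 j = 1 := if_pos (Fin.zero_le _)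

theorem ind_succ_zero (u : Fin N) : ind u.succ 0 = 0 := if_neg (by simp)

theorem ind_succ_succ (u j : Fin N) : ind u.succ j.succ = if u ≤ j then 1 else 0 := by
  unfold ind
  simp only [Fin.succ_le_succ_iff]

/-- The indicator convention: the vertex `i.succ` stands for y_i and the vertex 0 for 1. -/
theorem Kind.base_eq (e : Kind N) : ∃ f : Fin N → ℤ, e.base = qy (e.eps : ℤ) f ∧
    ∀ u, lexp (e.eps : ℤ) f u = e.eps + ind u e.tgt - ind u e.src := by
  rcases e with ⟨p | i, _ | _⟩
  · refine ⟨_, rfl, fun u => ?_⟩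
    refine Fin.cases ?_ (fun u => ?_) u
    · simp [lexp, ind_zero_left]
    · simp only [lexp, cons_succ, Pi.sub_apply, sum_sub_distrib, sum_Ici_single]
      simp only [Kind.src, Kind.tgt, ind_succ_succ]
      ring
  · refine ⟨_, rfl, fun u => ?_⟩
    refine Fin.cases ?_ (fun u => ?_) u
    · simp [lexp, ind_zero_left]
    · simp only [lexp, cons_succ, Pi.sub_apply, sum_sub_distrib, sum_Ici_single]
      simp only [Kind.src, Kind.tgt, ind_succ_succ]
      ring
  · refine ⟨_, rfl, fun u => ?_⟩
    refine Fin.cases ?_ (fun u => ?_) u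
    · simp [lexp, ind_zero_left]
    · simp only [lexp, cons_succ, sum_Ici_single]
      simp only [Kind.src, Kind.tgt, ind_succ_succ, ind_succ_zero]
      ring
  · refine ⟨_, rfl, fun u => ?_⟩
    refine Fin.cases ?_ (fun u => ?_) u
    · simp [lexp, ind_zero_left]
    · simp only [lexp, cons_succ, Pi.neg_apply, sum_neg_distrib, sum_Ici_single]
      simp only [Kind.src, Kind.tgt, ind_succ_succ, ind_succ_zero]
      ring

theorem Kind.base_mul_q_pow (e : Kind N) (n : ℕ) : e.base * Trace.q N ^ n =
    MvPowerSeries.monomial (xexp e.src e.tgt ((n + e.eps : ℕ) : ℤ)) 1 := by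
  obtain ⟨f, h1, h2⟩ := e.base_eq
  rw [h1, q_pow, qy, monomial_mul_monomial, one_mul, qyExp_eq, wexp_add, xexp]
  refine congrArg (fun f => MvPowerSeries.monomial (wexp f) 1) (funext fun u => ?_)
  have h3 := (e.isPos 0).nonneg u
  rw [zero_add] at h3
  rw [Pi.add_apply, h2]
  push_cast
  omega

/-- The simple poles of the factors. -/
def Kind.pole (e : Kind N) (n : ℕ) : Ser N :=
  Residue.pole e.src e.tgt ((n + e.eps : ℕ) : ℤ)

theorem Kind.pole_mul (e : Kind N) (n : ℕ) :
    e.pole n * (1 - e.base * Trace.q N ^ n) = e.base * Trace.q N ^ n := by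
  rw [Kind.pole, Residue.pole, if_pos (e.isPos n), e.base_mul_q_pow, geo_mul (xexp_ne_zero (e.isPos n))]

theorem Kind.wSer_base_mul (e : Kind N) (n : ℕ) : WSer (e.base * Trace.q N ^ n) := by
  classical
  intro β hβ
  rw [e.base_mul_q_pow, coeff_monomial] at hβ
  split_ifs at hβ with h
  · rw [h]
    exact WOnly.wexp _
  · exact absurd rfl hβ

theorem Kind.wSer_pole (e : Kind N) (n : ℕ) : WSer (e.pole n) := by
  intro β hβ
  rw [Kind.pole, Residue.pole, if_pos (e.isPos n)] at hβ
  obtain ⟨d, rfl⟩ := exists_of_coeff_geo_ne_zero (xexp_ne_zero (e.isPos n)) β hβ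
  intro x hx
  rw [Finsupp.smul_apply, xexp, WOnly.wexp _ x hx, smul_zero]

theorem Kind.constantCoeff_base (e : Kind N) : constantCoeff e.base = 0 := by
  classical
  have h := e.base_mul_q_pow 0
  rw [pow_zero, mul_one] at h
  rw [h, ← coeff_zero_eq_constantCoeff_apply, coeff_monomial,
    if_neg (xexp_ne_zero (e.isPos 0)).symm]

/-! ### The factors of the trace -/

/-- The first of the variables belonging to a factor. -/
def Kind.var : Kind N → Var N
  | (.inl p, false) => .pz p 0
  | (.inl p, true) => .pv p 0
  | (.inr i, false) => .z i
  | (.inr i, true) => .v i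

/-- The second variable of a factor for a pair. -/
def Kind.var' : Kind N → Var N
  | (.inl p, false) => .pz p 1
  | (.inl p, true) => .pv p 1
  | (.inr i, false) => .z i
  | (.inr i, true) => .v i

theorem Kind.zWt_var (e : Kind N) : zWt e.var = 1 := by rcases e with ⟨p | i, _ | _⟩ <;> rfl

theorem Kind.zWt_var' (e : Kind N) : zWt e.var' = 1 := by rcases e with ⟨p | i, _ | _⟩ <;> rfl

/-- The factors of the trace, with a replacement `P` for the infinite product. -/
def Kind.factor (P : Ser N → Ser N) (c d : Ser N) (e : Kind N) :
    Ser N :=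
  match e.1 with
  | .inl _ => P (expVar e.var * expVar e.var' * e.base) * P e.base *
      (P (expVar e.var * e.base) * P (expVar e.var' * e.base))⁻¹
  | .inr _ => fpow (P (expVar e.var * e.base) * (P e.base)⁻¹) (if e.2 then d else c)

theorem trace_eq (c d : Ser N) : Trace.trace N c d = ∏ e : Kind N, e.factor poch c d := by
  have h1 : ∀ p : Pair N, ratio (expVar (.pz p 0)) (expVar (.pz p 1)) (yy p) =
      Kind.factor poch c d (.inl p, false) := fun _ => rfl
  have h2 : ∀ p : Pair N, ratio (expVar (.pv p 0)) (expVar (.pv p 1))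
      (yyInvq p) = Kind.factor poch c d (.inl p, true) := fun _ => rfl
  have h3 : ∀ i : Fin N, fpow (poch (expVar (.z i) * Trace.y i) *
      (poch (Trace.y i))⁻¹) c = Kind.factor poch c d (.inr i, false) := fun _ => rfl
  have h4 : ∀ i : Fin N, fpow (poch (expVar (.v i) * yInvq i) *
      (poch (yInvq i))⁻¹) d = Kind.factor poch c d (.inr i, true) := fun _ => rfl
  rw [Fintype.prod_prod_type, Fintype.prod_sum_type, Trace.trace]
  simp only [h1, h2, h3, h4, Fintype.prod_bool]
  simp only [mul_comm (Kind.factor poch c d (_, true))]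

/-- The partial products of the infinite product. -/
def pochN (D : ℕ) (t : Ser N) : Ser N :=
  ∏ n ∈ range D, (1 - t * Trace.q N ^ n)

theorem constantCoeff_pochN (D : ℕ) {t : Ser N} (ht : constantCoeff t = 0) :
    constantCoeff (pochN D t) = 1 := by
  rw [pochN, map_prod]
  exact Finset.prod_eq_one fun n _ => by simp [ht]

/-- The contribution of the simple pole `T` to the logarithmic derivative of a factor. -/
def Kind.der (c d : Ser N) (e : Kind N) (T : Ser N) : Ser N :=
  match e.1 with
  | .inl _ => -pairDer (expVar e.var) (expVar e.var') T * (T * (1 + T))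
  | .inr _ => (if e.2 then d else c) * -simpleDer (expVar e.var) T

theorem Kind.logDer_pochN (e : Kind N) (D : ℕ) {x : Ser N}
    (hx : constantCoeff x = 1) :
    LogDer (pochN D (x * e.base)) (∑ n ∈ range D, -simpleDer x (e.pole n)) := by
  refine LogDer.prod _ fun n _ => ?_
  rw [mul_assoc]
  exact logDer_one_sub hx (e.wSer_base_mul n) (e.pole_mul n)

theorem Kind.logDer_pochN_base (e : Kind N) (D : ℕ) : LogDer (pochN D e.base) 0 := by
  have h := e.logDer_pochN D (x := 1) (map_one _)
  simpa [simpleDer, Derivation.map_one_eq_zero] using h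

theorem Kind.logDer_factor {c d : Ser N} (hc : euler zWt c = 0) (hd : euler zWt d = 0)
    (e : Kind N) (D : ℕ) :
    LogDer (e.factor (pochN D) c d) (∑ n ∈ range D, e.der c d (e.pole n)) := by
  have hx := constantCoeff_expVar e.var
  have hx' := constantCoeff_expVar e.var'
  have hbase := e.constantCoeff_base
  have hP : ∀ x : Ser N, constantCoeff (pochN D (x * e.base)) = 1 := fun x =>
    constantCoeff_pochN D (by rw [map_mul, hbase, mul_zero])
  unfold Kind.factor Kind.der
  match h : e.1 with
  | .inl _ =>
    simp only
    have h1 := ((e.logDer_pochN D (x := expVar e.var * expVar e.var')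
      (by rw [map_mul, hx, hx', one_mul])).mul (e.logDer_pochN_base D)).mul
      (((e.logDer_pochN D hx).mul (e.logDer_pochN D hx')).inv (by rw [map_mul, hP, hP]; simp))
    convert h1 using 1
    rw [add_zero, ← sum_add_distrib, ← sum_neg_distrib, ← sum_add_distrib]
    refine sum_congr rfl fun n _ => ?_
    rw [← pairDer_eq _ hx hx']
    ring
  | .inr _ =>
    simp only
    have hb : constantCoeff (pochN D e.base) = 1 := constantCoeff_pochN D hbase
    have h1 := (e.logDer_pochN D hx).mul ((e.logDer_pochN_base D).inv (by rw [hb]; simp))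
    rw [neg_zero, add_zero] at h1
    rw [← mul_sum]
    refine euler_fpow ?_ h1 ?_
    · rw [map_mul, hP, one_mul, constantCoeff_inv, hb, inv_one]
    · split_ifs <;> assumption

/-! ### Polynomials for the logarithmic derivative -/

/-- For a pair, `pairDer` has degree in z, v at least two above its degree in T, which pays for T(1
+ T). For a single index one unit pays for T, and the factor a or b is compensated in `rdeg` by a
variable z_i or v_i. -/
theorem Kind.exists_poly {c d : Ser N} (hc : HasPoly 0 (-1) fun _ => c)
    (hd : HasPoly 0 (-1) fun _ => d) (e : Kind N) {γ : Var N →₀ ℕ} (hγ : WFree γ) :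
    ∃ p : ℚ[X], (p ≠ 0 → p.natDegree ≤ zdeg γ ∧ 1 ≤ zdeg γ ∧ 0 ≤ rdeg γ) ∧
      X ∣ p ∧ (c = 0 → d = 0 → X * (1 + X) ∣ p) ∧
      ∀ T, WSer T → slice γ (e.der c d T) = aeval T p := by
  have hinv : ∀ {u : Ser N}, (HasPoly 1 0 fun _ => u) → HasPoly 0 0 fun T => (1 - u * T)⁻¹ :=
    fun h => h.inv_one_sub
  have hwser : ∀ T : Ser N, WSer T → WSer (T * (1 + T)) := by
    classical
    intro T hT β hβ
    rw [mul_add, mul_one, map_add] at hβ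
    by_cases h : coeff β T = 0
    · rw [h, zero_add, coeff_mul] at hβ
      obtain ⟨x, hx, hne⟩ := Finset.exists_ne_zero_of_sum_ne_zero hβ
      rw [← mem_antidiagonal.1 hx]
      exact (hT _ (left_ne_zero_of_mul hne)).add (hT _ (right_ne_zero_of_mul hne))
    · exact hT β h
  have hone : HasPoly 0 0 fun _ : Ser N => (-1 : Ser N) := HasPoly.const fun β hβ => by
    classical
    have : β = 0 := by
      by_contra h0
      rw [map_neg, coeff_one, if_neg h0, neg_zero] at hβ
      exact hβ rfl
    rw [this, map_zero, map_zero]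
    exact ⟨WFree.zero, le_rfl, le_rfl⟩
  have hdeg : (X * (1 + X) : ℚ[X]).natDegree ≤ 2 := by
    refine natDegree_mul_le.trans ?_
    have h1 := natDegree_X_le (R := ℚ)
    have h2 : (1 + X : ℚ[X]).natDegree ≤ 1 := by
      rw [add_comm]; exact (natDegree_X_add_C 1).le
    omega
  unfold Kind.der
  match h : e.1 with
  | .inl _ =>
    simp only
    have hr : 0 ≤ rWt e.var := by
      rcases e with ⟨p | i, _ | _⟩ <;> simp_all [Kind.var, rWt]
    have hr' : 0 ≤ rWt e.var' := by
      rcases e with ⟨p | i, _ | _⟩ <;> simp_all [Kind.var', rWt]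
    have h1 := (hasPoly_expVar_sub_one e.zWt_var hr).mono le_rfl hr
    have h1' := (hasPoly_expVar_sub_one e.zWt_var' hr').mono le_rfl hr'
    have h2 := (hasPoly_euler_expVar e.zWt_var hr).mono le_rfl hr
    have h2' := (hasPoly_euler_expVar e.zWt_var' hr').mono le_rfl hr'
    have h12 : HasPoly 1 0 fun _ => expVar e.var * expVar e.var' - 1 := by
      have := (h1.add h1').add ((h1.mul h1').mono (by norm_num : 1 ≤ 1 + 1) le_rfl)
      convert this using 2
      ring
    have h3 : HasPoly 2 0 (pairDer (expVar e.var) (expVar e.var')) :=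
      (((h2.mul h1').mul ((hinv h12).mul (hinv h1))).add
        ((h2'.mul h1).mul ((hinv h12).mul (hinv h1'))))
    obtain ⟨p, hp, h4⟩ := (hone.mul h3) γ hγ
    refine ⟨p * (X * (1 + X)), fun h0 => ?_,
      (dvd_mul_right _ _).trans (dvd_mul_left _ _), fun _ _ => dvd_mul_left _ _, fun T hT => ?_⟩
    · have h5 := hp (left_ne_zero_of_mul h0)
      have h6 := natDegree_mul_le (p := p) (q := X * (1 + X))
      exact ⟨by omega, by omega, by omega⟩
    · rw [neg_eq_neg_one_mul, slice_mul_wSer hγ (hwser T hT), h4 T hT]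
      simp
  | .inr _ =>
    simp only
    have hr : rWt e.var = 1 := by
      rcases e with ⟨p | i, _ | _⟩ <;> simp_all [Kind.var, rWt]
    have hr0 : 0 ≤ rWt e.var := by omega
    have h1 := (hasPoly_expVar_sub_one e.zWt_var hr0).mono le_rfl hr0
    have h2 := (hasPoly_euler_expVar e.zWt_var hr0)
    have hcd : HasPoly 0 (-1) fun _ => if e.2 then d else c := by split_ifs <;> assumption
    rw [hr] at h2
    obtain ⟨p, hp, h4⟩ := ((hone.mul hcd).mul (h2.mul (hinv h1))) γ hγ
    by_cases h0 : c = 0 ∧ d = 0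
    · refine ⟨0, fun h => absurd rfl h, dvd_zero _, fun _ _ => dvd_zero _, fun T _ => ?_⟩
      rw [h0.1, h0.2]
      simp
    · refine ⟨p * X, fun h0 => ?_, dvd_mul_left _ _, fun h h' => absurd ⟨h, h'⟩ h0,
        fun T hT => ?_⟩
      · have h5 := hp (left_ne_zero_of_mul h0)
        have h6 := natDegree_mul_le (p := p) (q := X)
        have h7 := natDegree_X_le (R := ℚ)
        exact ⟨by omega, by omega, by omega⟩
      · rw [map_mul (aeval T), aeval_X, ← h4 T hT, ← slice_mul_wSer hγ hT, simpleDer]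
        congr 1
        ring

/-! ### Congruences between series -/

/-- The ideal of all series whose coefficients at the exponents of a lower set vanish. -/
def coeffIdeal {σ : Type*} (B : LowerSet (σ →₀ ℕ)) : Ideal (MvPowerSeries σ ℚ) where
  carrier := {F | ∀ β ∈ B, coeff β F = 0}
  zero_mem' β _ := map_zero _
  add_mem' {F G} hF hG β hβ := by rw [map_add, hF β hβ, hG β hβ, add_zero]
  smul_mem' F G hG β hβ := by
    classical
    rw [smul_eq_mul, coeff_mul]
    refine sum_eq_zero fun x hx => ?_
    rw [hG x.2, mul_zero]
    refine B.lower ?_ hβ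
    rw [← mem_antidiagonal.1 hx]
    exact le_add_self

theorem mem_coeffIdeal {σ : Type*} {B : LowerSet (σ →₀ ℕ)} {F : MvPowerSeries σ ℚ} :
    F ∈ coeffIdeal B ↔ ∀ β ∈ B, coeff β F = 0 := Iff.rfl

theorem inv_congr {σ : Type*} {I : Ideal (MvPowerSeries σ ℚ)} {F G : MvPowerSeries σ ℚ}
    (hF : constantCoeff F = 1) (hG : constantCoeff G = 1)
    (h : Ideal.Quotient.mk I F = Ideal.Quotient.mk I G) :
    Ideal.Quotient.mk I F⁻¹ = Ideal.Quotient.mk I G⁻¹ := by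
  have h1 := congrArg (Ideal.Quotient.mk I) (MvPowerSeries.inv_mul_cancel F (by rw [hF]; simp))
  have h2 := congrArg (Ideal.Quotient.mk I) (MvPowerSeries.inv_mul_cancel G (by rw [hG]; simp))
  rw [map_mul, map_one] at h1 h2
  rw [← h] at h2
  linear_combination Ideal.Quotient.mk I G⁻¹ * h1 - Ideal.Quotient.mk I F⁻¹ * h2

/-- The exponents of degree `0` in the variables `z`, `v`. -/
def zeroSet : LowerSet (Var N →₀ ℕ) where
  carrier := {β | zdeg β = 0}
  lower' β γ h hβ := by
    obtain ⟨δ, rfl⟩ := exists_add_of_le h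
    rw [Set.mem_ofPred_eq, map_add] at hβ
    exact (add_eq_zero_iff.1 hβ).1

/-- The exponents of degree less than `D` in the variable `w 0`. -/
def lowSet (D : ℕ) : LowerSet (Var N →₀ ℕ) where
  carrier := {β | β (.w 0) < D}
  lower' _ _ h hβ := lt_of_le_of_lt (h (.w 0)) hβ

theorem expVar_congr_one {x : Var N} (hx : zWt x = 1) :
    Ideal.Quotient.mk (coeffIdeal zeroSet) (expVar x) = 1 := by
  classical
  rw [← map_one (Ideal.Quotient.mk (coeffIdeal zeroSet)), Ideal.Quotient.eq, mem_coeffIdeal]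
  intro β hβ
  have hβ : zdeg β = 0 := hβ
  rw [map_sub, coeff_one]
  split_ifs with h
  · rw [h, coeff_zero_eq_constantCoeff_apply, constantCoeff_expVar, sub_self]
  · rw [sub_zero]
    by_contra hne
    obtain ⟨n, rfl⟩ := coeff_expVar_ne_zero hne
    rw [zdeg, weight_single, hx, smul_eq_mul, mul_one] at hβ
    exact h (by rw [hβ, single_zero])

theorem pochN_congr {I : Ideal (Ser N)} (D : ℕ) {t t' : Ser N}
    (h : Ideal.Quotient.mk I t = Ideal.Quotient.mk I t') :
    Ideal.Quotient.mk I (pochN D t) = Ideal.Quotient.mk I (pochN D t') := by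
  simp only [pochN, map_prod, map_sub, map_mul, h]

/-- Setting all z and v to 0 makes every x equal to 1, and numerators cancel denominators. This is
the start of the recursion. -/
theorem factor_congr_one (c d : Ser N) (e : Kind N) (D : ℕ) :
    Ideal.Quotient.mk (coeffIdeal zeroSet) (e.factor (pochN D) c d) = 1 := by
  set π := Ideal.Quotient.mk (coeffIdeal (zeroSet (N := N))) with hπ
  have hbase := e.constantCoeff_base
  have hP : ∀ x : Ser N, constantCoeff (pochN D (x * e.base)) = 1 := fun x =>
    constantCoeff_pochN D (by rw [map_mul, hbase, mul_zero])
  have h1 : π (expVar e.var) = 1 := expVar_congr_one e.zWt_var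
  have h2 : π (expVar e.var') = 1 := expVar_congr_one e.zWt_var'
  have hx : ∀ x, π x = 1 → π (pochN D (x * e.base)) = π (pochN D e.base) := fun x hx =>
    pochN_congr D (by rw [← hπ, map_mul, hx, one_mul])
  have hb : constantCoeff (pochN D e.base) = 1 := constantCoeff_pochN D hbase
  unfold Kind.factor
  match e.1 with
  | .inl _ =>
    simp only
    have h3 := congrArg π (MvPowerSeries.inv_mul_cancel
      (pochN D (expVar e.var * e.base) * pochN D (expVar e.var' * e.base))
      (by rw [map_mul, hP, hP]; simp))
    rw [map_one, mul_comm, map_mul, map_mul, hx _ h1, hx _ h2] at h3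
    rw [map_mul, map_mul, hx _ (by rw [map_mul, h1, h2, one_mul]), h3]
  | .inr _ =>
    simp only
    rw [← map_one π, hπ, Ideal.Quotient.eq, ← fpow_one (if e.2 then d else c)]
    refine fpow_sub_mem (fun _ => mem_coeffIdeal (B := zeroSet)) ?_ (map_one _) ?_
    · rw [map_mul, hP, one_mul, constantCoeff_inv, hb, inv_one]
    · have h3 := congrArg π (MvPowerSeries.inv_mul_cancel (pochN D e.base) (by rw [hb]; simp))
      rw [mul_comm, map_mul] at h3
      rw [← Ideal.Quotient.eq, ← hπ, map_mul, hx _ h1, h3]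

/-- The further factors are 1 modulo q^D, and q is divisible by w_0. -/
theorem coeff_pochN_eq {t : Ser N} {D n : ℕ} (h : D ≤ n) :
    pochN n t - pochN D t ∈ coeffIdeal (lowSet D) := by
  classical
  induction n, h using Nat.le_induction with
  | base => rw [sub_self]; exact Ideal.zero_mem _
  | succ n hn ih =>
    have h1 : Trace.q N ^ n ∈ coeffIdeal (lowSet (N := N) D) := by
      rw [mem_coeffIdeal]
      intro β hβ
      rw [q_pow, coeff_monomial, if_neg]
      rintro rfl
      have : (wexp fun _ : Fin (N + 1) => n) (.w 0) < D := hβ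
      rw [wexp_apply] at this
      omega
    have h2 : pochN (n + 1) t - pochN D t = pochN n t - pochN D t + -(pochN n t * t) * Trace.q N ^ n := by
      rw [pochN, Finset.prod_range_succ, ← pochN]
      ring
    rw [h2]
    exact Ideal.add_mem _ ih (Ideal.mul_mem_left _ _ h1)

open scoped MvPowerSeries.WithPiTopology in
theorem poch_congr (t : Ser N) (D : ℕ) :
    Ideal.Quotient.mk (coeffIdeal (lowSet D)) (poch t) =
      Ideal.Quotient.mk (coeffIdeal (lowSet D)) (pochN D t) := by
  rw [Ideal.Quotient.eq, mem_coeffIdeal]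
  intro β hβ
  rw [map_sub, sub_eq_zero]
  have h1 := (Trace.multipliable_poch t).hasProd.tendsto_prod_nat
  have h2 := ((MvPowerSeries.WithPiTopology.continuous_coeff ℚ β).tendsto _).comp h1
  refine tendsto_nhds_unique h2 (tendsto_const_nhds.congr' ?_)
  filter_upwards [Filter.eventually_ge_atTop D] with n hn
  have := coeff_pochN_eq (t := t) hn β hβ
  rw [map_sub, sub_eq_zero] at this
  exact this.symm

theorem constantCoeff_poch {t : Ser N} (ht : constantCoeff t = 0) :
    constantCoeff (poch t) = 1 := by
  have h := poch_congr t 1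
  rw [Ideal.Quotient.eq, mem_coeffIdeal] at h
  have := h 0 Nat.zero_lt_one
  rw [map_sub, sub_eq_zero, coeff_zero_eq_constantCoeff_apply,
    coeff_zero_eq_constantCoeff_apply, constantCoeff_pochN 1 ht] at this
  exact this

theorem factor_congr (c d : Ser N) (e : Kind N) (D : ℕ) :
    Ideal.Quotient.mk (coeffIdeal (lowSet D)) (e.factor poch c d) =
      Ideal.Quotient.mk (coeffIdeal (lowSet D)) (e.factor (pochN D) c d) := by
  have hbase := e.constantCoeff_base
  have h0 : ∀ x : Ser N, constantCoeff (x * e.base) = 0 := fun x => by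
    rw [map_mul, hbase, mul_zero]
  have hP := fun x => constantCoeff_pochN D (h0 x)
  have hP' := fun x => constantCoeff_poch (h0 x)
  have hb := constantCoeff_pochN D hbase
  have hb' := constantCoeff_poch hbase
  unfold Kind.factor
  match e.1 with
  | .inl _ =>
    simp only
    rw [map_mul, map_mul, map_mul, map_mul, poch_congr, poch_congr]
    congr 1
    refine inv_congr (by rw [map_mul, hP', hP', one_mul]) (by rw [map_mul, hP, hP, one_mul]) ?_
    rw [map_mul, map_mul, poch_congr, poch_congr]
  | .inr _ =>
    simp only
    rw [Ideal.Quotient.eq]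
    refine fpow_sub_mem (fun _ => mem_coeffIdeal (B := lowSet D)) ?_ ?_ ?_
    · rw [map_mul, hP', one_mul, constantCoeff_inv, hb', inv_one]
    · rw [map_mul, hP, one_mul, constantCoeff_inv, hb, inv_one]
    · rw [← Ideal.Quotient.eq, map_mul, map_mul, poch_congr, inv_congr hb' hb (poch_congr _ _)]

/-- The trace with partial products in place of infinite products. -/
def traceN (D : ℕ) (c d : Ser N) : Ser N := ∏ e : Kind N, e.factor (pochN D) c d

theorem coeff_trace_eq (c d : Ser N) {D : ℕ} {β : Var N →₀ ℕ} (h : β (.w 0) < D) :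
    coeff β (Trace.trace N c d) = coeff β (traceN D c d) := by
  have h1 : Ideal.Quotient.mk (coeffIdeal (lowSet D)) (Trace.trace N c d) =
      Ideal.Quotient.mk (coeffIdeal (lowSet D)) (traceN D c d) := by
    rw [trace_eq, traceN, map_prod, map_prod]
    exact prod_congr rfl fun e _ => factor_congr c d e D
  rw [Ideal.Quotient.eq, mem_coeffIdeal] at h1
  have := h1 β h
  rwa [map_sub, sub_eq_zero] at this

theorem coeff_traceN_of_zdeg {c d : Ser N} (D : ℕ) {β : Var N →₀ ℕ} (h : zdeg β = 0) :
    coeff β (traceN D c d) = coeff β (1 : Ser N) := by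
  have h1 : Ideal.Quotient.mk (coeffIdeal zeroSet) (traceN D c d) =
      Ideal.Quotient.mk (coeffIdeal zeroSet) 1 := by
    rw [traceN, map_prod, map_one]
    exact Finset.prod_eq_one fun e _ => factor_congr_one c d e D
  rw [Ideal.Quotient.eq, mem_coeffIdeal] at h1
  have := h1 β h
  rwa [map_sub, sub_eq_zero] at this

theorem logDer_traceN {c d : Ser N} (hc : euler zWt c = 0) (hd : euler zWt d = 0) (D : ℕ) :
    LogDer (traceN D c d) (∑ e : Kind N, ∑ n ∈ range D, e.der c d (e.pole n)) :=
  LogDer.prod _ fun e _ => e.logDer_factor hc hd D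

/-! ### Sums over poles -/

/-- The span of the products of sums over poles, of bounded degree, where the polynomials are
divisible by `m`. -/
def sumSpan (m : ℚ[X]) (W : ℕ) : Submodule ℚ (ℕ → Ser N) :=
  Submodule.span ℚ {Φ | ∃ (J : Type) (_ : Fintype J) (e : J → Kind N) (g : J → ℚ[X]),
    (∀ j, m ∣ g j) ∧ ∑ j, (g j).natDegree ≤ W ∧
      Φ = fun D => ∏ j, ∑ n ∈ range D, aeval ((e j).pole n) (g j)}

theorem mul_mem_sumSpan {m : ℚ[X]} {W W' : ℕ} {Φ Ψ : ℕ → Ser N} (hΦ : Φ ∈ sumSpan m W)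
    (hΨ : Ψ ∈ sumSpan m W') : Φ * Ψ ∈ sumSpan m (W + W') := by
  have h := Submodule.mul_mem_mul hΦ hΨ
  rw [sumSpan, sumSpan, Submodule.span_mul_span] at h
  refine Submodule.span_mono ?_ h
  rintro _ ⟨_, ⟨J, i, e, g, h1, h2, rfl⟩, _, ⟨J', i', e', g', h1', h2', rfl⟩, rfl⟩
  refine ⟨J ⊕ J', inferInstance, Sum.elim e e', Sum.elim g g', ?_, ?_, ?_⟩
  · rintro (j | j)
    · exact h1 j
    · exact h1' j
  · rw [Fintype.sum_sum_type]
    exact add_le_add h2 h2'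
  · funext D
    simp only [Fintype.prod_sum_type, Sum.elim_inl, Sum.elim_inr, Pi.mul_apply]

theorem one_mem_sumSpan (m : ℚ[X]) (W : ℕ) : (1 : ℕ → Ser N) ∈ sumSpan m W :=
  subset_span ⟨Fin 0, inferInstance, Fin.elim0, Fin.elim0, fun j => j.elim0, by simp, by
    funext D; simp⟩

theorem sum_mem_sumSpan {m p : ℚ[X]} (h : m ∣ p) {W : ℕ} (hW : p.natDegree ≤ W) (e : Kind N) :
    (fun D => ∑ n ∈ range D, aeval (e.pole n) p) ∈ sumSpan m W :=
  subset_span ⟨Fin 1, inferInstance, fun _ => e, fun _ => p, fun _ => h, by simpa using hW, by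
    funext D; simp⟩

/-- The slice at γ of E F = F h determines the coefficient of F at γ, times its degree, from
coefficients of lower degree and those of h; the degree is nonzero except at the start, so it can be
divided out. -/
theorem exists_slice_traceN {c d : Ser N} (hc : euler zWt c = 0) (hd : euler zWt d = 0)
    (hc' : HasPoly 0 (-1) fun _ => c) (hd' : HasPoly 0 (-1) fun _ => d) {m : ℚ[X]}
    (hm : m = X ∨ c = 0 ∧ d = 0 ∧ m = X * (1 + X))
    {γ : Var N →₀ ℕ} (hγ : WFree γ) :
    ∃ Ψ ∈ sumSpan m (zdeg γ), (rdeg γ < 0 → Ψ = 0) ∧ ∀ D, slice γ (traceN D c d) = Ψ D := by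
  classical
  suffices H : ∀ M γ, WFree γ → zdeg γ < M →
      ∃ Ψ ∈ sumSpan m (zdeg γ), (rdeg γ < 0 → Ψ = 0) ∧ ∀ D, slice γ (traceN D c d) = Ψ D from
    H _ γ hγ (lt_succ_self _)
  intro M
  induction M with
  | zero => exact fun γ _ hM => absurd hM (Nat.not_lt_zero _)
  | succ M ih =>
    intro γ hγ hM
    -- In degree zero the trace is 1, so the exponents of a and b in γ must vanish too.
    by_cases h0 : zdeg γ = 0
    · have h1 : ∀ D, slice γ (traceN D c d) = slice γ (1 : Ser N) := fun D => by
        refine MvPowerSeries.ext fun ω => ?_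
        by_cases hω : WOnly ω
        · rw [coeff_slice γ _ hω, coeff_slice γ _ hω, coeff_traceN_of_zdeg]
          rw [map_add, h0, zdeg_of_wOnly hω]
        · rw [coeff_slice_of_not γ _ hω, coeff_slice_of_not γ _ hω]
      have hone : WSer (1 : Ser N) := fun β hβ => by
        have : β = 0 := by
          by_contra h
          rw [coeff_one, if_neg h] at hβ
          exact hβ rfl
        rw [this]
        exact fun _ _ => rfl
      by_cases hγ0 : γ = 0
      · refine ⟨1, one_mem_sumSpan _ _, fun h => ?_, fun D => ?_⟩
        · rw [hγ0, map_zero] at h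
          exact absurd h (lt_irrefl _)
        · rw [h1, hγ0, hone.slice_zero]
          rfl
      · refine ⟨0, zero_mem _, fun _ => rfl, fun D => ?_⟩
        rw [h1, hone.slice_of_ne hγ hγ0]
        rfl
    · have hx : ∀ x ∈ antidiagonal γ, ∃ Ψ ∈ sumSpan m (zdeg γ),
          (rdeg γ < 0 → Ψ = 0) ∧ ∀ D, slice x.1 (traceN D c d) *
            slice x.2 (∑ e : Kind N, ∑ n ∈ range D, e.der c d (e.pole n)) = Ψ D := by
        intro x hx
        rw [mem_antidiagonal] at hx
        have hw := WFree.of_add (hx ▸ hγ)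
        have hz : zdeg γ = zdeg x.1 + zdeg x.2 := by rw [← hx, map_add]
        have hr : rdeg γ = rdeg x.1 + rdeg x.2 := by rw [← hx, map_add]
        choose p hp hX hkd hsl using fun e : Kind N => e.exists_poly hc' hd' hw.2
        have hH : ∀ D, slice x.2 (∑ e : Kind N, ∑ n ∈ range D, e.der c d (e.pole n)) =
            ∑ e : Kind N, ∑ n ∈ range D, aeval (e.pole n) (p e) := fun D => by
          rw [map_sum]
          refine sum_congr rfl fun e _ => ?_
          rw [map_sum]
          exact sum_congr rfl fun n _ => hsl e _ (e.wSer_pole n)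
        by_cases hall : ∀ e, p e = 0
        · refine ⟨0, zero_mem _, fun _ => rfl, fun D => ?_⟩
          rw [hH]
          simp [hall]
        push Not at hall
        obtain ⟨e₀, he₀⟩ := hall
        have h2 := hp e₀ he₀
        -- A nonzero polynomial forces `x.2` to have positive degree, so `x.1` has smaller degree
        -- than γ.
        obtain ⟨Ψ, hΨ, hΨ0, hΨD⟩ := ih x.1 hw.1 (by omega)
        refine ⟨Ψ * fun D => ∑ e : Kind N, ∑ n ∈ range D, aeval (e.pole n) (p e), ?_,
          fun h => ?_, fun D => by rw [hH, hΨD]; rfl⟩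
        · rw [hz]
          refine mul_mem_sumSpan hΨ ?_
          have : (fun D => ∑ e : Kind N, ∑ n ∈ range D, aeval (e.pole n) (p e)) =
              ∑ e : Kind N, fun D => ∑ n ∈ range D, aeval (e.pole n) (p e) := by
            funext D
            rw [Finset.sum_apply]
          rw [this]
          refine sum_mem fun e _ => ?_
          refine sum_mem_sumSpan ?_ ?_ e
          · rcases hm with rfl | ⟨h1, h2, rfl⟩
            · exact hX e
            · exact hkd e h1 h2
          · by_cases h : p e = 0
            · rw [h, Polynomial.natDegree_zero]
              exact Nat.zero_le _
            · exact (hp e h).1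
        · rw [hΨ0 (by omega), zero_mul]
      choose! Ψ hΨ hΨ0 hΨD using hx
      refine ⟨(zdeg γ : ℚ)⁻¹ • ∑ x ∈ antidiagonal γ, Ψ x,
        smul_mem _ _ (sum_mem hΨ), fun h => ?_, fun D => ?_⟩
      · rw [sum_eq_zero fun x hx => hΨ0 x hx h, smul_zero]
      · have h1 := congrArg (slice γ) (logDer_traceN hc hd D)
        rw [slice_euler, slice_mul hγ, sum_congr rfl fun x hx => hΨD x hx D] at h1
        rw [Pi.smul_apply, Finset.sum_apply, ← h1, smul_smul, inv_mul_cancel₀ (by exact_mod_cast h0),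
          one_smul]

/-! ### The coefficients of the trace -/

/-- Expanding a product of sums over poles gives a sum over all choices of labels below D, each term
being a constant term of a product over edges. -/
theorem exists_coeff_sumSpan {m : ℚ[X]} {W : ℕ} {𝒮 : Submodule ℚ ℚ⟦X⟧}
    (H : ∀ (J : Type) (_ : Fintype J) (_ : DecidableEq J) (e : J → Kind N) (g : J → ℚ[X]),
      (∀ j, m ∣ g j) → ∑ j, (g j).natDegree ≤ W → ∃ f ∈ 𝒮, ∀ k D, k < D →
        ∑ n ∈ piFinset (fun _ : J => range D),
          cval univ (fun j => (e j).src) (fun j => (e j).tgt) g (label (fun j => (e j).eps) n) k =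
            PowerSeries.coeff k f)
    {Ψ : ℕ → Ser N} (hΨ : Ψ ∈ sumSpan m W) :
    ∃ f ∈ 𝒮, ∀ k D : ℕ, k < D → coeff (qyExp (k : ℤ) 0) (Ψ D) = PowerSeries.coeff k f := by
  classical
  unfold sumSpan at hΨ
  induction hΨ using span_induction with
  | mem Ψ hΨ =>
    obtain ⟨J, i, e, g, h1, h2, rfl⟩ := hΨ
    obtain ⟨f, hf, hf'⟩ := H J i inferInstance e g h1 h2
    refine ⟨f, hf, fun k D hk => ?_⟩
    beta_reduce
    rw [← hf' k D hk, Finset.prod_univ_sum, map_sum]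
    rfl
  | zero => exact ⟨0, zero_mem _, fun k D _ => by simp⟩
  | add Ψ Ψ' _ _ h1 h2 =>
    obtain ⟨f, hf, hf'⟩ := h1
    obtain ⟨f₂, hf₂, hf₂'⟩ := h2
    exact ⟨f + f₂, add_mem hf hf₂, fun k D hk => by
      rw [Pi.add_apply, map_add, map_add, hf' k D hk, hf₂' k D hk]⟩
  | smul c Ψ _ h1 =>
    obtain ⟨f, hf, hf'⟩ := h1
    exact ⟨c • f, smul_mem _ _ hf, fun k D hk => by
      rw [Pi.smul_apply, map_smul, map_smul, hf' k D hk]⟩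

/-- The monomial q^k has degree k in w_0, so partial products with k + 1 factors suffice, and the
limit series f does not depend on this cut-off. -/
theorem exists_coeff_trace {c d : Ser N} (hc : euler zWt c = 0) (hd : euler zWt d = 0)
    (hc' : HasPoly 0 (-1) fun _ => c) (hd' : HasPoly 0 (-1) fun _ => d) {m : ℚ[X]}
    (hm : m = X ∨ c = 0 ∧ d = 0 ∧ m = X * (1 + X))
    {γ : Var N →₀ ℕ} (hγ : WFree γ) {𝒮 : Submodule ℚ ℚ⟦X⟧}
    (H : ∀ (J : Type) (_ : Fintype J) (_ : DecidableEq J) (e : J → Kind N) (g : J → ℚ[X]),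
      (∀ j, m ∣ g j) → ∑ j, (g j).natDegree ≤ zdeg γ → ∃ f ∈ 𝒮, ∀ k D, k < D →
        ∑ n ∈ piFinset (fun _ : J => range D),
          cval univ (fun j => (e j).src) (fun j => (e j).tgt) g (label (fun j => (e j).eps) n) k =
            PowerSeries.coeff k f) :
    ∃ f ∈ 𝒮, (rdeg γ < 0 → f = 0) ∧ ∀ k : ℕ, coeff
      (γ + qyExp (k : ℤ) 0) (Trace.trace N c d) = PowerSeries.coeff k f := by
  obtain ⟨Ψ, hΨ, hΨ0, hΨD⟩ := exists_slice_traceN hc hd hc' hd' hm hγ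
  have key : ∀ k : ℕ, coeff (γ + qyExp (k : ℤ) 0) (Trace.trace N c d) =
      coeff (qyExp (k : ℤ) 0) (Ψ (k + 1)) := fun k => by
    have hw : WOnly (qyExp (k : ℤ) (0 : Fin N → ℤ)) := by
      rw [qyExp_zero]
      exact WOnly.wexp _
    rw [coeff_trace_eq c d (D := k + 1), ← hΨD, coeff_slice γ _ hw]
    rw [Finsupp.add_apply, hγ (.w 0) trivial, qyExp_zero, wexp_apply]
    omega
  by_cases h : rdeg γ < 0
  · refine ⟨0, zero_mem _, fun _ => rfl, fun k => ?_⟩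
    rw [key, hΨ0 h]
    simp
  · obtain ⟨f, hf, hf'⟩ := exists_coeff_sumSpan H hΨ
    exact ⟨f, hf, fun h' => absurd h' h, fun k => (key k).trans (hf' k (k + 1) (lt_succ_self k))⟩

theorem euler_X {x : Var N} (hx : zWt x = 0) : euler zWt (MvPowerSeries.X x : Ser N) = 0 := by
  classical
  refine MvPowerSeries.ext fun β => ?_
  rw [coeff_euler, coeff_X, map_zero]
  split_ifs with h
  · rw [h, weight_single, hx]
    simp
  · rw [mul_zero]

theorem hasPoly_X {x : Var N} (hw : ¬ IsW x) (hx : rWt x = -1) :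
    HasPoly 0 (-1) fun _ => (MvPowerSeries.X x : Ser N) := by
  classical
  refine HasPoly.const fun β hβ => ?_
  rw [coeff_X] at hβ
  have h : β = Finsupp.single x 1 := by
    by_contra h
    rw [if_neg h] at hβ
    exact hβ rfl
  refine ⟨fun v hv => ?_, Nat.zero_le _, ?_⟩
  · rw [h, single_apply, if_neg]
    rintro rfl
    exact hw hv
  · rw [h, rdeg, weight_single, hx]
    simp

theorem hasPoly_zero {s : ℕ} {r : ℤ} : HasPoly s r fun _ => (0 : Ser N) :=
  HasPoly.const fun β hβ => absurd (map_zero _) hβ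

theorem WFree.single {x : Var N} (hx : ¬ IsW x) (k : ℕ) : WFree (Finsupp.single x k) := by
  classical
  intro v hv
  rw [single_apply, if_neg]
  rintro rfl
  exact hx hv

theorem WFree.add {β γ : Var N →₀ ℕ} (h : WFree β) (h' : WFree γ) : WFree (β + γ) :=
  fun x hx => by rw [Finsupp.add_apply, h x hx, h' x hx]

theorem WFree.sum {ι : Type*} (s : Finset ι) {β : ι → Var N →₀ ℕ} (h : ∀ i ∈ s, WFree (β i)) :
    WFree (∑ i ∈ s, β i) := fun x hx => by
  rw [finsetSum_apply]
  exact sum_eq_zero fun i hi => h i hi x hx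

theorem wFree_zvExp (m n : Pair N → Fin 2 → ℕ) (m' n' : Fin N → ℕ) :
    WFree (zvExp m n m' n') :=
  (WFree.sum _ fun _ _ => WFree.sum _ fun _ _ => (WFree.single (x := .pz _ _) id _).add
    (WFree.single (x := .pv _ _) id _)).add
    (WFree.sum _ fun _ _ => (WFree.single (x := .z _) id _).add (WFree.single (x := .v _) id _))

theorem zdeg_zvExp (m n : Pair N → Fin 2 → ℕ) (m' n' : Fin N → ℕ) :
    zdeg (zvExp m n m' n') = (∑ p, ∑ l, (m p l + n p l)) + ∑ i, (m' i + n' i) := by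
  simp only [zvExp, map_add, map_sum, zdeg, weight_single, zWt, smul_eq_mul, mul_one]

theorem rdeg_zvExp (m n : Pair N → Fin 2 → ℕ) (m' n' : Fin N → ℕ) :
    rdeg (zvExp m n m' n') = ((∑ i, (m' i + n' i) : ℕ) : ℤ) := by
  simp only [zvExp, map_add, map_sum, rdeg, weight_single, rWt, smul_zero, add_zero,
    Finset.sum_const_zero, zero_add]
  simp

theorem Kind.exists_sum_cval_BD {J : Type} [Fintype J] [DecidableEq J] (e : J → Kind N)
    (g : J → ℚ[X]) (hg : ∀ j, X ∣ g j) {W : ℕ} (hW : ∑ j, (g j).natDegree ≤ W) :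
    ∃ f ∈ BD W, ∀ k D, k < D → ∑ n ∈ piFinset (fun _ : J => range D),
      cval univ (fun j => (e j).src) (fun j => (e j).tgt) g (label (fun j => (e j).eps) n) k =
        PowerSeries.coeff k f :=
  Residue.exists_sum_cval_BD (fun j => (e j).src_ne_tgt) (fun j => (e j).eps_le)
    (fun j h => (e j).src_lt_tgt h) hg hW

theorem Kind.exists_sum_cval_qBD {J : Type} [Fintype J] [DecidableEq J] (e : J → Kind N)
    (g : J → ℚ[X]) (hg : ∀ j, X * (1 + X) ∣ g j) {W : ℕ}
    (hW : ∑ j, (g j).natDegree ≤ W) :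
    ∃ f ∈ qBD W, ∀ k D, k < D → ∑ n ∈ piFinset (fun _ : J => range D),
      cval univ (fun j => (e j).src) (fun j => (e j).tgt) g (label (fun j => (e j).eps) n) k =
        PowerSeries.coeff k f :=
  Residue.exists_sum_cval_qBD (fun j => (e j).src_ne_tgt) (fun j => (e j).eps_le)
    (fun j h => (e j).src_lt_tgt h) hg hW

/-- The exponent vector of a coefficient of `coeffY0`. -/
def abExp (m n : Pair N → Fin 2 → ℕ) (m' n' : Fin N → ℕ) (d : Fin 2 →₀ ℕ) :
    Var N →₀ ℕ :=
  zvExp m n m' n' + Finsupp.single .a (d 0) + Finsupp.single .b (d 1)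

variable (m n : Pair N → Fin 2 → ℕ) (m' n' : Fin N → ℕ) (d : Fin 2 →₀ ℕ)

theorem coeff_sum_monomial {σ R : Type*} [CommSemiring R] {f : (σ →₀ ℕ) → R} {s : Finset (σ →₀ ℕ)}
    (h : ∀ d ∉ s, f d = 0) (e : σ →₀ ℕ) :
    (∑ d ∈ s, MvPolynomial.monomial d (f d)).coeff e = f e := by
  classical
  rw [MvPolynomial.coeff_sum]
  simp only [MvPolynomial.coeff_monomial]
  rw [Finset.sum_ite_eq' s e f]
  split_ifs with he
  · rfl
  · exact (h e he).symm

theorem wFree_abExp : WFree (abExp m n m' n' d) :=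
  ((wFree_zvExp m n m' n').add (WFree.single (x := .a) id _)).add (WFree.single (x := .b) id _)

theorem zdeg_abExp : zdeg (abExp m n m' n' d) = (∑ p, ∑ l, (m p l + n p l)) + ∑ i, (m' i + n' i) := by
  rw [abExp, map_add, map_add, zdeg_zvExp]
  simp [zdeg, weight_single, zWt]

theorem rdeg_abExp : rdeg (abExp m n m' n' d) = ((∑ i, (m' i + n' i) : ℕ) : ℤ) - d.degree := by
  rw [abExp, map_add, map_add, rdeg_zvExp, Finsupp.degree_eq_sum, Fin.sum_univ_two]
  simp [rdeg, weight_single, rWt]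
  ring

theorem coeff_coeffY0 (F : Ser N) (k : ℕ) :
    PowerSeries.coeff k (coeff d (coeffY0 m n m' n' F)) =
      coeff (abExp m n m' n' d + qyExp (k : ℤ) 0) F := by
  change PowerSeries.coeff k (coeffY0 m n m' n' F d) = _
  rw [coeffY0, coeff_mk]
  rfl

/-- The bound on the degree in a, b is the vanishing for negative `rdeg`. -/
theorem exists_coeffY0_eq_BD :
    ∃ f ∈ BD ((∑ p, ∑ l, (m p l + n p l)) + ∑ i, (m' i + n' i)),
      ((∑ i, (m' i + n' i)) < d.degree → f = 0) ∧
      coeff d (coeffY0 m n m' n'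
        (Trace.trace N (MvPowerSeries.X .a) (MvPowerSeries.X .b))) = f := by
  obtain ⟨f, hf, h0, h⟩ := exists_coeff_trace (c := (MvPowerSeries.X .a : Ser N))
    (d := MvPowerSeries.X .b) (euler_X rfl) (euler_X rfl) (hasPoly_X id rfl) (hasPoly_X id rfl)
    (.inl rfl) (wFree_abExp m n m' n' d) fun J _ _ e g hg hW => Kind.exists_sum_cval_BD e g hg hW
  rw [zdeg_abExp] at hf
  refine ⟨f, hf, fun hd => h0 (by rw [rdeg_abExp]; omega),
    PowerSeries.ext fun k => ?_⟩
  rw [← h k, coeff_coeffY0, abExp]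

/-- With both exponents 0 only the pair factors contribute, so all polynomials are divisible by X(1
+ X); any power of a or b makes `rdeg` negative. -/
theorem exists_coeffY0_eq_qBD :
    ∃ f ∈ qBD (∑ p, ∑ l, (m p l + n p l)), (d ≠ 0 → f = 0) ∧
      coeff d (coeffY0 m n 0 0 (Trace.trace N 0 0)) = f := by
  obtain ⟨f, hf, h0, h⟩ := exists_coeff_trace (c := (0 : Ser N)) (d := 0) (map_zero _)
    (map_zero _) hasPoly_zero hasPoly_zero (.inr ⟨rfl, rfl, rfl⟩) (wFree_abExp m n 0 0 d)
    fun J _ _ e g hg hW => Kind.exists_sum_cval_qBD e g hg hW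
  rw [zdeg_abExp] at hf
  refine ⟨f, by simpa using hf, fun hd => h0 ?_, PowerSeries.ext fun k => ?_⟩
  · have := mt (Finsupp.degree_eq_zero_iff d).1 hd
    rw [rdeg_abExp]
    simp
    omega
  · rw [← h k, coeff_coeffY0, abExp]

end

end Residue

/-! ### The theorem. -/

theorem theorem1p3 (N : ℕ) (hN : 2 ≤ N) :
    (∀ (m n : Trace.Pair N → Fin 2 → ℕ) (m' n' : Fin N → ℕ),
      ∃ P : MvPolynomial (Fin 2) ℚ⟦X⟧,
        Trace.coeffY0 m n m' n' (Trace.trace N (MvPowerSeries.X .a) (MvPowerSeries.X .b)) = ↑P ∧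
        (∀ d, P.coeff d ∈
          BiBracket.BD ((∑ p, ∑ l, (m p l + n p l)) + ∑ i, (m' i + n' i))) ∧
        P.totalDegree ≤ ∑ i, (m' i + n' i)) ∧
    (∀ m n : Trace.Pair N → Fin 2 → ℕ,
      ∃ f ∈ BiBracket.qBD (∑ p, ∑ l, (m p l + n p l)),
        Trace.coeffY0 m n 0 0 (Trace.trace N 0 0) = MvPowerSeries.C f) := by
  classical
  refine ⟨fun m n m' n' => ?_, fun m n => ?_⟩
  · choose f hf h0 h using Residue.exists_coeffY0_eq_BD m n m' n'
    -- Finitely many exponents have degree within the bound, and all other coefficients vanish, so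
    -- the series in a, b is a polynomial.
    have hP := Residue.coeff_sum_monomial (s := (Finsupp.finite_of_degree_le (σ := Fin 2)
      (∑ i, (m' i + n' i))).toFinset) fun d hd => h0 d (by simpa using hd)
    refine ⟨_, MvPowerSeries.ext fun d => (h d).trans ((hP d).symm.trans (MvPolynomial.coeff_coe _ _).symm),
      fun d => by rw [hP]; exact hf d, Finset.sup_le fun d hd => ?_⟩
    rw [MvPolynomial.mem_support_iff, hP] at hd
    change d.degree ≤ _
    exact not_lt.1 fun hlt => hd (h0 d hlt)
  · choose f hf h0 h using Residue.exists_coeffY0_eq_qBD m n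
    refine ⟨f 0, hf 0, MvPowerSeries.ext fun d => ?_⟩
    rw [h, MvPowerSeries.coeff_C]
    split_ifs with hd
    · rw [hd]
    · exact h0 d hd
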